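/- Let $\alpha>-\tfrac14$ and $0<\mu<\tfrac14$. Let $J_\nu,Y_\nu$ be the Bessel functions of the first and second kind, put $$\mathcal W_\alpha(x,\tau)=\frac{\operatorname{Im}\left[J_{\alpha+i\tau}(\sqrt x)\,Y_{\alpha-i\tau}(\sqrt x)\right]}{\sinh(\pi\tau)},\qquad (G_\alpha g)(x)=\int_{-\infty}^{\infty}\mathcal W_\alpha(x,\tau)\,g(\tau)\,d\tau,\qquad R_{\alpha,x}(y)=\operatorname{Re}\left[J_{\alpha+ix}(\sqrt y)\,Y_{\alpha-ix}(\sqrt y)\right],$$ and write $f^*(s)=\int_0^\infty f(x)x^{s-1}\,dx$ for the Mellin transform. Let $g$ be a complex-valued function such that $z\mapsto g(z/i)$ is even and analytic in the closed strip $|\operatorname{Re}z|\le\mu$, with $g(0)=g'(0)=0$, $g\in L_2(\mathbb R)$ and $g(z/i)\in L_2(\mu-i\infty,\mu+i\infty)$. Suppose that the integral defining $(G_\alpha g)^*(s)$ converges absolutely for $|\operatorname{Re}s|<\mu$, that $(G_\alpha g)^*$ is analytic in this strip, and that $$|s|^{1/2-\nu}e^{\pi|s|/2}(G_\alpha g)^*(s)\in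 L_1(\nu-i\infty,\nu+i\infty)\qquad\text{for every }\nu\in(-\mu,\mu).$$ Then for every $x\in\mathbb R$ the function $R_{\alpha,x}$ is differentiable on $(0,\infty)$, $R_{\alpha,x}(t)/t$ is integrable on $(y,\infty)$ for every $y>0$, and $$g(x)=-\pi x\sinh(\pi x)\int_0^\infty\left(\alpha^2\int_y^\infty R_{\alpha,x}(t)\,(G_\alpha g)(y)\,\frac{dt}{t\,y}+\frac{d}{dy}\left[R_{\alpha,x}(y)\right](G_\alpha g)(y)\right)dy,$$ where the outer integral converges absolutely. If moreover $\alpha>-\mu$ (in particular if $\alpha\ge0$), the two terms are separately absolutely integrable in $y$ over $(0,\infty)$, and $$g(x)=-\pi x\sinh(\pi x)\left(\alpha^2\int_0^\infty\int_y^\infty R_{\alpha,x}(t)\,(G_\alpha g)(y)\,\frac{dt\,dy}{t\,y}+\int_0^\infty\frac{d}{dy}\left[R_{\alpha,x}(y)\right](G_\alpha g)(y)\,dy\right).$$ -/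

import Mathlib

open MeasureTheory Set Filter Topology

noncomputable section

/-- Bessel function of the first kind (principal branch),
`J_ν(z) = (z/2)^ν ∑ (-1)^k (z/2)^(2k) / (k! Γ(ν+k+1))`.
At the poles of `Γ` the value `0` given by Mathlib makes the summand vanish, as it should. -/
def besselJ (ν z : ℂ) : ℂ :=
  (z / 2) ^ ν * ∑' k : ℕ,
    (-1) ^ k / ((k.factorial : ℂ) * Complex.Gamma (ν + k + 1)) * (z / 2) ^ (2 * k)

/-- The quotient `(J_w(z) cos(πw) - J_{-w}(z)) / sin(πw)`. -/
def besselYQuot (w z : ℂ) : ℂ :=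
  (besselJ w z * Complex.cos (Real.pi * w) - besselJ (-w) z) / Complex.sin (Real.pi * w)

/-- Bessel function of the second kind; at integer orders it is the limit in the order. -/
def besselY (ν z : ℂ) : ℂ :=
  if Complex.sin (Real.pi * ν) = 0 then limUnder (𝓝[≠] ν) (fun w => besselYQuot w z)
  else besselYQuot ν z

/-- The product `J_{α+iτ}(√x) Y_{α-iτ}(√x)`. -/
def besselProd (α τ x : ℝ) : ℂ :=
  besselJ (α + Complex.I * τ) (Real.sqrt x : ℝ) * besselY (α - Complex.I * τ) (Real.sqrt x : ℝ)

/-- The Weber type kernel `Im[J_{α+iτ}(√x) Y_{α-iτ}(√x)] / sinh(πτ)`. -/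
def weberKernel (α x τ : ℝ) : ℝ := (besselProd α τ x).im / Real.sinh (Real.pi * τ)

/-- `Re[J_{α+iτ}(√x) Y_{α-iτ}(√x)]`. -/
def weberRe (α τ x : ℝ) : ℝ := (besselProd α τ x).re

/-- The index transform `(G_α g)(x) = ∫ W_α(x,τ) g(τ) dτ` over the real line. -/
def indexG (α : ℝ) (g : ℂ → ℂ) (x : ℝ) : ℂ :=
  ∫ τ : ℝ, (weberKernel α x τ : ℂ) * g (τ : ℂ)

/-- The closed vertical strip `|Re z| ≤ μ`. -/
def closedStrip (μ : ℝ) : Set ℂ := {z : ℂ | |z.re| ≤ μ}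

/-- The open vertical strip `|Re z| < μ`. -/
def openStrip (μ : ℝ) : Set ℂ := {z : ℂ | |z.re| < μ}

end

/-!
Write `h = G_α g` and `R = R_{α,x}`. The proof computes Mellin transforms in the variable `y`, and
the inversion formula becomes the inversion of a sine transform.

**Symbols.** `E(p+d, w) E(p-d, w)`, where `J_ν(2√w) = w^{ν/2} E(ν, w)`, is a Mellin–Barnes integral
(`besselE_prod_eq_line_integral`): moving the line to the left picks up residues which sum, by
Chu–Vandermonde, to the Cauchy product of the two series, and Stirling bounds kill the remainder.
Hence, for `max(0, -α) < Re s < 1/4`, the kernels `Re [J Y]` and `W_α` have the symbols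
`K(s) β(s, x) sin πs cos πs` and `K(s) β(s, τ) cosh πτ`, up to sign and a power of `4`, with
`K(s) = Γ(s+α) / (π Γ(1-s+α))` and `β(s, τ) = Γ(s+iτ) Γ(s-iτ) Γ(1-2s) / π`. Under the substitution
`e^l = 2 sinh (v/2)`, written `v = logArc l`, a beta integral turns `β(s, τ)` into sine and cosine
integrals (`sin_logArc_integral`, `cos_logArc_integral`).

**The transform of `h`.** Let `P(v) = ∫ (g(τ)/τ) sin(τv) dτ`; the integral converges because `g` is
square integrable, differentiable and zero at `0`. Then `h^*(s)` is an explicit multiplier times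
`2 ∫ P(v(l)) e^{-2sl} dl` (`mellin_indexG`). So the quotient of `h^*` by the multiplier, which is
analytic wherever the Mellin integral of `h` converges, continues this Laplace transform across the
imaginary axis (`inverseSymbol_mul_mellin`, `inverseSymbol_mul_mellin_strip`).

**The pairing.** The combination `F_x(y) = α² ∫_y^∞ R dt/t + y R'(y)` has the symbol of `R`
multiplied by `(α² - s²)/s`, and the factor `α² - s²` cancels the pole at `s = -α`: the symbol of
`F_x` is, up to `β(s, x) cos πs`, the inverse multiplier at `-s` (`tailSymbol`, `tailSymbol_eq`).
Parseval's formula on a line `Re s = c` with `c` small and positive therefore pairs `F_x` with `h`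
as the sine integral of the inverse Laplace transform of the continued function, that is of `P`.
These integrals need not converge absolutely; Gaussian means in `log y`, which multiply symbols by
`e^{ε² s²}`, repair this (`gaussMean_pairing_eq_sine_integral`), and after damping the line can be
moved across the imaginary axis (`dampedInverse_eq_gaussMean`). As `ε → 0`, the damped pairings
converge to `∫ F_x(y) h(y) dy/y` (`tendsto_damped_pairing`), while tested against a smooth function
of `x` the sine integrals converge, by Fourier inversion for test functions, to
`∫ φ(t) g(t)/t dt` (`tendsto_integral_test_sine`). Both sides are continuous in `x ≠ 0`, which gives
the formula at every `x ≠ 0` (`tailPairing_inversion`). At `x = 0` both sides vanish.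

**Convergence.** All integrability comes from bounds on `R` and `D = y R'` (`WeberBounds`). For large
`y` they come from a monotone energy for the Bessel equation. Near `0` the leading term `y^α` is
annihilated by `α² ∫_y^∞ (·) dt/t + y d/dy` up to a constant, so that `F_x` is `O(y^{-δ})` for
every `δ > 0` even when `α < 0`; the two terms separately are `O(y^{-δ})` only for `δ ≥ -α`, and
`h(y) y^{-δ-1}` is integrable for `δ < μ`, whence the condition `α > -μ`. For `x = 0` and `α = n`
an integer, `Y_n` is a derivative in the order, and Cauchy's estimates transfer the bounds at
nearby orders (`weberRe_nat_bounds`).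
-/



/-! ### The entire factor of the Bessel function -/

/-- The entire function `E(ν, w) = ∑ (-1)^k w^k / (k! Γ(ν+k+1))`, so that
`J_ν(z) = (z/2)^ν E(ν, z²/4)`. -/
noncomputable def besselE (ν w : ℂ) : ℂ :=
  ∑' k : ℕ, (-1) ^ k / ((k.factorial : ℂ) * Complex.Gamma (ν + k + 1)) * w ^ k

theorem besselJ_eq_besselE (ν z : ℂ) : besselJ ν z = (z / 2) ^ ν * besselE ν ((z / 2) ^ 2) := by
  simp only [besselJ, besselE, pow_mul]

theorem inv_Gamma_nat_shift_bounded (R : ℝ) :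
    ∃ B : ℝ, 0 < B ∧ ∀ ν : ℂ, ‖ν‖ ≤ R → ∀ k : ℕ, ‖(Complex.Gamma (ν + k + 1))⁻¹‖ ≤ B := by
  obtain ⟨m, hm⟩ := exists_nat_ge R
  have hc : Continuous fun s : ℂ => (Complex.Gamma s)⁻¹ :=
    Complex.differentiable_one_div_Gamma.continuous
  obtain ⟨B, hB⟩ := (isCompact_closedBall (0 : ℂ) (R + m + 1)).exists_bound_of_continuousOn
    hc.continuousOn
  have base : ∀ ν : ℂ, ‖ν‖ ≤ R → ∀ k : ℕ, k ≤ m → ‖(Complex.Gamma (ν + k + 1))⁻¹‖ ≤ B := by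
    intro ν hν k hk
    apply hB
    rw [mem_closedBall_zero_iff]
    have h1 : ‖ν + k + 1‖ ≤ ‖ν‖ + k + 1 := by
      refine (norm_add_le _ _).trans ?_
      have := norm_add_le ν (k : ℂ)
      simp only [Complex.norm_natCast, norm_one] at *
      linarith
    have : (k : ℝ) ≤ m := by exact_mod_cast hk
    linarith
  refine ⟨|B| + 1, by positivity, fun ν hν k => ?_⟩
  suffices ‖(Complex.Gamma (ν + k + 1))⁻¹‖ ≤ B by
    have := le_abs_self B; linarith
  rcases le_total k m with hk | hk
  · exact base ν hν k hk
  · induction k, hk using Nat.le_induction with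
    | base => exact base ν hν m le_rfl
    | succ k hk ih =>
      have h1 : (1 : ℝ) ≤ ‖ν + k + 1‖ := by
        have h2 : (k : ℝ) + 1 ≤ ‖ν + k + 1‖ + ‖ν‖ := by
          have := norm_sub_le (ν + k + 1) ν
          rw [show ν + k + 1 - ν = ((k + 1 : ℕ) : ℂ) by push_cast; ring, Complex.norm_natCast] at this
          push_cast at this; exact this
        have : (m : ℝ) ≤ k := by exact_mod_cast hk
        linarith
      have h2 := Complex.one_div_Gamma_eq_self_mul_one_div_Gamma_add_one (ν + k + 1)
      rw [h2, norm_mul] at ih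
      push_cast
      rw [show ν + (k + 1) + 1 = ν + k + 1 + 1 by ring]
      refine le_trans ?_ ih
      exact le_mul_of_one_le_left (norm_nonneg _) h1

theorem besselE_term_bound (R : ℝ) :
    ∃ u : ℕ → ℝ, Summable u ∧ ∀ ν w : ℂ, ‖ν‖ ≤ R → ‖w‖ ≤ R → ∀ k : ℕ,
      ‖(-1) ^ k / ((k.factorial : ℂ) * Complex.Gamma (ν + k + 1)) * w ^ k‖ ≤ u k := by
  obtain ⟨B, hB0, hB⟩ := inv_Gamma_nat_shift_bounded R
  refine ⟨fun k => B * (R ^ k / k.factorial), (Real.summable_pow_div_factorial R).mul_left B,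
    fun ν w hν hw k => ?_⟩
  have h := hB ν hν k
  rw [div_eq_mul_inv, mul_inv]
  simp only [norm_mul, norm_pow, norm_neg, norm_one, one_pow, one_mul, norm_inv,
    Complex.norm_natCast] at *
  have h2 : ‖w‖ ^ k ≤ R ^ k := pow_le_pow_left₀ (norm_nonneg _) hw k
  have h3 : 0 ≤ ‖Complex.Gamma (ν + k + 1)‖⁻¹ := by positivity
  have h4 : 0 ≤ ((k.factorial : ℝ))⁻¹ := by positivity
  calc _ = (‖Complex.Gamma (ν + k + 1)‖⁻¹) * (‖w‖ ^ k * ((k.factorial : ℝ))⁻¹) := by ring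
    _ ≤ B * (R ^ k * ((k.factorial : ℝ))⁻¹) := by
        apply mul_le_mul h _ (by positivity) hB0.le
        exact mul_le_mul_of_nonneg_right h2 h4
    _ = _ := by rw [div_eq_mul_inv]

theorem besselE_summable_norm (ν w : ℂ) : Summable fun k : ℕ =>
    ‖(-1) ^ k / ((k.factorial : ℂ) * Complex.Gamma (ν + k + 1)) * w ^ k‖ := by
  obtain ⟨u, hu, h⟩ := besselE_term_bound (max ‖ν‖ ‖w‖)
  exact Summable.of_nonneg_of_le (fun _ => norm_nonneg _)
    (h ν w (le_max_left _ _) (le_max_right _ _)) hu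

theorem inv_Gamma_continuous : Continuous fun s : ℂ => (Complex.Gamma s)⁻¹ :=
  Complex.differentiable_one_div_Gamma.continuous

theorem besselE_continuous : Continuous fun p : ℂ × ℂ => besselE p.1 p.2 := by
  rw [continuous_iff_continuousAt]
  intro p
  obtain ⟨u, hu, h⟩ := besselE_term_bound (‖p‖ + 1)
  have : ContinuousOn (fun p : ℂ × ℂ => besselE p.1 p.2) (Metric.ball 0 (‖p‖ + 1)) := by
    refine continuousOn_tsum (fun k => ?_) hu (fun k q hq => ?_)
    · have : Continuous fun q : ℂ × ℂ => (Complex.Gamma (q.1 + k + 1))⁻¹ :=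
        inv_Gamma_continuous.comp (f := fun q : ℂ × ℂ => q.1 + k + 1) (by fun_prop)
      have h2 : Continuous fun q : ℂ × ℂ => (-1) ^ k * (((k.factorial : ℂ))⁻¹ *
          (Complex.Gamma (q.1 + k + 1))⁻¹) * q.2 ^ k := by fun_prop
      refine h2.continuousOn.congr fun q _ => ?_
      simp only [div_eq_mul_inv, mul_inv]
    · rw [mem_ball_zero_iff] at hq
      exact h _ _ ((norm_fst_le q).trans hq.le) ((norm_snd_le q).trans hq.le) k
  exact this.continuousAt (Metric.isOpen_ball.mem_nhds (by simp))

theorem besselE_differentiable_order (w : ℂ) : Differentiable ℂ fun ν => besselE ν w := by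
  intro ν
  obtain ⟨u, hu, h⟩ := besselE_term_bound (max (‖ν‖ + 1) ‖w‖)
  have : DifferentiableOn ℂ (fun ν => besselE ν w) (Metric.ball 0 (‖ν‖ + 1)) := by
    refine Complex.differentiableOn_tsum_of_summable_norm hu (fun k => ?_) Metric.isOpen_ball
      (fun k q hq => ?_)
    · have h2 : Differentiable ℂ fun q : ℂ => (-1) ^ k * (((k.factorial : ℂ))⁻¹ *
          (Complex.Gamma (q + k + 1))⁻¹) * w ^ k := by
        have : Differentiable ℂ fun q : ℂ => (Complex.Gamma (q + k + 1))⁻¹ :=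
          Complex.differentiable_one_div_Gamma.comp (f := fun q : ℂ => q + k + 1) (by fun_prop)
        fun_prop
      refine h2.differentiableOn.congr fun q _ => ?_
      simp only [div_eq_mul_inv, mul_inv]
    · rw [mem_ball_zero_iff] at hq
      exact h _ _ (hq.le.trans (le_max_left _ _)) (le_max_right _ _) k
  exact this.differentiableAt (Metric.isOpen_ball.mem_nhds (by simp))

theorem besselE_hasDerivAt (ν w : ℂ) :
    HasDerivAt (fun w => besselE ν w) (-besselE (ν + 1) w) w := by
  obtain ⟨u, hu, h⟩ := besselE_term_bound (max (‖w‖ + 1) ‖ν‖)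
  have hd : ∀ k : ℕ, DifferentiableOn ℂ (fun w : ℂ =>
      (-1) ^ k / ((k.factorial : ℂ) * Complex.Gamma (ν + k + 1)) * w ^ k)
        (Metric.ball 0 (‖w‖ + 1)) := fun k => by fun_prop
  have hb : ∀ (k : ℕ), ∀ q ∈ Metric.ball (0 : ℂ) (‖w‖ + 1),
      ‖(-1) ^ k / ((k.factorial : ℂ) * Complex.Gamma (ν + k + 1)) * q ^ k‖ ≤ u k := fun k q hq => by
    rw [mem_ball_zero_iff] at hq
    exact h _ _ (le_max_right _ _) (hq.le.trans (le_max_left _ _)) k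
  have hmem : w ∈ Metric.ball (0 : ℂ) (‖w‖ + 1) := by simp
  have h1 : DifferentiableOn ℂ (fun w => besselE ν w) (Metric.ball 0 (‖w‖ + 1)) :=
    Complex.differentiableOn_tsum_of_summable_norm hu hd Metric.isOpen_ball hb
  have h2 := Complex.hasSum_deriv_of_summable_norm hu hd Metric.isOpen_ball hb hmem
  have h3 := (h1.differentiableAt (Metric.isOpen_ball.mem_nhds hmem)).hasDerivAt
  suffices hd' : -besselE (ν + 1) w = deriv (fun w => besselE ν w) w by rw [hd']; exact h3
  have h4 : deriv (fun w => besselE ν w) w = deriv (fun w : ℂ => ∑' k : ℕ,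
      (-1) ^ k / ((k.factorial : ℂ) * Complex.Gamma (ν + k + 1)) * w ^ k) w := rfl
  rw [h4, ← h2.tsum_eq, h2.summable.tsum_eq_zero_add, besselE, ← tsum_neg]
  simp only [pow_zero, mul_one, deriv_const, zero_add]
  congr 1
  ext k
  rw [deriv_const_mul_field, deriv_pow_field, Nat.factorial_succ]
  push_cast
  have e : ν + 1 + (k : ℂ) + 1 = ν + (k + 1) + 1 := by ring
  have h5 : (k : ℂ) + 1 ≠ 0 := Nat.cast_add_one_ne_zero k
  have h6 : (k.factorial : ℂ) ≠ 0 := by exact_mod_cast k.factorial_ne_zero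
  rw [e, pow_succ]
  simp only [div_eq_mul_inv, mul_inv]
  field_simp

theorem besselE_recurrence (ν w : ℂ) :
    besselE ν w = (ν + 1) * besselE (ν + 1) w - w * besselE (ν + 2) w := by
  have hs : ∀ ν, Summable fun k : ℕ =>
      (-1) ^ k / ((k.factorial : ℂ) * Complex.Gamma (ν + k + 1)) * w ^ k :=
    fun ν => (besselE_summable_norm ν w).of_norm
  have e2 : Summable fun k : ℕ =>
      (k : ℂ) * ((-1) ^ k / ((k.factorial : ℂ) * Complex.Gamma (ν + 1 + k + 1)) * w ^ k) := by
    refine ((hs ν).sub ((hs (ν + 1)).mul_left (ν + 1))).congr fun k => ?_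
    have := Complex.one_div_Gamma_eq_self_mul_one_div_Gamma_add_one (ν + k + 1)
    simp only [div_eq_mul_inv, mul_inv]
    rw [this, show ν + 1 + (k : ℂ) + 1 = ν + k + 1 + 1 by ring]
    ring
  have e1 : w * besselE (ν + 2) w = -∑' k : ℕ,
      (k : ℂ) * ((-1) ^ k / ((k.factorial : ℂ) * Complex.Gamma (ν + 1 + k + 1)) * w ^ k) := by
    rw [e2.tsum_eq_zero_add, besselE, ← tsum_mul_left]
    simp only [Nat.cast_zero, zero_mul, zero_add]
    rw [← tsum_neg]
    congr 1
    ext k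
    have h5 : (k : ℂ) + 1 ≠ 0 := Nat.cast_add_one_ne_zero k
    have h6 : (k.factorial : ℂ) ≠ 0 := by exact_mod_cast k.factorial_ne_zero
    rw [Nat.factorial_succ]
    push_cast
    rw [show ν + 1 + ((k : ℂ) + 1) + 1 = ν + 2 + k + 1 by ring]
    simp only [div_eq_mul_inv, mul_inv]
    field_simp
    ring
  rw [e1, besselE, besselE, sub_neg_eq_add, ← tsum_mul_left,
    ← ((hs (ν + 1)).mul_left (ν + 1)).tsum_add e2]
  congr 1
  ext k
  have := Complex.one_div_Gamma_eq_self_mul_one_div_Gamma_add_one (ν + k + 1)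
  simp only [div_eq_mul_inv, mul_inv]
  rw [this, show ν + 1 + (k : ℂ) + 1 = ν + k + 1 + 1 by ring]
  ring

theorem besselE_conj (ν w : ℂ) :
    besselE (starRingEnd ℂ ν) (starRingEnd ℂ w) = starRingEnd ℂ (besselE ν w) := by
  rw [besselE, besselE, Complex.conj_tsum]
  congr 1
  ext k
  simp only [map_mul, map_div₀, map_pow, map_neg, map_one, Complex.conj_natCast,
    ← Complex.Gamma_conj, map_add]

/-! ### Products of two Bessel functions -/

theorem inv_Gamma_sub_nat (z : ℂ) (j : ℕ) :
    (Complex.Gamma (z - j + 1))⁻¹ =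
      (j.factorial : ℂ) * Ring.choose z j * (Complex.Gamma (z + 1))⁻¹ := by
  have key : ∀ j : ℕ, (j.factorial : ℂ) * Ring.choose z j =
      (descPochhammer ℤ j).smeval z := fun j => by
    rw [Ring.descPochhammer_eq_factorial_smul_choose, nsmul_eq_mul]
  rw [key]
  induction j with
  | zero => simp
  | succ j ih =>
    rw [descPochhammer_succ_right, Polynomial.smeval_mul]
    rw [show (Complex.Gamma (z - (j + 1 : ℕ) + 1))⁻¹ =
      (z - j) * (Complex.Gamma (z - j + 1))⁻¹ by
        push_cast
        rw [show z - ((j : ℂ) + 1) + 1 = z - j by ring]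
        exact Complex.one_div_Gamma_eq_self_mul_one_div_Gamma_add_one (z - j), ih]
    simp [Polynomial.smeval_sub, Polynomial.smeval_X, Polynomial.smeval_natCast]
    ring

/-- The Cauchy product of the two series; the coefficients are evaluated by the
Chu–Vandermonde identity. -/
theorem besselE_mul_hasSum (a b w : ℂ) (hab : -1 < (a + b).re) :
    HasSum (fun k : ℕ => (-1) ^ k / (k.factorial : ℂ) * (Complex.Gamma (a + b + 2 * k + 1) /
      (Complex.Gamma (a + b + k + 1) * Complex.Gamma (a + k + 1) * Complex.Gamma (b + k + 1)))
        * w ^ k) (besselE a w * besselE b w) := by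
  have h1 := besselE_summable_norm a w
  have h2 := besselE_summable_norm b w
  have h3 := (summable_norm_sum_mul_antidiagonal_of_summable_norm h1 h2).of_norm.hasSum
  rw [← tsum_mul_tsum_eq_tsum_sum_antidiagonal_of_summable_norm h1 h2] at h3
  have h4 : ∀ k : ℕ, Complex.Gamma (a + b + 2 * k + 1) ≠ 0 := fun k => by
    apply Complex.Gamma_ne_zero_of_re_pos
    have : (0 : ℝ) ≤ k := k.cast_nonneg
    simp only [Complex.add_re, Complex.mul_re, Complex.re_ofNat, Complex.natCast_re,
      Complex.im_ofNat, Complex.natCast_im, Complex.one_re] at *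
    linarith
  change HasSum _ (besselE a w * besselE b w) at h3
  refine Eq.mpr (congrArg (fun f : ℕ → ℂ => HasSum f _) (funext fun k => ?_)) h3
  have h5 : (k.factorial : ℂ) ≠ 0 := by exact_mod_cast k.factorial_ne_zero
  have hvan := Ring.add_choose_eq k (Commute.all (b + k) (a + k))
  have hch := inv_Gamma_sub_nat (b + k + (a + k)) k
  rw [show b + (k : ℂ) + (a + k) - k + 1 = a + b + k + 1 by ring,
    show b + (k : ℂ) + (a + k) + 1 = a + b + 2 * k + 1 by ring] at hch
  have e1 : Complex.Gamma (a + b + 2 * k + 1) * (Complex.Gamma (a + b + k + 1))⁻¹ =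
      (k.factorial : ℂ) * Ring.choose (b + k + (a + k)) k := by
    rw [hch]
    field_simp [h4 k]
  rw [div_eq_mul_inv (Complex.Gamma _), mul_inv, mul_inv, mul_assoc, ← mul_assoc (Complex.Gamma _),
    ← mul_assoc (Complex.Gamma _), e1, hvan, Finset.mul_sum, Finset.sum_mul, Finset.sum_mul,
    Finset.sum_mul, Finset.mul_sum]
  refine Finset.sum_congr rfl fun ij hij => ?_
  rw [Finset.HasAntidiagonal.mem_antidiagonal] at hij
  obtain ⟨i, j⟩ := ij
  simp only at hij ⊢
  have f1 := inv_Gamma_sub_nat (a + k) j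
  have f2 := inv_Gamma_sub_nat (b + k) i
  have hk : (k : ℂ) = i + j := by rw [← hij]; push_cast; ring
  rw [show a + (k : ℂ) - j + 1 = a + i + 1 by rw [hk]; ring] at f1
  rw [show b + (k : ℂ) - i + 1 = b + j + 1 by rw [hk]; ring] at f2
  simp only [div_eq_mul_inv, mul_inv]
  rw [f1, f2]
  have g1 : (i.factorial : ℂ) ≠ 0 := by exact_mod_cast i.factorial_ne_zero
  have g2 : (j.factorial : ℂ) ≠ 0 := by exact_mod_cast j.factorial_ne_zero
  rw [← hij, pow_add, pow_add]
  have h5' : ((i + j).factorial : ℂ) ≠ 0 := by exact_mod_cast (i + j).factorial_ne_zero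
  field_simp

-- unfolding the series in unification problems is never useful
attribute [irreducible] besselE



/-! ### Two-sided Stirling bounds for the Gamma function on vertical strips -/

theorem norm_Gamma_le_Gamma_re {s : ℂ} (hs : 0 < s.re) : ‖Complex.Gamma s‖ ≤ Real.Gamma s.re := by
  rw [Complex.Gamma_eq_integral hs, Real.Gamma_eq_integral hs, Complex.GammaIntegral]
  refine (norm_integral_le_integral_norm _).trans_eq ?_
  refine setIntegral_congr_fun measurableSet_Ioi fun x hx => ?_
  rw [mem_Ioi] at hx
  simp only [norm_mul, Complex.norm_real, Real.norm_eq_abs, Real.abs_exp]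
  rw [Complex.norm_cpow_eq_rpow_re_of_pos hx]
  simp

theorem norm_csin_le (z : ℂ) : ‖Complex.sin z‖ ≤ Real.exp |z.im| := by
  rw [Complex.sin, norm_div, norm_mul, Complex.norm_I, mul_one]
  have h1 : ‖Complex.exp (-z * Complex.I)‖ ≤ Real.exp |z.im| := by
    rw [Complex.norm_exp]; apply Real.exp_le_exp.2; simp [le_abs_self]
  have h2 : ‖Complex.exp (z * Complex.I)‖ ≤ Real.exp |z.im| := by
    rw [Complex.norm_exp]; apply Real.exp_le_exp.2; simp [neg_le_abs]
  have := norm_sub_le (Complex.exp (-z * Complex.I)) (Complex.exp (z * Complex.I))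
  rw [Complex.norm_ofNat]
  linarith

theorem norm_ccos_le (z : ℂ) : ‖Complex.cos z‖ ≤ Real.exp |z.im| := by
  have := norm_csin_le (z + Real.pi / 2)
  rw [Complex.sin_add_pi_div_two] at this
  simpa using this

theorem sinh_abs_le_norm_csin (z : ℂ) : Real.sinh |z.im| ≤ ‖Complex.sin z‖ := by
  rw [Complex.sin, norm_div, norm_mul, Complex.norm_I, mul_one, Complex.norm_ofNat, Real.sinh_eq]
  have h1 : ‖Complex.exp (-z * Complex.I)‖ = Real.exp z.im := by rw [Complex.norm_exp]; simp
  have h2 : ‖Complex.exp (z * Complex.I)‖ = Real.exp (-z.im) := by rw [Complex.norm_exp]; simp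
  have h3 := abs_norm_sub_norm_le (Complex.exp (-z * Complex.I)) (Complex.exp (z * Complex.I))
  rw [h1, h2] at h3
  rcases abs_cases z.im with ⟨h, _⟩ | ⟨h, _⟩ <;> rw [h]
  · linarith [le_abs_self (Real.exp z.im - Real.exp (-z.im))]
  · rw [neg_neg]; linarith [neg_le_abs (Real.exp z.im - Real.exp (-z.im))]

/-- On the critical line the modulus of `Γ` is elementary. -/
theorem norm_Gamma_half_sq (t : ℝ) :
    ‖Complex.Gamma (1 / 2 + t * Complex.I)‖ ^ 2 = Real.pi / Real.cosh (Real.pi * t) := by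
  have h := Complex.Gamma_mul_Gamma_one_sub (1 / 2 + t * Complex.I)
  have e1 : 1 - (1 / 2 + t * Complex.I) = (starRingEnd ℂ) (1 / 2 + t * Complex.I) := by
    rw [map_add, map_mul, Complex.conj_I, Complex.conj_ofReal, map_div₀, map_one, Complex.conj_ofNat]
    ring
  rw [e1, Complex.Gamma_conj, Complex.mul_conj, Complex.normSq_eq_norm_sq] at h
  have e2 : (Real.pi : ℂ) * (1 / 2 + t * Complex.I) =
      (Real.pi * t : ℝ) * Complex.I + Real.pi / 2 := by push_cast; ring
  rw [e2, Complex.sin_add_pi_div_two, Complex.cos_mul_I, ← Complex.ofReal_cosh] at h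
  exact_mod_cast h

theorem im_mul_arg_le (z : ℂ) (hz : 0 < z.re) :
    z.im * z.arg ≤ Real.pi * |z.im| / 2 ∧ Real.pi * |z.im| / 2 - z.re ≤ z.im * z.arg := by
  have h1 : |z.arg| < Real.pi / 2 := Complex.abs_arg_lt_pi_div_two_iff.2 (Or.inl hz)
  have h2 : z.im * z.arg = |z.im| * |z.arg| := by
    rcases le_or_gt 0 z.im with h | h
    · rw [abs_of_nonneg h, abs_of_nonneg (Complex.arg_nonneg_iff.2 h)]
    · rw [abs_of_neg h, abs_of_neg (Complex.arg_neg_iff.2 h)]; ring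
  constructor
  · rw [h2]; nlinarith [abs_nonneg z.im]
  · rcases eq_or_ne z.im 0 with h0 | h0
    · rw [h0]; simp; exact hz.le
    have h3 : 0 < |z.im| := abs_pos.2 h0
    have h4 : Real.tan |z.arg| = |z.im| / z.re := by
      rcases le_or_gt 0 z.im with h | h
      · rw [abs_of_nonneg h, abs_of_nonneg (Complex.arg_nonneg_iff.2 h), Complex.tan_arg]
      · rw [abs_of_neg h, abs_of_neg (Complex.arg_neg_iff.2 h), Real.tan_neg, Complex.tan_arg]
        ring
    have h5 : 0 < |z.arg| := by
      refine (abs_nonneg _).lt_of_ne' fun h => ?_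
      rw [h, Real.tan_zero] at h4
      exact (div_pos h3 hz).ne h4
    have h6 := Real.le_tan (x := Real.pi / 2 - |z.arg|) (by linarith) (by linarith)
    rw [Real.tan_pi_div_two_sub, h4, inv_div, le_div_iff₀ h3] at h6
    rw [h2]; linarith

theorem norm_exp_sub_half_mul_log (z : ℂ) (hz : 0 < z.re) :
    ‖Complex.exp ((z - 1 / 2) * Complex.log z)‖ =
      ‖z‖ ^ (z.re - 1 / 2) * Real.exp (-(z.im * z.arg)) := by
  have h0 : z ≠ 0 := by rintro rfl; simp at hz
  rw [Complex.norm_exp, Complex.mul_re, Complex.log_re, Complex.log_im,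
    Real.rpow_def_of_pos (norm_pos_iff.2 h0), ← Real.exp_add]
  congr 1
  simp
  ring

/-- The Stirling quotient is bounded above and below on `1/2 ≤ Re z ≤ 3/2`: by the reflection
formula this is elementary on the two edges, and the Phragmén–Lindelöf principle fills the strip. -/
theorem Gamma_stirling_strip : ∃ K : ℝ, 0 < K ∧ ∀ z : ℂ, 1 / 2 ≤ z.re → z.re ≤ 3 / 2 →
    ‖Complex.Gamma z‖ ≤ K * ‖Complex.exp ((z - 1 / 2) * Complex.log z)‖ ∧
    ‖Complex.exp ((z - 1 / 2) * Complex.log z)‖ ≤ K * ‖Complex.Gamma z‖ := by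
  set φ : ℂ → ℂ := fun z => Complex.exp ((z - 1 / 2) * Complex.log z) with hφ
  have hslit : ∀ z : ℂ, 0 < z.re → z ∈ Complex.slitPlane := fun z hz => Or.inl hz
  have hφd : ∀ z : ℂ, 0 < z.re → DifferentiableAt ℂ φ z := fun z hz => by
    have := hslit z hz
    fun_prop (disch := assumption)
  have hΓd : ∀ z : ℂ, 0 < z.re → DifferentiableAt ℂ Complex.Gamma z := fun z hz => by
    refine Complex.differentiableAt_Gamma z fun m hm => ?_
    rw [hm] at hz; simp at hz
    linarith [(Nat.cast_nonneg m : (0 : ℝ) ≤ m)]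
  have hΓ0 : ∀ z : ℂ, 0 < z.re → Complex.Gamma z ≠ 0 := fun z hz =>
    Complex.Gamma_ne_zero_of_re_pos hz
  have hφ0 : ∀ z : ℂ, φ z ≠ 0 := fun z => Complex.exp_ne_zero _
  have hcl : closure (Complex.re ⁻¹' Ioo (1 / 2 : ℝ) (3 / 2)) ⊆ {z : ℂ | 0 < z.re} := by
    intro z hz
    have := closure_minimal (s := Complex.re ⁻¹' Ioo (1 / 2 : ℝ) (3 / 2))
      (t := {z : ℂ | 1 / 2 ≤ z.re}) (fun z hz => hz.1.le)
      (isClosed_le continuous_const Complex.continuous_re) hz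
    have h2 : (1 / 2 : ℝ) ≤ z.re := this
    show 0 < z.re
    linarith
  -- the modulus on the two edges
  have hch : ∀ t : ℝ, Real.exp (Real.pi * |t|) / 2 ≤ Real.cosh (Real.pi * t) ∧
      Real.cosh (Real.pi * t) ≤ Real.exp (Real.pi * |t|) := fun t => by
    rw [← Real.cosh_abs, abs_mul, abs_of_pos Real.pi_pos, Real.cosh_eq]
    have h1 : Real.exp (-(Real.pi * |t|)) ≤ Real.exp (Real.pi * |t|) := by
      apply Real.exp_le_exp.2; have := Real.pi_pos; nlinarith [abs_nonneg t, mul_nonneg this.le (abs_nonneg t)]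
    have := Real.exp_pos (-(Real.pi * |t|))
    constructor <;> linarith
  have half : ∀ t : ℝ,
      ‖Complex.Gamma (1 / 2 + t * Complex.I)‖ ≤ 3 * Real.exp (-(Real.pi * |t| / 2)) ∧
      Real.exp (-(Real.pi * |t| / 2)) ≤ ‖Complex.Gamma (1 / 2 + t * Complex.I)‖ := fun t => by
    have h := norm_Gamma_half_sq t
    obtain ⟨h1, h2⟩ := hch t
    have e : Real.exp (-(Real.pi * |t| / 2)) ^ 2 * Real.exp (Real.pi * |t|) = 1 := by
      rw [← Real.exp_nat_mul, ← Real.exp_add]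
      simp; ring
    have hpos := Real.exp_pos (-(Real.pi * |t| / 2))
    have hposc : 0 < Real.cosh (Real.pi * t) := Real.cosh_pos _
    rw [eq_div_iff hposc.ne'] at h
    have hpi := Real.pi_gt_three
    have hpi' := Real.pi_lt_four
    have hE := Real.exp_pos (Real.pi * |t|)
    have hG := norm_nonneg (Complex.Gamma (1 / 2 + t * Complex.I))
    generalize Real.exp (Real.pi * |t|) = E at *
    generalize Real.exp (-(Real.pi * |t| / 2)) = e₀ at *
    generalize Real.cosh (Real.pi * t) = c at *
    generalize ‖Complex.Gamma (1 / 2 + t * Complex.I)‖ = G at *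
    constructor
    · refine le_of_not_gt fun hlt => ?_
      have h3 : (3 * e₀) ^ 2 < G ^ 2 := pow_lt_pow_left₀ hlt (by positivity) two_ne_zero
      have h4 : (3 * e₀) ^ 2 * (E / 2) < G ^ 2 * c := by
        calc (3 * e₀) ^ 2 * (E / 2) < G ^ 2 * (E / 2) := by gcongr
          _ ≤ G ^ 2 * c := by gcongr
      nlinarith
    · refine le_of_not_gt fun hlt => ?_
      have h3 : G ^ 2 ≤ e₀ ^ 2 := pow_le_pow_left₀ hG hlt.le 2
      have h4 : G ^ 2 * c ≤ e₀ ^ 2 * E := by gcongr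
      linarith
  have edge1 : ∀ z : ℂ, z.re = 1 / 2 → ‖Complex.Gamma z‖ ≤ 15 * ‖φ z‖ ∧
      ‖φ z‖ ≤ 15 * ‖Complex.Gamma z‖ := fun z hz => by
    obtain ⟨h1, h2⟩ := half z.im
    have hz' : 1 / 2 + (z.im : ℂ) * Complex.I = z := by
      apply Complex.ext <;> simp [hz]
    rw [hz'] at h1 h2
    obtain ⟨h3, h4⟩ := im_mul_arg_le z (by rw [hz]; norm_num)
    have h5 : ‖φ z‖ = Real.exp (-(z.im * z.arg)) := by
      rw [hφ, norm_exp_sub_half_mul_log z (by rw [hz]; norm_num), hz]; simp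
    have h6 : Real.exp (-(Real.pi * |z.im| / 2)) ≤ ‖φ z‖ := by
      rw [h5]; apply Real.exp_le_exp.2; linarith
    have h7 : ‖φ z‖ ≤ Real.exp 1 * Real.exp (-(Real.pi * |z.im| / 2)) := by
      rw [h5, ← Real.exp_add]; apply Real.exp_le_exp.2; linarith
    have h8 := Real.exp_one_lt_d9
    have h9 := Real.exp_pos (-(Real.pi * |z.im| / 2))
    constructor <;> nlinarith
  have edge2 : ∀ z : ℂ, z.re = 3 / 2 → ‖Complex.Gamma z‖ ≤ 15 * ‖φ z‖ ∧
      ‖φ z‖ ≤ 15 * ‖Complex.Gamma z‖ := fun z hz => by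
    obtain ⟨h1, h2⟩ := half z.im
    have hz' : 1 / 2 + (z.im : ℂ) * Complex.I = z - 1 := by
      apply Complex.ext
      · simp [hz]; norm_num
      · simp
    rw [hz'] at h1 h2
    have hz1 : (z - 1).re = 1 / 2 := by simp [hz]; norm_num
    have hne : z - 1 ≠ 0 := fun h => by rw [h] at hz1; norm_num at hz1
    have hG : ‖Complex.Gamma z‖ = ‖z - 1‖ * ‖Complex.Gamma (z - 1)‖ := by
      have := Complex.Gamma_add_one (z - 1) hne
      rw [sub_add_cancel] at this
      rw [this, norm_mul]
    obtain ⟨h3, h4⟩ := im_mul_arg_le z (by rw [hz]; norm_num)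
    have h5 : ‖φ z‖ = ‖z‖ * Real.exp (-(z.im * z.arg)) := by
      rw [hφ, norm_exp_sub_half_mul_log z (by rw [hz]; norm_num), hz]; norm_num
    have h6 : ‖z‖ * Real.exp (-(Real.pi * |z.im| / 2)) ≤ ‖φ z‖ := by
      rw [h5]; gcongr
    have h7 : ‖φ z‖ ≤ ‖z‖ * (Real.exp (3 / 2) * Real.exp (-(Real.pi * |z.im| / 2))) := by
      rw [h5, ← Real.exp_add]; gcongr; linarith
    have h8 : Real.exp (3 / 2) ≤ 5 := by
      have h := Real.exp_one_lt_d9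
      have h' : Real.exp (3 / 2) ^ 2 = Real.exp 1 ^ 3 := by
        rw [← Real.exp_nat_mul, ← Real.exp_nat_mul]; norm_num
      have h'' : Real.exp 1 ^ 3 ≤ 5 ^ 2 := by
        calc Real.exp 1 ^ 3 ≤ 2.75 ^ 3 := by gcongr; linarith
          _ ≤ 5 ^ 2 := by norm_num
      exact (pow_le_pow_iff_left₀ (Real.exp_pos _).le (by norm_num) two_ne_zero).1 (h' ▸ h'')
    have h9 := Real.exp_pos (-(Real.pi * |z.im| / 2))
    have n1 : ‖z‖ ≤ 3 * ‖z - 1‖ := by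
      have a1 := norm_add_le (z - 1) 1
      rw [sub_add_cancel, norm_one] at a1
      have a2 := Complex.re_le_norm (z - 1)
      rw [hz1] at a2
      linarith
    have n2 : ‖z - 1‖ ≤ ‖z‖ := by
      rw [← sq_le_sq₀ (norm_nonneg _) (norm_nonneg _), ← Complex.normSq_eq_norm_sq,
        ← Complex.normSq_eq_norm_sq, Complex.normSq_apply, Complex.normSq_apply, hz1, hz]
      simp; norm_num
    rw [hG]
    constructor
    · calc ‖z - 1‖ * ‖Complex.Gamma (z - 1)‖
          ≤ ‖z‖ * (3 * Real.exp (-(Real.pi * |z.im| / 2))) := by gcongr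
        _ = 3 * (‖z‖ * Real.exp (-(Real.pi * |z.im| / 2))) := by ring
        _ ≤ 3 * ‖φ z‖ := by gcongr
        _ ≤ 15 * ‖φ z‖ := by gcongr; norm_num
    · calc ‖φ z‖ ≤ ‖z‖ * (Real.exp (3 / 2) * Real.exp (-(Real.pi * |z.im| / 2))) := h7
        _ ≤ (3 * ‖z - 1‖) * (5 * ‖Complex.Gamma (z - 1)‖) := by gcongr
        _ = 15 * (‖z - 1‖ * ‖Complex.Gamma (z - 1)‖) := by ring
  -- crude growth inside the strip
  obtain ⟨M, hM⟩ : ∃ M : ℝ, ∀ x ∈ Icc (1 / 2 : ℝ) (3 / 2), ‖Real.Gamma x‖ ≤ M :=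
    isCompact_Icc.exists_bound_of_continuousOn fun x hx =>
      (Real.differentiableOn_Gamma_Ioi.differentiableAt
        (Ioi_mem_nhds (lt_of_lt_of_le (by norm_num) hx.1))).continuousAt.continuousWithinAt
  have hM0 : 0 ≤ M := (norm_nonneg _).trans (hM 1 (by norm_num))
  have hev : ∀ᶠ z in comap (_root_.abs ∘ Complex.im) atTop ⊓
      𝓟 (Complex.re ⁻¹' Ioo (1 / 2 : ℝ) (3 / 2)),
      1 ≤ |z.im| ∧ 1 / 2 < z.re ∧ z.re < 3 / 2 := by
    filter_upwards [mem_inf_of_left (preimage_mem_comap (Ici_mem_atTop (1 : ℝ))),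
      mem_inf_of_right (mem_principal_self _)] with z h1 h2
    exact ⟨h1, h2.1, h2.2⟩
  have growth1 : ∀ z : ℂ, 1 ≤ |z.im| ∧ 1 / 2 < z.re ∧ z.re < 3 / 2 →
      ‖Complex.Gamma z / φ z‖ ≤ M * Real.exp (4 * Real.exp (1 * |z.im|)) := by
    rintro z ⟨h1, h2, h3⟩
    have hz : 0 < z.re := by linarith
    obtain ⟨h4, h5⟩ := im_mul_arg_le z hz
    have hn : 1 ≤ ‖z‖ := h1.trans (Complex.abs_im_le_norm z)
    rw [norm_div, hφ, norm_exp_sub_half_mul_log z hz, div_le_iff₀ (by positivity)]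
    have g1 := (norm_Gamma_le_Gamma_re hz).trans ((le_abs_self _).trans (hM z.re ⟨h2.le, h3.le⟩))
    have g2 : 1 ≤ ‖z‖ ^ (z.re - 1 / 2) := Real.one_le_rpow hn (by linarith)
    have g3 : 1 ≤ Real.exp (4 * Real.exp (1 * |z.im|)) * Real.exp (-(z.im * z.arg)) := by
      rw [← Real.exp_add]
      apply Real.one_le_exp
      have := Real.add_one_le_exp (1 * |z.im|)
      have := Real.pi_lt_four
      nlinarith
    calc ‖Complex.Gamma z‖ ≤ M * (1 * 1) := by linarith
      _ ≤ M * (‖z‖ ^ (z.re - 1 / 2) *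
          (Real.exp (4 * Real.exp (1 * |z.im|)) * Real.exp (-(z.im * z.arg)))) := by gcongr
      _ = _ := by ring
  have growth2 : ∀ z : ℂ, 1 ≤ |z.im| ∧ 1 / 2 < z.re ∧ z.re < 3 / 2 →
      ‖φ z / Complex.Gamma z‖ ≤ M * Real.exp (4 * Real.exp (1 * |z.im|)) := by
    rintro z ⟨h1, h2, h3⟩
    have hz : 0 < z.re := by linarith
    obtain ⟨h4, h5⟩ := im_mul_arg_le z hz
    have hn : 1 ≤ ‖z‖ := h1.trans (Complex.abs_im_le_norm z)
    have h1z : 1 - z ≠ 0 := fun h => by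
      have : (1 - z).im = 0 := by rw [h]; simp
      simp at this; rw [this] at h1; norm_num at h1
    have hr := Complex.Gamma_mul_Gamma_one_sub z
    have hs : Complex.sin (Real.pi * z) ≠ 0 := fun h => by
      have := sinh_abs_le_norm_csin (Real.pi * z)
      rw [h, norm_zero] at this
      have h' : 0 < Real.sinh |((Real.pi : ℂ) * z).im| := by
        apply Real.sinh_pos_iff.2
        simp
        intro h0
        rw [h0] at h1; norm_num at h1
      linarith
    have hr2 : Complex.Gamma (2 - z) = (1 - z) * Complex.Gamma (1 - z) := by
      rw [← Complex.Gamma_add_one _ h1z]; congr 1; ring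
    have hinv : φ z / Complex.Gamma z =
        φ z * Complex.Gamma (2 - z) * Complex.sin (Real.pi * z) / (Real.pi * (1 - z)) := by
      rw [eq_div_iff hs] at hr
      have := hΓ0 z hz
      have hpi : (Real.pi : ℂ) ≠ 0 := by exact_mod_cast Real.pi_ne_zero
      rw [hr2, div_eq_div_iff this (mul_ne_zero hpi h1z)]
      linear_combination (-(φ z * (1 - z))) * hr
    have g1 : ‖Complex.Gamma (2 - z)‖ ≤ M := by
      have : (2 - z).re = 2 - z.re := by simp
      exact (norm_Gamma_le_Gamma_re (by rw [this]; linarith)).trans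
        ((le_abs_self _).trans (hM _ ⟨by rw [this]; linarith, by rw [this]; linarith⟩))
    have g2 : ‖Complex.sin (Real.pi * z)‖ ≤ Real.exp (4 * |z.im|) := by
      refine (norm_csin_le _).trans (Real.exp_le_exp.2 ?_)
      simp [abs_mul, abs_of_pos Real.pi_pos]
      gcongr
      exact Real.pi_lt_four.le
    have g3 : ‖φ z‖ ≤ 3 * |z.im| := by
      rw [hφ, norm_exp_sub_half_mul_log z hz]
      have a1 : ‖z‖ ^ (z.re - 1 / 2) ≤ ‖z‖ ^ (1 : ℝ) :=
        Real.rpow_le_rpow_of_exponent_le hn (by linarith)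
      have a2 : Real.exp (-(z.im * z.arg)) ≤ 1 := by
        apply Real.exp_le_one_iff.2
        have := Real.pi_gt_three
        nlinarith
      rw [Real.rpow_one] at a1
      have a3 := Complex.norm_le_abs_re_add_abs_im z
      rw [abs_of_pos hz] at a3
      calc _ ≤ ‖z‖ * 1 := by gcongr
        _ ≤ _ := by linarith
    have g4 : 3 * |z.im| ≤ ‖(Real.pi : ℂ) * (1 - z)‖ := by
      rw [norm_mul, Complex.norm_real, Real.norm_eq_abs, abs_of_pos Real.pi_pos]
      have := Complex.abs_im_le_norm (1 - z)
      simp at this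
      have := Real.pi_gt_three
      gcongr
    have g5 : Real.exp (4 * |z.im|) ≤ Real.exp (4 * Real.exp (1 * |z.im|)) := by
      apply Real.exp_le_exp.2
      have := Real.add_one_le_exp (1 * |z.im|)
      linarith
    rw [hinv, norm_div, norm_mul, norm_mul, div_le_iff₀ (lt_of_lt_of_le (by positivity) g4)]
    calc ‖φ z‖ * ‖Complex.Gamma (2 - z)‖ * ‖Complex.sin (Real.pi * z)‖
        ≤ ‖(Real.pi : ℂ) * (1 - z)‖ * M * Real.exp (4 * Real.exp (1 * |z.im|)) := by
          gcongr
          · exact g3.trans g4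
          · exact g2.trans g5
      _ = _ := by ring
  have pl : ∀ f : ℂ → ℂ, (∀ z : ℂ, 0 < z.re → DifferentiableAt ℂ f z) →
      (∀ z : ℂ, 1 ≤ |z.im| ∧ 1 / 2 < z.re ∧ z.re < 3 / 2 →
        ‖f z‖ ≤ M * Real.exp (4 * Real.exp (1 * |z.im|))) →
      (∀ z : ℂ, z.re = 1 / 2 → ‖f z‖ ≤ 15) → (∀ z : ℂ, z.re = 3 / 2 → ‖f z‖ ≤ 15) →
      ∀ z : ℂ, 1 / 2 ≤ z.re → z.re ≤ 3 / 2 → ‖f z‖ ≤ 15 := by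
    intro f hf hg h1 h2 z hz1 hz2
    refine PhragmenLindelof.vertical_strip (a := 1 / 2) (b := 3 / 2) ?_ ?_ h1 h2 hz1 hz2
    · exact DifferentiableOn.diffContOnCl fun z hz => (hf z (hcl hz)).differentiableWithinAt
    · refine ⟨1, by norm_num; exact lt_trans (by norm_num) Real.pi_gt_three, 4, ?_⟩
      refine Asymptotics.IsBigO.of_bound M ?_
      filter_upwards [hev] with z hz
      rw [Real.norm_eq_abs, Real.abs_exp]
      exact hg z hz
  refine ⟨15, by norm_num, fun z hz1 hz2 => ?_⟩
  have hz : 0 < z.re := by linarith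
  constructor
  · have := pl (fun z => Complex.Gamma z / φ z) (fun z hz => (hΓd z hz).div (hφd z hz) (hφ0 z))
      growth1 (fun z hz => ?_) (fun z hz => ?_) z hz1 hz2
    · rwa [norm_div, div_le_iff₀ (norm_pos_iff.2 (hφ0 z))] at this
    · rw [norm_div, div_le_iff₀ (norm_pos_iff.2 (hφ0 z))]; exact (edge1 z hz).1
    · rw [norm_div, div_le_iff₀ (norm_pos_iff.2 (hφ0 z))]; exact (edge2 z hz).1
  · have := pl (fun z => φ z / Complex.Gamma z)
      (fun z hz => (hφd z hz).div (hΓd z hz) (hΓ0 z hz))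
      growth2 (fun z hz => ?_) (fun z hz => ?_) z hz1 hz2
    · rwa [norm_div, div_le_iff₀ (norm_pos_iff.2 (hΓ0 z hz))] at this
    · have h0 : 0 < z.re := by rw [hz]; norm_num
      rw [norm_div, div_le_iff₀ (norm_pos_iff.2 (hΓ0 z h0))]; exact (edge1 z hz).2
    · have h0 : 0 < z.re := by rw [hz]; norm_num
      rw [norm_div, div_le_iff₀ (norm_pos_iff.2 (hΓ0 z h0))]; exact (edge2 z hz).2

/-- The modulus `|t|^(x-1/2) e^{-π|t|/2}` of the Stirling approximation to `Γ(x + it)`. -/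
noncomputable def stirlingWeight (x t : ℝ) : ℝ :=
  |t| ^ (x - 1 / 2) * Real.exp (-(Real.pi * |t| / 2))

theorem stirlingWeight_pos (x : ℝ) {t : ℝ} (ht : t ≠ 0) : 0 < stirlingWeight x t :=
  mul_pos (Real.rpow_pos_of_pos (abs_pos.2 ht) _) (Real.exp_pos _)

/-- The Stirling weight obeys the functional equation of `Γ` up to the factor `|t|` in place of
`|x + it|`; this propagates the bounds from one strip of width one to the next. -/
theorem stirlingWeight_add_one (x : ℝ) {t : ℝ} (ht : t ≠ 0) :
    stirlingWeight (x + 1) t = |t| * stirlingWeight x t := by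
  rw [stirlingWeight, stirlingWeight, show x + 1 - 1 / 2 = (x - 1 / 2) + 1 by ring,
    Real.rpow_add_one (abs_pos.2 ht).ne']
  ring

theorem Gamma_stirling_half (n : ℕ) : ∃ K : ℝ, 0 < K ∧ ∀ z : ℂ, 1 / 2 - n ≤ z.re →
    z.re ≤ 3 / 2 + n → 1 ≤ |z.im| →
    ‖Complex.Gamma z‖ ≤ K * stirlingWeight z.re z.im ∧
      stirlingWeight z.re z.im ≤ K * ‖Complex.Gamma z‖ := by
  induction n with
  | zero =>
    obtain ⟨K, hK0, hK⟩ := Gamma_stirling_strip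
    refine ⟨K * 15, by positivity, fun z h1 h2 h3 => ?_⟩
    simp only [Nat.cast_zero, sub_zero, add_zero] at h1 h2
    have hz : 0 < z.re := by linarith
    obtain ⟨k1, k2⟩ := hK z h1 h2
    obtain ⟨a1, a2⟩ := im_mul_arg_le z hz
    rw [norm_exp_sub_half_mul_log z hz] at k1 k2
    have hpos : 0 < |z.im| := by linarith
    have n1 : |z.im| ≤ ‖z‖ := Complex.abs_im_le_norm z
    have n2 : ‖z‖ ≤ 3 * |z.im| := by
      have := Complex.norm_le_abs_re_add_abs_im z
      rw [abs_of_pos hz] at this; linarith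
    have p1 : |z.im| ^ (z.re - 1 / 2) ≤ ‖z‖ ^ (z.re - 1 / 2) :=
      Real.rpow_le_rpow hpos.le n1 (by linarith)
    have p2 : ‖z‖ ^ (z.re - 1 / 2) ≤ 3 * |z.im| ^ (z.re - 1 / 2) := by
      calc ‖z‖ ^ (z.re - 1 / 2) ≤ (3 * |z.im|) ^ (z.re - 1 / 2) :=
            Real.rpow_le_rpow (norm_nonneg _) n2 (by linarith)
        _ = 3 ^ (z.re - 1 / 2) * |z.im| ^ (z.re - 1 / 2) := Real.mul_rpow (by norm_num) hpos.le
        _ ≤ 3 ^ (1 : ℝ) * |z.im| ^ (z.re - 1 / 2) := by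
            gcongr
            · norm_num
            · linarith
        _ = _ := by norm_num
    have e1 : Real.exp (-(z.im * z.arg)) ≤ 5 * Real.exp (-(Real.pi * |z.im| / 2)) := by
      have h : Real.exp (3 / 2) ≤ 5 := by
        have h := Real.exp_one_lt_d9
        have h' : Real.exp (3 / 2) ^ 2 = Real.exp 1 ^ 3 := by
          rw [← Real.exp_nat_mul, ← Real.exp_nat_mul]; norm_num
        have h'' : Real.exp 1 ^ 3 ≤ 5 ^ 2 := by
          calc Real.exp 1 ^ 3 ≤ 2.75 ^ 3 := by gcongr; linarith
            _ ≤ 5 ^ 2 := by norm_num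
        exact (pow_le_pow_iff_left₀ (Real.exp_pos _).le (by norm_num) two_ne_zero).1 (h' ▸ h'')
      calc Real.exp (-(z.im * z.arg)) ≤ Real.exp (3 / 2 + -(Real.pi * |z.im| / 2)) :=
            Real.exp_le_exp.2 (by linarith)
        _ = Real.exp (3 / 2) * Real.exp (-(Real.pi * |z.im| / 2)) := Real.exp_add _ _
        _ ≤ _ := by gcongr
    have e2 : Real.exp (-(Real.pi * |z.im| / 2)) ≤ Real.exp (-(z.im * z.arg)) :=
      Real.exp_le_exp.2 (by linarith)
    rw [stirlingWeight]
    constructor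
    · calc ‖Complex.Gamma z‖ ≤ K * (‖z‖ ^ (z.re - 1 / 2) * Real.exp (-(z.im * z.arg))) := k1
        _ ≤ K * ((3 * |z.im| ^ (z.re - 1 / 2)) * (5 * Real.exp (-(Real.pi * |z.im| / 2)))) := by
            gcongr
        _ = _ := by ring
    · calc |z.im| ^ (z.re - 1 / 2) * Real.exp (-(Real.pi * |z.im| / 2))
          ≤ ‖z‖ ^ (z.re - 1 / 2) * Real.exp (-(z.im * z.arg)) := by gcongr
        _ ≤ K * ‖Complex.Gamma z‖ := k2
        _ ≤ K * 15 * ‖Complex.Gamma z‖ := by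
            have := norm_nonneg (Complex.Gamma z); nlinarith [mul_nonneg hK0.le this]
  | succ n ih =>
    obtain ⟨K, hK0, hK⟩ := ih
    set L : ℝ := 4 + n with hL
    have hn : (0 : ℝ) ≤ n := n.cast_nonneg
    have hL1 : 1 ≤ L := by linarith
    refine ⟨K * L, by positivity, fun z h1 h2 h3 => ?_⟩
    push_cast at h1 h2
    have him : z.im ≠ 0 := fun h => by rw [h] at h3; norm_num at h3
    -- norms of points at height at least one, compared with the height
    have hnorm : ∀ w : ℂ, w.im = z.im → |w.re| ≤ 3 + n → |z.im| ≤ ‖w‖ ∧ ‖w‖ ≤ L * |z.im| := by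
      intro w hw hre
      have i1 := Complex.abs_im_le_norm w
      have i2 := Complex.norm_le_abs_re_add_abs_im w
      rw [hw] at i1 i2
      refine ⟨i1, i2.trans ?_⟩
      rw [hL]; nlinarith
    rcases le_or_gt z.re (3 / 2 + n) with h4 | h4
    · rcases le_or_gt (1 / 2 - (n : ℝ)) z.re with h5 | h5
      · obtain ⟨k1, k2⟩ := hK z h5 h4 h3
        have hw := (stirlingWeight_pos z.re him).le
        have hg := norm_nonneg (Complex.Gamma z)
        constructor
        · calc _ ≤ K * 1 * stirlingWeight z.re z.im := by rw [mul_one]; exact k1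
            _ ≤ _ := by gcongr
        · calc _ ≤ K * 1 * ‖Complex.Gamma z‖ := by rw [mul_one]; exact k2
            _ ≤ _ := by gcongr
      · -- go down: `Γ(z) = Γ(z+1)/z`
        obtain ⟨k1, k2⟩ := hK (z + 1) (by simp; linarith) (by simp; linarith) (by simpa using h3)
        have hz0 : z ≠ 0 := fun h => him (by rw [h]; simp)
        rw [Complex.Gamma_add_one z hz0, norm_mul] at k1 k2
        simp only [Complex.add_re, Complex.add_im, Complex.one_re, Complex.one_im, add_zero] at k1 k2
        rw [stirlingWeight_add_one _ him] at k1 k2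
        obtain ⟨n1, n2⟩ := hnorm z rfl (abs_le.2 ⟨by linarith, by linarith⟩)
        have hp : 0 < |z.im| := by linarith
        have hw := (stirlingWeight_pos z.re him).le
        have hg := norm_nonneg (Complex.Gamma z)
        constructor
        · refine le_of_mul_le_mul_left ?_ hp
          calc |z.im| * ‖Complex.Gamma z‖ ≤ ‖z‖ * ‖Complex.Gamma z‖ := by gcongr
            _ ≤ K * (|z.im| * stirlingWeight z.re z.im) := k1
            _ = |z.im| * (K * 1 * stirlingWeight z.re z.im) := by ring
            _ ≤ _ := by gcongr
        · refine le_of_mul_le_mul_left ?_ hp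
          calc |z.im| * stirlingWeight z.re z.im ≤ K * (‖z‖ * ‖Complex.Gamma z‖) := k2
            _ ≤ K * ((L * |z.im|) * ‖Complex.Gamma z‖) := by gcongr
            _ = _ := by ring
    · -- go up: `Γ(z) = (z-1)Γ(z-1)`
      obtain ⟨k1, k2⟩ := hK (z - 1) (by simp; linarith) (by simp; linarith) (by simpa using h3)
      have hz0 : z - 1 ≠ 0 := fun h => him (by
        have : (z - 1).im = 0 := by rw [h]; simp
        simpa using this)
      have hG := Complex.Gamma_add_one (z - 1) hz0
      rw [sub_add_cancel] at hG
      have hwt := stirlingWeight_add_one (z.re - 1) him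
      rw [sub_add_cancel] at hwt
      rw [hG, norm_mul, hwt]
      simp only [Complex.sub_re, Complex.sub_im, Complex.one_re, Complex.one_im, sub_zero] at k1 k2
      obtain ⟨n1, n2⟩ := hnorm (z - 1) (by simp) (by
        rw [Complex.sub_re, Complex.one_re]; exact abs_le.2 ⟨by linarith, by linarith⟩)
      have hw := (stirlingWeight_pos (z.re - 1) him).le
      have hg := norm_nonneg (Complex.Gamma (z - 1))
      constructor
      · calc ‖z - 1‖ * ‖Complex.Gamma (z - 1)‖
            ≤ (L * |z.im|) * (K * stirlingWeight (z.re - 1) z.im) := by gcongr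
          _ = _ := by ring
      · calc |z.im| * stirlingWeight (z.re - 1) z.im
            ≤ ‖z - 1‖ * (K * ‖Complex.Gamma (z - 1)‖) := by gcongr
          _ = K * 1 * (‖z - 1‖ * ‖Complex.Gamma (z - 1)‖) := by ring
          _ ≤ _ := by gcongr

/-- Stirling bounds on a vertical strip, with the height of the argument replaced by a real number
`y` at bounded distance from it. -/
theorem Gamma_stirling (A B D : ℝ) : ∃ K : ℝ, 0 < K ∧ ∀ (z : ℂ) (y : ℝ), A ≤ z.re → z.re ≤ B →
    |(|z.im| - y)| ≤ D → 2 * D + 2 ≤ y →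
    ‖Complex.Gamma z‖ ≤ K * (y ^ (z.re - 1 / 2) * Real.exp (-(Real.pi * y / 2))) ∧
      y ^ (z.re - 1 / 2) * Real.exp (-(Real.pi * y / 2)) ≤ K * ‖Complex.Gamma z‖ := by
  obtain ⟨n, hn⟩ := exists_nat_ge (|A| + |B| + 2)
  obtain ⟨K, hK0, hK⟩ := Gamma_stirling_half n
  set L : ℝ := 2 ^ (n + 3 : ℝ) with hL
  have hL0 : 0 < L := by positivity
  refine ⟨K * (L * Real.exp (Real.pi * D / 2)), by positivity, fun z y h1 h2 h3 h4 => ?_⟩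
  have hD : 0 ≤ D := (abs_nonneg _).trans h3
  rw [abs_le] at h3
  have hy : 0 < y := by linarith
  have hA := neg_abs_le A
  have hB := le_abs_self B
  have hA0 := abs_nonneg A
  have hB0 := abs_nonneg B
  have him : 1 ≤ |z.im| := by linarith
  have hi0 : 0 < |z.im| := by linarith
  obtain ⟨k1, k2⟩ := hK z (by linarith) (by linarith) him
  rw [stirlingWeight] at k1 k2
  have hexpo : |z.re - 1 / 2| ≤ n + 3 := abs_le.2 ⟨by linarith, by linarith⟩
  have rp : ∀ u v : ℝ, 0 < u → 0 < v → u ≤ 2 * v → v ≤ 2 * u →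
      u ^ (z.re - 1 / 2) ≤ L * v ^ (z.re - 1 / 2) := by
    intro u v hu hv h h'
    have e : u ^ (z.re - 1 / 2) = (u / v) ^ (z.re - 1 / 2) * v ^ (z.re - 1 / 2) := by
      rw [← Real.mul_rpow (by positivity) hv.le]; congr 1; field_simp
    rw [e]
    gcongr
    rcases le_total 0 (z.re - 1 / 2) with hs | hs
    · calc (u / v) ^ (z.re - 1 / 2) ≤ 2 ^ (z.re - 1 / 2) :=
            Real.rpow_le_rpow (by positivity) (by rw [div_le_iff₀ hv]; exact h) hs
        _ ≤ L := Real.rpow_le_rpow_of_exponent_le (by norm_num) ((le_abs_self _).trans hexpo)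
    · calc (u / v) ^ (z.re - 1 / 2) = (v / u) ^ (-(z.re - 1 / 2)) := by
            rw [Real.rpow_neg (by positivity), ← Real.inv_rpow (by positivity), inv_div]
        _ ≤ 2 ^ (-(z.re - 1 / 2)) :=
            Real.rpow_le_rpow (by positivity) (by rw [div_le_iff₀ hu]; exact h') (by linarith)
        _ ≤ L := Real.rpow_le_rpow_of_exponent_le (by norm_num) ((neg_le_abs _).trans hexpo)
  have ep : ∀ u v : ℝ, v - D ≤ u → Real.exp (-(Real.pi * u / 2)) ≤
      Real.exp (Real.pi * D / 2) * Real.exp (-(Real.pi * v / 2)) := by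
    intro u v h
    rw [← Real.exp_add]
    apply Real.exp_le_exp.2
    have := Real.pi_pos
    nlinarith
  constructor
  · calc ‖Complex.Gamma z‖ ≤ K * (|z.im| ^ (z.re - 1 / 2) * Real.exp (-(Real.pi * |z.im| / 2))) := k1
      _ ≤ K * ((L * y ^ (z.re - 1 / 2)) *
          (Real.exp (Real.pi * D / 2) * Real.exp (-(Real.pi * y / 2)))) := by
          gcongr
          · exact rp _ _ hi0 hy (by linarith) (by linarith)
          · exact ep _ _ (by linarith)
      _ = _ := by ring
  · calc y ^ (z.re - 1 / 2) * Real.exp (-(Real.pi * y / 2))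
        ≤ (L * |z.im| ^ (z.re - 1 / 2)) *
          (Real.exp (Real.pi * D / 2) * Real.exp (-(Real.pi * |z.im| / 2))) := by
          gcongr
          · exact rp _ _ hy hi0 (by linarith) (by linarith)
          · exact ep _ _ (by linarith)
      _ = (L * Real.exp (Real.pi * D / 2)) *
          (|z.im| ^ (z.re - 1 / 2) * Real.exp (-(Real.pi * |z.im| / 2))) := by ring
      _ ≤ (L * Real.exp (Real.pi * D / 2)) * (K * ‖Complex.Gamma z‖) := by gcongr
      _ = _ := by ring

/-- `1/Γ` grows at most exponentially on vertical strips. -/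
theorem norm_inv_Gamma_le (A B : ℝ) : ∃ K : ℝ, 0 < K ∧ ∀ z : ℂ, A ≤ z.re → z.re ≤ B →
    ‖(Complex.Gamma z)⁻¹‖ ≤ K * Real.exp (4 * |z.im|) := by
  obtain ⟨n, hn⟩ := exists_nat_ge (|A| + |B| + 2)
  obtain ⟨K, hK0, hK⟩ := Gamma_stirling_half n
  obtain ⟨M, hM⟩ := (IsCompact.reProdIm (isCompact_Icc (a := A) (b := B))
    (isCompact_Icc (a := (-1 : ℝ)) (b := 1))).exists_bound_of_continuousOn
    inv_Gamma_continuous.continuousOn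
  have hA := neg_abs_le A
  have hB := le_abs_self B
  have hA0 := abs_nonneg A
  have hB0 := abs_nonneg B
  refine ⟨|M| + K * n.factorial, by positivity, fun z h1 h2 => ?_⟩
  rcases le_or_gt |z.im| 1 with h3 | h3
  · have : ‖(Complex.Gamma z)⁻¹‖ ≤ M := hM z ⟨⟨h1, h2⟩, abs_le.1 h3⟩
    have h4 : 1 ≤ Real.exp (4 * |z.im|) := Real.one_le_exp (by positivity)
    calc ‖(Complex.Gamma z)⁻¹‖ ≤ |M| * 1 := by rw [mul_one]; exact this.trans (le_abs_self M)
      _ ≤ (|M| + K * n.factorial) * Real.exp (4 * |z.im|) := by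
        gcongr
        have : 0 ≤ K * n.factorial := by positivity
        linarith
  · obtain ⟨-, k2⟩ := hK z (by linarith) (by linarith) h3.le
    have him : z.im ≠ 0 := fun h => by rw [h] at h3; norm_num at h3
    have hp : 0 < |z.im| := by linarith
    have hw := stirlingWeight_pos z.re him
    have hG : 0 < ‖Complex.Gamma z‖ := by
      refine (norm_nonneg _).lt_of_ne' fun h => ?_
      rw [h, mul_zero] at k2
      linarith
    have e1 : (stirlingWeight z.re z.im)⁻¹ ≤ n.factorial * Real.exp (4 * |z.im|) := by
      rw [stirlingWeight, mul_inv, ← Real.rpow_neg hp.le, ← Real.exp_neg]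
      have b1 : |z.im| ^ (-(z.re - 1 / 2)) ≤ |z.im| ^ (n : ℝ) :=
        Real.rpow_le_rpow_of_exponent_le h3.le (by linarith)
      rw [Real.rpow_natCast] at b1
      have b2 := Real.pow_div_factorial_le_exp |z.im| hp.le n
      rw [div_le_iff₀ (by positivity)] at b2
      have b3 : Real.exp (- -(Real.pi * |z.im| / 2)) ≤ Real.exp (3 * |z.im|) := by
        apply Real.exp_le_exp.2
        have := Real.pi_lt_four
        nlinarith
      calc _ ≤ (Real.exp |z.im| * n.factorial) * Real.exp (3 * |z.im|) := by
            gcongr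
            exact b1.trans b2
        _ = n.factorial * (Real.exp |z.im| * Real.exp (3 * |z.im|)) := by ring
        _ = _ := by rw [← Real.exp_add]; congr 2; ring
    rw [norm_inv]
    calc ‖Complex.Gamma z‖⁻¹ ≤ K * (stirlingWeight z.re z.im)⁻¹ := by
          rw [← div_eq_mul_inv, le_div_iff₀ hw, inv_mul_le_iff₀ hG, mul_comm]; exact k2
      _ ≤ K * (n.factorial * Real.exp (4 * |z.im|)) := by gcongr
      _ = K * n.factorial * Real.exp (4 * |z.im|) := by ring
      _ ≤ _ := by
        gcongr
        have := abs_nonneg M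
        linarith



/-! ### Shifting vertical contours -/

theorem integrable_of_continuous_of_decay {f : ℝ → ℂ} (hf : Continuous f) {K T e : ℝ} (he : 1 < e)
    (h : ∀ t : ℝ, T ≤ |t| → ‖f t‖ ≤ K * |t| ^ (-e)) : Integrable f := by
  have h0 : Integrable fun t : ℝ => (1 + ‖t‖) ^ (-e) := integrable_one_add_norm (by simpa using he)
  set T' := max T 1 with hT'
  obtain ⟨M, hM⟩ := (isCompact_Icc (a := -T') (b := T')).exists_bound_of_continuousOn
    hf.continuousOn
  refine (h0.const_mul (|M| * (1 + T') ^ e + |K| * 2 ^ e)).mono' hf.aestronglyMeasurable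
    (ae_of_all _ fun t => ?_)
  have hT1 : 1 ≤ T' := le_max_right _ _
  have e0 : 0 < e := by linarith
  rw [Real.norm_eq_abs]
  have hp : 0 < 1 + |t| := by positivity
  have a1 : 0 ≤ |M| * (1 + T') ^ e := by positivity
  have a2 : 0 ≤ |K| * 2 ^ e := by positivity
  rcases le_or_gt |t| T' with ht | ht
  · have h1 : ‖f t‖ ≤ M := hM t (abs_le.1 ht)
    have h2 : 1 ≤ (1 + T') ^ e * (1 + |t|) ^ (-e) := by
      rw [Real.rpow_neg hp.le, ← div_eq_mul_inv, le_div_iff₀ (by positivity), one_mul]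
      exact Real.rpow_le_rpow hp.le (by linarith) e0.le
    calc ‖f t‖ ≤ |M| * 1 := by rw [mul_one]; exact h1.trans (le_abs_self M)
      _ ≤ |M| * ((1 + T') ^ e * (1 + |t|) ^ (-e)) := by gcongr
      _ = |M| * (1 + T') ^ e * (1 + |t|) ^ (-e) := by ring
      _ ≤ _ := by gcongr; linarith
  · have ht0 : 0 < |t| := by linarith
    have h1 := h t ((le_max_left _ _).trans ht.le)
    have h2 : |t| ^ (-e) ≤ 2 ^ e * (1 + |t|) ^ (-e) := by
      rw [Real.rpow_neg hp.le, Real.rpow_neg ht0.le, ← div_eq_mul_inv, le_div_iff₀ (by positivity),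
        inv_mul_le_iff₀ (by positivity), ← Real.mul_rpow ht0.le (by norm_num)]
      exact Real.rpow_le_rpow hp.le (by linarith) e0.le
    calc ‖f t‖ ≤ K * |t| ^ (-e) := h1
      _ ≤ |K| * |t| ^ (-e) := by gcongr; exact le_abs_self K
      _ ≤ |K| * (2 ^ e * (1 + |t|) ^ (-e)) := by gcongr
      _ = |K| * 2 ^ e * (1 + |t|) ^ (-e) := by ring
      _ ≤ _ := by gcongr; linarith

/-- Cauchy's theorem for two vertical lines; decay towards `±i∞` makes the horizontal edges of the
rectangles vanish. -/
theorem integral_vertical_line_eq {f : ℂ → ℂ} {a b : ℝ} (hab : a ≤ b)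
    (hd : ∀ z : ℂ, a ≤ z.re → z.re ≤ b → DifferentiableAt ℂ f z)
    (hdec : ∀ ε : ℝ, 0 < ε → ∃ T : ℝ, ∀ z : ℂ, a ≤ z.re → z.re ≤ b → T ≤ |z.im| → ‖f z‖ ≤ ε)
    (ha : Integrable fun t : ℝ => f (a + t * Complex.I))
    (hb : Integrable fun t : ℝ => f (b + t * Complex.I)) :
    ∫ t : ℝ, f (a + t * Complex.I) = ∫ t : ℝ, f (b + t * Complex.I) := by
  have hrect : ∀ T : ℝ, 0 ≤ T →
      ((∫ x : ℝ in a..b, f (x + (-T : ℝ) * Complex.I)) - ∫ x : ℝ in a..b, f (x + (T : ℝ) * Complex.I)) =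
      Complex.I * ((∫ y : ℝ in (-T)..T, f (a + y * Complex.I)) -
        ∫ y : ℝ in (-T)..T, f (b + y * Complex.I)) := by
    intro T hT
    have := Complex.integral_boundary_rect_eq_zero_of_differentiableOn f
      (a + (-T : ℝ) * Complex.I) (b + (T : ℝ) * Complex.I) (by
        intro z hz
        have h1 := hz.1
        simp [uIcc_of_le hab] at h1
        exact (hd z h1.1 h1.2).differentiableWithinAt)
    simp at this
    rw [mul_sub]
    push_cast at this ⊢
    simp only [neg_mul] at this ⊢
    linear_combination this
  have hlim : Tendsto (fun T : ℝ =>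
      Complex.I * ((∫ y : ℝ in (-T)..T, f (a + y * Complex.I)) -
        ∫ y : ℝ in (-T)..T, f (b + y * Complex.I))) atTop
      (𝓝 (Complex.I * ((∫ y : ℝ, f (a + y * Complex.I)) - ∫ y : ℝ, f (b + y * Complex.I)))) := by
    refine Tendsto.const_mul _ (Tendsto.sub ?_ ?_)
    · exact intervalIntegral_tendsto_integral ha tendsto_neg_atTop_atBot tendsto_id
    · exact intervalIntegral_tendsto_integral hb tendsto_neg_atTop_atBot tendsto_id
  have hzero : Tendsto (fun T : ℝ =>
      Complex.I * ((∫ y : ℝ in (-T)..T, f (a + y * Complex.I)) -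
        ∫ y : ℝ in (-T)..T, f (b + y * Complex.I))) atTop (𝓝 0) := by
    rw [Metric.tendsto_atTop]
    intro ε hε
    obtain ⟨T₀, hT₀⟩ := hdec (ε / (2 * (b - a) + 1)) (by
      apply div_pos hε; linarith)
    refine ⟨max T₀ 0, fun T hT => ?_⟩
    have hT0 : 0 ≤ T := (le_max_right _ _).trans hT
    rw [← hrect T hT0, dist_zero_right]
    have hh : ∀ T' : ℝ, |T'| = T → ‖∫ x : ℝ in a..b, f (x + (T' : ℝ) * Complex.I)‖ ≤
        ε / (2 * (b - a) + 1) * (b - a) := by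
      intro T' hT'
      have := intervalIntegral.norm_integral_le_of_norm_le_const (a := a) (b := b)
        (f := fun x : ℝ => f (x + (T' : ℝ) * Complex.I)) (C := ε / (2 * (b - a) + 1)) (by
          intro x hx
          rw [uIoc_of_le hab] at hx
          refine hT₀ _ (by simpa using hx.1.le) (by simpa using hx.2) ?_
          simp [hT']
          exact (le_max_left _ _).trans hT)
      rwa [abs_of_nonneg (by linarith)] at this
    refine (norm_sub_le _ _).trans_lt ?_
    have h1 := hh (-T) (by rw [abs_neg, abs_of_nonneg hT0])
    have h2 := hh T (abs_of_nonneg hT0)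
    have h3 : ε / (2 * (b - a) + 1) * (b - a) + ε / (2 * (b - a) + 1) * (b - a) < ε := by
      rw [← add_mul, ← add_div, ← mul_div_right_comm, div_lt_iff₀ (by linarith)]
      nlinarith
    linarith
  have := tendsto_nhds_unique hlim hzero
  rcases mul_eq_zero.1 this with h | h
  · exact absurd h Complex.I_ne_zero
  · exact sub_eq_zero.1 h

theorem integrable_cexp_sq_line (u : ℝ) (hu : u ≠ 0) :
    Integrable fun t : ℝ => Complex.exp ((u + t * Complex.I) ^ 2) / (u + t * Complex.I) := by
  have h0 : ∀ t : ℝ, (u : ℂ) + t * Complex.I ≠ 0 := fun t h => hu (by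
    have := congrArg Complex.re h; simpa using this)
  refine ((integrable_exp_neg_mul_sq (b := 1) one_pos).const_mul
    (Real.exp (u ^ 2) * |u|⁻¹)).mono' ?_ (ae_of_all _ fun t => ?_)
  · exact (Continuous.div (by fun_prop) (by fun_prop) h0).aestronglyMeasurable
  · rw [norm_div, Complex.norm_exp, div_eq_mul_inv]
    have e1 : ((u + t * Complex.I) ^ 2).re = u ^ 2 + -1 * t ^ 2 := by
      simp [sq]; ring
    rw [e1, Real.exp_add]
    have h1 : |u| ≤ ‖(u : ℂ) + t * Complex.I‖ := by
      have := Complex.abs_re_le_norm ((u : ℂ) + t * Complex.I)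
      simpa using this
    have h2 : 0 < |u| := abs_pos.2 hu
    calc _ ≤ Real.exp (u ^ 2) * Real.exp (-1 * t ^ 2) * |u|⁻¹ := by gcongr
      _ = _ := by ring

/-- Half the residue of the model function `exp (s²)/s`: its integrals over `Re s = u` and
`Re s = -u` are opposite by oddness, so they differ by `2π`. -/
theorem integral_cexp_sq_line {u : ℝ} (hu : 0 < u) :
    ∫ t : ℝ, Complex.exp ((u + t * Complex.I) ^ 2) / (u + t * Complex.I) = Real.pi := by
  have h1 : ∀ t : ℝ, Complex.exp ((u + t * Complex.I) ^ 2) / (u + t * Complex.I) =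
      ∫ r in Ioi (0 : ℝ), Complex.exp ((u + t * Complex.I) ^ 2 - (u + t * Complex.I) * r) := by
    intro t
    have := integral_exp_mul_complex_Ioi (a := -((u : ℂ) + t * Complex.I)) (by simpa using hu) 0
    simp_rw [sub_eq_add_neg, Complex.exp_add, ← neg_mul]
    rw [integral_const_mul, this, Complex.ofReal_zero, mul_zero, Complex.exp_zero, neg_div_neg_eq,
      one_div, div_eq_mul_inv]
  have hint : Integrable (Function.uncurry fun (t : ℝ) (r : ℝ) =>
      Complex.exp ((u + t * Complex.I) ^ 2 - (u + t * Complex.I) * r))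
      (volume.prod (volume.restrict (Ioi 0))) := by
    have i1 : Integrable (fun t : ℝ => Real.exp (u ^ 2) * Real.exp (-1 * t ^ 2)) :=
      (integrable_exp_neg_mul_sq (b := 1) one_pos).const_mul _
    have i2 : Integrable (fun r : ℝ => Real.exp (-u * r)) (volume.restrict (Ioi 0)) :=
      integrableOn_exp_mul_Ioi (by linarith) 0
    refine (i1.mul_prod i2).mono' ?_ (ae_of_all _ fun z => ?_)
    · exact Continuous.aestronglyMeasurable (by unfold Function.uncurry; fun_prop)
    · simp only [Function.uncurry, Complex.norm_exp]
      rw [← Real.exp_add, ← Real.exp_add]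
      apply Real.exp_le_exp.2
      simp [sq]
  simp_rw [h1]
  rw [integral_integral_swap hint]
  have h2 : ∀ r : ℝ, ∫ t : ℝ, Complex.exp ((u + t * Complex.I) ^ 2 - (u + t * Complex.I) * r) =
      ((Real.sqrt Real.pi * Real.exp (-(1 / 4) * r ^ 2) : ℝ) : ℂ) := by
    intro r
    have := GaussianFourier.integral_cexp_neg_mul_sq_add_real_mul_I (b := 1) (by simp) (-(u - r / 2))
    have e : ∀ t : ℝ, Complex.exp ((u + t * Complex.I) ^ 2 - (u + t * Complex.I) * r) =
        Complex.exp (-(1 / 4) * r ^ 2) *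
          Complex.exp (-1 * (t + (-(u - r / 2) : ℝ) * Complex.I) ^ 2) := by
      intro t
      rw [← Complex.exp_add]
      congr 1
      push_cast
      linear_combination (t ^ 2 + (u - r / 2) ^ 2) * Complex.I_sq
    simp_rw [e]
    rw [integral_const_mul, this, div_one]
    push_cast
    rw [mul_comm]
    congr 1
    rw [Real.sqrt_eq_rpow, Complex.ofReal_cpow Real.pi_pos.le]
    norm_num
  simp_rw [h2]
  rw [integral_complex_ofReal, integral_const_mul, integral_gaussian_Ioi]
  congr 1
  rw [show Real.pi / (1 / 4) = 2 ^ 2 * Real.pi by ring, Real.sqrt_mul (by norm_num),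
    Real.sqrt_sq (by norm_num)]
  have := Real.mul_self_sqrt Real.pi_pos.le
  linear_combination this

theorem integral_cexp_sq_line_neg {u : ℝ} (hu : u < 0) :
    ∫ t : ℝ, Complex.exp ((u + t * Complex.I) ^ 2) / (u + t * Complex.I) = -Real.pi := by
  have h := integral_cexp_sq_line (u := -u) (by linarith)
  rw [← integral_neg_eq_self, ← h, ← integral_neg]
  congr 1
  ext t
  have e : (u : ℂ) + (-t : ℝ) * Complex.I = -((-u : ℝ) + t * Complex.I) := by push_cast; ring
  rw [e, neg_sq, div_neg]

/-- Moving a vertical contour across one simple pole; the model `exp ((s-p)^2)/(s-p)` carries the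
residue. -/
theorem integral_vertical_line_sub_eq_residue {f H : ℂ → ℂ} {a b : ℝ} {p : ℂ} (hap : a < p.re)
    (hpb : p.re < b)
    (hd : ∀ z : ℂ, a ≤ z.re → z.re ≤ b → DifferentiableAt ℂ H z)
    (hf : ∀ z : ℂ, a ≤ z.re → z.re ≤ b → z ≠ p → f z = H z / (z - p))
    (hdec : ∀ ε : ℝ, 0 < ε → ∃ T : ℝ, ∀ z : ℂ, a ≤ z.re → z.re ≤ b → T ≤ |z.im| → ‖f z‖ ≤ ε)
    (ha : Integrable fun t : ℝ => f (a + t * Complex.I))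
    (hb : Integrable fun t : ℝ => f (b + t * Complex.I)) :
    (∫ t : ℝ, f (b + t * Complex.I)) - ∫ t : ℝ, f (a + t * Complex.I) = 2 * Real.pi * H p := by
  set e : ℂ → ℂ := fun z => H p * (Complex.exp ((z - p) ^ 2) / (z - p)) with he
  set g : ℂ → ℂ := fun z => H z - H p * Complex.exp ((z - p) ^ 2) with hg
  have hgp : g p = 0 := by simp [hg]
  set q := dslope g p with hq
  have hqf : ∀ z : ℂ, a ≤ z.re → z.re ≤ b → z ≠ p → q z = f z - e z := by
    intro z h1 h2 h3
    have h4 : z - p ≠ 0 := sub_ne_zero.2 h3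
    rw [hq, dslope_of_ne _ h3, slope_def_field, hgp, hf z h1 h2 h3, hg, he]
    field_simp
    ring
  have hgd : ∀ z : ℂ, a ≤ z.re → z.re ≤ b → DifferentiableAt ℂ g z := fun z h1 h2 => by
    have := hd z h1 h2
    fun_prop
  have hU : Complex.re ⁻¹' Ioo a b ∈ 𝓝 p :=
    (isOpen_Ioo.preimage Complex.continuous_re).mem_nhds ⟨hap, hpb⟩
  have hqd : ∀ z : ℂ, a ≤ z.re → z.re ≤ b → DifferentiableAt ℂ q z := by
    intro z h1 h2
    rcases eq_or_ne z p with rfl | h3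
    · have : DifferentiableOn ℂ g (Complex.re ⁻¹' Ioo a b) := fun z hz =>
        (hgd z hz.1.le hz.2.le).differentiableWithinAt
      exact ((Complex.differentiableOn_dslope hU).2 this).differentiableAt hU
    · exact (differentiableAt_dslope_of_ne h3).2 (hgd z h1 h2)
  have line : ∀ c : ℝ, c ≠ p.re → (Integrable fun t : ℝ => e (c + t * Complex.I)) ∧
      ∫ t : ℝ, e (c + t * Complex.I) = H p * ∫ t : ℝ,
        Complex.exp (((c - p.re : ℝ) + t * Complex.I) ^ 2) / ((c - p.re : ℝ) + t * Complex.I) := by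
    intro c hc
    have h1 := (integrable_cexp_sq_line (c - p.re) (sub_ne_zero.2 hc)).const_mul (H p)
    have e1 : ∀ t : ℝ, e (c + t * Complex.I) = (fun t : ℝ => H p *
        (Complex.exp (((c - p.re : ℝ) + t * Complex.I) ^ 2) /
          ((c - p.re : ℝ) + t * Complex.I))) (t - p.im) := by
      intro t
      have : (c : ℂ) + t * Complex.I - p = (c - p.re : ℝ) + (t - p.im : ℝ) * Complex.I := by
        apply Complex.ext <;> simp
      simp only [he, this]
    constructor
    · simp_rw [e1]
      exact h1.comp_sub_right p.im
    · simp_rw [e1]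
      rw [integral_sub_right_eq_self (μ := volume) (fun t : ℝ => H p *
        (Complex.exp (((c - p.re : ℝ) + t * Complex.I) ^ 2) /
          ((c - p.re : ℝ) + t * Complex.I))) p.im, integral_const_mul]
  obtain ⟨la, lai⟩ := line a hap.ne
  obtain ⟨lb, lbi⟩ := line b hpb.ne'
  have hne : ∀ c : ℝ, c ≠ p.re → ∀ t : ℝ, (c : ℂ) + t * Complex.I ≠ p := fun c hc t h => hc (by
    rw [← h]; simp)
  have qa : ∀ t : ℝ, q (a + t * Complex.I) = f (a + t * Complex.I) - e (a + t * Complex.I) :=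
    fun t => hqf _ (by simp) (by simp; linarith) (hne a hap.ne t)
  have qb : ∀ t : ℝ, q (b + t * Complex.I) = f (b + t * Complex.I) - e (b + t * Complex.I) :=
    fun t => hqf _ (by simp; linarith) (by simp) (hne b hpb.ne' t)
  have key := integral_vertical_line_eq (f := q) (hap.trans hpb).le hqd ?_ ?_ ?_
  · simp_rw [qa, qb] at key
    rw [integral_sub ha la, integral_sub hb lb, lai, lbi,
      integral_cexp_sq_line_neg (by linarith), integral_cexp_sq_line (by linarith)] at key
    linear_combination -key
  · intro ε hε
    obtain ⟨T, hT⟩ := hdec (ε / 2) (half_pos hε)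
    -- the model term decays like a Gaussian along horizontal segments
    have h0 : Tendsto (fun x : ℝ => ‖H p‖ * Real.exp ((b - a) ^ 2) * Real.exp (-x)) atTop (𝓝 0) := by
      have := (Real.tendsto_exp_neg_atTop_nhds_zero).const_mul (‖H p‖ * Real.exp ((b - a) ^ 2))
      simpa using this
    obtain ⟨T', hT'⟩ := (h0.eventually (gt_mem_nhds (half_pos hε))).exists_forall_of_atTop
    refine ⟨max T (max T' 1 + |p.im|), fun z h1 h2 h3 => ?_⟩
    have h4 : T ≤ |z.im| := (le_max_left _ _).trans h3
    have h5 : max T' 1 + |p.im| ≤ |z.im| := (le_max_right _ _).trans h3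
    have h6 : max T' 1 ≤ |z.im - p.im| := by
      have := abs_sub_abs_le_abs_sub z.im p.im; linarith
    have h7 : 1 ≤ |z.im - p.im| := (le_max_right _ _).trans h6
    have h8 : T' ≤ |z.im - p.im| := (le_max_left _ _).trans h6
    have h9 : z ≠ p := by rintro rfl; simp at h7; norm_num at h7
    rw [hqf z h1 h2 h9]
    have hez : ‖e z‖ ≤ ε / 2 := by
      refine le_trans ?_ (hT' _ h8).le
      rw [he, norm_mul, norm_div, Complex.norm_exp, mul_assoc]
      gcongr
      have n1 : 1 ≤ ‖z - p‖ := by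
        have := Complex.abs_im_le_norm (z - p)
        rw [Complex.sub_im] at this; linarith
      rw [← Real.exp_add]
      refine (div_le_self (Real.exp_pos _).le n1).trans (Real.exp_le_exp.2 ?_)
      have : ((z - p) ^ 2).re = (z.re - p.re) ^ 2 - |z.im - p.im| ^ 2 := by
        rw [sq_abs, sq, Complex.mul_re]; simp; ring
      rw [this]
      have n2 : (z.re - p.re) ^ 2 ≤ (b - a) ^ 2 := sq_le_sq' (by linarith) (by linarith)
      nlinarith
    have := hT z h1 h2 h4
    exact (norm_sub_le _ _).trans (by linarith)
  · simp_rw [qa]; exact ha.sub la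
  · simp_rw [qb]; exact hb.sub lb



/-! ### The Mellin–Barnes integral of a product of two Bessel functions -/

/-- The Mellin transform of `w ↦ w^p E(p+d, w) E(p-d, w)`, where `E = besselE`. -/
noncomputable def besselProdSymbol (p d s : ℂ) : ℂ :=
  Complex.Gamma (1 - 2 * s) * Complex.Gamma (s + p) *
    ((Complex.Gamma (1 - s - d))⁻¹ * (Complex.Gamma (1 - s + d))⁻¹ * (Complex.Gamma (1 - s + p))⁻¹)

theorem besselProdSymbol_bound (p d : ℂ) (A B : ℝ) : ∃ K T : ℝ, 0 < K ∧ 1 ≤ T ∧ ∀ z : ℂ,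
    A ≤ z.re → z.re ≤ B → T ≤ |z.im| →
    ‖besselProdSymbol p d z‖ ≤ K * |z.im| ^ (2 * z.re - 3 / 2) := by
  set R : ℝ := 3 + 2 * (|A| + |B|) + ‖p‖ + ‖d‖ with hR
  set D : ℝ := ‖p‖ + ‖d‖ with hD
  obtain ⟨K, hK0, hK⟩ := Gamma_stirling (-R) R D
  have hpn := norm_nonneg p
  have hdn := norm_nonneg d
  refine ⟨K ^ 5 * 2 ^ R, 2 * D + 2, by positivity, by linarith, fun z h1 h2 h3 => ?_⟩
  set y := |z.im| with hy
  set σ := z.re with hσ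
  have hy0 : 0 < y := by linarith
  have hp1 := Complex.abs_re_le_norm p
  have hp2 := Complex.abs_im_le_norm p
  have hd1 := Complex.abs_re_le_norm d
  have hd2 := Complex.abs_im_le_norm d
  have hA := neg_abs_le A
  have hB := le_abs_self B
  have hA0 := abs_nonneg A
  have hB0 := abs_nonneg B
  obtain ⟨hp3, hp4⟩ := abs_le.1 hp1
  obtain ⟨hd3, hd4⟩ := abs_le.1 hd1
  set E := Real.exp (-(Real.pi * y / 2)) with hE
  have hE0 : 0 < E := Real.exp_pos _
  have himd : ∀ u : ℂ, ‖u‖ ≤ D → |(|z.im + u.im| - y)| ≤ D := fun u hu => by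
    have h := abs_abs_sub_abs_le (z.im + u.im) z.im
    rw [add_sub_cancel_left] at h
    exact h.trans ((Complex.abs_im_le_norm u).trans hu)
  have g1 : ‖Complex.Gamma (1 - 2 * z)‖ ≤ K * (2 ^ R * y ^ (1 / 2 - 2 * σ) * E ^ 2) := by
    have hre : (1 - 2 * z).re = 1 - 2 * σ := by simp [hσ]
    have him : |(1 - 2 * z).im| = 2 * y := by simp [abs_mul, hy]
    have := (hK (1 - 2 * z) (2 * y) (by rw [hre]; linarith) (by rw [hre]; linarith)
      (by rw [him, sub_self, abs_zero]; positivity) (by linarith)).1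
    rw [hre, Real.mul_rpow (by norm_num) hy0.le] at this
    refine this.trans ?_
    have e1 : Real.exp (-(Real.pi * (2 * y) / 2)) = E ^ 2 := by
      rw [hE, ← Real.exp_nat_mul]; congr 1; push_cast; ring
    rw [e1, show 1 - 2 * σ - 1 / 2 = 1 / 2 - 2 * σ by ring]
    gcongr
    · norm_num
    · linarith
  have g2 : ‖Complex.Gamma (z + p)‖ ≤ K * (y ^ (σ + p.re - 1 / 2) * E) := by
    have hre : (z + p).re = σ + p.re := by simp [hσ]
    have := (hK (z + p) y (by rw [hre]; linarith) (by rw [hre]; linarith)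
      (by rw [Complex.add_im]; exact himd p (by linarith)) h3).1
    rwa [hre] at this
  have gi : ∀ u : ℂ, ‖u‖ ≤ D →
      ‖(Complex.Gamma (1 - z + u))⁻¹‖ ≤ K * (y ^ (σ - u.re - 1 / 2) * E⁻¹) := by
    intro u hu
    have hu1 := abs_le.1 (Complex.abs_re_le_norm u)
    have hre : (1 - z + u).re = 1 - σ + u.re := by simp [hσ]
    have := (hK (1 - z + u) y (by rw [hre]; linarith) (by rw [hre]; linarith) (by
      have := himd (-u) (by rwa [norm_neg])
      rw [Complex.neg_im] at this
      rw [show (1 - z + u).im = -(z.im + -u.im) by simp; ring, abs_neg]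
      exact this) h3).2
    rw [hre] at this
    have hpos : 0 < y ^ (1 - σ + u.re - 1 / 2) * E := by positivity
    have hG : 0 < ‖Complex.Gamma (1 - z + u)‖ := by
      refine (norm_nonneg _).lt_of_ne' fun h => ?_
      rw [h, mul_zero] at this
      linarith
    rw [norm_inv, show σ - u.re - 1 / 2 = -(1 - σ + u.re - 1 / 2) by ring, Real.rpow_neg hy0.le,
      ← mul_inv, ← div_eq_mul_inv, le_div_iff₀ hpos, inv_mul_le_iff₀ hG]
    linarith
  have g3 := gi (-d) (by rw [norm_neg]; linarith)
  have g4 := gi d (by linarith)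
  have g5 := gi p (by linarith)
  rw [← sub_eq_add_neg, Complex.neg_re] at g3
  rw [besselProdSymbol, norm_mul, norm_mul, norm_mul, norm_mul]
  calc _ ≤ (K * (2 ^ R * y ^ (1 / 2 - 2 * σ) * E ^ 2)) * (K * (y ^ (σ + p.re - 1 / 2) * E)) *
        ((K * (y ^ (σ - -d.re - 1 / 2) * E⁻¹)) * (K * (y ^ (σ - d.re - 1 / 2) * E⁻¹)) *
          (K * (y ^ (σ - p.re - 1 / 2) * E⁻¹))) := by gcongr
    _ = K ^ 5 * 2 ^ R * (y ^ (1 / 2 - 2 * σ) * y ^ (σ + p.re - 1 / 2) * y ^ (σ - -d.re - 1 / 2) *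
          y ^ (σ - d.re - 1 / 2) * y ^ (σ - p.re - 1 / 2)) * (E ^ 3 * (E⁻¹) ^ 3) := by ring
    _ = K ^ 5 * 2 ^ R * y ^ (2 * σ - 3 / 2) := by
        rw [← mul_pow, mul_inv_cancel₀ hE0.ne', one_pow, mul_one, ← Real.rpow_add hy0,
          ← Real.rpow_add hy0, ← Real.rpow_add hy0, ← Real.rpow_add hy0]
        congr 2; ring

theorem differentiableAt_Gamma_of_re_pos {f : ℂ → ℂ} {z : ℂ} (hf : DifferentiableAt ℂ f z)
    (h : 0 < (f z).re) : DifferentiableAt ℂ (fun s => Complex.Gamma (f s)) z := by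
  refine DifferentiableAt.comp (g := Complex.Gamma) z
    (Complex.differentiableAt_Gamma _ fun m hm => ?_) hf
  rw [hm] at h
  simp at h
  linarith [(Nat.cast_nonneg m : (0 : ℝ) ≤ m)]

theorem differentiable_inv_Gamma_comp {f : ℂ → ℂ} (hf : Differentiable ℂ f) :
    Differentiable ℂ (fun s => (Complex.Gamma (f s))⁻¹) :=
  Complex.differentiable_one_div_Gamma.comp hf

theorem Gamma_add_nat (z : ℂ) (n : ℕ) (hz : ∀ k < n, z + k ≠ 0) :
    Complex.Gamma (z + n) = (∏ i ∈ Finset.range n, (z + i)) * Complex.Gamma z := by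
  induction n with
  | zero => simp
  | succ n ih =>
    rw [Finset.prod_range_succ, Nat.cast_add_one, ← add_assoc,
      Complex.Gamma_add_one _ (hz n (Nat.lt_succ_self n)), ih fun k hk => hz k (hk.trans (Nat.lt_succ_self n))]
    ring

theorem besselProdSymbol_differentiableAt {p d z : ℂ} (h1 : z.re < 1 / 2)
    (h2 : ∀ m : ℕ, z + p ≠ -m) : DifferentiableAt ℂ (besselProdSymbol p d) z := by
  have e1 : DifferentiableAt ℂ (fun s : ℂ => Complex.Gamma (1 - 2 * s)) z :=
    differentiableAt_Gamma_of_re_pos (by fun_prop) (by simp; linarith)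
  have e2 : DifferentiableAt ℂ (fun s : ℂ => Complex.Gamma (s + p)) z :=
    DifferentiableAt.comp (g := Complex.Gamma) z (Complex.differentiableAt_Gamma _ h2) (by fun_prop)
  have e3 := differentiable_inv_Gamma_comp (f := fun s => 1 - s - d) (by fun_prop)
  have e4 := differentiable_inv_Gamma_comp (f := fun s => 1 - s + d) (by fun_prop)
  have e5 := differentiable_inv_Gamma_comp (f := fun s => 1 - s + p) (by fun_prop)
  exact (e1.mul e2).mul (((e3 z).mul (e4 z)).mul (e5 z))

theorem cpow_neg_differentiable {w : ℝ} (hw : 0 < w) :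
    Differentiable ℂ (fun s : ℂ => (w : ℂ) ^ (-s)) := fun s => by
  have : (w : ℂ) ≠ 0 := by exact_mod_cast hw.ne'
  exact DifferentiableAt.const_cpow (by fun_prop) (Or.inl this)

theorem norm_cpow_neg_le {w : ℝ} (hw : 0 < w) {A B : ℝ} {z : ℂ} (hA : A ≤ z.re) (hB : z.re ≤ B) :
    ‖(w : ℂ) ^ (-z)‖ ≤ w ^ (-A) + w ^ (-B) := by
  rw [Complex.norm_cpow_eq_rpow_re_of_pos hw, Complex.neg_re]
  have h1 : 0 < w ^ (-A) := by positivity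
  have h2 : 0 < w ^ (-B) := by positivity
  rcases le_total 1 w with h | h
  · have := Real.rpow_le_rpow_of_exponent_le h (neg_le_neg hA)
    linarith
  · have := Real.rpow_le_rpow_of_exponent_ge hw h (neg_le_neg hB)
    linarith

theorem besselProdKernel_bound (p d : ℂ) {w : ℝ} (hw : 0 < w) (A B : ℝ) : ∃ K T : ℝ, 0 < K ∧ 1 ≤ T ∧
    ∀ z : ℂ, A ≤ z.re → z.re ≤ B → T ≤ |z.im| →
    ‖(w : ℂ) ^ (-z) * besselProdSymbol p d z‖ ≤ K * |z.im| ^ (2 * z.re - 3 / 2) := by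
  obtain ⟨K, T, hK, hT, h⟩ := besselProdSymbol_bound p d A B
  refine ⟨(w ^ (-A) + w ^ (-B)) * K, T, by positivity, hT, fun z h1 h2 h3 => ?_⟩
  rw [norm_mul, mul_assoc]
  have := norm_cpow_neg_le hw h1 h2
  have := h z h1 h2 h3
  gcongr

theorem besselProdKernel_decay (p d : ℂ) {w : ℝ} (hw : 0 < w) {A B : ℝ} (hB : B ≤ 1 / 4) (ε : ℝ)
    (hε : 0 < ε) : ∃ T : ℝ, ∀ z : ℂ, A ≤ z.re → z.re ≤ B → T ≤ |z.im| →
      ‖(w : ℂ) ^ (-z) * besselProdSymbol p d z‖ ≤ ε := by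
  obtain ⟨K, T, hK, hT, h⟩ := besselProdKernel_bound p d hw A B
  refine ⟨max T (K / ε), fun z h1 h2 h3 => ?_⟩
  have h4 : T ≤ |z.im| := (le_max_left _ _).trans h3
  have h5 : K / ε ≤ |z.im| := (le_max_right _ _).trans h3
  have h6 : 1 ≤ |z.im| := hT.trans h4
  refine (h z h1 h2 h4).trans ?_
  calc K * |z.im| ^ (2 * z.re - 3 / 2) ≤ K * |z.im| ^ (-1 : ℝ) := by
        gcongr
        linarith
    _ = K / |z.im| := by rw [Real.rpow_neg_one, div_eq_mul_inv]
    _ ≤ ε := by rwa [div_le_iff₀ (by linarith), ← div_le_iff₀' hε]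

theorem besselProdSymbol_line_integrable (p d : ℂ) {c : ℝ} (hc : c < 1 / 4)
    (hcp : ∀ m : ℕ, c + p.re ≠ -m) :
    Integrable (fun t : ℝ => besselProdSymbol p d (c + t * Complex.I)) := by
  obtain ⟨K, T, hK, hT, h⟩ := besselProdSymbol_bound p d c c
  refine integrable_of_continuous_of_decay (K := K) (T := T) (e := 3 / 2 - 2 * c) ?_ (by linarith)
    fun t ht => ?_
  · rw [continuous_iff_continuousAt]
    intro t
    have : DifferentiableAt ℂ (besselProdSymbol p d) (c + t * Complex.I) := by
      refine besselProdSymbol_differentiableAt (by simp; linarith) fun m hm => hcp m ?_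
      have := congrArg Complex.re hm
      simpa using this
    exact ContinuousAt.comp (f := fun t : ℝ => (c : ℂ) + t * Complex.I) this.continuousAt
      (by fun_prop)
  · have := h (c + t * Complex.I) (by simp) (by simp) (by simpa using ht)
    rw [show ((c : ℂ) + t * Complex.I).re = c by simp, show ((c : ℂ) + t * Complex.I).im = t by simp,
      show 2 * c - 3 / 2 = -(3 / 2 - 2 * c) by ring] at this
    exact this

theorem besselProdKernel_line_integrable (p d : ℂ) {w : ℝ} (hw : 0 < w) {c : ℝ} (hc : c < 1 / 4)
    (hcp : ∀ m : ℕ, c + p.re ≠ -m) : Integrable (fun t : ℝ =>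
      (w : ℂ) ^ (-((c : ℂ) + t * Complex.I)) * besselProdSymbol p d (c + t * Complex.I)) := by
  refine (besselProdSymbol_line_integrable p d hc hcp).bdd_mul (c := w ^ (-c)) ?_
    (ae_of_all _ fun t => ?_)
  · exact ((cpow_neg_differentiable hw).continuous.comp
      (by fun_prop : Continuous fun t : ℝ => (c : ℂ) + t * Complex.I)).aestronglyMeasurable
  · rw [Complex.norm_cpow_eq_rpow_re_of_pos hw]; simp

/-- One step of the contour shift to the left: the strip `c - k - 1 ≤ Re s ≤ c - k` contains exactly
the pole `s = -p - k`. -/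
theorem besselProdKernel_step (p d : ℂ) {w : ℝ} (hw : 0 < w) {c : ℝ} (hc : c < 1 / 4)
    (hpc : -p.re < c) (hcp : c < 1 - p.re) (k : ℕ) :
    (∫ t : ℝ, (w : ℂ) ^ (-(((c - k : ℝ) : ℂ) + t * Complex.I)) *
        besselProdSymbol p d ((c - k : ℝ) + t * Complex.I)) -
      ∫ t : ℝ, (w : ℂ) ^ (-(((c - k - 1 : ℝ) : ℂ) + t * Complex.I)) *
        besselProdSymbol p d ((c - k - 1 : ℝ) + t * Complex.I) =
    2 * Real.pi * ((w : ℂ) ^ p * ((-1) ^ k / (k.factorial : ℂ) *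
      (Complex.Gamma ((p + d) + (p - d) + 2 * k + 1) / (Complex.Gamma ((p + d) + (p - d) + k + 1) *
        Complex.Gamma (p + d + k + 1) * Complex.Gamma (p - d + k + 1))) * (w : ℂ) ^ k)) := by
  have hw0 : (w : ℂ) ≠ 0 := by exact_mod_cast hw.ne'
  have hk : (0 : ℝ) ≤ k := k.cast_nonneg
  set P : ℂ := -p - k with hP
  have hPre : P.re = -p.re - k := by simp [hP]
  set H : ℂ → ℂ := fun s => (w : ℂ) ^ (-s) * (Complex.Gamma (1 - 2 * s) *
    (Complex.Gamma (s + p + k + 1) * (∏ i ∈ Finset.range k, (s + p + i))⁻¹) *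
    ((Complex.Gamma (1 - s - d))⁻¹ * (Complex.Gamma (1 - s + d))⁻¹ *
      (Complex.Gamma (1 - s + p))⁻¹)) with hH
  have hnz : ∀ z : ℂ, z.re ≤ c - k → ∀ i < k, z + p + i ≠ 0 := by
    intro z hz i hi h
    have h1 := congrArg Complex.re h
    simp at h1
    have h2 : (i : ℝ) + 1 ≤ k := by exact_mod_cast hi
    linarith
  have hline : ∀ j : ℕ, ∀ m : ℕ, (c - j : ℝ) + p.re ≠ -m := by
    intro j m h
    have h1 : (j : ℝ) < m + 1 := by linarith
    have h2 : (m : ℝ) < j := by linarith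
    have h3 : j < m + 1 := by exact_mod_cast h1
    have h4 : m < j := by exact_mod_cast h2
    omega
  have key := integral_vertical_line_sub_eq_residue
    (f := fun s => (w : ℂ) ^ (-s) * besselProdSymbol p d s) (H := H)
    (a := c - k - 1) (b := c - k) (p := P) (by rw [hPre]; linarith) (by rw [hPre]; linarith)
    ?_ ?_ ?_ ?_ ?_
  · rw [key]
    congr 1
    simp only [hH]
    have e1 : ∏ i ∈ Finset.range k, (P + p + i) = (-1) ^ k * (k.factorial : ℂ) := by
      rw [← Finset.prod_range_add_one_eq_factorial, Nat.cast_prod,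
        ← Finset.prod_range_reflect (fun i => (((i + 1 : ℕ)) : ℂ)), ← Finset.card_range k,
        ← Finset.prod_const, Finset.card_range, ← Finset.prod_mul_distrib]
      refine Finset.prod_congr rfl fun i hi => ?_
      rw [Finset.mem_range] at hi
      rw [hP, show k - 1 - i + 1 = k - i by omega, Nat.cast_sub hi.le]
      ring
    rw [e1, show P + p + k + 1 = 1 by rw [hP]; ring, Complex.Gamma_one,
      show 1 - 2 * P = p + d + (p - d) + 2 * k + 1 by rw [hP]; ring,
      show 1 - P - d = p - d + k + 1 by rw [hP]; ring,
      show 1 - P + d = p + d + k + 1 by rw [hP]; ring,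
      show 1 - P + p = p + d + (p - d) + k + 1 by rw [hP]; ring,
      show -P = p + k by rw [hP]; ring, Complex.cpow_add _ _ hw0, Complex.cpow_natCast]
    simp only [div_eq_mul_inv, mul_inv, one_mul]
    rw [← inv_pow, inv_neg, inv_one]
    ring
  · intro z h1 h2
    have e0 := cpow_neg_differentiable hw z
    have e1 : DifferentiableAt ℂ (fun s : ℂ => Complex.Gamma (1 - 2 * s)) z :=
      differentiableAt_Gamma_of_re_pos (by fun_prop) (by simp; linarith)
    have e2 : DifferentiableAt ℂ (fun s : ℂ => Complex.Gamma (s + p + k + 1)) z :=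
      differentiableAt_Gamma_of_re_pos (by fun_prop) (by simp; linarith)
    have e3 := differentiable_inv_Gamma_comp (f := fun s => 1 - s - d) (by fun_prop)
    have e4 := differentiable_inv_Gamma_comp (f := fun s => 1 - s + d) (by fun_prop)
    have e5 := differentiable_inv_Gamma_comp (f := fun s => 1 - s + p) (by fun_prop)
    have e6 : DifferentiableAt ℂ (fun s : ℂ => (∏ i ∈ Finset.range k, (s + p + i))⁻¹) z := by
      refine DifferentiableAt.inv (by fun_prop) ?_
      exact Finset.prod_ne_zero_iff.2 fun i hi => hnz z h2 i (Finset.mem_range.1 hi)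
    exact e0.mul ((e1.mul (e2.mul e6)).mul (((e3 z).mul (e4 z)).mul (e5 z)))
  · intro z h1 h2 h3
    have hzP : z + p + k ≠ 0 := fun h => h3 (by rw [hP]; linear_combination h)
    have hall : ∀ i < k + 1, z + p + i ≠ 0 := by
      intro i hi
      rcases Nat.lt_succ_iff_lt_or_eq.1 hi with h | rfl
      · exact hnz z h2 i h
      · exact hzP
    have hprod : ∏ i ∈ Finset.range k, (z + p + i) ≠ 0 :=
      Finset.prod_ne_zero_iff.2 fun i hi => hnz z h2 i (Finset.mem_range.1 hi)
    have hG := Gamma_add_nat (z + p) (k + 1) hall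
    rw [Finset.prod_range_succ, Nat.cast_add_one, ← add_assoc] at hG
    simp only [hH, besselProdSymbol]
    rw [hG, show z - P = z + p + k by rw [hP]; ring]
    field_simp
  · exact fun ε hε => besselProdKernel_decay p d hw (by linarith) ε hε
  · have := besselProdKernel_line_integrable p d hw (c := c - k - 1) (by linarith) (by
      intro m; have := hline (k + 1) m; push_cast at this; rwa [← sub_sub] at this)
    exact this
  · exact besselProdKernel_line_integrable p d hw (by linarith) (hline k)

/-- Shifting the line by `n` units collects the first `n` residues, which are the coefficients of the
Cauchy product of the two Bessel series. -/
theorem besselProdKernel_shift_sum (p d : ℂ) {w : ℝ} (hw : 0 < w) {c : ℝ} (hc : c < 1 / 4)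
    (hpc : -p.re < c) (hcp : c < 1 - p.re) (n : ℕ) :
    (∫ t : ℝ, (w : ℂ) ^ (-((c : ℂ) + t * Complex.I)) * besselProdSymbol p d (c + t * Complex.I)) =
      (∫ t : ℝ, (w : ℂ) ^ (-(((c - n : ℝ) : ℂ) + t * Complex.I)) *
        besselProdSymbol p d ((c - n : ℝ) + t * Complex.I)) +
    ∑ k ∈ Finset.range n, 2 * Real.pi * ((w : ℂ) ^ p * ((-1) ^ k / (k.factorial : ℂ) *
      (Complex.Gamma ((p + d) + (p - d) + 2 * k + 1) / (Complex.Gamma ((p + d) + (p - d) + k + 1) *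
        Complex.Gamma (p + d + k + 1) * Complex.Gamma (p - d + k + 1))) * (w : ℂ) ^ k)) := by
  induction n with
  | zero => simp
  | succ n ih =>
    rw [Finset.sum_range_succ, ih, ← besselProdKernel_step p d hw hc hpc hcp n]
    have e : (c - (n + 1 : ℕ) : ℝ) = c - n - 1 := by push_cast; ring
    rw [e]
    ring

theorem besselProdSymbol_recurrence {p d s : ℂ} (h1 : s - 1 + p ≠ 0) (h2 : 1 - s ≠ 0)
    (h3 : 1 - 2 * s ≠ 0) :
    besselProdSymbol p d (s - 1) * ((s - 1 + p) * (1 - s - d) * (1 - s + d) * (1 - s + p)) =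
      besselProdSymbol p d s * ((2 - 2 * s) * (1 - 2 * s)) := by
  have r1 : Complex.Gamma (1 - 2 * (s - 1)) =
      (2 - 2 * s) * ((1 - 2 * s) * Complex.Gamma (1 - 2 * s)) := by
    rw [← Complex.Gamma_add_one _ h3, show 2 - 2 * s = 1 - 2 * s + 1 by ring,
      ← Complex.Gamma_add_one _ (by
        rw [show 1 - 2 * s + 1 = 2 * (1 - s) by ring]; exact mul_ne_zero two_ne_zero h2)]
    congr 1; ring
  have r2 : Complex.Gamma (s + p) = (s - 1 + p) * Complex.Gamma (s - 1 + p) := by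
    rw [← Complex.Gamma_add_one _ h1]; congr 1; ring
  have r3 := Complex.one_div_Gamma_eq_self_mul_one_div_Gamma_add_one (1 - s - d)
  have r4 := Complex.one_div_Gamma_eq_self_mul_one_div_Gamma_add_one (1 - s + d)
  have r5 := Complex.one_div_Gamma_eq_self_mul_one_div_Gamma_add_one (1 - s + p)
  rw [besselProdSymbol, besselProdSymbol, r1, r2, r3, r4, r5,
    show 1 - (s - 1) - d = 1 - s - d + 1 by ring, show 1 - (s - 1) + d = 1 - s + d + 1 by ring,
    show 1 - (s - 1) + p = 1 - s + p + 1 by ring]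
  ring

/-- Far to the left each unit step gains a factor of order `1/n`, so the shifted integrals vanish in
the limit. -/
theorem besselProdKernel_far_left (p d : ℂ) {w : ℝ} (hw : 0 < w) {c : ℝ} (hc : c < 1 / 4)
    (hpc : -p.re < c) (hcp : c < 1 - p.re) :
    Tendsto (fun n : ℕ => ∫ t : ℝ, (w : ℂ) ^ (-(((c - n : ℝ) : ℂ) + t * Complex.I)) *
        besselProdSymbol p d ((c - n : ℝ) + t * Complex.I)) atTop (𝓝 0) := by
  obtain ⟨j, hj⟩ := exists_nat_ge (2 * (‖p‖ + ‖d‖) + 1 - c)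
  have hpn := norm_nonneg p
  have hdn := norm_nonneg d
  have step : ∀ s : ℂ, ∀ n : ℕ, s.re = c - (n + j : ℕ) →
      ‖(w : ℂ) ^ (-(s - 1)) * besselProdSymbol p d (s - 1)‖ ≤
        64 * w / (n + 1) * ‖(w : ℂ) ^ (-s) * besselProdSymbol p d s‖ := by
    intro s n hs
    push_cast at hs
    have hn : (0 : ℝ) ≤ n := n.cast_nonneg
    have hre : 1 - c + n + j ≤ ‖1 - s‖ := by
      have := Complex.re_le_norm (1 - s)
      simp only [Complex.sub_re, Complex.one_re, hs] at this
      linarith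
    have q1 : n + 1 ≤ ‖1 - s‖ := by linarith
    have q2 : 1 ≤ ‖1 - s‖ := by linarith
    have big : ∀ u : ℂ, ‖u‖ ≤ ‖p‖ + ‖d‖ → ‖1 - s‖ / 2 ≤ ‖1 - s + u‖ := by
      intro u hu
      have := norm_sub_le_norm_add (1 - s) u
      linarith
    have b1 : ‖1 - s‖ / 2 ≤ ‖s - 1 + p‖ := by
      rw [← norm_neg (s - 1 + p), show -(s - 1 + p) = 1 - s + -p by ring]
      exact big _ (by rw [norm_neg]; linarith)
    have b2 : ‖1 - s‖ / 2 ≤ ‖1 - s - d‖ := by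
      rw [sub_eq_add_neg _ d]
      exact big _ (by rw [norm_neg]; linarith)
    have b3 := big d (by linarith)
    have b4 := big p (by linarith)
    have hnz : ∀ u : ℂ, ‖1 - s‖ / 2 ≤ ‖u‖ → u ≠ 0 := fun u hu h => by
      rw [h, norm_zero] at hu; linarith
    have h3 : ‖1 - 2 * s‖ ≤ 2 * ‖1 - s‖ := by
      rw [← Complex.norm_ofNat 2, ← norm_mul, ← sq_le_sq₀ (norm_nonneg _) (norm_nonneg _),
        ← Complex.normSq_eq_norm_sq, ← Complex.normSq_eq_norm_sq, Complex.normSq_apply,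
        Complex.normSq_apply]
      simp [hs]
      nlinarith
    have h3' : 1 - 2 * s ≠ 0 := fun h => by
      have := congrArg Complex.re h
      simp [hs] at this
      nlinarith
    have hrec := besselProdSymbol_recurrence (p := p) (d := d) (s := s) (hnz _ b1)
      (fun h => by rw [h, norm_zero] at q2; linarith) h3'
    have hw0 : (w : ℂ) ≠ 0 := by exact_mod_cast hw.ne'
    have hwp : ‖(w : ℂ) ^ (-(s - 1))‖ = w * ‖(w : ℂ) ^ (-s)‖ := by
      rw [show -(s - 1) = -s + 1 by ring, Complex.cpow_add _ _ hw0, Complex.cpow_one, norm_mul,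
        Complex.norm_real, Real.norm_eq_abs, abs_of_pos hw, mul_comm]
    have rn := congrArg norm hrec
    simp only [norm_mul] at rn
    set m := ‖1 - s‖ with hm
    set G := ‖besselProdSymbol p d s‖
    set G' := ‖besselProdSymbol p d (s - 1)‖
    have hG : 0 ≤ G := norm_nonneg _
    have hG' : 0 ≤ G' := norm_nonneg _
    have h2n : ‖2 - 2 * s‖ = 2 * m := by
      rw [show 2 - 2 * s = 2 * (1 - s) by ring, norm_mul, Complex.norm_ofNat]
    rw [h2n] at rn
    have up : G' * ((m / 2) * (m / 2) * (m / 2) * (m / 2)) ≤ G * ((2 * m) * (2 * m)) := by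
      calc _ ≤ G' * (‖s - 1 + p‖ * ‖1 - s - d‖ * ‖1 - s + d‖ * ‖1 - s + p‖) := by gcongr
        _ = G * (2 * m * ‖1 - 2 * s‖) := rn
        _ ≤ _ := by gcongr
    have up2 : G' * m ^ 2 ≤ 64 * G := by
      have hm2 : 0 < m ^ 2 := by positivity
      refine le_of_mul_le_mul_right ?_ hm2
      nlinarith
    have up3 : G' ≤ 64 / (n + 1) * G := by
      rw [div_mul_eq_mul_div, le_div_iff₀ (by positivity)]
      refine le_trans ?_ up2
      gcongr
      nlinarith
    rw [norm_mul, norm_mul, hwp]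
    calc w * ‖(w : ℂ) ^ (-s)‖ * G' ≤ w * ‖(w : ℂ) ^ (-s)‖ * (64 / (n + 1) * G) := by gcongr
      _ = _ := by ring
  have bound : ∀ n : ℕ, ∀ t : ℝ, ‖(w : ℂ) ^ (-(((c - (n + j : ℕ) : ℝ) : ℂ) + t * Complex.I)) *
        besselProdSymbol p d ((c - (n + j : ℕ) : ℝ) + t * Complex.I)‖ ≤
      (64 * w) ^ n / n.factorial * ‖(w : ℂ) ^ (-(((c - j : ℝ) : ℂ) + t * Complex.I)) *
        besselProdSymbol p d ((c - j : ℝ) + t * Complex.I)‖ := by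
    intro n t
    induction n with
    | zero => simp
    | succ n ih =>
      have := step ((c - (n + j : ℕ) : ℝ) + t * Complex.I) n (by simp)
      have e : ((c - (n + j : ℕ) : ℝ) : ℂ) + t * Complex.I - 1 =
          ((c - (n + 1 + j : ℕ) : ℝ) : ℂ) + t * Complex.I := by push_cast; ring
      rw [e] at this
      refine this.trans ?_
      calc _ ≤ 64 * w / (n + 1) * ((64 * w) ^ n / n.factorial *
            ‖(w : ℂ) ^ (-(((c - j : ℝ) : ℂ) + t * Complex.I)) *
              besselProdSymbol p d ((c - j : ℝ) + t * Complex.I)‖) := by gcongr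
        _ = _ := by
          rw [Nat.factorial_succ, pow_succ]
          push_cast
          field_simp
  have hint := besselProdKernel_line_integrable p d hw (c := c - j) (by
      have : (0 : ℝ) ≤ j := j.cast_nonneg
      linarith) (by
      intro m h
      have h1 : (j : ℝ) < m + 1 := by linarith
      have h2 : (m : ℝ) < j := by linarith
      have h3 : j < m + 1 := by exact_mod_cast h1
      have h4 : m < j := by exact_mod_cast h2
      omega)
  rw [← tendsto_add_atTop_iff_nat j]
  refine squeeze_zero_norm (a := fun n : ℕ => (64 * w) ^ n / n.factorial *
    ∫ t : ℝ, ‖(w : ℂ) ^ (-(((c - j : ℝ) : ℂ) + t * Complex.I)) *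
        besselProdSymbol p d ((c - j : ℝ) + t * Complex.I)‖) (fun n => ?_) ?_
  · rw [← integral_const_mul]
    exact norm_integral_le_of_norm_le (hint.norm.const_mul _) (ae_of_all _ (bound n))
  · have := (FloorSemiring.tendsto_pow_div_factorial_atTop (64 * w)).mul_const
      (∫ t : ℝ, ‖(w : ℂ) ^ (-(((c - j : ℝ) : ℂ) + t * Complex.I)) *
        besselProdSymbol p d ((c - j : ℝ) + t * Complex.I)‖)
    rwa [zero_mul] at this

theorem besselE_prod_eq_line_integral_aux (p d : ℂ) {w : ℝ} (hw : 0 < w)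
    {c : ℝ} (hc : c < 1 / 4) (hpc : -p.re < c) (hcp : c < 1 - p.re) :
    ∫ t : ℝ, (w : ℂ) ^ (-((c : ℂ) + t * Complex.I)) * besselProdSymbol p d (c + t * Complex.I) =
      2 * Real.pi * ((w : ℂ) ^ p * (besselE (p + d) w * besselE (p - d) w)) := by
  have hs := ((besselE_mul_hasSum (p + d) (p - d) w (by simp; linarith)).mul_left
    ((w : ℂ) ^ p)).mul_left (2 * Real.pi : ℂ)
  have h1 := hs.tendsto_sum_nat
  have h2 := besselProdKernel_far_left p d hw hc hpc hcp
  have h3 := h2.add h1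
  rw [zero_add] at h3
  refine tendsto_nhds_unique ?_ h3
  refine tendsto_const_nhds.congr fun n => ?_
  exact besselProdKernel_shift_sum p d hw hc hpc hcp n

/-- Mellin–Barnes representation of a product of two Bessel functions. -/
theorem besselE_prod_eq_line_integral (p d : ℂ) {w : ℝ} (hw : 0 < w)
    {c : ℝ} (hc : c < 1 / 4) (hpc : -p.re < c) :
    ∫ t : ℝ, (w : ℂ) ^ (-((c : ℂ) + t * Complex.I)) * besselProdSymbol p d (c + t * Complex.I) =
      2 * Real.pi * ((w : ℂ) ^ p * (besselE (p + d) w * besselE (p - d) w)) := by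
  set c₀ := min c (-p.re + 1 / 2) with hc₀
  have h1 : c₀ ≤ c := min_le_left _ _
  have h2 : c₀ ≤ -p.re + 1 / 2 := min_le_right _ _
  have h3 : -p.re < c₀ := lt_min hpc (by linarith)
  have hne : ∀ c' : ℝ, -p.re < c' → ∀ m : ℕ, c' + p.re ≠ -m := fun c' h m hm => by
    have : (0 : ℝ) ≤ m := m.cast_nonneg
    linarith
  rw [← besselE_prod_eq_line_integral_aux p d hw (c := c₀) (by linarith) h3 (by linarith)]
  refine (integral_vertical_line_eq (f := fun s => (w : ℂ) ^ (-s) * besselProdSymbol p d s) h1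
    (fun z hz1 hz2 => ?_) (fun ε hε => besselProdKernel_decay p d hw hc.le ε hε)
    (besselProdKernel_line_integrable p d hw (by linarith) (hne _ h3))
    (besselProdKernel_line_integrable p d hw hc (hne _ hpc))).symm
  refine (cpow_neg_differentiable hw z).mul (besselProdSymbol_differentiableAt (by linarith) ?_)
  intro m hm
  have := congrArg Complex.re hm
  simp at this
  have h0 : (0 : ℝ) ≤ m := m.cast_nonneg
  linarith



/-! ### The products of Bessel functions as Mellin–Barnes integrals -/

/-- `G(ν, w) = J_ν(2 √w)` for real `w > 0`. -/
noncomputable def besselG (ν : ℂ) (w : ℝ) : ℂ := (w : ℂ) ^ (ν / 2) * besselE ν w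

theorem besselJ_sqrt (ν : ℂ) {y : ℝ} (hy : 0 < y) :
    besselJ ν (Real.sqrt y : ℝ) = besselG ν (y / 4) := by
  have h0 : 0 < Real.sqrt y / 2 := by positivity
  have hsq : (Real.sqrt y / 2) ^ 2 = y / 4 := by
    rw [div_pow, Real.sq_sqrt hy.le]; norm_num
  have h1 : ((Real.sqrt y : ℝ) : ℂ) / 2 = ((Real.sqrt y / 2 : ℝ) : ℂ) := by push_cast; ring
  rw [besselJ_eq_besselE, besselG, h1, ← hsq, Complex.ofReal_pow]
  congr 1
  generalize Real.sqrt y / 2 = r at h0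
  have hr : (r : ℂ) ≠ 0 := by exact_mod_cast h0.ne'
  rw [← Complex.ofReal_pow, Complex.cpow_def_of_ne_zero hr,
    Complex.cpow_def_of_ne_zero (by exact_mod_cast (pow_pos h0 2).ne'), ← Complex.ofReal_log h0.le,
    ← Complex.ofReal_log (by positivity), Real.log_pow]
  push_cast
  ring_nf

theorem besselG_mul (p d : ℂ) {w : ℝ} (hw : 0 < w) :
    besselG (p + d) w * besselG (p - d) w =
      (w : ℂ) ^ p * (besselE (p + d) w * besselE (p - d) w) := by
  have hr : (w : ℂ) ≠ 0 := by exact_mod_cast hw.ne'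
  rw [besselG, besselG, show (w : ℂ) ^ p = (w : ℂ) ^ ((p + d) / 2) * (w : ℂ) ^ ((p - d) / 2) by
    rw [← Complex.cpow_add _ _ hr]; ring_nf]
  ring

theorem besselG_conj (ν : ℂ) {w : ℝ} (hw : 0 < w) :
    besselG ((starRingEnd ℂ) ν) w = (starRingEnd ℂ) (besselG ν w) := by
  have h := besselE_conj ν w
  rw [Complex.conj_ofReal] at h
  rw [besselG, besselG, map_mul, h]
  congr 1
  have h2 : (starRingEnd ℂ) (2 : ℂ) = 2 := map_ofNat _ 2
  have h1 := Complex.cpow_conj (w : ℂ) (ν / 2)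
    (by rw [Complex.arg_ofReal_of_nonneg hw.le]; exact Real.pi_pos.ne)
  rw [Complex.conj_ofReal, map_div₀, h2] at h1
  exact h1

theorem besselProd_eq {α τ y : ℝ} (hy : 0 < y)
    (hs : Complex.sin (Real.pi * (α - Complex.I * τ)) ≠ 0) :
    besselProd α τ y =
      (besselG (α + Complex.I * τ) (y / 4) * besselG (α - Complex.I * τ) (y / 4) *
        Complex.cos (Real.pi * (α - Complex.I * τ)) -
      besselG (Complex.I * τ + α) (y / 4) * besselG (Complex.I * τ - α) (y / 4)) /
        Complex.sin (Real.pi * (α - Complex.I * τ)) := by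
  rw [besselProd, besselY, if_neg hs, besselYQuot, besselJ_sqrt _ hy, besselJ_sqrt _ hy,
    besselJ_sqrt _ hy, add_comm (Complex.I * (τ : ℂ)), neg_sub]
  ring

theorem sin_pi_order_ne_zero {α τ : ℝ} (hτ : τ ≠ 0) :
    Complex.sin (Real.pi * (α - Complex.I * τ)) ≠ 0 := by
  intro h
  have h1 := sinh_abs_le_norm_csin (Real.pi * (α - Complex.I * τ))
  rw [h, norm_zero] at h1
  have h2 : ((Real.pi : ℂ) * (α - Complex.I * τ)).im = -(Real.pi * τ) := by simp
  rw [h2] at h1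
  have h3 : 0 < |-(Real.pi * τ)| := by
    rw [abs_neg, abs_mul, abs_of_pos Real.pi_pos]
    exact mul_pos Real.pi_pos (abs_pos.2 hτ)
  have := Real.sinh_pos_iff.2 h3
  linarith

theorem csin_conj_order (α τ : ℝ) : Complex.sin (Real.pi * (α - Complex.I * (-τ : ℝ))) =
    (starRingEnd ℂ) (Complex.sin (Real.pi * (α - Complex.I * τ))) := by
  rw [← Complex.sin_conj]; simp

theorem besselProd_neg {α τ y : ℝ} (hy : 0 < y)
    (hs : Complex.sin (Real.pi * (α - Complex.I * τ)) ≠ 0) :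
    besselProd α (-τ) y = (starRingEnd ℂ) (besselProd α τ y) := by
  have hs' : Complex.sin (Real.pi * (α - Complex.I * (-τ : ℝ))) ≠ 0 := by
    rw [csin_conj_order]; simpa using hs
  have e1 : (α + Complex.I * (-τ : ℝ) : ℂ) = (starRingEnd ℂ) (α + Complex.I * τ) := by simp
  have e2 : (α - Complex.I * (-τ : ℝ) : ℂ) = (starRingEnd ℂ) (α - Complex.I * τ) := by simp
  have e3 : (Complex.I * (-τ : ℝ) + α : ℂ) = (starRingEnd ℂ) (Complex.I * τ + α) := by simp
  have e4 : (Complex.I * (-τ : ℝ) - α : ℂ) = (starRingEnd ℂ) (Complex.I * τ - α) := by simp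
  have hw : 0 < y / 4 := by positivity
  rw [besselProd_eq hy hs', besselProd_eq hy hs, csin_conj_order, map_div₀, e1, e3, e4, e2,
    besselG_conj _ hw, besselG_conj _ hw, besselG_conj _ hw, besselG_conj _ hw]
  simp [← Complex.cos_conj]

/-- `K(s) = Γ(s+α) / (π Γ(1-s+α))`. -/
noncomputable def weberSymbol (α : ℝ) (s : ℂ) : ℂ :=
  Complex.Gamma (s + α) * (Complex.Gamma (1 - s + α))⁻¹ / Real.pi

/-- `β(s, τ) = Γ(s+iτ) Γ(s-iτ) Γ(1-2s) / π`. -/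
noncomputable def betaSymbol (τ : ℝ) (s : ℂ) : ℂ :=
  Complex.Gamma (s + Complex.I * τ) * Complex.Gamma (s - Complex.I * τ) *
    Complex.Gamma (1 - 2 * s) / Real.pi

theorem betaSymbol_neg (τ : ℝ) (s : ℂ) : betaSymbol (-τ) s = betaSymbol τ s := by
  simp only [betaSymbol, Complex.ofReal_neg, mul_neg, sub_neg_eq_add]
  rw [← sub_eq_add_neg]
  ring

theorem inv_Gamma_one_sub {z : ℂ} (hz : 0 < z.re) :
    (Complex.Gamma (1 - z))⁻¹ = Complex.Gamma z * Complex.sin (Real.pi * z) / Real.pi := by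
  have h := Complex.Gamma_mul_Gamma_one_sub z
  have hpi : (Real.pi : ℂ) ≠ 0 := by exact_mod_cast Real.pi_ne_zero
  have hG := Complex.Gamma_ne_zero_of_re_pos hz
  by_cases hs : Complex.sin (Real.pi * z) = 0
  · rw [hs, div_zero] at h
    rw [hs, (mul_eq_zero.1 h).resolve_left hG]
    simp
  · have : Complex.Gamma (1 - z) ≠ 0 := by
      intro h0
      rw [h0, mul_zero, eq_comm, div_eq_zero_iff] at h
      tauto
    rw [eq_div_iff hs] at h
    rw [eq_div_iff hpi, inv_mul_eq_iff_eq_mul₀ this]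
    linear_combination -h

/-- The trigonometric identity behind the symbol of `J_{α+iτ} Y_{α-iτ}`: with
`Y = (J cos - J_{-}) / sin`, two symbols of products of functions `J` combine into one. -/
theorem besselProdSymbol_combination {α τ : ℝ} {s : ℂ} (h0 : 0 < s.re) (h1 : 0 < s.re + α) :
    besselProdSymbol α (Complex.I * τ) s * Complex.cos (Real.pi * (α - Complex.I * τ)) -
      besselProdSymbol (Complex.I * τ) α s =
    -(weberSymbol α s * betaSymbol τ s) * (Complex.sin (Real.pi * (s - Complex.I * τ)) *
      Complex.cos (Real.pi * (s + Complex.I * τ))) * Complex.sin (Real.pi * (α - Complex.I * τ)) := by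
  have a1 := inv_Gamma_one_sub (z := s + Complex.I * τ) (by simpa using h0)
  have a2 := inv_Gamma_one_sub (z := s - Complex.I * τ) (by simpa using h0)
  have a3 := inv_Gamma_one_sub (z := s + α) (by simpa using h1)
  rw [← sub_sub] at a1 a3
  rw [show 1 - (s - Complex.I * τ) = 1 - s + Complex.I * τ by ring] at a2
  have hadd : Complex.sin (Real.pi * (s + α)) = Complex.sin (Real.pi * (s + Complex.I * τ)) *
      Complex.cos (Real.pi * (α - Complex.I * τ)) + Complex.cos (Real.pi * (s + Complex.I * τ)) *
      Complex.sin (Real.pi * (α - Complex.I * τ)) := by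
    rw [← Complex.sin_add]; ring_nf
  rw [besselProdSymbol, besselProdSymbol, a1, a2, a3, hadd, weberSymbol, betaSymbol]
  ring

theorem besselProd_eq_line_integral {α τ y c : ℝ} (hy : 0 < y) (hc0 : 0 < c) (hcα : -α < c)
    (hc : c < 1 / 4) (hs : Complex.sin (Real.pi * (α - Complex.I * τ)) ≠ 0) :
    Integrable (fun t : ℝ => ((y / 4 : ℝ) : ℂ) ^ (-((c : ℂ) + t * Complex.I)) *
      (-(weberSymbol α (c + t * Complex.I) * betaSymbol τ (c + t * Complex.I)) *
      (Complex.sin (Real.pi * (c + t * Complex.I - Complex.I * τ)) *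
      Complex.cos (Real.pi * (c + t * Complex.I + Complex.I * τ))))) ∧
    ∫ t : ℝ, ((y / 4 : ℝ) : ℂ) ^ (-((c : ℂ) + t * Complex.I)) *
      (-(weberSymbol α (c + t * Complex.I) * betaSymbol τ (c + t * Complex.I)) *
      (Complex.sin (Real.pi * (c + t * Complex.I - Complex.I * τ)) *
      Complex.cos (Real.pi * (c + t * Complex.I + Complex.I * τ)))) =
    2 * Real.pi * besselProd α τ y := by
  have hw : 0 < y / 4 := by positivity
  have hp : ∀ m : ℕ, c + (α : ℂ).re ≠ -m := fun m hm => by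
    have : (0 : ℝ) ≤ m := m.cast_nonneg
    simp at hm; linarith
  have hp' : ∀ m : ℕ, c + (Complex.I * τ).re ≠ -m := fun m hm => by
    have : (0 : ℝ) ≤ m := m.cast_nonneg
    simp at hm; linarith
  have i1 := besselProdKernel_line_integrable (α : ℂ) (Complex.I * τ) hw hc hp
  have i2 := besselProdKernel_line_integrable (Complex.I * τ) (α : ℂ) hw hc hp'
  have e1 := besselE_prod_eq_line_integral (α : ℂ) (Complex.I * τ) hw hc (by simpa using hcα)
  have e2 := besselE_prod_eq_line_integral (Complex.I * τ) (α : ℂ) hw hc (by simpa using hc0)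
  rw [← besselG_mul _ _ hw] at e1 e2
  have i3 := ((i1.mul_const (Complex.cos (Real.pi * (α - Complex.I * τ)))).sub i2).div_const
    (Complex.sin (Real.pi * (α - Complex.I * τ)))
  have hpt : ∀ t : ℝ, ((y / 4 : ℝ) : ℂ) ^ (-((c : ℂ) + t * Complex.I)) *
      (-(weberSymbol α (c + t * Complex.I) * betaSymbol τ (c + t * Complex.I)) *
      (Complex.sin (Real.pi * (c + t * Complex.I - Complex.I * τ)) *
      Complex.cos (Real.pi * (c + t * Complex.I + Complex.I * τ)))) =
      (((y / 4 : ℝ) : ℂ) ^ (-((c : ℂ) + t * Complex.I)) *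
        besselProdSymbol α (Complex.I * τ) (c + t * Complex.I) *
        Complex.cos (Real.pi * (α - Complex.I * τ)) -
      ((y / 4 : ℝ) : ℂ) ^ (-((c : ℂ) + t * Complex.I)) *
        besselProdSymbol (Complex.I * τ) α (c + t * Complex.I)) /
      Complex.sin (Real.pi * (α - Complex.I * τ)) := fun t => by
    rw [mul_assoc (_ ^ _), ← mul_sub, besselProdSymbol_combination (by simpa using hc0)
      (by simp; linarith), eq_div_iff hs]
    ring
  refine ⟨i3.congr (ae_of_all _ fun t => (hpt t).symm), ?_⟩
  simp_rw [hpt]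
  rw [integral_div, integral_sub (i1.mul_const _) i2, integral_mul_const, e1, e2,
    besselProd_eq hy hs]
  ring

/-- The Mellin–Barnes integral of `Re [J_{α+iτ} Y_{α-iτ}]`. -/
theorem weberRe_eq_line_integral {α τ y c : ℝ} (hy : 0 < y) (hc0 : 0 < c) (hcα : -α < c)
    (hc : c < 1 / 4) (hs : Complex.sin (Real.pi * (α - Complex.I * τ)) ≠ 0) :
    Integrable (fun t : ℝ => ((y / 4 : ℝ) : ℂ) ^ (-((c : ℂ) + t * Complex.I)) *
      (-(weberSymbol α (c + t * Complex.I) * betaSymbol τ (c + t * Complex.I)) *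
      (Complex.sin (Real.pi * (c + t * Complex.I)) *
      Complex.cos (Real.pi * (c + t * Complex.I))))) ∧
    ∫ t : ℝ, ((y / 4 : ℝ) : ℂ) ^ (-((c : ℂ) + t * Complex.I)) *
      (-(weberSymbol α (c + t * Complex.I) * betaSymbol τ (c + t * Complex.I)) *
      (Complex.sin (Real.pi * (c + t * Complex.I)) *
      Complex.cos (Real.pi * (c + t * Complex.I)))) =
    2 * Real.pi * (weberRe α τ y : ℂ) := by
  have hs' : Complex.sin (Real.pi * (α - Complex.I * (-τ : ℝ))) ≠ 0 := by
    rw [csin_conj_order]; simpa using hs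
  obtain ⟨i1, e1⟩ := besselProd_eq_line_integral hy hc0 hcα hc hs
  obtain ⟨i2, e2⟩ := besselProd_eq_line_integral hy hc0 hcα hc hs'
  have hpt : ∀ t : ℝ, ((y / 4 : ℝ) : ℂ) ^ (-((c : ℂ) + t * Complex.I)) *
      (-(weberSymbol α (c + t * Complex.I) * betaSymbol τ (c + t * Complex.I)) *
      (Complex.sin (Real.pi * (c + t * Complex.I)) *
      Complex.cos (Real.pi * (c + t * Complex.I)))) =
      (((y / 4 : ℝ) : ℂ) ^ (-((c : ℂ) + t * Complex.I)) *
      (-(weberSymbol α (c + t * Complex.I) * betaSymbol τ (c + t * Complex.I)) *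
      (Complex.sin (Real.pi * (c + t * Complex.I - Complex.I * τ)) *
      Complex.cos (Real.pi * (c + t * Complex.I + Complex.I * τ)))) +
      ((y / 4 : ℝ) : ℂ) ^ (-((c : ℂ) + t * Complex.I)) *
      (-(weberSymbol α (c + t * Complex.I) * betaSymbol (-τ) (c + t * Complex.I)) *
      (Complex.sin (Real.pi * (c + t * Complex.I - Complex.I * (-τ : ℝ))) *
      Complex.cos (Real.pi * (c + t * Complex.I + Complex.I * (-τ : ℝ)))))) / 2 := fun t => by
    have h1 := Complex.sin_sq_add_cos_sq (Real.pi * (Complex.I * τ))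
    have h2 := Complex.sin_sq_add_cos_sq (Real.pi * (c + t * Complex.I))
    rw [betaSymbol_neg]
    simp only [Complex.ofReal_neg, mul_neg, sub_neg_eq_add, ← sub_eq_add_neg]
    rw [mul_sub (Real.pi : ℂ) _ (Complex.I * τ), mul_add (Real.pi : ℂ) _ (Complex.I * τ),
      Complex.sin_sub, Complex.sin_add, Complex.cos_sub, Complex.cos_add]
    generalize Complex.sin (Real.pi * (c + t * Complex.I)) = S at *
    generalize Complex.cos (Real.pi * (c + t * Complex.I)) = C at *
    linear_combination (((y / 4 : ℝ) : ℂ) ^ (-((c : ℂ) + t * Complex.I)) *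
      (weberSymbol α (c + t * Complex.I) * betaSymbol τ (c + t * Complex.I)) * (S * C)) * h1
  refine ⟨((i1.add i2).div_const 2).congr (ae_of_all _ fun t => (hpt t).symm), ?_⟩
  simp_rw [hpt]
  rw [integral_div, integral_add i1 i2, e1, e2, besselProd_neg hy hs, weberRe, ← mul_add,
    Complex.add_conj]
  push_cast
  ring

/-- The Mellin–Barnes integral of the kernel `W_α`. -/
theorem weberKernel_eq_line_integral {α τ y c : ℝ} (hy : 0 < y) (hc0 : 0 < c) (hcα : -α < c)
    (hc : c < 1 / 4) (hτ : τ ≠ 0) :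
    ∫ t : ℝ, ((y / 4 : ℝ) : ℂ) ^ (-((c : ℂ) + t * Complex.I)) *
      (weberSymbol α (c + t * Complex.I) * betaSymbol τ (c + t * Complex.I) *
        Complex.cosh (Real.pi * τ)) =
    2 * Real.pi * (weberKernel α y τ : ℂ) := by
  have hs := sin_pi_order_ne_zero (α := α) hτ
  have hs' := sin_pi_order_ne_zero (α := α) (neg_ne_zero.2 hτ)
  obtain ⟨i1, e1⟩ := besselProd_eq_line_integral hy hc0 hcα hc hs
  obtain ⟨i2, e2⟩ := besselProd_eq_line_integral hy hc0 hcα hc hs'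
  have hsh : Complex.sinh (Real.pi * τ) ≠ 0 := by
    rw [← Complex.ofReal_mul, ← Complex.ofReal_sinh, Complex.ofReal_ne_zero, Real.sinh_ne_zero]
    exact mul_ne_zero Real.pi_ne_zero hτ
  have hpt : ∀ t : ℝ, ((y / 4 : ℝ) : ℂ) ^ (-((c : ℂ) + t * Complex.I)) *
      (weberSymbol α (c + t * Complex.I) * betaSymbol τ (c + t * Complex.I) *
        Complex.cosh (Real.pi * τ)) =
      (((y / 4 : ℝ) : ℂ) ^ (-((c : ℂ) + t * Complex.I)) *
      (-(weberSymbol α (c + t * Complex.I) * betaSymbol τ (c + t * Complex.I)) *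
      (Complex.sin (Real.pi * (c + t * Complex.I - Complex.I * τ)) *
      Complex.cos (Real.pi * (c + t * Complex.I + Complex.I * τ)))) -
      ((y / 4 : ℝ) : ℂ) ^ (-((c : ℂ) + t * Complex.I)) *
      (-(weberSymbol α (c + t * Complex.I) * betaSymbol (-τ) (c + t * Complex.I)) *
      (Complex.sin (Real.pi * (c + t * Complex.I - Complex.I * (-τ : ℝ))) *
      Complex.cos (Real.pi * (c + t * Complex.I + Complex.I * (-τ : ℝ)))))) /
        (2 * Complex.I * Complex.sinh (Real.pi * τ)) := fun t => by
    have h2 := Complex.sin_sq_add_cos_sq (Real.pi * (c + t * Complex.I))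
    have h3 : Complex.sin (Real.pi * (Complex.I * τ)) = Complex.sinh (Real.pi * τ) * Complex.I := by
      rw [← Complex.sin_mul_I]; ring_nf
    have h4 : Complex.cos (Real.pi * (Complex.I * τ)) = Complex.cosh (Real.pi * τ) := by
      rw [← Complex.cos_mul_I]; ring_nf
    rw [betaSymbol_neg]
    simp only [Complex.ofReal_neg, mul_neg, sub_neg_eq_add, ← sub_eq_add_neg]
    rw [mul_sub (Real.pi : ℂ) _ (Complex.I * τ), mul_add (Real.pi : ℂ) _ (Complex.I * τ),
      Complex.sin_sub, Complex.sin_add, Complex.cos_sub, Complex.cos_add, h3, h4,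
      eq_div_iff (by simpa using hsh)]
    generalize Complex.sin (Real.pi * (c + t * Complex.I)) = S at *
    generalize Complex.cos (Real.pi * (c + t * Complex.I)) = C at *
    linear_combination (-2 * ((y / 4 : ℝ) : ℂ) ^ (-((c : ℂ) + t * Complex.I)) *
      (weberSymbol α (c + t * Complex.I) * betaSymbol τ (c + t * Complex.I)) *
      (Complex.cosh (Real.pi * τ) * Complex.sinh (Real.pi * τ) * Complex.I)) * h2
  simp_rw [hpt]
  rw [integral_div, integral_sub i1 i2, e1, e2, besselProd_neg hy hs, weberKernel, ← mul_sub,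
    Complex.sub_conj]
  push_cast
  field_simp



/-! ### The substitution `e^l = 2 sinh (v/2)` and the beta integral -/

theorem integrable_of_exp_bounds {E : Type*} [NormedAddCommGroup E] {f : ℝ → E}
    (hf : AEStronglyMeasurable f) {a b C : ℝ} (ha : 0 < a) (hb : 0 < b)
    (h1 : ∀ l, l ≤ 0 → ‖f l‖ ≤ C * Real.exp (a * l))
    (h2 : ∀ l, 0 < l → ‖f l‖ ≤ C * Real.exp (-(b * l))) : Integrable f := by
  rw [← integrableOn_univ, ← Iic_union_Ioi (a := (0 : ℝ)), integrableOn_union]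
  constructor
  · refine Integrable.mono' ((integrableOn_exp_mul_Iic ha 0).const_mul C) hf.restrict ?_
    filter_upwards [ae_restrict_mem measurableSet_Iic] with l hl using h1 l hl
  · refine Integrable.mono' ((integrableOn_exp_mul_Ioi (neg_lt_zero.2 hb) 0).const_mul C)
      hf.restrict ?_
    filter_upwards [ae_restrict_mem measurableSet_Ioi] with l hl
    have := h2 l hl
    rwa [← neg_mul] at this

/-- The solution `v > 0` of `2 sinh (v/2) = e^l`. -/
noncomputable def logArc (l : ℝ) : ℝ := 2 * Real.arsinh (Real.exp l / 2)

/-- The derivative of `logArc`. -/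
noncomputable def logArcDeriv (l : ℝ) : ℝ := Real.exp l / Real.sqrt (1 + (Real.exp l / 2) ^ 2)

theorem logArc_hasDerivAt (l : ℝ) : HasDerivAt logArc (logArcDeriv l) l := by
  have h := (((Real.hasDerivAt_exp l).div_const 2).arsinh).const_mul 2
  refine h.congr_deriv ?_
  rw [logArcDeriv, smul_eq_mul]
  ring

theorem logArc_continuous : Continuous logArc :=
  continuous_iff_continuousAt.2 fun l => (logArc_hasDerivAt l).continuousAt

theorem logArcDeriv_continuous : Continuous logArcDeriv := by
  unfold logArcDeriv
  refine Real.continuous_exp.div (by fun_prop) fun l => ?_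
  positivity

theorem logArc_pos (l : ℝ) : 0 < logArc l := by
  have := Real.arsinh_pos_iff.2 (show 0 < Real.exp l / 2 by positivity)
  unfold logArc
  linarith

theorem exp_eq_two_sinh (l : ℝ) : Real.exp l = 2 * Real.sinh (logArc l / 2) := by
  rw [logArc, mul_div_cancel_left₀ _ two_ne_zero, Real.sinh_arsinh]
  ring

theorem logArc_le_exp (l : ℝ) : logArc l ≤ Real.exp l := by
  have h := Real.self_le_sinh_iff.2 (show 0 ≤ logArc l / 2 by linarith [logArc_pos l])
  rw [exp_eq_two_sinh]
  linarith

theorem logArcDeriv_pos (l : ℝ) : 0 < logArcDeriv l := by unfold logArcDeriv; positivity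

theorem logArcDeriv_le_exp (l : ℝ) : logArcDeriv l ≤ Real.exp l := by
  unfold logArcDeriv
  refine div_le_self (Real.exp_pos l).le ?_
  rw [Real.one_le_sqrt]
  nlinarith [sq_nonneg (Real.exp l / 2)]

theorem logArcDeriv_le_two (l : ℝ) : logArcDeriv l ≤ 2 := by
  unfold logArcDeriv
  rw [div_le_iff₀ (by positivity)]
  have : Real.exp l / 2 ≤ Real.sqrt (1 + (Real.exp l / 2) ^ 2) :=
    Real.le_sqrt_of_sq_le (by linarith)
  linarith

theorem logArc_injective : Function.Injective logArc := fun a b h =>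
  Real.exp_injective (by rw [exp_eq_two_sinh, exp_eq_two_sinh, h])

theorem logArc_image : logArc '' univ = Ioi 0 := by
  ext v
  constructor
  · rintro ⟨l, -, rfl⟩
    exact logArc_pos l
  · intro hv
    refine ⟨Real.log (2 * Real.sinh (v / 2)), mem_univ _, ?_⟩
    have : 0 < Real.sinh (v / 2) := Real.sinh_pos_iff.2 (half_pos hv)
    rw [logArc, Real.exp_log (by positivity), mul_div_cancel_left₀ _ two_ne_zero, Real.arsinh_sinh]
    ring

theorem integral_comp_logArc {E : Type*} [NormedAddCommGroup E] [NormedSpace ℝ E] (f : ℝ → E) :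
    ∫ v in Ioi (0 : ℝ), f v = ∫ l, logArcDeriv l • f (logArc l) := by
  rw [← logArc_image, integral_image_eq_integral_abs_deriv_smul MeasurableSet.univ
    (fun l _ => (logArc_hasDerivAt l).hasDerivWithinAt) logArc_injective.injOn, setIntegral_univ]
  simp_rw [abs_of_pos (logArcDeriv_pos _)]

theorem integrableOn_comp_logArc {E : Type*} [NormedAddCommGroup E] [NormedSpace ℝ E] {f : ℝ → E}
    (hf : IntegrableOn f (Ioi 0)) : Integrable fun l => logArcDeriv l • f (logArc l) := by
  rw [← logArc_image, integrableOn_image_iff_integrableOn_abs_deriv_smul MeasurableSet.univ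
    (fun l _ => (logArc_hasDerivAt l).hasDerivWithinAt) logArc_injective.injOn,
    integrableOn_univ] at hf
  simpa only [abs_of_pos (logArcDeriv_pos _)] using hf

theorem one_sub_exp_neg_logArc (l : ℝ) :
    1 - Real.exp (-logArc l) = Real.exp (l - logArc l / 2) := by
  have h1 : Real.exp (-logArc l) = Real.exp (-(logArc l / 2)) * Real.exp (-(logArc l / 2)) := by
    rw [← Real.exp_add]; ring_nf
  have h2 : Real.exp (logArc l / 2) * Real.exp (-(logArc l / 2)) = 1 := by
    rw [← Real.exp_add]; simp
  rw [sub_eq_add_neg l, Real.exp_add, exp_eq_two_sinh l, Real.sinh_eq, h1]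
  linear_combination -h2

theorem norm_cexp_real_mul (s : ℂ) (l : ℝ) :
    ‖Complex.exp (s * l)‖ = Real.exp (s.re * l) := by
  rw [Complex.norm_exp]; simp

theorem integrable_exp_mul_logArcDeriv {f : ℝ → ℂ} (hf : Continuous f) (hb : ∀ l, ‖f l‖ ≤ 1)
    {s : ℂ} (h0 : 0 < s.re) (h1 : s.re < 1 / 2) :
    Integrable fun l : ℝ => f l * Complex.exp (-2 * s * l) * logArcDeriv l := by
  refine integrable_of_exp_bounds (C := 2) (a := 1 - 2 * s.re) (b := 2 * s.re) ?_
    (by linarith) (by linarith) (fun l hl => ?_) fun l hl => ?_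
  · exact ((hf.mul (by fun_prop)).mul
      (Complex.continuous_ofReal.comp logArcDeriv_continuous)).aestronglyMeasurable
  all_goals
    rw [norm_mul, norm_mul, norm_cexp_real_mul, Complex.norm_real, Real.norm_eq_abs,
      abs_of_pos (logArcDeriv_pos l)]
    simp only [Complex.mul_re, Complex.neg_re, Complex.re_ofNat, Complex.neg_im, Complex.im_ofNat,
      neg_zero, zero_mul, sub_zero]
  · calc ‖f l‖ * Real.exp (-2 * s.re * l) * logArcDeriv l
        ≤ 1 * Real.exp (-2 * s.re * l) * Real.exp l := by
          gcongr
          · exact (logArcDeriv_pos l).le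
          · exact hb l
          · exact logArcDeriv_le_exp l
      _ = Real.exp ((1 - 2 * s.re) * l) := by rw [one_mul, ← Real.exp_add]; ring_nf
      _ ≤ _ := by linarith [Real.exp_pos ((1 - 2 * s.re) * l)]
  · calc ‖f l‖ * Real.exp (-2 * s.re * l) * logArcDeriv l
        ≤ 1 * Real.exp (-2 * s.re * l) * 2 := by
          gcongr
          · exact (logArcDeriv_pos l).le
          · exact hb l
          · exact logArcDeriv_le_two l
      _ = _ := by ring_nf

/-- Euler's beta integral in the variable `e^{-v(l)}`. -/
theorem beta_integral_logArc (τ : ℝ) {s : ℂ} (h0 : 0 < s.re) (h1 : s.re < 1 / 2) :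
    ∫ l : ℝ, Complex.exp (-(Complex.I * (τ * logArc l : ℝ))) * Complex.exp (-2 * s * l) *
      logArcDeriv l = betaSymbol τ s * Complex.sin (Real.pi * (s - Complex.I * τ)) := by
  have hd : ∀ l ∈ (univ : Set ℝ), HasDerivWithinAt (fun l => Real.exp (-logArc l))
      (Real.exp (-logArc l) * -logArcDeriv l) univ l := fun l _ =>
    ((logArc_hasDerivAt l).neg.exp).hasDerivWithinAt
  have hinj : InjOn (fun l => Real.exp (-logArc l)) univ := fun a _ b _ h =>
    logArc_injective (neg_injective (Real.exp_injective h))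
  have himg : (fun l => Real.exp (-logArc l)) '' univ = Ioo 0 1 := by
    have : (fun l => Real.exp (-logArc l)) = (fun v => Real.exp (-v)) ∘ logArc := rfl
    rw [this, image_comp, logArc_image]
    ext x
    constructor
    · rintro ⟨v, hv, rfl⟩
      exact ⟨Real.exp_pos _, Real.exp_lt_one_iff.2 (neg_lt_zero.2 hv)⟩
    · rintro ⟨hx0, hx1⟩
      exact ⟨-Real.log x, neg_pos.2 (Real.log_neg hx0 hx1), by simp [Real.exp_log hx0]⟩
  have hB := Complex.Gamma_mul_Gamma_eq_betaIntegral (s := s + Complex.I * τ) (t := 1 - 2 * s)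
    (by simpa using h0) (by simp; linarith)
  rw [Complex.betaIntegral, intervalIntegral.integral_of_le zero_le_one, integral_Ioc_eq_integral_Ioo,
    ← himg, integral_image_eq_integral_abs_deriv_smul MeasurableSet.univ hd hinj,
    setIntegral_univ] at hB
  have hpt : ∀ l : ℝ, |Real.exp (-logArc l) * -logArcDeriv l| •
      (((Real.exp (-logArc l) : ℝ) : ℂ) ^ (s + Complex.I * τ - 1) *
        (1 - ((Real.exp (-logArc l) : ℝ) : ℂ)) ^ (1 - 2 * s - 1)) =
      Complex.exp (-(Complex.I * (τ * logArc l : ℝ))) * Complex.exp (-2 * s * l) *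
      logArcDeriv l := fun l => by
    have e1 : (1 - ((Real.exp (-logArc l) : ℝ) : ℂ)) = ((Real.exp (l - logArc l / 2) : ℝ) : ℂ) := by
      rw [← one_sub_exp_neg_logArc]; push_cast; rfl
    have e2 : ∀ (a : ℝ) (z : ℂ), ((Real.exp a : ℝ) : ℂ) ^ z = Complex.exp (a * z) := fun a z => by
      rw [Complex.cpow_def_of_ne_zero (by exact_mod_cast (Real.exp_pos a).ne'),
        ← Complex.ofReal_log (Real.exp_pos a).le, Real.log_exp]
    rw [e1, e2, e2, mul_neg, abs_neg, abs_of_pos (mul_pos (Real.exp_pos _) (logArcDeriv_pos l)),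
      ← Complex.exp_add, ← Complex.exp_add, Complex.real_smul, Complex.ofReal_mul,
      Complex.ofReal_exp, mul_right_comm, ← Complex.exp_add]
    congr 2
    push_cast
    ring
  simp_rw [hpt] at hB
  have hne : Complex.Gamma (1 - s + Complex.I * τ) ≠ 0 :=
    Complex.Gamma_ne_zero_of_re_pos (by simp; linarith)
  have a2 := inv_Gamma_one_sub (z := s - Complex.I * τ) (by simpa using h0)
  rw [show 1 - (s - Complex.I * τ) = 1 - s + Complex.I * τ by ring] at a2
  rw [show s + Complex.I * τ + (1 - 2 * s) = 1 - s + Complex.I * τ by ring] at hB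
  generalize (∫ l : ℝ, Complex.exp (-(Complex.I * (τ * logArc l : ℝ))) * Complex.exp (-2 * s * l) *
      logArcDeriv l) = J at *
  have : J = (Complex.Gamma (1 - s + Complex.I * τ))⁻¹ *
      (Complex.Gamma (s + Complex.I * τ) * Complex.Gamma (1 - 2 * s)) := by
    rw [hB, inv_mul_cancel_left₀ hne]
  rw [this, a2, betaSymbol]
  ring

theorem integrable_cos_logArc (τ : ℝ) {s : ℂ} (h0 : 0 < s.re) (h1 : s.re < 1 / 2) :
    Integrable fun l : ℝ => (Real.cos (τ * logArc l) : ℂ) * Complex.exp (-2 * s * l) *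
      logArcDeriv l := by
  refine integrable_exp_mul_logArcDeriv ?_ (fun l => ?_) h0 h1
  · exact Complex.continuous_ofReal.comp
      (Real.continuous_cos.comp (continuous_const.mul logArc_continuous))
  · rw [Complex.norm_real]; exact Real.abs_cos_le_one _

theorem integrable_sin_logArc (τ : ℝ) {s : ℂ} (h0 : 0 < s.re) (h1 : s.re < 1 / 2) :
    Integrable fun l : ℝ => (Real.sin (τ * logArc l) : ℂ) * Complex.exp (-2 * s * l) *
      logArcDeriv l := by
  refine integrable_exp_mul_logArcDeriv ?_ (fun l => ?_) h0 h1
  · exact Complex.continuous_ofReal.comp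
      (Real.continuous_sin.comp (continuous_const.mul logArc_continuous))
  · rw [Complex.norm_real]; exact Real.abs_sin_le_one _

theorem cos_sub_sin_logArc_integral (τ : ℝ) {s : ℂ} (h0 : 0 < s.re) (h1 : s.re < 1 / 2) :
    (∫ l : ℝ, (Real.cos (τ * logArc l) : ℂ) * Complex.exp (-2 * s * l) * logArcDeriv l) -
      Complex.I * (∫ l : ℝ, (Real.sin (τ * logArc l) : ℂ) * Complex.exp (-2 * s * l) *
        logArcDeriv l) = betaSymbol τ s * Complex.sin (Real.pi * (s - Complex.I * τ)) := by
  rw [← beta_integral_logArc τ h0 h1, ← integral_const_mul, ← integral_sub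
    (integrable_cos_logArc τ h0 h1) ((integrable_sin_logArc τ h0 h1).const_mul _)]
  refine integral_congr_ae (ae_of_all _ fun l => ?_)
  have : Complex.exp (-(Complex.I * (τ * logArc l : ℝ))) =
      Real.cos (τ * logArc l) - Complex.I * Real.sin (τ * logArc l) := by
    rw [show -(Complex.I * (τ * logArc l : ℝ)) = (-(τ * logArc l : ℝ) : ℂ) * Complex.I by ring,
      Complex.exp_mul_I, Complex.cos_neg, Complex.sin_neg, ← Complex.ofReal_cos, ← Complex.ofReal_sin]
    ring
  simp only [this]
  ring

theorem sin_pi_sub_I_mul (s : ℂ) (τ : ℝ) : Complex.sin (Real.pi * (s - Complex.I * τ)) =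
    Complex.sin (Real.pi * s) * Complex.cosh (Real.pi * τ) -
      Complex.I * (Complex.cos (Real.pi * s) * Complex.sinh (Real.pi * τ)) := by
  have h3 : Complex.sin (Real.pi * (Complex.I * τ)) = Complex.sinh (Real.pi * τ) * Complex.I := by
    rw [← Complex.sin_mul_I]; ring_nf
  have h4 : Complex.cos (Real.pi * (Complex.I * τ)) = Complex.cosh (Real.pi * τ) := by
    rw [← Complex.cos_mul_I]; ring_nf
  rw [mul_sub, Complex.sin_sub, h3, h4]
  ring

theorem cos_logArc_integral (τ : ℝ) {s : ℂ} (h0 : 0 < s.re) (h1 : s.re < 1 / 2) :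
    ∫ l : ℝ, (Real.cos (τ * logArc l) : ℂ) * Complex.exp (-2 * s * l) * logArcDeriv l =
      betaSymbol τ s * (Complex.sin (Real.pi * s) * Complex.cosh (Real.pi * τ)) := by
  have e1 := cos_sub_sin_logArc_integral τ h0 h1
  have e2 := cos_sub_sin_logArc_integral (-τ) h0 h1
  have e3 : ∫ l : ℝ, -((Real.sin (τ * logArc l) : ℂ) * Complex.exp (-2 * s * l)) *
      logArcDeriv l = -∫ l : ℝ, (Real.sin (τ * logArc l) : ℂ) * Complex.exp (-2 * s * l) *
        logArcDeriv l := by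
    rw [← integral_neg]
    exact integral_congr_ae (ae_of_all _ fun l => neg_mul _ _)
  rw [sin_pi_sub_I_mul] at e1 e2
  simp only [neg_mul τ, neg_mul (Complex.ofReal _), Real.cos_neg, Real.sin_neg, Complex.ofReal_neg, mul_neg,
    Complex.cosh_neg, Complex.sinh_neg, betaSymbol_neg] at e1 e2
  rw [e3] at e2
  linear_combination (e1 + e2) / 2

theorem sin_logArc_integral (τ : ℝ) {s : ℂ} (h0 : 0 < s.re) (h1 : s.re < 1 / 2) :
    ∫ l : ℝ, (Real.sin (τ * logArc l) : ℂ) * Complex.exp (-2 * s * l) * logArcDeriv l =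
      betaSymbol τ s * (Complex.cos (Real.pi * s) * Complex.sinh (Real.pi * τ)) := by
  have e1 := cos_sub_sin_logArc_integral τ h0 h1
  rw [cos_logArc_integral τ h0 h1, sin_pi_sub_I_mul] at e1
  linear_combination Complex.I * e1 + ((∫ l : ℝ, (Real.sin (τ * logArc l) : ℂ) *
    Complex.exp (-2 * s * l) * logArcDeriv l) - betaSymbol τ s *
    (Complex.cos (Real.pi * s) * Complex.sinh (Real.pi * τ))) * Complex.I_sq

/-- Interpolation between `|sin x| ≤ 1` and `|sin x| ≤ |x|`. -/
theorem abs_sin_le_rpow {θ : ℝ} (h0 : 0 ≤ θ) (h1 : θ ≤ 1) (x : ℝ) : |Real.sin x| ≤ |x| ^ θ := by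
  rcases le_total |x| 1 with h | h
  · refine (Real.abs_sin_le_abs (x := x)).trans ?_
    calc |x| = |x| ^ (1 : ℝ) := (Real.rpow_one _).symm
      _ ≤ |x| ^ θ := Real.rpow_le_rpow_of_exponent_ge_of_imp (abs_nonneg x) h h1
          (fun hx hθ => by simp at hθ)
  · exact (Real.abs_sin_le_one x).trans (Real.one_le_rpow h h0)

/-- The sine of `τ v(l)` against the weight `1 + |τ|^θ`: bounded, and of order `e^{θl}` at `-∞`. -/
theorem abs_sin_logArc_le {θ : ℝ} (h0 : 0 ≤ θ) (h1 : θ ≤ 1) (τ l : ℝ) :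
    |Real.sin (τ * logArc l)| ≤ (1 + |τ| ^ θ) * min 1 (Real.exp (θ * l)) := by
  have hn : 0 ≤ |τ| ^ θ := by positivity
  have hv := logArc_pos l
  rcases min_cases 1 (Real.exp (θ * l)) with ⟨h, -⟩ | ⟨h, -⟩ <;> rw [h]
  · linarith [Real.abs_sin_le_one (τ * logArc l)]
  · refine (abs_sin_le_rpow h0 h1 _).trans ?_
    rw [abs_mul, Real.mul_rpow (abs_nonneg _) (abs_nonneg _), abs_of_pos hv]
    have : logArc l ^ θ ≤ Real.exp (θ * l) := by
      rw [mul_comm, Real.exp_mul]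
      exact Real.rpow_le_rpow hv.le (logArc_le_exp l) h0
    nlinarith [Real.exp_pos (θ * l), Real.rpow_pos_of_pos hv θ]

theorem integrable_min_exp {θ σ : ℝ} (h0 : 0 < σ) (h1 : 2 * σ < θ) :
    Integrable fun l : ℝ => min 1 (Real.exp (θ * l)) * Real.exp (-2 * σ * l) := by
  refine integrable_of_exp_bounds (C := 1) (a := θ - 2 * σ) (b := 2 * σ) ?_
    (by linarith) (by linarith) (fun l hl => ?_) fun l hl => ?_
  · exact (by fun_prop : Continuous fun l : ℝ =>
      min 1 (Real.exp (θ * l)) * Real.exp (-2 * σ * l)).aestronglyMeasurable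
  all_goals
    rw [Real.norm_of_nonneg (by positivity)]
  · rw [one_mul, show (θ - 2 * σ) * l = θ * l + -2 * σ * l by ring, Real.exp_add]
    gcongr
    exact min_le_right _ _
  · rw [← neg_mul, ← neg_mul]
    gcongr
    exact min_le_left _ _

theorem integrable_sin_logArc_exp (τ : ℝ) {s : ℂ} (h0 : 0 < s.re) (h1 : s.re < 1 / 2) :
    Integrable fun l : ℝ => (Real.sin (τ * logArc l) : ℂ) * Complex.exp (-2 * s * l) := by
  refine Integrable.mono' ((integrable_min_exp (θ := 1) h0 (by linarith)).const_mul (1 + |τ| ^ (1 : ℝ)))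
    ?_ (ae_of_all _ fun l => ?_)
  · exact ((Complex.continuous_ofReal.comp (Real.continuous_sin.comp
      (continuous_const.mul logArc_continuous))).mul (by fun_prop)).aestronglyMeasurable
  · rw [norm_mul, norm_cexp_real_mul, Complex.norm_real, Real.norm_eq_abs, ← mul_assoc]
    refine mul_le_mul (abs_sin_logArc_le zero_le_one le_rfl τ l) (by simp) (by positivity)
      (by positivity)

/-- Integration by parts in `l`; it removes the derivative of `v` and one power of `τ`, which makes
the `τ`-integral against `f` absolutely convergent. -/
theorem cos_logArc_integral_by_parts (τ : ℝ) {s : ℂ} (h0 : 0 < s.re) (h1 : s.re < 1 / 2) :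
    τ * ∫ l : ℝ, (Real.cos (τ * logArc l) : ℂ) * Complex.exp (-2 * s * l) * logArcDeriv l =
      2 * s * ∫ l : ℝ, (Real.sin (τ * logArc l) : ℂ) * Complex.exp (-2 * s * l) := by
  have hu : ∀ l : ℝ, HasDerivAt (fun l : ℝ => (Real.sin (τ * logArc l) : ℂ))
      ((Real.cos (τ * logArc l) * (τ * logArcDeriv l) : ℝ) : ℂ) l := fun l =>
    (((logArc_hasDerivAt l).const_mul τ).sin).ofReal_comp
  have hv : ∀ l : ℝ, HasDerivAt (fun l : ℝ => Complex.exp (-2 * s * l))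
      (Complex.exp (-2 * s * l) * (-2 * s)) l := fun l => by
    have := ((hasDerivAt_id (l : ℂ)).const_mul (-2 * s)).cexp.comp_ofReal
    simpa using this
  have i1 := integrable_sin_logArc_exp τ h0 h1
  have i2 := integrable_cos_logArc τ h0 h1
  have h := integral_mul_deriv_eq_deriv_mul_of_integrable (fun l _ => hu l) (fun l _ => hv l)
    ((i1.mul_const (-2 * s)).congr (ae_of_all _ fun l => by simp only [Pi.mul_apply]; ring))
    ((i2.const_mul (τ : ℂ)).congr (ae_of_all _ fun l => by
      simp only [Pi.mul_apply]; push_cast; ring)) i1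
  rw [← integral_const_mul, ← integral_const_mul]
  have e1 : ∫ l : ℝ, (τ : ℂ) * ((Real.cos (τ * logArc l) : ℂ) * Complex.exp (-2 * s * l) *
      logArcDeriv l) = ∫ l : ℝ, ((Real.cos (τ * logArc l) * (τ * logArcDeriv l) : ℝ) : ℂ) *
        Complex.exp (-2 * s * l) :=
    integral_congr_ae (ae_of_all _ fun l => by push_cast; ring)
  rw [e1, ← neg_eq_iff_eq_neg.2 h, ← integral_neg]
  exact integral_congr_ae (ae_of_all _ fun l => by ring)



/-! ### The Mellin transform of the index transform -/

theorem continuous_Gamma_comp {X : Type*} [TopologicalSpace X] {f : X → ℂ} (hf : Continuous f)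
    (h : ∀ x, 0 < (f x).re) : Continuous fun x => Complex.Gamma (f x) := by
  refine continuous_iff_continuousAt.2 fun x => ?_
  have h1 : DifferentiableAt ℂ (fun s : ℂ => Complex.Gamma s) (f x) :=
    differentiableAt_Gamma_of_re_pos (f := fun s => s) differentiableAt_id (h x)
  exact ContinuousAt.comp (g := Complex.Gamma) h1.continuousAt hf.continuousAt

theorem continuous_inv_Gamma_comp {X : Type*} [TopologicalSpace X] {f : X → ℂ}
    (hf : Continuous f) : Continuous fun x => (Complex.Gamma (f x))⁻¹ :=
  inv_Gamma_continuous.comp hf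

/-- `∫ (f(τ)/τ) sin(τ v) dτ`. -/
noncomputable def sineTransform (f : ℝ → ℂ) (v : ℝ) : ℂ :=
  ∫ τ : ℝ, f τ / τ * (Real.sin (τ * v) : ℂ)

/-- Continuity, a zero at `0`, and integrability of `f(τ)/τ` against the weights `1 + |τ|^θ`,
`θ < 1/2`. The weight accounts for the growth in `τ` of the sine integrals on a line `Re s < 1/4`. -/
def SineAdmissible (f : ℝ → ℂ) : Prop :=
  Continuous f ∧ f 0 = 0 ∧
    ∀ θ : ℝ, 0 ≤ θ → θ < 1 / 2 → Integrable fun τ : ℝ => ‖f τ / τ‖ * (1 + |τ| ^ θ)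

theorem SineAdmissible.measurable {f : ℝ → ℂ} (hf : SineAdmissible f) :
    Measurable fun τ : ℝ => f τ / τ :=
  hf.1.measurable.div Complex.measurable_ofReal

theorem SineAdmissible.integrable {f : ℝ → ℂ} (hf : SineAdmissible f) :
    Integrable fun τ : ℝ => f τ / τ := by
  refine (hf.2.2 0 le_rfl (by norm_num)).mono' hf.measurable.aestronglyMeasurable
    (ae_of_all _ fun τ => ?_)
  rw [Real.rpow_zero]
  linarith [norm_nonneg (f τ / τ)]

theorem sineTransform_continuous {f : ℝ → ℂ} (hf : SineAdmissible f) :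
    Continuous (sineTransform f) := by
  refine continuous_of_dominated (bound := fun τ => ‖f τ / τ‖) (fun v => ?_)
    (fun v => ae_of_all _ fun τ => ?_) hf.integrable.norm (ae_of_all _ fun τ => by fun_prop)
  · exact (hf.measurable.mul (by fun_prop)).aestronglyMeasurable
  · rw [norm_mul, Complex.norm_real]
    exact mul_le_of_le_one_right (norm_nonneg _) (Real.abs_sin_le_one _)

theorem norm_sine_integrand_le (f : ℝ → ℂ) {θ : ℝ} (h0 : 0 ≤ θ) (h1 : θ < 1 / 2) (τ l : ℝ) :
    ‖f τ / τ * (Real.sin (τ * logArc l) : ℂ)‖ ≤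
      ‖f τ / τ‖ * (1 + |τ| ^ θ) * min 1 (Real.exp (θ * l)) := by
  rw [norm_mul, Complex.norm_real, mul_assoc]
  exact mul_le_mul_of_nonneg_left (abs_sin_logArc_le h0 (by linarith) τ l) (norm_nonneg _)

theorem norm_sineTransform_logArc_le {f : ℝ → ℂ} (hf : SineAdmissible f) {θ : ℝ} (h0 : 0 ≤ θ)
    (h1 : θ < 1 / 2) (l : ℝ) : ‖sineTransform f (logArc l)‖ ≤
      (∫ τ : ℝ, ‖f τ / τ‖ * (1 + |τ| ^ θ)) * min 1 (Real.exp (θ * l)) := by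
  rw [← integral_mul_const]
  exact norm_integral_le_of_norm_le ((hf.2.2 θ h0 h1).mul_const _)
    (ae_of_all _ fun τ => norm_sine_integrand_le f h0 h1 τ l)

/-- `2 ∫ P(v(l)) e^{-2sl} dl` for the sine transform `P` of `f(τ)/τ`. -/
noncomputable def sineLaplace (f : ℝ → ℂ) (s : ℂ) : ℂ :=
  2 * ∫ l : ℝ, sineTransform f (logArc l) * Complex.exp (-2 * s * l)

theorem exists_exponent {σ : ℝ} (h0 : 0 < σ) (h1 : σ < 1 / 4) :
    ∃ θ : ℝ, 0 ≤ θ ∧ θ < 1 / 2 ∧ 2 * σ < θ :=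
  ⟨σ + 1 / 4, by linarith, by linarith, by linarith⟩

theorem norm_cexp_neg_two_mul (s : ℂ) (l : ℝ) :
    ‖Complex.exp (-2 * s * l)‖ = Real.exp (-2 * s.re * l) := by
  rw [norm_cexp_real_mul]; simp

theorem sineLaplace_integrable {f : ℝ → ℂ} (hf : SineAdmissible f) {s : ℂ} (h0 : 0 < s.re)
    (h1 : s.re < 1 / 4) :
    Integrable fun l : ℝ => sineTransform f (logArc l) * Complex.exp (-2 * s * l) := by
  obtain ⟨θ, ht0, ht1, ht⟩ := exists_exponent h0 h1
  refine Integrable.mono' ((integrable_min_exp h0 ht).const_mul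
    (∫ τ : ℝ, ‖f τ / τ‖ * (1 + |τ| ^ θ))) ?_ (ae_of_all _ fun l => ?_)
  · exact (((sineTransform_continuous hf).comp logArc_continuous).mul
      (by fun_prop)).aestronglyMeasurable
  · rw [norm_mul, norm_cexp_neg_two_mul, ← mul_assoc]
    exact mul_le_mul_of_nonneg_right (norm_sineTransform_logArc_le hf ht0 ht1 l) (by positivity)

/-- `A(s, τ) f(τ)` with `A` the cosine integral, after integrating by parts. -/
theorem cosine_integral_mul (f : ℝ → ℂ) (hf0 : f 0 = 0) (τ : ℝ) {s : ℂ} (h0 : 0 < s.re)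
    (h1 : s.re < 1 / 2) :
    betaSymbol τ s * (Complex.sin (Real.pi * s) * Complex.cosh (Real.pi * τ)) * f τ =
      2 * s * ∫ l : ℝ, f τ / τ * (Real.sin (τ * logArc l) : ℂ) * Complex.exp (-2 * s * l) := by
  by_cases hτ : τ = 0
  · simp [hτ, hf0]
  have hτ' : (τ : ℂ) ≠ 0 := by exact_mod_cast hτ
  rw [← cos_logArc_integral τ h0 h1]
  simp_rw [mul_assoc (f τ / τ)]
  rw [integral_const_mul]
  have := cos_logArc_integral_by_parts τ h0 h1
  generalize (∫ l : ℝ, (Real.cos (τ * logArc l) : ℂ) * Complex.exp (-2 * s * l) *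
    logArcDeriv l) = A at *
  generalize (∫ l : ℝ, (Real.sin (τ * logArc l) : ℂ) * Complex.exp (-2 * s * l)) = B at *
  field_simp
  linear_combination f τ * this

theorem norm_cosine_integral_mul_le (f : ℝ → ℂ) (hf0 : f 0 = 0) {θ : ℝ} (ht0 : 0 ≤ θ)
    (ht1 : θ < 1 / 2) (τ : ℝ) {s : ℂ} (h0 : 0 < s.re) (ht : 2 * s.re < θ) :
    ‖betaSymbol τ s * (Complex.sin (Real.pi * s) * Complex.cosh (Real.pi * τ)) * f τ‖ ≤
      ‖s‖ * (2 * (‖f τ / τ‖ * (1 + |τ| ^ θ)) *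
        ∫ l : ℝ, min 1 (Real.exp (θ * l)) * Real.exp (-2 * s.re * l)) := by
  rw [cosine_integral_mul f hf0 τ h0 (by linarith), norm_mul, norm_mul, Complex.norm_ofNat,
    mul_comm (2 : ℝ), mul_assoc, mul_assoc 2, ← integral_const_mul]
  refine mul_le_mul_of_nonneg_left (mul_le_mul_of_nonneg_left ?_ zero_le_two) (norm_nonneg s)
  refine norm_integral_le_of_norm_le ((integrable_min_exp h0 ht).const_mul _)
    (ae_of_all _ fun l => ?_)
  rw [norm_mul, norm_cexp_neg_two_mul, ← mul_assoc]
  exact mul_le_mul_of_nonneg_right (norm_sine_integrand_le f ht0 ht1 τ l) (by positivity)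

theorem integral_cosine_integral_mul {f : ℝ → ℂ} (hf : SineAdmissible f) {s : ℂ} (h0 : 0 < s.re)
    (h1 : s.re < 1 / 4) :
    ∫ τ : ℝ, betaSymbol τ s * (Complex.sin (Real.pi * s) * Complex.cosh (Real.pi * τ)) * f τ =
      s * sineLaplace f s := by
  obtain ⟨θ, ht0, ht1, ht⟩ := exists_exponent h0 h1
  simp_rw [cosine_integral_mul f hf.2.1 _ h0 (show s.re < 1 / 2 by linarith)]
  rw [integral_const_mul, integral_integral_swap]
  · rw [sineLaplace, mul_comm 2 s, mul_assoc]
    congr 2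
    refine integral_congr_ae (ae_of_all _ fun l => ?_)
    simp only [sineTransform]
    rw [integral_mul_const]
  · refine Integrable.mono' ((hf.2.2 θ ht0 ht1).mul_prod (integrable_min_exp h0 ht)) ?_
      (ae_of_all _ fun z => ?_)
    · refine Measurable.aestronglyMeasurable ?_
      refine ((hf.measurable.comp measurable_fst).mul ?_).mul ?_
      · exact (Complex.continuous_ofReal.comp (Real.continuous_sin.comp
          (continuous_fst.mul (logArc_continuous.comp continuous_snd)))).measurable
      · fun_prop
    · simp only [Function.uncurry]
      rw [norm_mul, norm_cexp_neg_two_mul, ← mul_assoc]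
      exact mul_le_mul_of_nonneg_right (norm_sine_integrand_le f ht0 ht1 _ _) (by positivity)

theorem weberSymbol_line_bound {α c : ℝ} (hc1 : c < 1 / 4) :
    ∃ C : ℝ, 0 < C ∧ ∀ t : ℝ, 2 ≤ |t| → ‖weberSymbol α (c + t * Complex.I)‖ ≤ C := by
  obtain ⟨K, hK, h⟩ := Gamma_stirling (min (c + α) (1 - c + α)) (max (c + α) (1 - c + α)) 0
  refine ⟨K * K / Real.pi, by positivity, fun t ht => ?_⟩
  have e1 : (c + t * Complex.I + α : ℂ).re = c + α := by simp
  have e2 : (1 - (c + t * Complex.I) + α : ℂ).re = 1 - c + α := by simp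
  have h1 := (h (c + t * Complex.I + α) |t| (by rw [e1]; exact min_le_left _ _)
    (by rw [e1]; exact le_max_left _ _) (by simp) (by linarith)).1
  have h2 := (h (1 - (c + t * Complex.I) + α) |t| (by rw [e2]; exact min_le_right _ _)
    (by rw [e2]; exact le_max_right _ _) (by simp) (by linarith)).2
  rw [e1] at h1
  rw [e2] at h2
  have ht0 : 0 < |t| := by linarith
  have hpos : 0 < |t| ^ (1 - c + α - 1 / 2) * Real.exp (-(Real.pi * |t| / 2)) := by positivity
  have hG : 0 < ‖Complex.Gamma (1 - (c + t * Complex.I) + α)‖ := by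
    by_contra hcon
    nlinarith
  rw [weberSymbol, norm_div, norm_mul, norm_inv, Complex.norm_real,
    Real.norm_of_nonneg Real.pi_pos.le]
  refine div_le_div_of_nonneg_right ?_ Real.pi_pos.le
  rw [← div_eq_mul_inv, div_le_iff₀ hG]
  have h3 : |t| ^ (c + α - 1 / 2) ≤ |t| ^ (1 - c + α - 1 / 2) :=
    Real.rpow_le_rpow_of_exponent_le (by linarith) (by linarith)
  calc _ ≤ _ := h1
    _ ≤ K * (|t| ^ (1 - c + α - 1 / 2) * Real.exp (-(Real.pi * |t| / 2))) := by gcongr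
    _ ≤ K * (K * ‖Complex.Gamma (1 - (c + t * Complex.I) + α)‖) := by gcongr
    _ = _ := by ring

theorem csin_pi_ne_zero {s : ℂ} (h0 : 0 < s.re) (h1 : s.re < 1) :
    Complex.sin (Real.pi * s) ≠ 0 := by
  intro h
  obtain ⟨k, hk⟩ := Complex.sin_eq_zero_iff.1 h
  have hpi : (Real.pi : ℂ) ≠ 0 := by exact_mod_cast Real.pi_ne_zero
  have : s = k := mul_left_cancel₀ hpi (by rw [hk]; ring)
  rw [this, Complex.intCast_re] at h0 h1
  have h2 : (0 : ℤ) < k := by exact_mod_cast h0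
  have h3 : k < (1 : ℤ) := by exact_mod_cast h1
  omega

theorem line_factor_continuous {α c : ℝ} (hc0 : 0 < c) (hcα : -α < c) (hc1 : c < 1 / 4) :
    Continuous fun t : ℝ => weberSymbol α (c + t * Complex.I) * (c + t * Complex.I) /
      Complex.sin (Real.pi * (c + t * Complex.I)) := by
  have hl : Continuous fun t : ℝ => (c + t * Complex.I : ℂ) := by fun_prop
  refine ((((continuous_Gamma_comp (by fun_prop) fun t => ?_).mul
    (continuous_inv_Gamma_comp (by fun_prop))).div_const _).mul hl).div ?_ fun t => ?_
  · simp; linarith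
  · exact Complex.continuous_sin.comp (continuous_const.mul hl)
  · exact csin_pi_ne_zero (by simpa using hc0) (by simp; linarith)

theorem cube_le_sinh {x : ℝ} (hx : 0 ≤ x) : x ^ 3 / 12 ≤ Real.sinh x := by
  have h1 : x ^ 3 / (Nat.factorial 3 : ℝ) ≤ Real.exp x := Real.pow_div_factorial_le_exp x hx 3
  rcases le_total x 1 with h | h
  · have := Real.self_le_sinh_iff.2 hx
    nlinarith [mul_nonneg hx hx, mul_le_one₀ h hx h, pow_nonneg hx 3]
  · have h2 : (x - 1 / 2) * 2 + 0 ≤ 2 * Real.sinh x := by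
      nlinarith [Real.self_le_sinh_iff.2 hx]
    have h3 : Real.exp (-x) ≤ 1 := Real.exp_le_one_iff.2 (by linarith)
    rw [Real.sinh_eq]
    have h4 : (Nat.factorial 3 : ℝ) = 6 := by norm_num [Nat.factorial]
    rw [h4] at h1
    have h5 : 1 + x + x ^ 2 / 2 + x ^ 3 / 6 ≤ Real.exp x := by
      have := Real.sum_le_exp_of_nonneg hx 4
      simp [Finset.sum_range_succ, Nat.factorial] at this
      linarith
    nlinarith [sq_nonneg x]

theorem line_factor_integrable {α c : ℝ} (hc0 : 0 < c) (hcα : -α < c) (hc1 : c < 1 / 4) :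
    Integrable fun t : ℝ => weberSymbol α (c + t * Complex.I) * (c + t * Complex.I) /
      Complex.sin (Real.pi * (c + t * Complex.I)) := by
  obtain ⟨C, hC, h⟩ := weberSymbol_line_bound (α := α) hc1
  refine integrable_of_continuous_of_decay (K := C * 2 * 12) (T := 2) (e := 2)
    (line_factor_continuous hc0 hcα hc1) one_lt_two fun t ht => ?_
  have ht0 : 0 < |t| := by linarith
  have h1 : |t| ^ 3 / 12 ≤ ‖Complex.sin (Real.pi * (c + t * Complex.I))‖ := by
    refine le_trans ?_ (sinh_abs_le_norm_csin _)
    have : ((Real.pi : ℂ) * (c + t * Complex.I)).im = Real.pi * t := by simp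
    rw [this, abs_mul, abs_of_pos Real.pi_pos]
    refine le_trans ?_ (cube_le_sinh (by positivity))
    have : |t| ≤ Real.pi * |t| := by nlinarith [Real.pi_gt_three]
    gcongr
  have h2 : ‖(c + t * Complex.I : ℂ)‖ ≤ 2 * |t| := by
    refine (norm_add_le _ _).trans ?_
    simp only [Complex.norm_real, norm_mul, Complex.norm_I, mul_one, Real.norm_eq_abs]
    rw [abs_of_pos hc0]
    linarith
  rw [norm_div, norm_mul, Real.rpow_neg ht0.le, Real.rpow_two,
    div_le_iff₀ (lt_of_lt_of_le (by positivity) h1)]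
  calc _ ≤ C * (2 * |t|) := mul_le_mul (h t ht) h2 (norm_nonneg _) hC.le
    _ = C * 2 * 12 * (|t| ^ 2)⁻¹ * (|t| ^ 3 / 12) := by field_simp
    _ ≤ _ := by gcongr

/-- The index transform as a Mellin line integral: the line integral of the kernel and the integral
in `τ` are interchanged, and the latter is evaluated by `integral_cosine_integral_mul`. -/
theorem indexG_eq_line_integral {α : ℝ} {g : ℂ → ℂ} (hf : SineAdmissible fun τ : ℝ => g τ)
    {c y : ℝ} (hy : 0 < y) (hc0 : 0 < c) (hcα : -α < c) (hc1 : c < 1 / 4) :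
    ∫ t : ℝ, ((y / 4 : ℝ) : ℂ) ^ (-((c : ℂ) + t * Complex.I)) *
      (weberSymbol α (c + t * Complex.I) * (c + t * Complex.I) /
        Complex.sin (Real.pi * (c + t * Complex.I)) *
        sineLaplace (fun τ : ℝ => g τ) (c + t * Complex.I)) = 2 * Real.pi * indexG α g y := by
  obtain ⟨θ, ht0, ht1, ht⟩ := exists_exponent hc0 hc1
  have hw : 0 < y / 4 := by positivity
  have hre : ∀ t : ℝ, (c + t * Complex.I : ℂ).re = c := fun t => by simp
  have hsin : ∀ t : ℝ, Complex.sin (Real.pi * (c + t * Complex.I)) ≠ 0 := fun t =>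
    csin_pi_ne_zero (by rw [hre]; exact hc0) (by rw [hre]; linarith)
  have e1 : ∀ t : ℝ, ((y / 4 : ℝ) : ℂ) ^ (-((c : ℂ) + t * Complex.I)) *
      (weberSymbol α (c + t * Complex.I) * (c + t * Complex.I) /
        Complex.sin (Real.pi * (c + t * Complex.I)) *
        sineLaplace (fun τ : ℝ => g τ) (c + t * Complex.I)) =
      ∫ τ : ℝ, ((y / 4 : ℝ) : ℂ) ^ (-((c : ℂ) + t * Complex.I)) *
      (weberSymbol α (c + t * Complex.I) * betaSymbol τ (c + t * Complex.I) *
        Complex.cosh (Real.pi * τ)) * g τ := fun t => by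
    have := integral_cosine_integral_mul hf (s := c + t * Complex.I) (by rw [hre]; exact hc0)
      (by rw [hre]; exact hc1)
    rw [mul_div_right_comm, mul_assoc (_ / _), ← this, ← integral_const_mul, ← integral_const_mul]
    refine integral_congr_ae (ae_of_all _ fun τ => ?_)
    have hS := hsin t
    simp only
    generalize Complex.sin (Real.pi * (c + t * Complex.I)) = S at *
    field_simp
  simp_rw [e1]
  rw [integral_integral_swap, indexG, ← integral_const_mul]
  · refine integral_congr_ae (ae_of_all _ fun τ => ?_)
    simp only
    rw [integral_mul_const]
    by_cases hτ : τ = 0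
    · have : g ((τ : ℝ) : ℂ) = 0 := by rw [hτ]; exact hf.2.1
      rw [this, mul_zero, mul_zero, mul_zero]
    · rw [weberKernel_eq_line_integral hy hc0 hcα hc1 hτ, mul_assoc]
  · refine Integrable.mono' (((line_factor_integrable hc0 hcα hc1).norm.const_mul
      ((y / 4) ^ (-c))).mul_prod ((hf.2.2 θ ht0 ht1).const_mul
      (2 * ∫ l : ℝ, min 1 (Real.exp (θ * l)) * Real.exp (-2 * c * l)))) ?_ (ae_of_all _ fun z => ?_)
    · refine Continuous.aestronglyMeasurable ?_
      have hl : Continuous fun z : ℝ × ℝ => (c + z.1 * Complex.I : ℂ) := by fun_prop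
      refine Continuous.mul (Continuous.mul ?_ (Continuous.mul (Continuous.mul ?_ ?_) ?_)) ?_
      · exact (cpow_neg_differentiable hw).continuous.comp hl
      · refine ((continuous_Gamma_comp (by fun_prop) fun t => ?_).mul
          (continuous_inv_Gamma_comp (by fun_prop))).div_const _
        simp; linarith
      · refine (((continuous_Gamma_comp (by fun_prop) fun t => ?_).mul
          (continuous_Gamma_comp (by fun_prop) fun t => ?_)).mul
          (continuous_Gamma_comp (by fun_prop) fun t => ?_)).div_const _
        · simpa using hc0
        · simpa using hc0
        · simp; linarith
      · fun_prop
      · exact hf.1.comp continuous_snd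
    · obtain ⟨t, τ⟩ := z
      simp only [Function.uncurry]
      have hb := norm_cosine_integral_mul_le (fun τ : ℝ => g τ) hf.2.1 ht0 ht1 τ
        (s := c + t * Complex.I) (by rw [hre]; exact hc0) (by rw [hre]; exact ht)
      rw [hre] at hb
      have e2 : ((y / 4 : ℝ) : ℂ) ^ (-((c : ℂ) + t * Complex.I)) *
          (weberSymbol α (c + t * Complex.I) * betaSymbol τ (c + t * Complex.I) *
          Complex.cosh (Real.pi * τ)) * g τ = ((y / 4 : ℝ) : ℂ) ^ (-((c : ℂ) + t * Complex.I)) *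
          (weberSymbol α (c + t * Complex.I) / Complex.sin (Real.pi * (c + t * Complex.I))) *
          (betaSymbol τ (c + t * Complex.I) * (Complex.sin (Real.pi * (c + t * Complex.I)) *
            Complex.cosh (Real.pi * τ)) * g τ) := by
        have hS := hsin t
        generalize Complex.sin (Real.pi * (c + t * Complex.I)) = S at *
        field_simp
      rw [e2, norm_mul, norm_mul, Complex.norm_cpow_eq_rpow_re_of_pos hw, Complex.neg_re, hre]
      refine (mul_le_mul_of_nonneg_left hb (by positivity)).trans (le_of_eq ?_)
      rw [norm_div (weberSymbol α _), norm_div (_ * _), norm_mul]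
      ring



/-! ### Fourier inversion and analytic continuation of the Mellin transform -/

theorem rpow_le_add_rpow {y a b r : ℝ} (hy : 0 < y) (ha : a ≤ r) (hb : r ≤ b) :
    y ^ r ≤ y ^ a + y ^ b := by
  have h1 : 0 < y ^ a := by positivity
  have h2 : 0 < y ^ b := by positivity
  rcases le_total 1 y with h | h
  · have := Real.rpow_le_rpow_of_exponent_le h hb
    linarith
  · have := Real.rpow_le_rpow_of_exponent_ge hy h ha
    linarith

theorem aestronglyMeasurable_cpow (s : ℂ) :
    AEStronglyMeasurable (fun y : ℝ => (y : ℂ) ^ s) (volume.restrict (Ioi 0)) := by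
  refine ContinuousOn.aestronglyMeasurable (fun y hy => ?_) measurableSet_Ioi
  exact (Complex.continuousAt_ofReal_cpow_const _ _ (Or.inr (ne_of_gt hy))).continuousWithinAt

theorem mellinConvergent_iff_norm {f : ℝ → ℂ}
    (hm : AEStronglyMeasurable f (volume.restrict (Ioi 0))) (s : ℂ) :
    MellinConvergent f s ↔ IntegrableOn (fun y => y ^ (s.re - 1) * ‖f y‖) (Ioi 0) := by
  have hmeas : AEStronglyMeasurable (fun y : ℝ => (y : ℂ) ^ (s - 1) • f y)
      (volume.restrict (Ioi 0)) := (aestronglyMeasurable_cpow _).mul hm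
  rw [MellinConvergent, IntegrableOn, ← integrable_norm_iff hmeas]
  refine integrableOn_congr_fun (fun y hy => ?_) measurableSet_Ioi
  simp only [norm_smul, Complex.norm_cpow_eq_rpow_re_of_pos hy, Complex.sub_re, Complex.one_re]

theorem MellinConvergent.aestronglyMeasurable {f : ℝ → ℂ} {s : ℂ} (h : MellinConvergent f s) :
    AEStronglyMeasurable f (volume.restrict (Ioi 0)) := by
  have h1 : AEStronglyMeasurable (fun y : ℝ => (y : ℂ) ^ (1 - s) • ((y : ℂ) ^ (s - 1) • f y))
      (volume.restrict (Ioi 0)) := (aestronglyMeasurable_cpow _).mul h.1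
  refine h1.congr ?_
  filter_upwards [ae_restrict_mem measurableSet_Ioi] with y hy
  have hy' : (y : ℂ) ≠ 0 := by exact_mod_cast (ne_of_gt hy)
  rw [smul_smul, ← Complex.cpow_add _ _ hy']
  simp

theorem mellinConvergent_of_rpow_bounds {f : ℝ → ℂ}
    (hm : AEStronglyMeasurable f (volume.restrict (Ioi 0))) {a b C : ℝ} {s : ℂ}
    (has : a < s.re) (hsb : s.re < b) (ha : ∀ y : ℝ, 0 < y → ‖f y‖ ≤ C * y ^ (-a))
    (hb : ∀ y : ℝ, 0 < y → ‖f y‖ ≤ C * y ^ (-b)) : MellinConvergent f s := by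
  have hm' : AEStronglyMeasurable (fun y : ℝ => y ^ (s.re - 1) * ‖f y‖)
      (volume.restrict (Ioi 0)) := by
    refine AEStronglyMeasurable.mul ?_ hm.norm
    exact (Measurable.pow_const measurable_id _).aestronglyMeasurable
  rw [mellinConvergent_iff_norm hm, ← Ioc_union_Ioi_eq_Ioi zero_le_one, integrableOn_union]
  constructor
  · have h1 : IntegrableOn (fun y : ℝ => y ^ (s.re - 1 - a)) (Ioc 0 1) := by
      have := intervalIntegral.intervalIntegrable_rpow' (a := 0) (b := 1)
        (r := s.re - 1 - a) (by linarith)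
      rwa [intervalIntegrable_iff_integrableOn_Ioc_of_le zero_le_one] at this
    refine Integrable.mono' (h1.const_mul C)
      (hm'.mono_measure (Measure.restrict_mono Ioc_subset_Ioi_self le_rfl)) ?_
    filter_upwards [ae_restrict_mem measurableSet_Ioc] with y hy
    have hy0 : 0 < y := hy.1
    rw [Real.norm_of_nonneg (by positivity), sub_eq_add_neg _ a, Real.rpow_add hy0]
    have := mul_le_mul_of_nonneg_left (ha y hy0) (Real.rpow_pos_of_pos hy0 (s.re - 1)).le
    linarith
  · have h1 : IntegrableOn (fun y : ℝ => y ^ (s.re - 1 - b)) (Ioi 1) :=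
      integrableOn_Ioi_rpow_of_lt (by linarith) one_pos
    refine Integrable.mono' (h1.const_mul C)
      (hm'.mono_measure (Measure.restrict_mono (Ioi_subset_Ioi zero_le_one) le_rfl)) ?_
    filter_upwards [ae_restrict_mem measurableSet_Ioi] with y hy
    have hy0 : 0 < y := lt_trans one_pos hy
    rw [Real.norm_of_nonneg (by positivity), sub_eq_add_neg _ b, Real.rpow_add hy0]
    have := mul_le_mul_of_nonneg_left (hb y hy0) (Real.rpow_pos_of_pos hy0 (s.re - 1)).le
    linarith

theorem MellinConvergent.integrable_norm_rpow {f : ℝ → ℂ} {s : ℂ} (h : MellinConvergent f s) :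
    IntegrableOn (fun y => y ^ (s.re - 1) * ‖f y‖) (Ioi 0) :=
  (mellinConvergent_iff_norm h.aestronglyMeasurable s).1 h

theorem MellinConvergent.between {f : ℝ → ℂ} {a b : ℝ} (ha : MellinConvergent f a)
    (hb : MellinConvergent f b) {s : ℂ} (has : a ≤ s.re) (hsb : s.re ≤ b) :
    MellinConvergent f s := by
  have hm := ha.aestronglyMeasurable
  rw [mellinConvergent_iff_norm hm]
  refine Integrable.mono' (ha.integrable_norm_rpow.add hb.integrable_norm_rpow) ?_ ?_
  · refine AEStronglyMeasurable.mul ?_ hm.norm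
    exact (Measurable.pow_const measurable_id _).aestronglyMeasurable
  · filter_upwards [ae_restrict_mem measurableSet_Ioi] with y hy
    have hy0 : 0 < y := hy
    rw [Real.norm_of_nonneg (by positivity), Pi.add_apply, ← add_mul]
    exact mul_le_mul_of_nonneg_right (rpow_le_add_rpow hy0 (by simpa using has)
      (by simpa using hsb)) (norm_nonneg _)

theorem norm_mellin_le {f : ℝ → ℂ} {a b : ℝ} (ha : MellinConvergent f a)
    (hb : MellinConvergent f b) : ∃ M : ℝ, 0 ≤ M ∧ ∀ s : ℂ, a ≤ s.re → s.re ≤ b →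
      ‖mellin f s‖ ≤ M := by
  refine ⟨∫ y in Ioi (0 : ℝ), (y ^ (a - 1) * ‖f y‖ + y ^ (b - 1) * ‖f y‖), ?_, fun s h1 h2 => ?_⟩
  · refine setIntegral_nonneg measurableSet_Ioi fun y (hy : 0 < y) => by positivity
  · rw [mellin]
    refine norm_integral_le_of_norm_le
      (ha.integrable_norm_rpow.add hb.integrable_norm_rpow) ?_
    filter_upwards [ae_restrict_mem measurableSet_Ioi] with y hy
    have hy0 : 0 < y := hy
    rw [norm_smul, Complex.norm_cpow_eq_rpow_re_of_pos hy0, Complex.sub_re, Complex.one_re]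
    rw [← add_mul]
    exact mul_le_mul_of_nonneg_right (rpow_le_add_rpow hy0 (by linarith) (by linarith))
      (norm_nonneg _)

theorem abs_log_le_rpow {y ε : ℝ} (hy : 0 < y) (hε : 0 < ε) :
    |Real.log y| ≤ (y ^ ε + y ^ (-ε)) / ε := by
  have h1 := Real.log_le_rpow_div hy.le hε
  have h2 := Real.log_le_rpow_div (inv_pos.2 hy).le hε
  rw [Real.log_inv, Real.inv_rpow hy.le, ← Real.rpow_neg hy.le] at h2
  have h3 : 0 < y ^ ε / ε := by positivity
  have h4 : 0 < y ^ (-ε) / ε := by positivity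
  rw [add_div, abs_le]
  constructor <;> linarith

/-- Two exponents of absolute convergence suffice for analyticity between them: the extra factor
`log x` is absorbed by moving the exponent slightly. -/
theorem differentiableAt_mellin_between {f : ℝ → ℂ} {a b : ℝ} (ha : MellinConvergent f a)
    (hb : MellinConvergent f b) {s : ℂ} (has : a < s.re) (hsb : s.re < b) :
    DifferentiableAt ℂ (mellin f) s := by
  obtain ⟨r, hr0, hra, hrb⟩ : ∃ r : ℝ, 0 < r ∧ a ≤ s.re - 2 * r ∧ s.re + 2 * r ≤ b :=
    ⟨min (s.re - a) (b - s.re) / 2, by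
      have := lt_min (sub_pos.2 has) (sub_pos.2 hsb)
      linarith, by linarith [min_le_left (s.re - a) (b - s.re)], by
      linarith [min_le_right (s.re - a) (b - s.re)]⟩
  have hm := ha.aestronglyMeasurable
  refine ((hasDerivAt_integral_of_dominated_loc_of_deriv_le (μ := volume.restrict (Ioi (0 : ℝ)))
    (F := fun (z : ℂ) (y : ℝ) => (y : ℂ) ^ (z - 1) • f y)
    (F' := fun (z : ℂ) (y : ℝ) => ((y : ℂ) ^ (z - 1) * Complex.log y) • f y) (x₀ := s)
    (s := Metric.ball s r)
    (bound := fun y => 2 / r * (y ^ (a - 1) * ‖f y‖ + y ^ (b - 1) * ‖f y‖)) (Metric.ball_mem_nhds s hr0)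
    (Eventually.of_forall fun z => ?_) (ha.between hb has.le hsb.le) ?_ ?_ ?_ ?_).2).differentiableAt
  · exact (aestronglyMeasurable_cpow _).mul hm
  · exact ((aestronglyMeasurable_cpow _).mul
      (Complex.measurable_log.comp Complex.measurable_ofReal).aestronglyMeasurable).mul hm
  · filter_upwards [ae_restrict_mem measurableSet_Ioi] with y hy z hz
    have hy0 : 0 < y := hy
    have hz1 : |z.re - s.re| < r := by
      have := Complex.abs_re_le_norm (z - s)
      rw [Complex.sub_re] at this
      exact this.trans_lt (by simpa [dist_eq_norm] using hz)
    obtain ⟨hz2, hz3⟩ := abs_lt.1 hz1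
    rw [norm_smul, norm_mul, Complex.norm_cpow_eq_rpow_re_of_pos hy0, ← Complex.ofReal_log hy0.le,
      Complex.norm_real, Real.norm_eq_abs, Complex.sub_re, Complex.one_re, ← add_mul, ← mul_assoc]
    refine mul_le_mul_of_nonneg_right ?_ (norm_nonneg _)
    have h1 := rpow_le_add_rpow hy0 (show a - 1 ≤ z.re - 1 + r by linarith)
      (show z.re - 1 + r ≤ b - 1 by linarith)
    have h2 := rpow_le_add_rpow hy0 (show a - 1 ≤ z.re - 1 + -r by linarith)
      (show z.re - 1 + -r ≤ b - 1 by linarith)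
    calc y ^ (z.re - 1) * |Real.log y| ≤ y ^ (z.re - 1) * ((y ^ r + y ^ (-r)) / r) := by
          gcongr
          exact abs_log_le_rpow hy0 hr0
      _ = (y ^ (z.re - 1 + r) + y ^ (z.re - 1 + -r)) / r := by
          rw [Real.rpow_add hy0, Real.rpow_add hy0]; ring
      _ ≤ ((y ^ (a - 1) + y ^ (b - 1)) + (y ^ (a - 1) + y ^ (b - 1))) / r := by gcongr
      _ = _ := by ring
  · exact (ha.integrable_norm_rpow.add hb.integrable_norm_rpow).const_mul _
  · filter_upwards [ae_restrict_mem measurableSet_Ioi] with y hy z hz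
    have hy' : (y : ℂ) ≠ 0 := by exact_mod_cast (ne_of_gt hy)
    have h1 : HasDerivAt (fun z : ℂ => (y : ℂ) ^ (z - 1)) ((y : ℂ) ^ (z - 1) * Complex.log y) z := by
      have := ((hasDerivAt_id z).sub_const 1).const_cpow (c := (y : ℂ)) (Or.inl hy')
      simpa using this
    exact h1.smul_const (f y)

open FourierTransform in
/-- Fourier inversion: a function given by an absolutely convergent Mellin–Barnes integral has
the integrand as its Mellin transform. -/
theorem mellin_eq_of_line_integral {f : ℝ → ℂ} {H : ℂ → ℂ} {c : ℝ}
    (hcont : Continuous fun t : ℝ => H (c + t * Complex.I))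
    (hint : Integrable fun t : ℝ => H (c + t * Complex.I))
    (hf : ∀ y : ℝ, 0 < y → ∫ t : ℝ, (y : ℂ) ^ (-((c : ℂ) + t * Complex.I)) * H (c + t * Complex.I) =
      2 * Real.pi * f y) (hconv : MellinConvergent f c) (t : ℝ) :
    mellin f (c + t * Complex.I) = H (c + t * Complex.I) := by
  set φ : ℝ → ℂ := fun u => H (c + 2 * Real.pi * u * Complex.I) with hφ
  have h2pi : (2 * Real.pi : ℝ) ≠ 0 := by positivity
  have hφ' : φ = fun u : ℝ => (fun t : ℝ => H (c + t * Complex.I)) ((2 * Real.pi) * u) := by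
    ext u; simp [hφ]
  have hφc : Continuous φ := by rw [hφ']; exact hcont.comp (continuous_const.mul continuous_id)
  have hφi : Integrable φ := by rw [hφ']; exact hint.comp_mul_left' h2pi
  have hpi : (Real.pi : ℂ) ≠ 0 := by exact_mod_cast Real.pi_ne_zero
  have hinv : ∀ u : ℝ, 𝓕⁻ φ u = Real.exp (-c * u) • f (Real.exp (-u)) := fun u => by
    have h1 := mellinInv_eq_fourierInv c H (Real.exp_pos (-u))
    rw [Real.log_exp, neg_neg] at h1
    have h2 : mellinInv c H (Real.exp (-u)) = f (Real.exp (-u)) := by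
      rw [mellinInv]
      have := hf _ (Real.exp_pos (-u))
      simp only [smul_eq_mul]
      rw [this]
      simp only [Complex.real_smul]
      push_cast
      field_simp
    rw [h2] at h1
    rw [h1, Complex.real_smul, smul_eq_mul, ← mul_assoc]
    have h3 : ((Real.exp (-c * u) : ℝ) : ℂ) * ((Real.exp (-u) : ℝ) : ℂ) ^ (-c : ℂ) = 1 := by
      rw [← Complex.ofReal_neg, ← Complex.ofReal_cpow (Real.exp_pos _).le, ← Real.exp_mul,
        ← Complex.ofReal_mul, ← Real.exp_add, show -c * u + -u * -c = 0 by ring, Real.exp_zero,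
        Complex.ofReal_one]
    rw [h3, one_mul]
  have hi : Integrable (𝓕⁻ φ) := by
    have h1 := hconv
    have himg : (fun u => Real.exp (-u)) '' univ = Ioi 0 := by
      ext x
      constructor
      · rintro ⟨v, -, rfl⟩
        exact Real.exp_pos _
      · intro hx
        exact ⟨-Real.log x, mem_univ _, by simp [Real.exp_log hx]⟩
    rw [MellinConvergent, ← himg, integrableOn_image_iff_integrableOn_abs_deriv_smul
      MeasurableSet.univ (f' := fun u => Real.exp (-u) * -1)
      (fun u _ => ((hasDerivAt_neg u).exp).hasDerivWithinAt)
      (fun a _ b _ h => neg_injective (Real.exp_injective h)), integrableOn_univ] at h1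
    refine h1.congr (ae_of_all _ fun u => ?_)
    simp only
    rw [hinv, mul_neg_one, abs_neg, abs_of_pos (Real.exp_pos _), Complex.real_smul,
      Complex.real_smul, smul_eq_mul, ← mul_assoc]
    congr 1
    rw [← Complex.ofReal_one, ← Complex.ofReal_sub, ← Complex.ofReal_cpow (Real.exp_pos _).le,
      ← Real.exp_mul, ← Complex.ofReal_mul, ← Real.exp_add]
    congr 2
    ring
  have hi' : Integrable (𝓕 φ) := by
    have : 𝓕 φ = fun u => 𝓕⁻ φ (-u) := by
      ext u
      rw [Real.fourierInv_eq_fourier_neg, neg_neg]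
    rw [this]
    exact hi.comp_neg
  rw [mellin_eq_fourier]
  have e : (fun u : ℝ => Real.exp (-(c + t * Complex.I : ℂ).re * u) • f (Real.exp (-u))) = 𝓕⁻ φ := by
    ext u
    rw [hinv]
    simp
  rw [e, hφc.fourier_fourierInv_eq hφi hi']
  simp only [hφ]
  congr 1
  simp only [Complex.add_im, Complex.ofReal_im, Complex.mul_im, Complex.ofReal_re, Complex.I_im,
    Complex.I_re]
  push_cast
  field_simp
  simp



/-! ### The continuation of the sine Laplace transform -/

theorem sineLaplace_line_continuous {f : ℝ → ℂ} (hf : SineAdmissible f) {c : ℝ} (h0 : 0 < c)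
    (h1 : c < 1 / 4) : Continuous fun t : ℝ => sineLaplace f (c + t * Complex.I) := by
  have hre : ∀ t : ℝ, (c + t * Complex.I : ℂ).re = c := fun t => by simp
  unfold sineLaplace
  refine continuous_const.mul (continuous_of_dominated
    (bound := fun l => ‖sineTransform f (logArc l) * Complex.exp (-2 * (c : ℂ) * l)‖)
    (fun t => (sineLaplace_integrable hf (by rwa [hre]) (by rwa [hre])).1)
    (fun t => ae_of_all _ fun l => ?_)
    (sineLaplace_integrable hf (by simpa using h0) (by simpa using h1)).norm
    (ae_of_all _ fun l => by fun_prop))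
  rw [norm_mul, norm_mul, norm_cexp_neg_two_mul, norm_cexp_neg_two_mul, hre, Complex.ofReal_re]

theorem norm_sineLaplace_le {f : ℝ → ℂ} {c : ℝ} (t : ℝ) :
    ‖sineLaplace f (c + t * Complex.I)‖ ≤
      2 * ∫ l : ℝ, ‖sineTransform f (logArc l) * Complex.exp (-2 * (c : ℂ) * l)‖ := by
  rw [sineLaplace, norm_mul, Complex.norm_ofNat]
  refine mul_le_mul_of_nonneg_left ((norm_integral_le_integral_norm _).trans (le_of_eq ?_))
    zero_le_two
  refine integral_congr_ae (ae_of_all _ fun l => ?_)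
  simp only [norm_mul, norm_cexp_neg_two_mul]
  simp

theorem mellin_integrand_integrable {α : ℝ} {f : ℝ → ℂ} (hf : SineAdmissible f) {c : ℝ}
    (hc0 : 0 < c) (hcα : -α < c) (hc1 : c < 1 / 4) :
    Integrable fun t : ℝ => weberSymbol α (c + t * Complex.I) * (c + t * Complex.I) /
        Complex.sin (Real.pi * (c + t * Complex.I)) * sineLaplace f (c + t * Complex.I) :=
  (line_factor_integrable hc0 hcα hc1).mul_bdd
    (sineLaplace_line_continuous hf hc0 hc1).aestronglyMeasurable
    (ae_of_all _ fun t => norm_sineLaplace_le t)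

theorem div_four_cpow_neg {y : ℝ} (hy : 0 < y) (s : ℂ) :
    ((y / 4 : ℝ) : ℂ) ^ (-s) = (y : ℂ) ^ (-s) * 4 ^ s := by
  have h4 : ((4 : ℝ) : ℂ) = 4 := by norm_num
  rw [Complex.cpow_def_of_ne_zero (by exact_mod_cast (show y / 4 ≠ 0 by positivity)),
    Complex.cpow_def_of_ne_zero (by exact_mod_cast hy.ne'),
    Complex.cpow_def_of_ne_zero (by norm_num), ← Complex.exp_add, ← Complex.ofReal_log (by positivity),
    ← Complex.ofReal_log hy.le, ← h4, ← Complex.ofReal_log (by norm_num),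
    Real.log_div hy.ne' (by norm_num)]
  push_cast
  ring_nf

theorem norm_indexG_le {α : ℝ} {g : ℂ → ℂ} (hf : SineAdmissible fun τ : ℝ => g τ) {c : ℝ}
    (hc0 : 0 < c) (hcα : -α < c) (hc1 : c < 1 / 4) :
    ∃ C : ℝ, 0 ≤ C ∧ ∀ y : ℝ, 0 < y → ‖indexG α g y‖ ≤ C * y ^ (-c) := by
  refine ⟨4 ^ c * ∫ t : ℝ, ‖weberSymbol α (c + t * Complex.I) * (c + t * Complex.I) /
        Complex.sin (Real.pi * (c + t * Complex.I)) *
        sineLaplace (fun τ : ℝ => g τ) (c + t * Complex.I)‖, by positivity, fun y hy => ?_⟩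
  have h := indexG_eq_line_integral hf hy hc0 hcα hc1
  have h2 : ‖(2 * Real.pi * indexG α g y : ℂ)‖ = 2 * Real.pi * ‖indexG α g y‖ := by
    rw [norm_mul, norm_mul, Complex.norm_real, Complex.norm_ofNat, Real.norm_of_nonneg Real.pi_pos.le]
  have h3 : ‖indexG α g y‖ ≤ 2 * Real.pi * ‖indexG α g y‖ :=
    le_mul_of_one_le_left (norm_nonneg _) (by linarith [Real.pi_gt_three])
  refine h3.trans ?_
  rw [← h2, ← h]
  refine (norm_integral_le_integral_norm _).trans (le_of_eq ?_)
  have hw : 0 < y / 4 := by positivity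
  have e : (y / 4) ^ (-c) = 4 ^ c * y ^ (-c) := by
    rw [Real.div_rpow hy.le (by norm_num), Real.rpow_neg (by norm_num : (0 : ℝ) ≤ 4)]
    field_simp
  rw [mul_right_comm, ← e, ← integral_const_mul]
  refine integral_congr_ae (ae_of_all _ fun t => ?_)
  simp only
  rw [norm_mul ((((y / 4 : ℝ) : ℂ)) ^ _), Complex.norm_cpow_eq_rpow_re_of_pos hw]
  simp

theorem indexG_mellinConvergent {α : ℝ} {g : ℂ → ℂ} (hf : SineAdmissible fun τ : ℝ => g τ)
    (hm : AEStronglyMeasurable (indexG α g) (volume.restrict (Ioi 0))) {c : ℝ}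
    (hc0 : 0 < c) (hcα : -α < c) (hc1 : c < 1 / 4) : MellinConvergent (indexG α g) c := by
  obtain ⟨a, ha0, hac⟩ := exists_between (max_lt hc0 hcα)
  obtain ⟨b, hcb, hb1⟩ := exists_between hc1
  obtain ⟨C, hC, h⟩ := norm_indexG_le (α := α) hf ((le_max_left _ _).trans_lt ha0)
    ((le_max_right _ _).trans_lt ha0) (hac.trans hc1)
  obtain ⟨D, hD, h'⟩ := norm_indexG_le (α := α) hf (hc0.trans hcb) (hcα.trans hcb) hb1
  refine mellinConvergent_of_rpow_bounds hm (a := a) (b := b) (C := max C D) hac hcb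
    (fun y hy => (h y hy).trans ?_) fun y hy => (h' y hy).trans ?_
  · exact mul_le_mul_of_nonneg_right (le_max_left _ _) (by positivity)
  · exact mul_le_mul_of_nonneg_right (le_max_right _ _) (by positivity)

theorem mellin_indexG {α : ℝ} {g : ℂ → ℂ} (hf : SineAdmissible fun τ : ℝ => g τ)
    (hm : AEStronglyMeasurable (indexG α g) (volume.restrict (Ioi 0))) {c : ℝ}
    (hc0 : 0 < c) (hcα : -α < c) (hc1 : c < 1 / 4) (t : ℝ) :
    mellin (indexG α g) (c + t * Complex.I) = 4 ^ (c + t * Complex.I : ℂ) *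
      (weberSymbol α (c + t * Complex.I) * (c + t * Complex.I) /
        Complex.sin (Real.pi * (c + t * Complex.I)) *
        sineLaplace (fun τ : ℝ => g τ) (c + t * Complex.I)) := by
  have h4 : Continuous fun t : ℝ => (4 : ℂ) ^ (c + t * Complex.I : ℂ) :=
    Continuous.const_cpow (by fun_prop) (Or.inl (by norm_num))
  refine mellin_eq_of_line_integral (H := fun s => 4 ^ s * (weberSymbol α s * s /
    Complex.sin (Real.pi * s) * sineLaplace (fun τ : ℝ => g τ) s)) ?_ ?_ ?_
    (indexG_mellinConvergent hf hm hc0 hcα hc1) t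
  · exact h4.mul ((line_factor_continuous hc0 hcα hc1).mul (sineLaplace_line_continuous hf hc0 hc1))
  · refine (mellin_integrand_integrable hf hc0 hcα hc1).bdd_mul (c := 4 ^ c) h4.aestronglyMeasurable
      (ae_of_all _ fun t => ?_)
    have := Complex.norm_cpow_eq_rpow_re_of_pos (show (0 : ℝ) < 4 by norm_num) (c + t * Complex.I)
    push_cast at this
    rw [this]
    simp
  · intro y hy
    rw [← indexG_eq_line_integral hf hy hc0 hcα hc1]
    refine integral_congr_ae (ae_of_all _ fun t => ?_)
    simp only
    rw [div_four_cpow_neg hy, mul_assoc]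

/-- The reciprocal of the multiplier `4^s K(s) s / sin (πs)`, written without poles for
`Re s < 1 + α`. -/
noncomputable def inverseSymbol (α : ℝ) (s : ℂ) : ℂ :=
  Real.pi ^ 2 * 4 ^ (-s) * Complex.Gamma (1 - s + α) *
    ((Complex.Gamma (s + α))⁻¹ * (Complex.Gamma (1 + s))⁻¹ * (Complex.Gamma (1 - s))⁻¹)

theorem inverseSymbol_mul_symbol {α : ℝ} {s : ℂ} (h0 : 0 < s.re) (hα : -α < s.re)
    (h1 : s.re < 1) (hα1 : s.re < 1 + α) : inverseSymbol α s *
      (4 ^ s * (weberSymbol α s * s / Complex.sin (Real.pi * s))) = 1 := by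
  have hpi : (Real.pi : ℂ) ≠ 0 := by exact_mod_cast Real.pi_ne_zero
  have hs := csin_pi_ne_zero h0 h1
  have hs0 : s ≠ 0 := fun h => by simp [h] at h0
  have g1 : Complex.Gamma (1 - s + α) ≠ 0 :=
    Complex.Gamma_ne_zero_of_re_pos (by simp; linarith)
  have g2 : Complex.Gamma (s + α) ≠ 0 := Complex.Gamma_ne_zero_of_re_pos (by simp; linarith)
  have g3 : Complex.Gamma s ≠ 0 := Complex.Gamma_ne_zero_of_re_pos h0
  have e4 : (4 : ℂ) ^ (-s) * 4 ^ s = 1 := by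
    rw [← Complex.cpow_add _ _ (by norm_num)]; simp
  rw [inverseSymbol, weberSymbol, inv_Gamma_one_sub h0, add_comm 1 s, Complex.Gamma_add_one s hs0]
  generalize Complex.sin (Real.pi * s) = S at *
  field_simp
  rw [mul_comm] at e4
  linear_combination e4

/-- The quotient of the Mellin transform of `G_α g` by its multiplier is the Laplace transform of the
sine transform. The left side is analytic wherever the Mellin integral converges, so it continues
the right side to the left of the imaginary axis. -/
theorem inverseSymbol_mul_mellin {α : ℝ} {g : ℂ → ℂ} (hf : SineAdmissible fun τ : ℝ => g τ)
    (hm : AEStronglyMeasurable (indexG α g) (volume.restrict (Ioi 0))) {c : ℝ}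
    (hc0 : 0 < c) (hcα : -α < c) (hc1 : c < 1 / 4) (t : ℝ) :
    inverseSymbol α (c + t * Complex.I) * mellin (indexG α g) (c + t * Complex.I) =
      sineLaplace (fun τ : ℝ => g τ) (c + t * Complex.I) := by
  have hre : (c + t * Complex.I : ℂ).re = c := by simp
  rw [mellin_indexG hf hm hc0 hcα hc1, ← mul_assoc (4 ^ _), ← mul_assoc,
    inverseSymbol_mul_symbol (by rwa [hre]) (by rwa [hre]) (by rw [hre]; linarith)
      (by rw [hre]; linarith), one_mul]

theorem inverseSymbol_differentiableAt {α : ℝ} {s : ℂ} (h : s.re < 1 + α) :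
    DifferentiableAt ℂ (inverseSymbol α) s := by
  have e1 : DifferentiableAt ℂ (fun s : ℂ => Complex.Gamma (1 - s + α)) s :=
    differentiableAt_Gamma_of_re_pos (by fun_prop) (by simp; linarith)
  have e2 := differentiable_inv_Gamma_comp (f := fun s => s + α) (by fun_prop)
  have e3 := differentiable_inv_Gamma_comp (f := fun s => 1 + s) (by fun_prop)
  have e4 := differentiable_inv_Gamma_comp (f := fun s => 1 - s) (by fun_prop)
  have e5 := cpow_neg_differentiable (w := 4) (by norm_num)
  push_cast at e5
  exact (((differentiableAt_const _).mul (e5 s)).mul e1).mul (((e2 s).mul (e3 s)).mul (e4 s))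

theorem norm_inverseSymbol_le {α A B : ℝ} (hB : B < 1 + α) : ∃ C : ℝ, 0 < C ∧ ∀ s : ℂ,
    A ≤ s.re → s.re ≤ B → ‖inverseSymbol α s‖ ≤ C * Real.exp (12 * |s.im|) := by
  obtain ⟨K1, hK1, h1⟩ := norm_inv_Gamma_le (A + α) (B + α)
  obtain ⟨K2, hK2, h2⟩ := norm_inv_Gamma_le (1 + A) (1 + B)
  obtain ⟨K3, hK3, h3⟩ := norm_inv_Gamma_le (1 - B) (1 - A)
  obtain ⟨M, hM⟩ := (isCompact_Icc (a := 1 - B + α) (b := 1 - A + α)).exists_bound_of_continuousOn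
    (f := Real.Gamma) fun x hx => (Real.differentiableAt_Gamma fun m hm => by
      have : (0 : ℝ) ≤ m := m.cast_nonneg
      linarith [hx.1]).continuousAt.continuousWithinAt
  refine ⟨Real.pi ^ 2 * (4 ^ (-A) + 4 ^ (-B)) * |M| * (K1 * K2 * K3) + 1, ?_, fun s hA hB' => ?_⟩
  · have : (0 : ℝ) ≤ Real.pi ^ 2 * (4 ^ (-A) + 4 ^ (-B)) * |M| * (K1 * K2 * K3) := by positivity
    linarith
  have i1 := h1 (s + α) (by simpa using hA) (by simpa using hB')
  have i2 := h2 (1 + s) (by simpa using hA) (by simpa using hB')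
  have i3 := h3 (1 - s) (by simp; linarith) (by simp; linarith)
  have i4 : ‖Complex.Gamma (1 - s + α)‖ ≤ |M| := by
    have e : (1 - s + α : ℂ).re = 1 - s.re + α := by simp
    refine (norm_Gamma_le_Gamma_re (by rw [e]; linarith)).trans ?_
    rw [e]
    exact (le_abs_self _).trans ((hM (1 - s.re + α) ⟨by linarith, by linarith⟩).trans (le_abs_self _))
  have i5 := norm_cpow_neg_le (w := 4) (by norm_num) hA hB'
  simp only [Complex.add_im, Complex.sub_im, Complex.one_im, Complex.ofReal_im, add_zero, zero_add,
    zero_sub, abs_neg] at i1 i2 i3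
  push_cast at i5
  rw [inverseSymbol, norm_mul, norm_mul, norm_mul, norm_mul, norm_mul, norm_pow, Complex.norm_real,
    Real.norm_of_nonneg Real.pi_pos.le]
  have he : Real.exp (12 * |s.im|) =
      Real.exp (4 * |s.im|) * Real.exp (4 * |s.im|) * Real.exp (4 * |s.im|) := by
    rw [← Real.exp_add, ← Real.exp_add]; ring_nf
  calc _ ≤ Real.pi ^ 2 * (4 ^ (-A) + 4 ^ (-B)) * |M| * ((K1 * Real.exp (4 * |s.im|)) *
        (K2 * Real.exp (4 * |s.im|)) * (K3 * Real.exp (4 * |s.im|))) := by gcongr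
    _ = Real.pi ^ 2 * (4 ^ (-A) + 4 ^ (-B)) * |M| * (K1 * K2 * K3) * Real.exp (12 * |s.im|) := by
        rw [he]; ring
    _ ≤ _ := by
        gcongr
        linarith

/-- Near `0` the quotient `g(τ)/τ` is bounded because `g(0) = 0`; at infinity the
square integrable `g` is paired with `|τ|^{θ-1}`, square integrable for `θ < 1/2`. -/
theorem sineAdmissible_of_memLp {g : ℂ → ℂ} (hg : ∀ τ : ℝ, DifferentiableAt ℂ g τ) (h0 : g 0 = 0)
    (h2 : MemLp (fun τ : ℝ => g τ) 2) : SineAdmissible fun τ : ℝ => g τ := by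
  have hd : ∀ τ : ℝ, DifferentiableAt ℝ (fun τ : ℝ => g τ) τ := fun τ =>
    ((hg τ).hasDerivAt.comp_ofReal).differentiableAt
  have hc : Continuous fun τ : ℝ => g τ :=
    continuous_iff_continuousAt.2 fun τ => (hd τ).continuousAt
  refine ⟨hc, by simpa using h0, fun θ ht0 ht1 => ?_⟩
  have hds : Continuous (dslope (fun τ : ℝ => g τ) 0) := by
    refine continuous_iff_continuousAt.2 fun τ => ?_
    by_cases hτ : τ = 0
    · rw [hτ]; exact continuousAt_dslope_same.2 (hd 0)
    · exact (continuousAt_dslope_of_ne hτ).2 hc.continuousAt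
  obtain ⟨M, hM⟩ := (isCompact_Icc (a := (-1 : ℝ)) (b := 1)).exists_bound_of_continuousOn
    hds.continuousOn
  have hM0 : 0 ≤ M := (norm_nonneg _).trans (hM 0 (by norm_num))
  have hr : (1 : ℝ) < 2 - 2 * θ := by linarith
  have hb : Integrable fun τ : ℝ => (1 + ‖τ‖) ^ (-(2 - 2 * θ)) :=
    integrable_one_add_norm (by simpa using hr)
  have hsq : Integrable fun τ : ℝ => ‖g τ‖ ^ 2 := h2.integrable_norm_pow (by norm_num)
  refine Integrable.mono' (hsq.add (hb.const_mul (8 * M + 4))) ?_ (ae_of_all _ fun τ => ?_)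
  · have hm : Measurable fun τ : ℝ => g τ / τ := hc.measurable.div Complex.measurable_ofReal
    exact (hm.norm.mul (measurable_const.add (measurable_norm.pow_const _))).aestronglyMeasurable
  rw [Real.norm_of_nonneg (by positivity), Pi.add_apply, Real.norm_eq_abs]
  have hp : 0 ≤ (1 + |τ|) ^ (-(2 - 2 * θ)) := by positivity
  have hq : ((1 + |τ|) / 2) ^ (-(2 - 2 * θ)) ≤ 4 * (1 + |τ|) ^ (-(2 - 2 * θ)) := by
    rw [Real.div_rpow (by positivity) zero_le_two, Real.rpow_neg zero_le_two, div_inv_eq_mul, mul_comm]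
    refine mul_le_mul_of_nonneg_right ?_ hp
    calc (2 : ℝ) ^ (2 - 2 * θ) ≤ 2 ^ (2 : ℝ) :=
          Real.rpow_le_rpow_of_exponent_le one_le_two (by linarith)
      _ = 4 := by norm_num
  rcases le_total |τ| 1 with h | h
  · have h1 : ‖g τ / τ‖ ≤ M := by
      by_cases hτ : τ = 0
      · simpa [hτ] using hM0
      · have := hM τ (abs_le.1 h)
        rw [dslope_of_ne _ hτ, slope_def_module] at this
        simp only [sub_zero, Complex.ofReal_zero, h0, Complex.real_smul, Complex.ofReal_inv] at this
        rwa [inv_mul_eq_div] at this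
    have h3 : |τ| ^ θ ≤ 1 := Real.rpow_le_one (abs_nonneg _) h ht0
    have h4 : 1 ≤ ((1 + |τ|) / 2) ^ (-(2 - 2 * θ)) :=
      Real.one_le_rpow_of_pos_of_le_one_of_nonpos (by positivity) (by linarith) (by linarith)
    have h5 : ‖g τ / τ‖ * (1 + |τ| ^ θ) ≤ M * 2 := by gcongr; linarith
    nlinarith [sq_nonneg ‖g τ‖]
  · have ht0' : 0 < |τ| := by linarith
    have h3 : |τ| ^ (θ - 1) * |τ| ^ (θ - 1) ≤ 4 * (1 + |τ|) ^ (-(2 - 2 * θ)) := by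
      rw [← Real.rpow_add ht0', show θ - 1 + (θ - 1) = -(2 - 2 * θ) by ring]
      refine le_trans ?_ hq
      exact Real.rpow_le_rpow_of_nonpos (by positivity) (by linarith) (by linarith)
    have h4 : ‖g τ / τ‖ * (1 + |τ| ^ θ) ≤ 2 * (‖g τ‖ * |τ| ^ (θ - 1)) := by
      have h6 : 1 ≤ |τ| ^ θ := Real.one_le_rpow h ht0
      rw [norm_div, Complex.norm_real, Real.norm_eq_abs, Real.rpow_sub_one ht0'.ne', div_mul_eq_mul_div,
        ← mul_div_assoc, ← mul_div_assoc]
      refine div_le_div_of_nonneg_right ?_ ht0'.le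
      nlinarith [norm_nonneg (g τ)]
    nlinarith [sq_nonneg (‖g τ‖ - |τ| ^ (θ - 1))]



/-! ### Bounds for the Bessel functions, uniform in the order -/

/-- The logarithmic derivative `w (d/dw) J_ν(2 √w)`. -/
noncomputable def besselDG (ν : ℂ) (w : ℝ) : ℂ :=
  (w : ℂ) ^ (ν / 2) * (ν / 2 * besselE ν w - w * besselE (ν + 1) w)

theorem hasDerivAt_ofReal_cpow {w : ℝ} (hw : 0 < w) (p : ℂ) :
    HasDerivAt (fun w : ℝ => (w : ℂ) ^ p) ((w : ℂ) ^ p * (p / w)) w := by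
  have hw' : (w : ℂ) ≠ 0 := by exact_mod_cast hw.ne'
  have h := ((hasDerivAt_id (w : ℂ)).cpow_const (c := p)
    (Or.inl (by simpa using hw))).comp_ofReal
  refine h.congr_deriv ?_
  simp only [id, mul_one]
  rw [Complex.cpow_sub _ _ hw', Complex.cpow_one]
  ring

theorem besselG_hasDerivAt (ν : ℂ) {w : ℝ} (hw : 0 < w) :
    HasDerivAt (besselG ν) (besselDG ν w / w) w := by
  have hw' : (w : ℂ) ≠ 0 := by exact_mod_cast hw.ne'
  refine ((hasDerivAt_ofReal_cpow hw (ν / 2)).mul (besselE_hasDerivAt ν w).comp_ofReal).congr_deriv ?_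
  rw [besselDG]
  field_simp
  ring

theorem besselDG_hasDerivAt (ν : ℂ) {w : ℝ} (hw : 0 < w) :
    HasDerivAt (besselDG ν) ((ν ^ 2 / 4 - w) * besselG ν w / w) w := by
  have hw' : (w : ℂ) ≠ 0 := by exact_mod_cast hw.ne'
  have h1 := (besselE_hasDerivAt ν w).comp_ofReal
  have h2 := (besselE_hasDerivAt (ν + 1) w).comp_ofReal
  have h3 := (hasDerivAt_id (w : ℂ)).comp_ofReal
  refine ((hasDerivAt_ofReal_cpow hw (ν / 2)).mul
    ((h1.const_mul (ν / 2)).sub (h3.mul h2))).congr_deriv ?_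
  have hr := besselE_recurrence ν w
  rw [add_assoc, one_add_one_eq_two]
  simp only [id, besselG, Pi.sub_apply, Pi.mul_apply]
  rw [hr]
  field_simp
  ring

theorem continuous_besselE_comp {X : Type*} [TopologicalSpace X] {a b : X → ℂ} (ha : Continuous a)
    (hb : Continuous b) : Continuous fun x => besselE (a x) (b x) :=
  besselE_continuous.comp (ha.prodMk hb)

theorem continuousOn_besselG : ContinuousOn (fun z : ℂ × ℝ => besselG z.1 z.2) {z | 0 < z.2} := by
  refine ContinuousOn.mul ?_
    (continuous_besselE_comp continuous_fst (by fun_prop)).continuousOn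
  exact ContinuousOn.cpow (by fun_prop) (by fun_prop) fun z hz => Or.inl (by simpa using hz)

theorem continuousOn_besselDG :
    ContinuousOn (fun z : ℂ × ℝ => besselDG z.1 z.2) {z | 0 < z.2} := by
  have h1 : Continuous fun z : ℂ × ℝ => besselE z.1 z.2 :=
    continuous_besselE_comp continuous_fst (by fun_prop)
  have h2 : Continuous fun z : ℂ × ℝ => besselE (z.1 + 1) z.2 :=
    continuous_besselE_comp (by fun_prop) (by fun_prop)
  refine ContinuousOn.mul ?_ (Continuous.continuousOn (((continuous_fst.div_const 2).mul h1).sub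
    ((Complex.continuous_ofReal.comp continuous_snd).mul h2)))
  exact ContinuousOn.cpow (by fun_prop) (by fun_prop) fun z hz => Or.inl (by simpa using hz)

/-- The energy `|u|² + |u'|²` of `u = √z J_ν(z)`, `z = 2 √w`, up to constant factors. -/
noncomputable def besselEnergy (ν : ℂ) (w : ℝ) : ℝ :=
  ‖((w ^ (1 / 4 : ℝ) : ℝ) : ℂ) * besselG ν w‖ ^ 2 +
    ‖((w ^ (-(1 / 4) : ℝ) : ℝ) : ℂ) * (besselDG ν w + besselG ν w / 4)‖ ^ 2

/-- The potential in the equation for `√z J_ν(z)` differs from a constant by a multiple of `1/z²`,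
so the logarithmic derivative of the energy is integrable at infinity; the exponential factor
compensates for its integral. -/
theorem besselEnergy_antitone (ν : ℂ) : AntitoneOn
    (fun w : ℝ => besselEnergy ν w * Real.exp (2 * ‖ν ^ 2 / 4 - 1 / 16‖ * w ^ (-(1 / 2) : ℝ)))
    (Ici 1) := by
  set c : ℂ := ν ^ 2 / 4 - 1 / 16 with hc
  have key : ∀ w : ℝ, 0 < w → ∃ d : ℝ, d ≤ 0 ∧ HasDerivAt (fun w : ℝ => besselEnergy ν w *
      Real.exp (2 * ‖c‖ * w ^ (-(1 / 2) : ℝ))) d w := by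
    intro w hw
    have hw' : (w : ℂ) ≠ 0 := by exact_mod_cast hw.ne'
    have hr1 := (Real.hasDerivAt_rpow_const (x := w) (p := 1 / 4) (Or.inl hw.ne')).ofReal_comp
    have hr2 := (Real.hasDerivAt_rpow_const (x := w) (p := -(1 / 4)) (Or.inl hw.ne')).ofReal_comp
    have hr3 := Real.hasDerivAt_rpow_const (x := w) (p := -(1 / 2)) (Or.inl hw.ne')
    set a := w ^ (1 / 4 : ℝ) with ha
    have ha0 : 0 < a := by positivity
    have e1 : w ^ (1 / 4 - 1 : ℝ) = a / w := by rw [Real.rpow_sub_one hw.ne']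
    have e2 : w ^ (-(1 / 4) - 1 : ℝ) = a⁻¹ / w := by
      rw [Real.rpow_sub_one hw.ne', Real.rpow_neg hw.le]
    have ea : w ^ (-(1 / 4) : ℝ) = a⁻¹ := Real.rpow_neg hw.le _
    have e3 : w ^ (-(1 / 2) - 1 : ℝ) = (a ^ 2)⁻¹ / w := by
      rw [Real.rpow_sub_one hw.ne', Real.rpow_neg hw.le, ha, ← Real.rpow_natCast, ← Real.rpow_mul hw.le]
      norm_num
    have ew : w = a ^ 4 := by
      rw [ha, ← Real.rpow_natCast, ← Real.rpow_mul hw.le]; norm_num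
    have hG := besselG_hasDerivAt ν hw
    have hD := besselDG_hasDerivAt ν hw
    set u : ℂ := (a : ℂ) * besselG ν w with hu
    set p : ℂ := ((a⁻¹ : ℝ) : ℂ) * (besselDG ν w + besselG ν w / 4) with hp
    have ha' : (a : ℂ) ≠ 0 := by exact_mod_cast ha0.ne'
    have ewc : (w : ℂ) = (a : ℂ) ^ 4 := by exact_mod_cast ew
    have hU : HasDerivAt (fun w : ℝ => ((w ^ (1 / 4 : ℝ) : ℝ) : ℂ) * besselG ν w)
        (((a ^ 2)⁻¹ : ℝ) • p) w := by
      refine (hr1.mul hG).congr_deriv ?_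
      rw [e1, hp, ewc, Complex.real_smul]
      push_cast
      rw [ewc]
      field_simp
      ring
    have hP : HasDerivAt (fun w : ℝ => ((w ^ (-(1 / 4) : ℝ) : ℝ) : ℂ) *
        (besselDG ν w + besselG ν w / 4)) (-(((a ^ 2)⁻¹ : ℝ) • u) + ((a ^ 6)⁻¹ : ℝ) • (c * u)) w := by
      refine (hr2.mul (hD.add (hG.div_const 4))).congr_deriv ?_
      simp only [Pi.add_apply]
      rw [e2, ea, hu, hc, ewc, Complex.real_smul, Complex.real_smul]
      push_cast
      rw [ewc]
      field_simp
      ring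
    have hE := (hU.norm_sq.add hP.norm_sq).mul ((hr3.const_mul (2 * ‖c‖)).exp)
    refine ⟨_, ?_, hE⟩
    simp only [Pi.add_apply]
    rw [ea, e3]
    rw [← ha, ← hu, ← hp, inner_add_right, inner_neg_right, real_inner_smul_right, real_inner_smul_right,
      real_inner_smul_right, real_inner_comm u p]
    have hin : inner ℝ p (c * u) ≤ ‖p‖ * (‖c‖ * ‖u‖) := by
      rw [← norm_mul]; exact real_inner_le_norm _ _
    set X := Real.exp (2 * ‖c‖ * w ^ (-(1 / 2) : ℝ)) with hX
    have hX0 : 0 < X := Real.exp_pos _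
    have ha6 : 0 < (a ^ 6)⁻¹ := by positivity
    have e6 : (a ^ 2)⁻¹ / w = (a ^ 6)⁻¹ := by rw [ew]; field_simp
    rw [e6]
    have h2 : 2 * inner ℝ p (c * u) ≤ ‖c‖ * (‖u‖ ^ 2 + ‖p‖ ^ 2) := by
      nlinarith [mul_nonneg (norm_nonneg c) (sq_nonneg (‖u‖ - ‖p‖))]
    have h3 := mul_le_mul_of_nonneg_left h2 (mul_pos hX0 ha6).le
    linarith
  refine antitoneOn_of_deriv_nonpos (convex_Ici 1) (fun w hw => ?_) (fun w hw => ?_) fun w hw => ?_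
  · obtain ⟨d, -, hd⟩ := key w (lt_of_lt_of_le one_pos hw)
    exact hd.continuousAt.continuousWithinAt
  · rw [interior_Ici] at hw
    obtain ⟨d, -, hd⟩ := key w (one_pos.trans hw)
    exact hd.differentiableAt.differentiableWithinAt
  · rw [interior_Ici] at hw
    obtain ⟨d, hd0, hd⟩ := key w (one_pos.trans hw)
    rw [hd.deriv]
    exact hd0

theorem besselG_large_bound {S : Set ℂ} (hS : IsCompact S) : ∃ C : ℝ, 0 < C ∧ ∀ ν ∈ S, ∀ w : ℝ,
    1 ≤ w → ‖besselG ν w‖ ≤ C * w ^ (-(1 / 4) : ℝ) ∧ ‖besselDG ν w‖ ≤ C * w ^ (1 / 4 : ℝ) := by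
  have hone : ContinuousOn (fun ν : ℂ => ((ν, 1) : ℂ × ℝ)) S := by fun_prop
  obtain ⟨M1, hM1⟩ := hS.exists_bound_of_continuousOn
    (continuousOn_besselG.comp hone fun ν _ => by simp)
  obtain ⟨M2, hM2⟩ := hS.exists_bound_of_continuousOn
    (continuousOn_besselDG.comp hone fun ν _ => by simp)
  obtain ⟨M3, hM3⟩ := hS.exists_bound_of_continuousOn
    (by fun_prop : ContinuousOn (fun ν : ℂ => ν ^ 2 / 4 - 1 / 16) S)
  set B := (M1 ^ 2 + (M2 + M1 / 4) ^ 2) * Real.exp (2 * M3) with hB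
  refine ⟨2 * Real.sqrt B + 1, by positivity, fun ν hν w hw => ?_⟩
  have hw0 : 0 < w := lt_of_lt_of_le one_pos hw
  have h1 := besselEnergy_antitone ν (mem_Ici.2 le_rfl) (mem_Ici.2 hw) hw
  simp only [Real.one_rpow, mul_one] at h1
  have hE : besselEnergy ν w ≤ B := by
    have h2 : besselEnergy ν 1 ≤ M1 ^ 2 + (M2 + M1 / 4) ^ 2 := by
      have i1 : ‖besselG ν 1‖ ≤ M1 := hM1 ν hν
      have i2 : ‖besselDG ν 1‖ ≤ M2 := hM2 ν hν
      have i3 : ‖besselDG ν 1 + besselG ν 1 / 4‖ ≤ M2 + M1 / 4 := by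
        refine (norm_add_le _ _).trans ?_
        rw [norm_div, Complex.norm_ofNat]
        linarith
      simp only [besselEnergy, Real.one_rpow, Complex.ofReal_one, one_mul]
      gcongr
    have h3 : 1 ≤ Real.exp (2 * ‖ν ^ 2 / 4 - 1 / 16‖ * w ^ (-(1 / 2) : ℝ)) :=
      Real.one_le_exp (by positivity)
    have h4 : 0 ≤ besselEnergy ν w := by unfold besselEnergy; positivity
    calc besselEnergy ν w ≤ _ := le_mul_of_one_le_right h4 h3
      _ ≤ _ := h1
      _ ≤ B := by
        rw [hB]
        gcongr
        exact hM3 ν hν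
  have hu : ‖((w ^ (1 / 4 : ℝ) : ℝ) : ℂ) * besselG ν w‖ ≤ Real.sqrt B := by
    refine Real.le_sqrt_of_sq_le (le_trans ?_ hE)
    rw [besselEnergy]
    exact le_add_of_nonneg_right (by positivity)
  have hp : ‖((w ^ (-(1 / 4) : ℝ) : ℝ) : ℂ) * (besselDG ν w + besselG ν w / 4)‖ ≤ Real.sqrt B := by
    refine Real.le_sqrt_of_sq_le (le_trans ?_ hE)
    rw [besselEnergy]
    exact le_add_of_nonneg_left (by positivity)
  set a := w ^ (1 / 4 : ℝ) with ha
  have ha0 : 0 < a := by positivity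
  have ha1 : 1 ≤ a := Real.one_le_rpow hw (by norm_num)
  have ea : w ^ (-(1 / 4) : ℝ) = a⁻¹ := Real.rpow_neg hw0.le _
  rw [ea] at hp ⊢
  rw [norm_mul, Complex.norm_real, Real.norm_of_nonneg (by positivity)] at hu hp
  have hs := Real.sqrt_nonneg B
  have hG : ‖besselG ν w‖ ≤ Real.sqrt B * a⁻¹ := by
    rw [← div_eq_mul_inv, le_div_iff₀ ha0]; linarith
  rw [inv_mul_le_iff₀ ha0] at hp
  constructor
  · refine hG.trans ?_
    gcongr
    linarith
  · have h5 : ‖besselDG ν w‖ ≤ ‖besselDG ν w + besselG ν w / 4‖ + ‖besselG ν w / 4‖ :=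
      norm_le_add_norm_add _ _
    rw [norm_div, Complex.norm_ofNat] at h5
    have h6 : Real.sqrt B * a⁻¹ ≤ Real.sqrt B * a := by
      gcongr
      exact (inv_le_one_of_one_le₀ ha1).trans ha1
    nlinarith

theorem besselG_small_bound {S : Set ℂ} (hS : IsCompact S) : ∃ C : ℝ, 0 < C ∧ ∀ ν ∈ S, ∀ w : ℝ,
    0 < w → w ≤ 1 → ‖besselG ν w‖ ≤ C * w ^ (ν.re / 2) ∧ ‖besselDG ν w‖ ≤ C * w ^ (ν.re / 2) ∧
      ‖besselDG ν w - ν / 2 * besselG ν w‖ ≤ C * (w ^ (ν.re / 2) * w) := by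
  have hK := hS.prod (isCompact_Icc (a := (0 : ℝ)) (b := 1))
  have h1 : Continuous fun z : ℂ × ℝ => besselE z.1 z.2 :=
    continuous_besselE_comp continuous_fst (by fun_prop)
  have h2 : Continuous fun z : ℂ × ℝ => besselE (z.1 + 1) z.2 :=
    continuous_besselE_comp (by fun_prop) (by fun_prop)
  obtain ⟨M1, hM1⟩ := hK.exists_bound_of_continuousOn h1.continuousOn
  obtain ⟨M2, hM2⟩ := hK.exists_bound_of_continuousOn h2.continuousOn
  obtain ⟨M3, hM3⟩ := hK.exists_bound_of_continuousOn
    (f := fun z : ℂ × ℝ => z.1 / 2 * besselE z.1 z.2 - z.2 * besselE (z.1 + 1) z.2)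
    (((continuous_fst.div_const 2).mul h1).sub
      ((Complex.continuous_ofReal.comp continuous_snd).mul h2)).continuousOn
  refine ⟨|M1| + |M2| + |M3| + 1, by positivity, fun ν hν w hw hw1 => ?_⟩
  have hmem : ((ν, w) : ℂ × ℝ) ∈ S ×ˢ Icc (0 : ℝ) 1 := ⟨hν, hw.le, hw1⟩
  have i1 := (hM1 _ hmem).trans (le_abs_self _)
  have i2 := (hM2 _ hmem).trans (le_abs_self _)
  have i3 := (hM3 _ hmem).trans (le_abs_self _)
  simp only at i1 i2 i3
  have hre : (ν / 2).re = ν.re / 2 := by simp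
  have hp : 0 < w ^ (ν.re / 2) := by positivity
  have a1 := abs_nonneg M1
  have a2 := abs_nonneg M2
  have a3 := abs_nonneg M3
  refine ⟨?_, ?_, ?_⟩
  · rw [besselG, norm_mul, Complex.norm_cpow_eq_rpow_re_of_pos hw, hre, mul_comm]
    gcongr
    linarith
  · rw [besselDG, norm_mul, Complex.norm_cpow_eq_rpow_re_of_pos hw, hre, mul_comm]
    gcongr
    linarith
  · have e : besselDG ν w - ν / 2 * besselG ν w =
        (w : ℂ) ^ (ν / 2) * (-(w : ℂ) * besselE (ν + 1) w) := by
      rw [besselDG, besselG]; ring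
    rw [e, norm_mul, Complex.norm_cpow_eq_rpow_re_of_pos hw, hre, norm_mul, norm_neg,
      Complex.norm_real, Real.norm_of_nonneg hw.le]
    calc w ^ (ν.re / 2) * (w * ‖besselE (ν + 1) w‖)
        = ‖besselE (ν + 1) w‖ * (w ^ (ν.re / 2) * w) := by ring
      _ ≤ _ := by gcongr; linarith



/-! ### The functions `Re [J_{α+ix} Y_{α-ix}]` and their logarithmic derivatives -/

/-- `J_a(√y) J_b(√y)`. -/
noncomputable def besselPair (a b : ℂ) (y : ℝ) : ℂ := besselG a (y / 4) * besselG b (y / 4)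

/-- The logarithmic derivative `y (d/dy) [J_a(√y) J_b(√y)]`. -/
noncomputable def besselPairD (a b : ℂ) (y : ℝ) : ℂ :=
  besselDG a (y / 4) * besselG b (y / 4) + besselG a (y / 4) * besselDG b (y / 4)

theorem besselPair_hasDerivAt (a b : ℂ) {y : ℝ} (hy : 0 < y) :
    HasDerivAt (besselPair a b) (besselPairD a b y / y) y := by
  have hw : 0 < y / 4 := by positivity
  have hy' : (y : ℂ) ≠ 0 := by exact_mod_cast hy.ne'
  have h4 := (hasDerivAt_id y).div_const 4
  have h1 := HasDerivAt.scomp (g₁ := besselG a) (h := fun y => id y / 4) y (besselG_hasDerivAt a hw) h4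
  have h2 := HasDerivAt.scomp (g₁ := besselG b) (h := fun y => id y / 4) y (besselG_hasDerivAt b hw) h4
  refine (h1.mul h2).congr_deriv ?_
  simp only [Function.comp, id, Complex.real_smul, besselPairD]
  push_cast
  field_simp

theorem continuousOn_besselPair_order {a b : ℝ → ℂ} (ha : Continuous a) (hb : Continuous b)
    {y : ℝ} (hy : 0 < y) : Continuous (fun x => besselPair (a x) (b x) y) := by
  have hw : 0 < y / 4 := by positivity
  have h : ∀ c : ℝ → ℂ, Continuous c → Continuous fun x => besselG (c x) (y / 4) := fun c hc => by
    have := continuousOn_besselG.comp (s := univ) (f := fun x : ℝ => (c x, y / 4)) (by fun_prop)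
      (fun x _ => hw)
    exact continuousOn_univ.1 this
  exact (h a ha).mul (h b hb)

theorem continuousOn_besselPairD_order {a b : ℝ → ℂ} (ha : Continuous a) (hb : Continuous b)
    {y : ℝ} (hy : 0 < y) : Continuous (fun x => besselPairD (a x) (b x) y) := by
  have hw : 0 < y / 4 := by positivity
  have h : ∀ c : ℝ → ℂ, Continuous c → Continuous fun x => besselG (c x) (y / 4) := fun c hc => by
    have := continuousOn_besselG.comp (s := univ) (f := fun x : ℝ => (c x, y / 4)) (by fun_prop)
      (fun x _ => hw)
    exact continuousOn_univ.1 this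
  have h' : ∀ c : ℝ → ℂ, Continuous c → Continuous fun x => besselDG (c x) (y / 4) := fun c hc => by
    have := continuousOn_besselDG.comp (s := univ) (f := fun x : ℝ => (c x, y / 4)) (by fun_prop)
      (fun x _ => hw)
    exact continuousOn_univ.1 this
  exact ((h' a ha).mul (h b hb)).add ((h a ha).mul (h' b hb))

theorem continuousOn_besselPairD (a b : ℂ) : ContinuousOn (besselPairD a b) (Ioi 0) := by
  have h : ∀ c : ℂ, ContinuousOn (fun y : ℝ => besselG c (y / 4)) (Ioi 0) := fun c =>
    continuousOn_besselG.comp (f := fun y : ℝ => (c, y / 4)) (by fun_prop)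
      (fun y (hy : 0 < y) => show 0 < y / 4 by positivity)
  have h' : ∀ c : ℂ, ContinuousOn (fun y : ℝ => besselDG c (y / 4)) (Ioi 0) := fun c =>
    continuousOn_besselDG.comp (f := fun y : ℝ => (c, y / 4)) (by fun_prop)
      (fun y (hy : 0 < y) => show 0 < y / 4 by positivity)
  exact ((h' a).mul (h b)).add ((h a).mul (h' b))

theorem besselPair_large_bound {S : Set ℂ} (hS : IsCompact S) : ∃ C : ℝ, 0 < C ∧ ∀ a ∈ S, ∀ b ∈ S,
    ∀ y : ℝ, 4 ≤ y → ‖besselPair a b y‖ ≤ C * y ^ (-(1 / 2) : ℝ) ∧ ‖besselPairD a b y‖ ≤ C := by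
  obtain ⟨C, hC, h⟩ := besselG_large_bound hS
  refine ⟨2 * C ^ 2, by positivity, fun a ha b hb y hy => ?_⟩
  have hw1 : 1 ≤ y / 4 := by linarith
  have hw : 0 < y / 4 := by linarith
  obtain ⟨a1, a2⟩ := h a ha _ hw1
  obtain ⟨b1, b2⟩ := h b hb _ hw1
  have e1 : (y / 4) ^ (-(1 / 4) : ℝ) * (y / 4) ^ (-(1 / 4) : ℝ) = 2 * y ^ (-(1 / 2) : ℝ) := by
    rw [← Real.rpow_add hw, Real.div_rpow (by linarith) (by norm_num)]
    have : (4 : ℝ) ^ (-(1 / 4) + -(1 / 4) : ℝ) = 1 / 2 := by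
      rw [show (-(1 / 4) + -(1 / 4) : ℝ) = -(1 / 2) by norm_num, Real.rpow_neg (by norm_num),
        ← Real.sqrt_eq_rpow, show (4 : ℝ) = 2 ^ 2 by norm_num, Real.sqrt_sq (by norm_num), one_div]
    rw [this, show (-(1 / 4) + -(1 / 4) : ℝ) = -(1 / 2) by norm_num]
    ring
  have e2 : (y / 4) ^ (1 / 4 : ℝ) * (y / 4) ^ (-(1 / 4) : ℝ) = 1 := by
    rw [← Real.rpow_add hw]; simp
  constructor
  · rw [besselPair, norm_mul]
    calc _ ≤ (C * (y / 4) ^ (-(1 / 4) : ℝ)) * (C * (y / 4) ^ (-(1 / 4) : ℝ)) := by gcongr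
      _ = C ^ 2 * ((y / 4) ^ (-(1 / 4) : ℝ) * (y / 4) ^ (-(1 / 4) : ℝ)) := by ring
      _ = _ := by rw [e1]; ring
  · rw [besselPairD]
    refine (norm_add_le _ _).trans ?_
    rw [norm_mul, norm_mul]
    calc _ ≤ (C * (y / 4) ^ (1 / 4 : ℝ)) * (C * (y / 4) ^ (-(1 / 4) : ℝ)) +
          (C * (y / 4) ^ (-(1 / 4) : ℝ)) * (C * (y / 4) ^ (1 / 4 : ℝ)) := by gcongr
      _ = 2 * C ^ 2 * ((y / 4) ^ (1 / 4 : ℝ) * (y / 4) ^ (-(1 / 4) : ℝ)) := by ring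
      _ = _ := by rw [e2, mul_one]

theorem besselPair_small_bound {S : Set ℂ} (hS : IsCompact S) : ∃ C : ℝ, 0 < C ∧ ∀ a ∈ S, ∀ b ∈ S,
    ∀ y : ℝ, 0 < y → y ≤ 4 → ‖besselPair a b y‖ ≤ C * (y / 4) ^ ((a.re + b.re) / 2) ∧
      ‖besselPairD a b y‖ ≤ C * (y / 4) ^ ((a.re + b.re) / 2) ∧
      ‖besselPairD a b y - (a + b) / 2 * besselPair a b y‖ ≤
        C * ((y / 4) ^ ((a.re + b.re) / 2) * y) := by
  obtain ⟨C, hC, h⟩ := besselG_small_bound hS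
  refine ⟨2 * C ^ 2, by positivity, fun a ha b hb y hy0 hy => ?_⟩
  have hw : 0 < y / 4 := by positivity
  obtain ⟨a1, a2, a3⟩ := h a ha _ hw (by linarith)
  obtain ⟨b1, b2, b3⟩ := h b hb _ hw (by linarith)
  have e1 : (y / 4) ^ ((a.re + b.re) / 2) = (y / 4) ^ (a.re / 2) * (y / 4) ^ (b.re / 2) := by
    rw [← Real.rpow_add hw]; ring_nf
  rw [e1]
  set A := (y / 4) ^ (a.re / 2)
  set B := (y / 4) ^ (b.re / 2)
  have hA : 0 < A := by positivity
  have hB : 0 < B := by positivity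
  refine ⟨?_, ?_, ?_⟩
  · rw [besselPair, norm_mul]
    calc _ ≤ (C * A) * (C * B) := by gcongr
      _ ≤ _ := by nlinarith [mul_pos (mul_pos hC hC) (mul_pos hA hB)]
  · rw [besselPairD]
    refine (norm_add_le _ _).trans ?_
    rw [norm_mul, norm_mul]
    calc _ ≤ (C * A) * (C * B) + (C * A) * (C * B) := by gcongr
      _ = _ := by ring
  · have e : besselPairD a b y - (a + b) / 2 * besselPair a b y =
        (besselDG a (y / 4) - a / 2 * besselG a (y / 4)) * besselG b (y / 4) +
        besselG a (y / 4) * (besselDG b (y / 4) - b / 2 * besselG b (y / 4)) := by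
      rw [besselPairD, besselPair]; ring
    rw [e]
    refine (norm_add_le _ _).trans ?_
    rw [norm_mul, norm_mul]
    calc _ ≤ (C * (A * (y / 4))) * (C * B) + (C * A) * (C * (B * (y / 4))) := by gcongr
      _ = C ^ 2 * (A * B * y) / 2 := by ring
      _ ≤ _ := by nlinarith [mul_pos (mul_pos hC hC) (mul_pos (mul_pos hA hB) hy0)]

/-- `y R'(y)` for `R = Re [J_{α+ix}(√y) Y_{α-ix}(√y)]`. -/
noncomputable def weberReD (α x y : ℝ) : ℝ :=
  ((besselPairD (α + Complex.I * x) (α - Complex.I * x) y *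
        Complex.cos (Real.pi * (α - Complex.I * x)) -
      besselPairD (Complex.I * x + α) (Complex.I * x - α) y) /
        Complex.sin (Real.pi * (α - Complex.I * x))).re

theorem weberRe_eq {α x y : ℝ} (hy : 0 < y)
    (hs : Complex.sin (Real.pi * (α - Complex.I * x)) ≠ 0) : weberRe α x y =
    ((besselPair (α + Complex.I * x) (α - Complex.I * x) y *
        Complex.cos (Real.pi * (α - Complex.I * x)) -
      besselPair (Complex.I * x + α) (Complex.I * x - α) y) /
        Complex.sin (Real.pi * (α - Complex.I * x))).re := by
  rw [weberRe, besselProd_eq hy hs]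
  rfl

theorem weberRe_hasDerivAt {α x y : ℝ} (hy : 0 < y)
    (hs : Complex.sin (Real.pi * (α - Complex.I * x)) ≠ 0) :
    HasDerivAt (weberRe α x) (weberReD α x y / y) y := by
  have h := ((((besselPair_hasDerivAt (α + Complex.I * x) (α - Complex.I * x) hy).mul_const
    (Complex.cos (Real.pi * (α - Complex.I * x)))).sub
    (besselPair_hasDerivAt (Complex.I * x + α) (Complex.I * x - α) hy)).div_const
    (Complex.sin (Real.pi * (α - Complex.I * x))))
  have h2 := (Complex.reCLM.hasFDerivAt.comp_hasDerivAt y h)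
  refine (h2.congr_of_eventuallyEq ?_).congr_deriv ?_
  · filter_upwards [lt_mem_nhds hy] with t ht
    rw [weberRe_eq ht hs]
    rfl
  · rw [weberReD, ← Complex.div_ofReal_re]
    simp only [Complex.reCLM_apply]
    congr 1
    ring

/-- The two-sided control of `R` and `D = y R'` behind all convergence statements. Near `0`, only
the combination `α² ∫ R dt/t + D` is controlled: for `α < 0` both terms may be of order `y^α`. -/
structure WeberBounds (α δ C : ℝ) (R D : ℝ → ℝ) : Prop where
  deriv : ∀ y, 0 < y → HasDerivAt R (D y / y) y
  cont : ContinuousOn D (Ioi 0)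
  largeR : ∀ y, 4 ≤ y → |R y| ≤ C * y ^ (-(1 / 2) : ℝ)
  largeD : ∀ y, 4 ≤ y → |D y| ≤ C
  small : ∀ y, 0 < y → y ≤ 4 → |α ^ 2 * (∫ t in y..4, R t / t) + D y| ≤ C * y ^ (-δ)

theorem intervalIntegrable_div_self {A : ℝ → ℝ} (hA : ContinuousOn A (Ioi 0)) {y z : ℝ} (hy : 0 < y)
    (hz : 0 < z) : IntervalIntegrable (fun t => A t / t) volume y z := by
  refine ContinuousOn.intervalIntegrable ?_
  have hsub : uIcc y z ⊆ Ioi 0 := fun t ht => lt_of_lt_of_le (lt_min hy hz) ht.1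
  exact (hA.mono hsub).div continuousOn_id fun t ht => (ne_of_gt (hsub ht))

theorem integral_rpow_le {α y : ℝ} (hα : -(1 / 4) < α) (hy : 0 < y) :
    ∫ t in y..4, t ^ α ≤ 4 ^ (α + 1) / (α + 1) := by
  rw [integral_rpow (Or.inl (by linarith))]
  refine div_le_div_of_nonneg_right ?_ (by linarith)
  linarith [Real.rpow_pos_of_pos hy (α + 1)]

/-- A function of order `y^α` at `0` whose leading term is a multiple of `y^α` is annihilated to
leading order by `α² ∫_y dt/t + y d/dy`. -/
theorem tail_cancellation {α C : ℝ} (hα : -(1 / 4) < α) (hC : 0 ≤ C) {A A' : ℝ → ℝ}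
    (hA : ∀ y, 0 < y → HasDerivAt A (A' y / y) y) (hA' : ContinuousOn A' (Ioi 0))
    (h : ∀ y, 0 < y → y ≤ 4 → |A' y - α * A y| ≤ C * (y ^ α * y)) {y : ℝ} (hy : 0 < y)
    (hy4 : y ≤ 4) : |α ^ 2 * (∫ t in y..4, A t / t) + A' y| ≤
      |α| * (C * (4 ^ (α + 1) / (α + 1))) + |α| * |A 4| + C * 4 ^ (α + 1) := by
  have hAc : ContinuousOn A (Ioi 0) := fun t ht => (hA t ht).continuousAt.continuousWithinAt
  have i1 := intervalIntegrable_div_self hAc hy four_pos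
  have i2 := intervalIntegrable_div_self hA' hy four_pos
  have hftc : ∫ t in y..4, A' t / t = A 4 - A y :=
    intervalIntegral.integral_eq_sub_of_hasDerivAt (fun t ht => by
      rw [uIcc_of_le hy4] at ht
      exact hA t (lt_of_lt_of_le hy ht.1)) i2
  have e : α ^ 2 * (∫ t in y..4, A t / t) + A' y =
      α * (∫ t in y..4, (α * (A t / t) - A' t / t)) + α * A 4 + (A' y - α * A y) := by
    rw [intervalIntegral.integral_sub (i1.const_mul α) i2, hftc, intervalIntegral.integral_const_mul]
    ring
  have hb : |∫ t in y..4, (α * (A t / t) - A' t / t)| ≤ C * (4 ^ (α + 1) / (α + 1)) := by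
    have h1 : ‖∫ t in y..4, (α * (A t / t) - A' t / t)‖ ≤ ∫ t in y..4, C * t ^ α := by
      refine intervalIntegral.norm_integral_le_of_norm_le hy4 (ae_of_all _ fun t ht => ?_)
        ((intervalIntegral.intervalIntegrable_rpow' (by linarith)).const_mul C)
      have ht0 : 0 < t := hy.trans ht.1
      rw [← mul_div_assoc, ← sub_div, norm_div, Real.norm_of_nonneg ht0.le, div_le_iff₀ ht0,
        Real.norm_eq_abs, abs_sub_comm, mul_assoc]
      exact h t ht0 ht.2
    rw [intervalIntegral.integral_const_mul] at h1
    exact h1.trans (mul_le_mul_of_nonneg_left (integral_rpow_le hα hy) hC)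
  have hl : |A' y - α * A y| ≤ C * 4 ^ (α + 1) := by
    refine (h y hy hy4).trans ?_
    rw [← Real.rpow_add_one hy.ne']
    gcongr
    linarith
  rw [e]
  refine (abs_add_three _ _ _).trans ?_
  rw [abs_mul, abs_mul]
  gcongr

theorem tail_of_bound {α δ C : ℝ} (hδ : 0 < δ) {B B' : ℝ → ℝ}
    (h : ∀ y, 0 < y → y ≤ 4 → |B y| ≤ C * y ^ (-δ)) (h' : ∀ y, 0 < y → y ≤ 4 → |B' y| ≤ C * y ^ (-δ))
    {y : ℝ} (hy : 0 < y) (hy4 : y ≤ 4) :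
    |α ^ 2 * (∫ t in y..4, B t / t) + B' y| ≤ (α ^ 2 / δ + 1) * C * y ^ (-δ) := by
  have hC : 0 ≤ C := by
    have := (abs_nonneg _).trans (h y hy hy4)
    exact nonneg_of_mul_nonneg_left this (by positivity)
  have h0 : (0 : ℝ) ∉ uIcc y 4 := fun ht => by
    rw [uIcc_of_le hy4] at ht
    linarith [ht.1]
  have hb : |∫ t in y..4, B t / t| ≤ C * (y ^ (-δ) / δ) := by
    have h1 : ‖∫ t in y..4, B t / t‖ ≤ ∫ t in y..4, C * t ^ (-δ - 1) := by
      refine intervalIntegral.norm_integral_le_of_norm_le hy4 (ae_of_all _ fun t ht => ?_)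
        ((intervalIntegral.intervalIntegrable_rpow (Or.inr h0)).const_mul C)
      have ht0 : 0 < t := hy.trans ht.1
      rw [norm_div, Real.norm_of_nonneg ht0.le, Real.rpow_sub_one ht0.ne', ← mul_div_assoc]
      exact div_le_div_of_nonneg_right (h t ht0 ht.2) ht0.le
    rw [intervalIntegral.integral_const_mul, integral_rpow (Or.inr ⟨by linarith, h0⟩),
      sub_add_cancel] at h1
    refine h1.trans (mul_le_mul_of_nonneg_left ?_ hC)
    rw [← neg_div_neg_eq, neg_neg]
    refine div_le_div_of_nonneg_right ?_ hδ.le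
    linarith [Real.rpow_pos_of_pos four_pos (-δ)]
  refine (abs_add_le _ _).trans ?_
  rw [abs_mul, abs_of_nonneg (sq_nonneg α)]
  calc _ ≤ α ^ 2 * (C * (y ^ (-δ) / δ)) + C * y ^ (-δ) := by
        gcongr
        exact h' y hy hy4
    _ = _ := by ring

theorem abs_re_mul_le (a b : ℂ) : |(a * b).re| ≤ ‖a‖ * ‖b‖ :=
  (Complex.abs_re_le_norm _).trans (norm_mul _ _).le

/-- Everything needed about `R_{α,x}` for `x` in a compact set avoiding the zeros of
`sin π(α - ix)`. -/
theorem weberRe_bounds {α : ℝ} (hα : -(1 / 4) < α) {X : Set ℝ} (hX : IsCompact X)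
    (hs : ∀ x ∈ X, Complex.sin (Real.pi * (α - Complex.I * x)) ≠ 0) {δ : ℝ} (hδ : 0 < δ) :
    ∃ C : ℝ, 0 < C ∧ ∀ x ∈ X, WeberBounds α δ C (weberRe α x) (weberReD α x) ∧
      ∀ y, 0 < y → y ≤ 4 → |weberRe α x y| ≤ C * ((y / 4) ^ α + 1) ∧
        |weberReD α x y| ≤ C * ((y / 4) ^ α + 1) := by
  obtain ⟨N, hN⟩ := hX.isBounded.exists_norm_le
  set S : Set ℂ := Metric.closedBall 0 (|α| + N) with hS
  have hScomp : IsCompact S := isCompact_closedBall _ _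
  have hmem : ∀ x ∈ X, (α + Complex.I * x : ℂ) ∈ S ∧ (α - Complex.I * x : ℂ) ∈ S ∧
      (Complex.I * x + α : ℂ) ∈ S ∧ (Complex.I * x - α : ℂ) ∈ S := fun x hx => by
    have h1 : ‖(α : ℂ)‖ = |α| := by simp
    have h2 : ‖Complex.I * (x : ℂ)‖ ≤ N := by simpa using hN x hx
    simp only [hS, mem_closedBall_zero_iff]
    exact ⟨(norm_add_le _ _).trans (by linarith), (norm_sub_le _ _).trans (by linarith),
      (norm_add_le _ _).trans (by linarith), (norm_sub_le _ _).trans (by linarith)⟩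
  obtain ⟨C1, hC1, hl⟩ := besselPair_large_bound hScomp
  obtain ⟨C2, hC2, hsm⟩ := besselPair_small_bound hScomp
  have hsc : ContinuousOn (fun x : ℝ => (Complex.sin (Real.pi * (α - Complex.I * x)))⁻¹) X :=
    ContinuousOn.inv₀ (by fun_prop) hs
  obtain ⟨K, hK⟩ := hX.exists_bound_of_continuousOn (hsc.mul
    (by fun_prop : Continuous fun x : ℝ => Complex.cos (Real.pi * (α - Complex.I * x))).continuousOn)
  obtain ⟨L, hL⟩ := hX.exists_bound_of_continuousOn hsc
  set M := |K| + |L| with hM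
  have hM0 : 0 ≤ M := by positivity
  set C3 := M * (C2 * ((4 ^ α)⁻¹ : ℝ)) with hC3
  set C4 := M * C2 * 4 ^ δ with hC4
  have hC30 : 0 ≤ C3 := by positivity
  have hC40 : 0 ≤ C4 := by positivity
  set C5 := |α| * (C3 * (4 ^ (α + 1) / (α + 1))) + |α| * (M * C2) + C3 * 4 ^ (α + 1) with hC5
  have hα1 : 0 < α + 1 := by linarith
  have hC50 : 0 ≤ C5 := by positivity
  set C6 := C5 * 4 ^ δ + (α ^ 2 / δ + 1) * C4 with hC6
  have hC60 : 0 ≤ C6 := by positivity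
  refine ⟨2 * M * C1 + C6 + M * C2 + 1, by positivity, fun x hx => ?_⟩
  obtain ⟨m1, m2, m3, m4⟩ := hmem x hx
  have hsx := hs x hx
  have hk : ‖(Complex.sin (Real.pi * (α - Complex.I * x)))⁻¹ *
      Complex.cos (Real.pi * (α - Complex.I * x))‖ ≤ M :=
    (hK x hx).trans ((le_abs_self K).trans (le_add_of_nonneg_right (abs_nonneg L)))
  have hlam : ‖(Complex.sin (Real.pi * (α - Complex.I * x)))⁻¹‖ ≤ M :=
    (hL x hx).trans ((le_abs_self L).trans (le_add_of_nonneg_left (abs_nonneg K)))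
  set κ := (Complex.sin (Real.pi * (α - Complex.I * x)))⁻¹ *
      Complex.cos (Real.pi * (α - Complex.I * x)) with hκ
  set lam := (Complex.sin (Real.pi * (α - Complex.I * x)))⁻¹ with hlamdef
  set a : ℂ := α + Complex.I * x with ha
  set b : ℂ := α - Complex.I * x with hb
  set a' : ℂ := Complex.I * x + α with ha'
  set b' : ℂ := Complex.I * x - α with hb'
  have eR : ∀ y, 0 < y → weberRe α x y =
      (κ * besselPair a b y).re - (lam * besselPair a' b' y).re := fun y hy => by
    rw [weberRe_eq hy hsx, ← ha, ← hb, ← ha', ← hb', ← Complex.sub_re, hκ, hlamdef, div_eq_inv_mul]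
    ring_nf
  have eD : ∀ y, weberReD α x y =
      (κ * besselPairD a b y).re - (lam * besselPairD a' b' y).re := fun y => by
    rw [weberReD, ← ha, ← hb, ← ha', ← hb', ← Complex.sub_re, hκ, hlamdef, div_eq_inv_mul]
    ring_nf
  have hr1 : (a.re + b.re) / 2 = α := by simp [ha, hb]
  have hr2 : (a'.re + b'.re) / 2 = 0 := by simp [ha', hb']
  have hab : (a + b) / 2 = α := by rw [ha, hb]; ring
  -- bounds for the two parts near zero
  have s1 : ∀ y, 0 < y → y ≤ 4 → |(κ * besselPair a b y).re| ≤ M * C2 * (y / 4) ^ α ∧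
      |(κ * besselPairD a b y).re| ≤ M * C2 * (y / 4) ^ α ∧
      |(κ * besselPairD a b y).re - α * (κ * besselPair a b y).re| ≤ C3 * (y ^ α * y) :=
    fun y hy hy4 => by
    obtain ⟨h1, h2, h3⟩ := hsm a m1 b m2 y hy hy4
    rw [hr1] at h1 h2 h3
    have hp : 0 < (y / 4) ^ α := by positivity
    refine ⟨(abs_re_mul_le _ _).trans ?_, (abs_re_mul_le _ _).trans ?_, ?_⟩
    · rw [mul_assoc]; gcongr
    · rw [mul_assoc]; gcongr
    · have e : (κ * besselPairD a b y).re - α * (κ * besselPair a b y).re =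
          (κ * (besselPairD a b y - (a + b) / 2 * besselPair a b y)).re := by
        rw [hab, ← Complex.re_ofReal_mul, ← Complex.sub_re]
        congr 1
        ring
      rw [e, hC3]
      refine (abs_re_mul_le _ _).trans ?_
      rw [Real.div_rpow hy.le (by norm_num)] at h3
      calc _ ≤ M * (C2 * (y ^ α / 4 ^ α * y)) := by gcongr
        _ = _ := by ring
  have s2 : ∀ y, 0 < y → y ≤ 4 → |(lam * besselPair a' b' y).re| ≤ M * C2 ∧
      |(lam * besselPairD a' b' y).re| ≤ M * C2 := fun y hy hy4 => by
    obtain ⟨h1, h2, -⟩ := hsm a' m3 b' m4 y hy hy4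
    rw [hr2, Real.rpow_zero, mul_one] at h1 h2
    refine ⟨(abs_re_mul_le _ _).trans ?_, (abs_re_mul_le _ _).trans ?_⟩ <;> gcongr
  have hpow : ∀ y : ℝ, 0 < y → y ≤ 4 → 1 ≤ 4 ^ δ * y ^ (-δ) := fun y hy hy4 => by
    rw [Real.rpow_neg hy.le, ← div_eq_mul_inv, ← Real.div_rpow (by norm_num) hy.le]
    exact Real.one_le_rpow (by rw [le_div_iff₀ hy]; linarith) hδ.le
  have dA : ∀ (k p q : ℂ) (y : ℝ), 0 < y → HasDerivAt (fun y => (k * besselPair p q y).re)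
      ((k * besselPairD p q y).re / y) y := fun k p q y hy => by
    have h := Complex.reCLM.hasFDerivAt.comp_hasDerivAt y
      ((besselPair_hasDerivAt p q hy).const_mul k)
    refine h.congr_deriv ?_
    rw [← Complex.div_ofReal_re]
    simp only [Complex.reCLM_apply]
    rw [mul_div_assoc]
  have cA : ∀ k p q : ℂ, ContinuousOn (fun y => (k * besselPairD p q y).re) (Ioi 0) :=
    fun k p q => Complex.continuous_re.comp_continuousOn
      (continuousOn_const.mul (continuousOn_besselPairD p q))
  have cB : ∀ k p q : ℂ, ContinuousOn (fun y => (k * besselPair p q y).re) (Ioi 0) :=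
    fun k p q y hy => (dA k p q y hy).continuousAt.continuousWithinAt
  refine ⟨⟨fun y hy => weberRe_hasDerivAt hy hsx, ?_, fun y hy => ?_, fun y hy => ?_,
    fun y hy hy4 => ?_⟩, fun y hy hy4 => ⟨?_, ?_⟩⟩
  · exact ((cA κ a b).sub (cA lam a' b')).congr fun y _ => eD y
  · rw [eR y (by linarith)]
    have h1 := (hl a m1 b m2 y hy).1
    have h2 := (hl a' m3 b' m4 y hy).1
    have hp : 0 ≤ y ^ (-(1 / 2) : ℝ) := Real.rpow_nonneg (by linarith) _
    calc _ ≤ |(κ * besselPair a b y).re| + |(lam * besselPair a' b' y).re| := abs_sub _ _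
      _ ≤ ‖κ‖ * ‖besselPair a b y‖ + ‖lam‖ * ‖besselPair a' b' y‖ :=
        add_le_add (abs_re_mul_le _ _) (abs_re_mul_le _ _)
      _ ≤ M * (C1 * y ^ (-(1 / 2) : ℝ)) + M * (C1 * y ^ (-(1 / 2) : ℝ)) := by gcongr
      _ = 2 * M * C1 * y ^ (-(1 / 2) : ℝ) := by ring
      _ ≤ _ := by
        gcongr
        have : 0 ≤ M * C2 := by positivity
        linarith
  · rw [eD y]
    have h1 := (hl a m1 b m2 y hy).2
    have h2 := (hl a' m3 b' m4 y hy).2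
    calc _ ≤ |(κ * besselPairD a b y).re| + |(lam * besselPairD a' b' y).re| := abs_sub _ _
      _ ≤ ‖κ‖ * ‖besselPairD a b y‖ + ‖lam‖ * ‖besselPairD a' b' y‖ :=
        add_le_add (abs_re_mul_le _ _) (abs_re_mul_le _ _)
      _ ≤ M * C1 + M * C1 := by gcongr
      _ ≤ _ := by
        have : 0 ≤ M * C2 := by positivity
        linarith
  · have hpy := hpow y hy hy4
    have hint : ∫ t in y..4, weberRe α x t / t = (∫ t in y..4, (κ * besselPair a b t).re / t) -
        ∫ t in y..4, (lam * besselPair a' b' t).re / t := by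
      rw [← intervalIntegral.integral_sub (intervalIntegrable_div_self (cB κ a b) hy four_pos)
        (intervalIntegrable_div_self (cB lam a' b') hy four_pos)]
      refine intervalIntegral.integral_congr fun t ht => ?_
      rw [uIcc_of_le hy4] at ht
      rw [eR t (lt_of_lt_of_le hy ht.1), sub_div]
    have h1 := tail_cancellation hα hC30 (dA κ a b) (cA κ a b) (fun y hy hy4 => (s1 y hy hy4).2.2)
      hy hy4
    have h2 := tail_of_bound (α := α) (C := C4) hδ (B := fun y => (lam * besselPair a' b' y).re)
      (B' := fun y => (lam * besselPairD a' b' y).re)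
      (fun y hy hy4 => (s2 y hy hy4).1.trans (by
        rw [hC4, mul_assoc]
        exact le_mul_of_one_le_right (by positivity) (hpow y hy hy4)))
      (fun y hy hy4 => (s2 y hy hy4).2.trans (by
        rw [hC4, mul_assoc]
        exact le_mul_of_one_le_right (by positivity) (hpow y hy hy4))) hy hy4
    have h3 : |(κ * besselPair a b 4).re| ≤ M * C2 := by
      have := (s1 4 four_pos le_rfl).1
      simpa using this
    have h4 : |α ^ 2 * (∫ t in y..4, (κ * besselPair a b t).re / t) + (κ * besselPairD a b y).re| ≤
        C5 := h1.trans (by rw [hC5]; gcongr)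
    rw [hint, eD y]
    calc _ = |(α ^ 2 * (∫ t in y..4, (κ * besselPair a b t).re / t) + (κ * besselPairD a b y).re) -
          (α ^ 2 * (∫ t in y..4, (lam * besselPair a' b' t).re / t) +
            (lam * besselPairD a' b' y).re)| := by congr 1; ring
      _ ≤ C5 + (α ^ 2 / δ + 1) * C4 * y ^ (-δ) := (abs_sub _ _).trans (add_le_add h4 h2)
      _ ≤ C5 * (4 ^ δ * y ^ (-δ)) + (α ^ 2 / δ + 1) * C4 * y ^ (-δ) := by
        gcongr
        exact le_mul_of_one_le_right hC50 hpy
      _ = C6 * y ^ (-δ) := by rw [hC6]; ring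
      _ ≤ _ := by
        have : 0 ≤ M * C2 := by positivity
        have : 0 ≤ 2 * M * C1 := by positivity
        gcongr
        linarith
  · rw [eR y hy]
    have hp : 0 < (y / 4) ^ α := by positivity
    have := add_le_add (s1 y hy hy4).1 (s2 y hy hy4).1
    calc _ ≤ M * C2 * (y / 4) ^ α + M * C2 := (abs_sub _ _).trans this
      _ = M * C2 * ((y / 4) ^ α + 1) := by ring
      _ ≤ _ := by
        have : 0 ≤ 2 * M * C1 := by positivity
        gcongr
        linarith
  · rw [eD y]
    have hp : 0 < (y / 4) ^ α := by positivity
    have := add_le_add (s1 y hy hy4).2.1 (s2 y hy hy4).2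
    calc _ ≤ M * C2 * (y / 4) ^ α + M * C2 := (abs_sub _ _).trans this
      _ = M * C2 * ((y / 4) ^ α + 1) := by ring
      _ ≤ _ := by
        have : 0 ≤ 2 * M * C1 := by positivity
        gcongr
        linarith



/-! ### The combination `α² ∫_y^∞ R dt/t + y R'(y)` -/

/-- `α² ∫_y^∞ R(t) dt/t + D(y)`, where `D(y) = y R'(y)`. -/
noncomputable def weberTail (α : ℝ) (R D : ℝ → ℝ) (y : ℝ) : ℝ :=
  α ^ 2 * (∫ t in Ioi y, R t / t) + D y

namespace WeberBounds

variable {α δ C : ℝ} {R D : ℝ → ℝ}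

theorem continuousOn (h : WeberBounds α δ C R D) : ContinuousOn R (Ioi 0) := fun y hy =>
  (h.deriv y hy).continuousAt.continuousWithinAt

theorem nonneg (h : WeberBounds α δ C R D) : 0 ≤ C :=
  (abs_nonneg _).trans (h.largeD 4 le_rfl)

theorem integrableOn_four (h : WeberBounds α δ C R D) :
    IntegrableOn (fun t => R t / t) (Ioi 4) := by
  refine Integrable.mono' ((integrableOn_Ioi_rpow_of_lt (a := -(3 / 2)) (by norm_num)
    four_pos).const_mul C) ?_ ?_
  · exact (((h.continuousOn.mono (Ioi_subset_Ioi zero_le_four)).div continuousOn_id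
      fun t (ht : 4 < t) => by simp only [id]; linarith).aestronglyMeasurable measurableSet_Ioi)
  · filter_upwards [ae_restrict_mem measurableSet_Ioi] with t ht
    have ht4 : 4 ≤ t := le_of_lt ht
    have ht0 : 0 < t := by linarith
    rw [norm_div, Real.norm_of_nonneg ht0.le, div_le_iff₀ ht0, mul_assoc, ← Real.rpow_add_one ht0.ne']
    exact (h.largeR t ht4).trans (le_of_eq (by norm_num))

theorem integrableOn (h : WeberBounds α δ C R D) {y : ℝ} (hy : 0 < y) :
    IntegrableOn (fun t => R t / t) (Ioi y) := by
  have h1 := intervalIntegrable_div_self h.continuousOn hy four_pos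
  rw [intervalIntegrable_iff] at h1
  refine (h1.union h.integrableOn_four).mono_set fun t ht => ?_
  rcases lt_or_ge 4 t with h4 | h4
  · exact Or.inr h4
  · exact Or.inl ⟨lt_of_le_of_lt (min_le_left _ _) ht, h4.trans (le_max_right _ _)⟩

theorem integral_eq (h : WeberBounds α δ C R D) {y : ℝ} (hy : 0 < y) :
    ∫ t in Ioi y, R t / t = (∫ t in y..4, R t / t) + ∫ t in Ioi 4, R t / t :=
  (intervalIntegral.integral_interval_add_Ioi (h.integrableOn hy) h.integrableOn_four).symm

theorem abs_integral_le (h : WeberBounds α δ C R D) {y : ℝ} (hy : 4 ≤ y) :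
    |∫ t in Ioi y, R t / t| ≤ C := by
  have hy0 : 0 < y := by linarith
  have h1 : ‖∫ t in Ioi y, R t / t‖ ≤ ∫ t in Ioi y, C * t ^ (-(3 / 2) : ℝ) := by
    refine norm_integral_le_of_norm_le ((integrableOn_Ioi_rpow_of_lt (by norm_num)
      hy0).const_mul C) ?_
    filter_upwards [ae_restrict_mem measurableSet_Ioi] with t ht
    have ht4 : 4 ≤ t := hy.trans (le_of_lt ht)
    have ht0 : 0 < t := by linarith
    rw [norm_div, Real.norm_of_nonneg ht0.le, div_le_iff₀ ht0, mul_assoc, ← Real.rpow_add_one ht0.ne']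
    exact (h.largeR t ht4).trans (le_of_eq (by norm_num))
  rw [integral_const_mul, integral_Ioi_rpow_of_lt (by norm_num) hy0] at h1
  refine h1.trans (mul_le_of_le_one_right h.nonneg ?_)
  have h2 : y ^ (-(3 / 2) + 1 : ℝ) ≤ 4 ^ (-(3 / 2) + 1 : ℝ) :=
    Real.rpow_le_rpow_of_nonpos four_pos hy (by norm_num)
  have h3 : (4 : ℝ) ^ (-(3 / 2) + 1 : ℝ) = 1 / 2 := by
    rw [show (-(3 / 2) + 1 : ℝ) = -(1 / 2) by norm_num, Real.rpow_neg (by norm_num),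
      ← Real.sqrt_eq_rpow, show (4 : ℝ) = 2 ^ 2 by norm_num, Real.sqrt_sq (by norm_num), one_div]
  norm_num at h2 h3 ⊢
  linarith

theorem abs_weberTail_le (h : WeberBounds α δ C R D) {y : ℝ} (hy : 0 < y) :
    |weberTail α R D y| ≤ (α ^ 2 + 1) * C * (1 + y ^ (-δ)) := by
  have hC := h.nonneg
  have hp : 0 < y ^ (-δ) := by positivity
  have hp2 : 0 ≤ C * y ^ (-δ) := by positivity
  have hp3 : 0 ≤ α ^ 2 * C := by positivity
  have hp4 : 0 ≤ α ^ 2 * (C * y ^ (-δ)) := by positivity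
  unfold weberTail
  rcases le_total y 4 with h4 | h4
  · have e : α ^ 2 * (∫ t in Ioi y, R t / t) + D y =
        α ^ 2 * (∫ t in Ioi 4, R t / t) + (α ^ 2 * (∫ t in y..4, R t / t) + D y) := by
      rw [h.integral_eq hy]; ring
    rw [e]
    refine (abs_add_le _ _).trans ?_
    rw [abs_mul, abs_of_nonneg (sq_nonneg α)]
    have h1 := mul_le_mul_of_nonneg_left (h.abs_integral_le le_rfl) (sq_nonneg α)
    have h2 := h.small y hy h4
    linarith
  · refine (abs_add_le _ _).trans ?_
    rw [abs_mul, abs_of_nonneg (sq_nonneg α)]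
    have h1 := mul_le_mul_of_nonneg_left (h.abs_integral_le h4) (sq_nonneg α)
    have h2 := h.largeD y h4
    linarith

theorem integral_continuousOn (h : WeberBounds α δ C R D) :
    ContinuousOn (fun y => ∫ t in Ioi y, R t / t) (Ioi 0) := by
  intro y hy
  have hy0 : 0 < y := hy
  have hc : ContinuousOn (fun t => R t / t) (Ioi 0) :=
    h.continuousOn.div continuousOn_id fun t ht => ne_of_gt ht
  have h1 := intervalIntegral.integral_hasDerivAt_right
    (intervalIntegrable_div_self h.continuousOn four_pos hy0)
    (hc.stronglyMeasurableAtFilter isOpen_Ioi y hy) (hc.continuousAt (Ioi_mem_nhds hy))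
  have h2 : ContinuousAt (fun y => (∫ t in Ioi 4, R t / t) - ∫ t in (4 : ℝ)..y, R t / t) y :=
    continuousAt_const.sub h1.continuousAt
  refine (h2.congr ?_).continuousWithinAt
  filter_upwards [lt_mem_nhds hy0] with z hz
  rw [h.integral_eq hz, intervalIntegral.integral_symm]
  ring

theorem weberTail_continuousOn (h : WeberBounds α δ C R D) :
    ContinuousOn (weberTail α R D) (Ioi 0) :=
  (continuousOn_const.mul h.integral_continuousOn).add h.cont

end WeberBounds

theorem weberTail_integrand {α : ℝ} {R D : ℝ → ℝ} {y : ℝ} (hy : 0 < y)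
    (hd : HasDerivAt R (D y / y) y) (h : ℂ) :
    (α : ℂ) ^ 2 * (∫ t in Ioi y, (R t : ℂ) * h / (t * y)) + ((deriv R y : ℝ) : ℂ) * h =
      (weberTail α R D y : ℂ) * (h / y) := by
  have hy' : (y : ℂ) ≠ 0 := by exact_mod_cast hy.ne'
  have e : ∫ t in Ioi y, (R t : ℂ) * h / (t * y) =
      ((∫ t in Ioi y, R t / t : ℝ) : ℂ) * (h / y) := by
    rw [← integral_complex_ofReal, ← integral_mul_const]
    refine integral_congr_ae (ae_of_all _ fun t => ?_)
    push_cast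
    rw [mul_div_mul_comm]
  rw [e, hd.deriv, weberTail]
  push_cast
  field_simp

/-- Integrability of a product with `h(y)/y` from a bound by `1 + y^{-δ}`. -/
theorem integrableOn_mul_div_of_bound {f : ℝ → ℝ} {h : ℝ → ℂ} {δ C : ℝ}
    (hf : ContinuousOn f (Ioi 0)) (hb : ∀ y, 0 < y → |f y| ≤ C * (1 + y ^ (-δ)))
    (h0 : MellinConvergent h (0 : ℝ)) (hδ : MellinConvergent h (-δ : ℝ)) :
    IntegrableOn (fun y => (f y : ℂ) * (h y / y)) (Ioi 0) := by
  have i1 := h0.integrable_norm_rpow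
  have i2 := hδ.integrable_norm_rpow
  refine Integrable.mono' ((i1.add i2).const_mul C) ?_ ?_
  · refine AEStronglyMeasurable.mul
      ((Complex.continuous_ofReal.comp_continuousOn hf).aestronglyMeasurable measurableSet_Ioi) ?_
    exact h0.aestronglyMeasurable.mul
      (Complex.measurable_ofReal.inv).aestronglyMeasurable |>.congr
        (ae_of_all _ fun y => (div_eq_mul_inv _ _).symm)
  · filter_upwards [ae_restrict_mem measurableSet_Ioi] with y hy
    have hy0 : 0 < y := hy
    simp only [Pi.add_apply, Complex.ofReal_re]
    rw [norm_mul, norm_div, Complex.norm_real, Complex.norm_real, Real.norm_eq_abs,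
      Real.norm_of_nonneg hy0.le, Real.rpow_sub_one hy0.ne', Real.rpow_sub_one hy0.ne', Real.rpow_zero]
    calc _ ≤ C * (1 + y ^ (-δ)) * (‖h y‖ / y) := by
          gcongr
          exact hb y hy0
      _ = _ := by ring

theorem WeberBounds.integrableOn_tail {α δ C : ℝ} {R D : ℝ → ℝ} {h : ℝ → ℂ}
    (hW : WeberBounds α δ C R D) (h0 : MellinConvergent h (0 : ℝ))
    (hδ : MellinConvergent h (-δ : ℝ)) :
    IntegrableOn (fun y => (weberTail α R D y : ℂ) * (h y / y)) (Ioi 0) :=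
  integrableOn_mul_div_of_bound hW.weberTail_continuousOn (fun _ hy => hW.abs_weberTail_le hy) h0 hδ

theorem weberRe_continuousOn_order (α : ℝ) {y : ℝ} (hy : 0 < y) :
    ContinuousOn (fun x => weberRe α x y) {0}ᶜ := by
  have h1 := continuousOn_besselPair_order (a := fun x : ℝ => α + Complex.I * x)
    (b := fun x : ℝ => α - Complex.I * x) (by fun_prop) (by fun_prop) hy
  have h2 := continuousOn_besselPair_order (a := fun x : ℝ => Complex.I * x + α)
    (b := fun x : ℝ => Complex.I * x - α) (by fun_prop) (by fun_prop) hy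
  refine ContinuousOn.congr (f := fun x : ℝ =>
    ((besselPair (α + Complex.I * x) (α - Complex.I * x) y *
        Complex.cos (Real.pi * (α - Complex.I * x)) -
      besselPair (Complex.I * x + α) (Complex.I * x - α) y) /
        Complex.sin (Real.pi * (α - Complex.I * x))).re) ?_
    fun x hx => weberRe_eq hy (sin_pi_order_ne_zero hx)
  exact Complex.continuous_re.comp_continuousOn
    (((h1.mul (by fun_prop)).sub h2).continuousOn.div (by fun_prop)
      fun x hx => sin_pi_order_ne_zero hx)

theorem weberReD_continuousOn_order (α : ℝ) {y : ℝ} (hy : 0 < y) :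
    ContinuousOn (fun x => weberReD α x y) {0}ᶜ := by
  have h1 := continuousOn_besselPairD_order (a := fun x : ℝ => α + Complex.I * x)
    (b := fun x : ℝ => α - Complex.I * x) (by fun_prop) (by fun_prop) hy
  have h2 := continuousOn_besselPairD_order (a := fun x : ℝ => Complex.I * x + α)
    (b := fun x : ℝ => Complex.I * x - α) (by fun_prop) (by fun_prop) hy
  exact Complex.continuous_re.comp_continuousOn
    (((h1.mul (by fun_prop)).sub h2).continuousOn.div (by fun_prop)
      fun x hx => sin_pi_order_ne_zero hx)

/-- For fixed `y` the tail function is continuous in `x ≠ 0`. -/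
theorem weberTail_continuousOn_order {α : ℝ} (hα : -(1 / 4) < α) {y : ℝ} (hy : 0 < y) :
    ContinuousOn (fun x => weberTail α (weberRe α x) (weberReD α x) y) {0}ᶜ := by
  intro x₀ hx₀
  obtain ⟨r, hr0, hr⟩ := Metric.isOpen_iff.1 isOpen_compl_singleton x₀ hx₀
  have hK : IsCompact (Metric.closedBall x₀ (r / 2)) := isCompact_closedBall _ _
  have hsub : Metric.closedBall x₀ (r / 2) ⊆ {0}ᶜ :=
    (Metric.closedBall_subset_ball (by linarith)).trans hr
  obtain ⟨C, hC, hW⟩ := weberRe_bounds hα hK (fun x hx => sin_pi_order_ne_zero (hsub hx)) one_pos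
  have hnhds : Metric.closedBall x₀ (r / 2) ∈ 𝓝 x₀ := Metric.closedBall_mem_nhds _ (by linarith)
  have key : ∀ x ∈ Metric.closedBall x₀ (r / 2), weberTail α (weberRe α x) (weberReD α x) y =
      α ^ 2 * ((∫ t in y..4, weberRe α x t / t) + ∫ t in Ioi 4, weberRe α x t / t) +
        weberReD α x y := fun x hx => by
    rw [weberTail, (hW x hx).1.integral_eq hy]
  -- on `[4, ∞)` the uniform decay dominates; on the compact part use `|R| ≤ C((t/4)^α + 1)`
  have c1 : ContinuousAt (fun x => ∫ t in Ioi 4, weberRe α x t / t) x₀ := by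
    refine continuousAt_of_dominated (bound := fun t => C * t ^ (-(3 / 2) : ℝ)) ?_ ?_
      ((integrableOn_Ioi_rpow_of_lt (by norm_num) four_pos).const_mul C) ?_
    · filter_upwards [hnhds] with x hx using (hW x hx).1.integrableOn_four.1
    · filter_upwards [hnhds] with x hx
      filter_upwards [ae_restrict_mem measurableSet_Ioi] with t ht
      have ht4 : 4 ≤ t := le_of_lt ht
      have ht0 : 0 < t := by linarith
      rw [norm_div, Real.norm_of_nonneg ht0.le, div_le_iff₀ ht0, mul_assoc, ← Real.rpow_add_one ht0.ne']
      exact ((hW x hx).1.largeR t ht4).trans (le_of_eq (by norm_num))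
    · filter_upwards [ae_restrict_mem measurableSet_Ioi] with t ht
      have ht0 : 0 < t := lt_trans four_pos ht
      exact ((weberRe_continuousOn_order α ht0).continuousAt
        (isOpen_compl_singleton.mem_nhds hx₀)).div_const t
  have c2 : ContinuousAt (fun x => ∫ t in y..4, weberRe α x t / t) x₀ := by
    have hmin : 0 < min y 4 := lt_min hy four_pos
    refine intervalIntegral.continuousAt_of_dominated_interval
      (bound := fun t => C * ((t / 4) ^ α + 1 + t ^ (-(1 / 2) : ℝ)) / t) ?_ ?_ ?_ ?_
    · filter_upwards [hnhds] with x hx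
      exact (intervalIntegrable_div_self (hW x hx).1.continuousOn hy four_pos).def'.1
    · filter_upwards [hnhds] with x hx
      refine ae_of_all _ fun t ht => ?_
      have ht0 : 0 < t := lt_trans hmin ht.1
      have hp1 : 0 < (t / 4) ^ α := by positivity
      have hp2 : 0 < t ^ (-(1 / 2) : ℝ) := by positivity
      rw [norm_div, Real.norm_of_nonneg ht0.le, Real.norm_eq_abs]
      refine div_le_div_of_nonneg_right ?_ ht0.le
      rcases le_total t 4 with h4 | h4
      · exact ((hW x hx).2 t ht0 h4).1.trans (mul_le_mul_of_nonneg_left (by linarith) hC.le)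
      · exact ((hW x hx).1.largeR t h4).trans (mul_le_mul_of_nonneg_left (by linarith) hC.le)
    · refine intervalIntegrable_div_self (fun t (ht : 0 < t) => ?_) hy four_pos
      have h1 : ContinuousAt (fun t : ℝ => (t / 4) ^ α) t :=
        ContinuousAt.rpow_const (by fun_prop) (Or.inl (by positivity))
      have h2 : ContinuousAt (fun t : ℝ => t ^ (-(1 / 2) : ℝ)) t :=
        ContinuousAt.rpow_const continuousAt_id (Or.inl ht.ne')
      exact (continuousAt_const.mul ((h1.add continuousAt_const).add h2)).continuousWithinAt
    · refine ae_of_all _ fun t ht => ?_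
      have ht0 : 0 < t := lt_trans hmin ht.1
      exact ((weberRe_continuousOn_order α ht0).continuousAt
        (isOpen_compl_singleton.mem_nhds hx₀)).div_const t
  have c3 := (weberReD_continuousOn_order α hy).continuousAt (isOpen_compl_singleton.mem_nhds hx₀)
  have c4 : ContinuousAt (fun x => α ^ 2 * ((∫ t in y..4, weberRe α x t / t) +
      ∫ t in Ioi 4, weberRe α x t / t) + weberReD α x y) x₀ :=
    (continuousAt_const.mul (c2.add c1)).add c3
  refine (c4.congr ?_).continuousWithinAt
  filter_upwards [hnhds] with x hx using (key x hx).symm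



/-! ### Integer order: the logarithmic case `x = 0`, `α ∈ ℕ` -/

theorem hasDerivAt_deriv_order {f f' : ℂ → ℝ → ℂ}
    (hf : ∀ y, 0 < y → Differentiable ℂ fun w => f w y)
    (hf' : ∀ y, 0 < y → Differentiable ℂ fun w => f' w y)
    (hd : ∀ w y, 0 < y → HasDerivAt (f w) (f' w y) y)
    (hc' : ContinuousOn (fun z : ℂ × ℝ => f' z.1 z.2) {z | 0 < z.2}) (n : ℂ) {y : ℝ} (hy : 0 < y) :
    HasDerivAt (fun y => deriv (fun w => f w y) n) (deriv (fun w => f' w y) n) y := by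
  have key : ∀ g : ℂ → ℝ → ℂ, (∀ y, 0 < y → Differentiable ℂ fun w => g w y) → ∀ y, 0 < y →
      deriv (fun w => g w y) n = (2 * Real.pi * Complex.I : ℂ)⁻¹ •
        ∮ z in C(n, 1), ((z - n) ^ 2)⁻¹ • g z y := fun g hg y hy =>
    (Complex.two_pi_I_inv_smul_circleIntegral_sub_sq_inv_smul_of_differentiable isOpen_univ
      (subset_univ _) (hg y hy).differentiableOn (Metric.mem_ball_self one_pos)).symm
  have hpole : ∀ θ : ℝ, circleMap n 1 θ - n ≠ 0 := fun θ h => by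
    have := circleMap_ne_center (c := n) one_ne_zero (θ := θ)
    exact this (sub_eq_zero.1 h)
  have hw : Continuous fun θ : ℝ => deriv (circleMap n 1) θ * ((circleMap n 1 θ - n) ^ 2)⁻¹ := by
    simp only [deriv_circleMap]
    refine Continuous.mul (by fun_prop) (Continuous.inv₀ (by fun_prop) fun θ =>
      pow_ne_zero 2 (hpole θ))
  set s : Set ℝ := Icc (y / 2) (2 * y) with hs
  have hs0 : ∀ t ∈ s, 0 < t := fun t ht => lt_of_lt_of_le (half_pos hy) ht.1
  have hc'' : ContinuousOn (fun z : ℝ × ℝ => f' (circleMap n 1 z.1) z.2) (Icc 0 (2 * Real.pi) ×ˢ s) :=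
    hc'.comp (f := fun z : ℝ × ℝ => (circleMap n 1 z.1, z.2)) (by fun_prop) fun z hz => hs0 _ hz.2
  obtain ⟨M, hM⟩ := (isCompact_Icc.prod isCompact_Icc).exists_bound_of_continuousOn
    ((hw.comp continuous_fst).continuousOn.mul hc'')
  have hcs : ∀ g : ℂ → ℝ → ℂ, (∀ y, 0 < y → Differentiable ℂ fun w => g w y) → ∀ t, 0 < t →
      Continuous fun θ : ℝ => deriv (circleMap n 1) θ * ((circleMap n 1 θ - n) ^ 2)⁻¹ *
        g (circleMap n 1 θ) t := fun g hg t ht =>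
    hw.mul ((hg t ht).continuous.comp (continuous_circleMap n 1))
  have hmain := (intervalIntegral.hasDerivAt_integral_of_dominated_loc_of_deriv_le
    (μ := volume) (a := 0) (b := 2 * Real.pi) (x₀ := y) (s := s) (bound := fun _ => M)
    (F := fun t θ => deriv (circleMap n 1) θ * ((circleMap n 1 θ - n) ^ 2)⁻¹ *
        f (circleMap n 1 θ) t)
    (F' := fun t θ => deriv (circleMap n 1) θ * ((circleMap n 1 θ - n) ^ 2)⁻¹ *
        f' (circleMap n 1 θ) t) (Icc_mem_nhds (by linarith) (by linarith))
    (by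
      filter_upwards [lt_mem_nhds hy] with t ht using (hcs f hf t ht).aestronglyMeasurable)
    ((hcs f hf y hy).intervalIntegrable _ _) (hcs f' hf' y hy).aestronglyMeasurable
    (ae_of_all _ fun θ hθ t ht => by
      rw [uIoc_of_le (by positivity)] at hθ
      exact hM (θ, t) ⟨Ioc_subset_Icc_self hθ, ht⟩)
    intervalIntegrable_const
    (ae_of_all _ fun θ _ t ht => (hd _ t (hs0 t ht)).const_mul _)).2
  have hmain2 := hmain.const_smul (2 * Real.pi * Complex.I : ℂ)⁻¹
  rw [key f' hf' y hy]
  refine (hmain2.congr_of_eventuallyEq ?_).congr_deriv ?_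
  · filter_upwards [lt_mem_nhds hy] with t ht
    rw [key f hf t ht]
    simp only [circleIntegral, smul_eq_mul, mul_assoc, Pi.smul_apply]
  · simp only [circleIntegral, smul_eq_mul, mul_assoc]

theorem besselE_neg_nat (n : ℕ) (w : ℂ) :
    besselE (-n) w = (-w) ^ n * besselE n w ∧
      besselE (-(n + 1 : ℕ)) w = (-w) ^ (n + 1) * besselE (n + 1 : ℕ) w := by
  induction n with
  | zero =>
    refine ⟨by simp, ?_⟩
    have := besselE_recurrence (-1) w
    norm_num at this ⊢
    exact this
  | succ n ih =>
    refine ⟨ih.2, ?_⟩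
    have h1 := besselE_recurrence (-(n + 1 + 1 : ℕ)) w
    have h2 := besselE_recurrence n w
    rw [show (-((n + 1 + 1 : ℕ) : ℂ) + 1) = -((n + 1 : ℕ) : ℂ) by push_cast; ring,
      show (-((n + 1 + 1 : ℕ) : ℂ) + 2) = -(n : ℂ) by push_cast; ring, ih.1, ih.2] at h1
    rw [h1, h2]
    push_cast
    rw [show (n : ℂ) + 1 + 1 = n + 2 by ring]
    ring

/-- Numerator of the quotient defining `Y`. -/
noncomputable def besselYNum (w : ℂ) (y : ℝ) : ℂ :=
  besselG w (y / 4) * Complex.cos (Real.pi * w) - besselG (-w) (y / 4)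

/-- `y d/dy` of `besselYNum`. -/
noncomputable def besselYNumD (w : ℂ) (y : ℝ) : ℂ :=
  besselDG w (y / 4) * Complex.cos (Real.pi * w) - besselDG (-w) (y / 4)

theorem besselG_differentiable_order {w : ℝ} (hw : 0 < w) : Differentiable ℂ fun ν => besselG ν w := by
  have hw' : (w : ℂ) ≠ 0 := by exact_mod_cast hw.ne'
  intro ν
  exact (DifferentiableAt.const_cpow (by fun_prop) (Or.inl hw')).mul (besselE_differentiable_order _ ν)

theorem besselDG_differentiable_order {w : ℝ} (hw : 0 < w) :
    Differentiable ℂ fun ν => besselDG ν w := by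
  have hw' : (w : ℂ) ≠ 0 := by exact_mod_cast hw.ne'
  intro ν
  have h1 := besselE_differentiable_order (w : ℂ) ν
  have h2 : DifferentiableAt ℂ (fun ν : ℂ => besselE (ν + 1) w) ν :=
    DifferentiableAt.comp (g := fun ν => besselE ν w) ν (besselE_differentiable_order (w : ℂ) (ν + 1))
      (by fun_prop)
  have h3 : DifferentiableAt ℂ (fun ν : ℂ => ν / 2) ν := by fun_prop
  exact (DifferentiableAt.const_cpow h3 (Or.inl hw')).mul ((h3.mul h1).sub (h2.const_mul _))

theorem besselYNum_differentiable {y : ℝ} (hy : 0 < y) : Differentiable ℂ fun w => besselYNum w y := by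
  have h := besselG_differentiable_order (show 0 < y / 4 by positivity)
  exact (h.mul (by fun_prop)).sub (h.comp differentiable_neg)

theorem besselYNumD_differentiable {y : ℝ} (hy : 0 < y) :
    Differentiable ℂ fun w => besselYNumD w y := by
  have h := besselDG_differentiable_order (show 0 < y / 4 by positivity)
  exact (h.mul (by fun_prop)).sub (h.comp differentiable_neg)

theorem hasDerivAt_comp_div_four {f f' : ℝ → ℂ} {y : ℝ} (h : HasDerivAt f (f' (y / 4)) (y / 4)) :
    HasDerivAt (fun y => f (y / 4)) (f' (y / 4) / 4) y := by
  have := HasDerivAt.scomp (g₁ := f) (h := fun y => id y / 4) y h ((hasDerivAt_id y).div_const 4)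
  refine this.congr_deriv ?_
  rw [Complex.real_smul]
  push_cast
  ring

theorem besselG_hasDerivAt_div_four (w : ℂ) {y : ℝ} (hy : 0 < y) :
    HasDerivAt (fun y => besselG w (y / 4)) (besselDG w (y / 4) / y) y := by
  refine (hasDerivAt_comp_div_four (f' := fun t => besselDG w t / t)
    (besselG_hasDerivAt w (show 0 < y / 4 by positivity))).congr_deriv ?_
  push_cast
  field_simp

theorem besselDG_hasDerivAt_div_four (w : ℂ) {y : ℝ} (hy : 0 < y) :
    HasDerivAt (fun y => besselDG w (y / 4)) ((w ^ 2 - y) / 4 * besselG w (y / 4) / y) y := by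
  refine (hasDerivAt_comp_div_four (f' := fun t => (w ^ 2 / 4 - t) * besselG w t / t)
    (besselDG_hasDerivAt w (show 0 < y / 4 by positivity))).congr_deriv ?_
  push_cast
  field_simp

theorem continuousOn_besselG_div_four (σ : ℂ → ℂ) (hσ : Continuous σ) :
    ContinuousOn (fun z : ℂ × ℝ => besselG (σ z.1) (z.2 / 4)) {z | 0 < z.2} :=
  continuousOn_besselG.comp (f := fun z : ℂ × ℝ => (σ z.1, z.2 / 4)) (by fun_prop)
    fun z (hz : 0 < z.2) => show 0 < z.2 / 4 by positivity

theorem continuousOn_besselDG_div_four (σ : ℂ → ℂ) (hσ : Continuous σ) :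
    ContinuousOn (fun z : ℂ × ℝ => besselDG (σ z.1) (z.2 / 4)) {z | 0 < z.2} :=
  continuousOn_besselDG.comp (f := fun z : ℂ × ℝ => (σ z.1, z.2 / 4)) (by fun_prop)
    fun z (hz : 0 < z.2) => show 0 < z.2 / 4 by positivity

theorem deriv_besselYNum_hasDerivAt (n : ℂ) {y : ℝ} (hy : 0 < y) :
    HasDerivAt (fun y => deriv (fun w => besselYNum w y) n)
      (deriv (fun w => besselYNumD w y) n / y) y := by
  have h := hasDerivAt_deriv_order (f := besselYNum) (f' := fun w y => besselYNumD w y / y)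
    (fun y hy => besselYNum_differentiable hy) (fun y hy => (besselYNumD_differentiable hy).div_const _)
    (fun w y hy => by
      refine (((besselG_hasDerivAt_div_four w hy).mul_const _).sub
        (besselG_hasDerivAt_div_four (-w) hy)).congr_deriv ?_
      rw [besselYNumD]; ring)
    ((((continuousOn_besselDG_div_four (fun w => w) continuous_id).mul
      (Continuous.continuousOn (by fun_prop))).sub
        (continuousOn_besselDG_div_four (fun w => -w) continuous_neg)).div
      (Continuous.continuousOn (by fun_prop)) fun z (hz : 0 < z.2) => by
        exact_mod_cast hz.ne') n hy
  rwa [deriv_div_const] at h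

theorem deriv_besselYNumD_continuousOn (n : ℂ) :
    ContinuousOn (fun y => deriv (fun w => besselYNumD w y) n) (Ioi 0) := by
  intro y hy
  refine (hasDerivAt_deriv_order (f := besselYNumD)
    (f' := fun w y => ((w ^ 2 - y) / 4 * besselG w (y / 4) * Complex.cos (Real.pi * w) -
      (w ^ 2 - y) / 4 * besselG (-w) (y / 4)) / y)
    (fun y hy => besselYNumD_differentiable hy) (fun y hy => ?_) (fun w y hy => ?_) ?_ n
      hy).continuousAt.continuousWithinAt
  · have h := besselG_differentiable_order (show 0 < y / 4 by positivity)
    have h' : Differentiable ℂ fun w : ℂ => (w ^ 2 - y) / 4 := by fun_prop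
    exact (((h'.mul h).mul (by fun_prop)).sub (h'.mul (h.comp differentiable_neg))).div_const _
  · refine (((besselDG_hasDerivAt_div_four w hy).mul_const _).sub
        (besselDG_hasDerivAt_div_four (-w) hy)).congr_deriv ?_
    ring
  · have h' : Continuous fun z : ℂ × ℝ => (z.1 ^ 2 - z.2) / 4 := by fun_prop
    exact (((h'.continuousOn.mul (continuousOn_besselG_div_four (fun w => w) continuous_id)).mul
      (Continuous.continuousOn (by fun_prop))).sub
        (h'.continuousOn.mul (continuousOn_besselG_div_four (fun w => -w) continuous_neg))).div
      (Continuous.continuousOn (by fun_prop)) fun z (hz : 0 < z.2) => by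
        exact_mod_cast hz.ne'

theorem besselYNum_nat (n : ℕ) {y : ℝ} (hy : 0 < y) : besselYNum n y = 0 := by
  have hw : 0 < y / 4 := by positivity
  have hw' : ((y / 4 : ℝ) : ℂ) ≠ 0 := by exact_mod_cast hw.ne'
  have hcos : Complex.cos (Real.pi * n) = (-1) ^ n := by
    rw [mul_comm]; exact_mod_cast congrArg Complex.ofReal (Real.cos_nat_mul_pi n)
  rw [besselYNum, besselG, besselG, (besselE_neg_nat n _).1, hcos, neg_pow (((y / 4 : ℝ) : ℂ)),
    neg_div]
  have : ((y / 4 : ℝ) : ℂ) ^ ((n : ℂ) / 2) = ((y / 4 : ℝ) : ℂ) ^ (-((n : ℂ) / 2)) *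
      ((y / 4 : ℝ) : ℂ) ^ n := by
    rw [← Complex.cpow_natCast, ← Complex.cpow_add _ _ hw']
    congr 1
    ring
  rw [this]
  ring

/-- At integer order `Y_n` is the derivative in the order of the numerator. -/
theorem besselY_nat (n : ℕ) {y : ℝ} (hy : 0 < y) : besselY n (Real.sqrt y : ℝ) =
    deriv (fun w => besselYNum w y) n / (Real.pi * (-1) ^ n) := by
  have hcos : Complex.cos (Real.pi * n) = (-1) ^ n := by
    rw [mul_comm]; exact_mod_cast congrArg Complex.ofReal (Real.cos_nat_mul_pi n)
  have hsin : Complex.sin (Real.pi * n) = 0 := by rw [mul_comm, Complex.sin_nat_mul_pi]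
  have hpi : (Real.pi : ℂ) ≠ 0 := by exact_mod_cast Real.pi_ne_zero
  have h1 : (-1 : ℂ) ^ n ≠ 0 := pow_ne_zero _ (by norm_num)
  rw [besselY, if_pos hsin]
  refine Tendsto.limUnder_eq ?_
  have hn := ((besselYNum_differentiable hy n).hasDerivAt).tendsto_slope
  have hs : HasDerivAt (fun w : ℂ => Complex.sin (Real.pi * w)) ((-1) ^ n * Real.pi) n := by
    have := ((hasDerivAt_id (n : ℂ)).const_mul (Real.pi : ℂ)).csin
    simpa [hcos] using this
  have := hn.div hs.tendsto_slope (mul_ne_zero h1 hpi)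
  rw [mul_comm ((-1 : ℂ) ^ n)] at this
  refine this.congr' ?_
  filter_upwards [self_mem_nhdsWithin] with w hw
  have hwn : w - n ≠ 0 := sub_ne_zero.2 hw
  simp only [Pi.div_apply, slope_def_field]
  rw [besselYNum_nat n hy, hsin, sub_zero, sub_zero, div_div_div_cancel_right₀ hwn, besselYQuot,
    besselJ_sqrt _ hy, besselJ_sqrt _ hy, besselYNum]

theorem norm_deriv_order_le {f : ℂ → ℂ} (hf : Differentiable ℂ f) (n : ℂ) {r M : ℝ} (hr : 0 < r)
    (h : ∀ w ∈ Metric.closedBall n r, ‖f w‖ ≤ M) : ‖deriv f n‖ ≤ M / r :=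
  Complex.norm_deriv_le_of_forall_mem_sphere_norm_le hr hf.diffContOnCl fun z hz =>
    h z (Metric.sphere_subset_closedBall hz)

/-- The bounds at `x = 0` and `α = n`: near `0` the functions are `O(log y)`, bounded here by
`y^{-δ}` by means of Cauchy's estimate on a circle of radius `2δ` around the order. -/
theorem weberRe_nat_bounds (n : ℕ) {δ : ℝ} (hδ : 0 < δ) : ∃ (C : ℝ) (D : ℝ → ℝ), 0 < C ∧
    WeberBounds n δ C (weberRe n 0) D ∧
      ∀ y, 0 < y → y ≤ 4 → |weberRe n 0 y| ≤ C * y ^ (-δ) ∧ |D y| ≤ C * y ^ (-δ) := by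
  set B := Metric.closedBall (n : ℂ) (2 * δ) with hB
  have h2δ : 0 < 2 * δ := by positivity
  have hBc : IsCompact B := isCompact_closedBall _ _
  have hnB : (n : ℂ) ∈ B := Metric.mem_closedBall_self h2δ.le
  have hSc : IsCompact (B ∪ (fun w => -w) '' B) := hBc.union (hBc.image continuous_neg)
  obtain ⟨C1, hC1, hl⟩ := besselG_large_bound hSc
  obtain ⟨C2, hC2, hsm⟩ := besselG_small_bound hSc
  obtain ⟨K, hK⟩ := hBc.exists_bound_of_continuousOn
    (by fun_prop : Continuous fun w : ℂ => Complex.cos (Real.pi * w)).continuousOn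
  have hK0 : 0 ≤ K := (norm_nonneg _).trans (hK n hnB)
  have hm : ∀ w ∈ B, w ∈ B ∪ (fun w => -w) '' B ∧ -w ∈ B ∪ (fun w => -w) '' B := fun w hw =>
    ⟨Or.inl hw, Or.inr ⟨w, hw, rfl⟩⟩
  have hpi : (Real.pi : ℂ) ≠ 0 := by exact_mod_cast Real.pi_ne_zero
  have h1 : (-1 : ℂ) ^ n ≠ 0 := pow_ne_zero _ (by norm_num)
  set P : ℝ → ℂ := fun y => deriv (fun w => besselYNum w y) n with hP
  set Q : ℝ → ℂ := fun y => deriv (fun w => besselYNumD w y) n with hQ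
  set cst : ℂ := (Real.pi * (-1) ^ n : ℂ)⁻¹ with hcst
  have hcstn : ‖cst‖ ≤ 1 := by
    rw [hcst, norm_inv, norm_mul, norm_pow, norm_neg, norm_one, one_pow, mul_one, Complex.norm_real,
      Real.norm_of_nonneg Real.pi_pos.le]
    exact inv_le_one_of_one_le₀ (by linarith [Real.pi_gt_three])
  have eR : ∀ y, 0 < y → weberRe n 0 y = (cst * (besselG n (y / 4) * P y)).re := fun y hy => by
    rw [weberRe, besselProd]
    simp only [Complex.ofReal_natCast, Complex.ofReal_zero, mul_zero, add_zero, sub_zero]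
    rw [besselJ_sqrt _ hy, besselY_nat n hy]
    congr 1
    rw [hcst, hP]
    ring
  set D : ℝ → ℝ := fun y => (cst * (besselDG n (y / 4) * P y + besselG n (y / 4) * Q y)).re with hD
  have hPd : ∀ y, 0 < y → HasDerivAt P (Q y / y) y := fun y hy => deriv_besselYNum_hasDerivAt n hy
  -- `P` and `Q` are derivatives in the order, so Cauchy's estimate on the circle of radius `2 δ`
  -- bounds them by the Bessel functions at orders in `B` and `-B`
  have hPQ : ∀ y M M', 0 < y → (∀ w ∈ B ∪ (fun w => -w) '' B, ‖besselG w (y / 4)‖ ≤ M) →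
      (∀ w ∈ B ∪ (fun w => -w) '' B, ‖besselDG w (y / 4)‖ ≤ M') →
      ‖P y‖ ≤ (K + 1) / (2 * δ) * M ∧ ‖Q y‖ ≤ (K + 1) / (2 * δ) * M' := fun y M M' hy hM hM' => by
    have e : ∀ N : ℝ, (K + 1) / (2 * δ) * N = (N * K + N) / (2 * δ) := fun N => by ring
    rw [e, e]
    constructor
    · refine norm_deriv_order_le (besselYNum_differentiable hy) _ h2δ fun w hw => ?_
      refine (norm_sub_le _ _).trans (add_le_add ?_ (hM _ (hm w hw).2))
      rw [norm_mul]
      exact mul_le_mul (hM _ (hm w hw).1) (hK w hw) (norm_nonneg _)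
        ((norm_nonneg _).trans (hM _ (hm w hw).1))
    · refine norm_deriv_order_le (besselYNumD_differentiable hy) _ h2δ fun w hw => ?_
      refine (norm_sub_le _ _).trans (add_le_add ?_ (hM' _ (hm w hw).2))
      rw [norm_mul]
      exact mul_le_mul (hM' _ (hm w hw).1) (hK w hw) (norm_nonneg _)
        ((norm_nonneg _).trans (hM' _ (hm w hw).1))
  set L := (K + 1) / (2 * δ) with hL
  have hL0 : 0 < L := by positivity
  have hDle : ∀ y, |D y| ≤ ‖besselDG n (y / 4)‖ * ‖P y‖ + ‖besselG n (y / 4)‖ * ‖Q y‖ := fun y => by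
    refine (abs_re_mul_le _ _).trans ((mul_le_of_le_one_left (norm_nonneg _) hcstn).trans ?_)
    refine (norm_add_le _ _).trans ?_
    rw [norm_mul, norm_mul]
  have hRle : ∀ y, 0 < y → |weberRe n 0 y| ≤ ‖besselG n (y / 4)‖ * ‖P y‖ := fun y hy => by
    rw [eR y hy]
    refine (abs_re_mul_le _ _).trans ((mul_le_of_le_one_left (norm_nonneg _) hcstn).trans ?_)
    rw [norm_mul]
  -- for small `y` the Bessel functions of orders in `B` and `-B` are `O(y^{-(n + 2 δ)/2})`
  have hre : ∀ w ∈ B ∪ (fun w => -w) '' B, -(n + 2 * δ) ≤ w.re := by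
    have h0 : ∀ w ∈ B, |w.re - n| ≤ 2 * δ := fun w hw => by
      have h1 : ‖w - n‖ ≤ 2 * δ := by simpa [hB, dist_eq_norm] using hw
      have h2 := Complex.abs_re_le_norm (w - n)
      simp only [Complex.sub_re, Complex.natCast_re] at h2
      linarith
    have hn0 : (0 : ℝ) ≤ n := n.cast_nonneg
    rintro w (hw | ⟨v, hv, rfl⟩)
    · have := (abs_le.1 (h0 w hw)).1
      linarith
    · have := (abs_le.1 (h0 v hv)).2
      simp only [Complex.neg_re]
      linarith
  have hsmall : ∀ y, 0 < y → y ≤ 4 → |weberRe n 0 y| ≤ 2 * L * C2 ^ 2 * 4 ^ δ * y ^ (-δ) ∧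
      |D y| ≤ 2 * L * C2 ^ 2 * 4 ^ δ * y ^ (-δ) := fun y hy hy4 => by
    have hw : 0 < y / 4 := by positivity
    have hw1 : y / 4 ≤ 1 := by linarith
    set A := (y / 4) ^ (-(n + 2 * δ) / 2) with hA
    have hA0 : 0 < A := by positivity
    have hmono : ∀ w ∈ B ∪ (fun w => -w) '' B, (y / 4) ^ (w.re / 2) ≤ A := fun w hwB =>
      Real.rpow_le_rpow_of_exponent_ge hw hw1 (by linarith [hre w hwB])
    obtain ⟨p1, p2⟩ := hPQ y (C2 * A) (C2 * A) hy
      (fun w hwB => (hsm w hwB _ hw hw1).1.trans (by gcongr; exact hmono w hwB))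
      (fun w hwB => (hsm w hwB _ hw hw1).2.1.trans (by gcongr; exact hmono w hwB))
    obtain ⟨q1, q2, -⟩ := hsm n (Or.inl hnB) _ hw hw1
    rw [Complex.natCast_re] at q1 q2
    set A' := (y / 4) ^ ((n : ℝ) / 2) with hA'
    have hA0' : 0 < A' := by positivity
    have hprod : A' * A = 4 ^ δ * y ^ (-δ) := by
      rw [hA, hA', ← Real.rpow_add hw, show (n : ℝ) / 2 + -(n + 2 * δ) / 2 = -δ by ring,
        Real.div_rpow hy.le (by norm_num), Real.rpow_neg (by norm_num : (0 : ℝ) ≤ 4)]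
      field_simp
    have hx : C2 * A' * (L * (C2 * A)) = L * C2 ^ 2 * (4 ^ δ * y ^ (-δ)) := by
      rw [← hprod]; ring
    constructor
    · refine (hRle y hy).trans ?_
      calc _ ≤ C2 * A' * (L * (C2 * A)) := by gcongr
        _ = L * C2 ^ 2 * (4 ^ δ * y ^ (-δ)) := hx
        _ ≤ _ := by
          have : 0 ≤ L * C2 ^ 2 * (4 ^ δ * y ^ (-δ)) := by positivity
          linarith
    · refine (hDle y).trans ?_
      calc _ ≤ C2 * A' * (L * (C2 * A)) + C2 * A' * (L * (C2 * A)) := by gcongr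
        _ = _ := by rw [hx]; ring
  set C4 := 2 * L * C2 ^ 2 * 4 ^ δ with hC4
  have hC40 : 0 < C4 := by positivity
  have hlarge : ∀ y, 4 ≤ y → |weberRe n 0 y| ≤ 2 * L * C1 ^ 2 * y ^ (-(1 / 2) : ℝ) ∧
      |D y| ≤ 2 * L * C1 ^ 2 := fun y hy4 => by
    have hy : 0 < y := by linarith
    have hw1 : 1 ≤ y / 4 := by linarith
    have hw : 0 < y / 4 := by positivity
    obtain ⟨p1, p2⟩ := hPQ y _ _ hy (fun w hwB => (hl w hwB _ hw1).1) (fun w hwB => (hl w hwB _ hw1).2)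
    obtain ⟨q1, q2⟩ := hl n (Or.inl hnB) _ hw1
    have e1 : (y / 4) ^ (-(1 / 4) : ℝ) * (y / 4) ^ (-(1 / 4) : ℝ) = 2 * y ^ (-(1 / 2) : ℝ) := by
      rw [← Real.rpow_add hw, Real.div_rpow (by linarith) (by norm_num)]
      have : (4 : ℝ) ^ (-(1 / 4) + -(1 / 4) : ℝ) = 1 / 2 := by
        rw [show (-(1 / 4) + -(1 / 4) : ℝ) = -(1 / 2) by norm_num, Real.rpow_neg (by norm_num),
          ← Real.sqrt_eq_rpow, show (4 : ℝ) = 2 ^ 2 by norm_num, Real.sqrt_sq (by norm_num), one_div]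
      rw [this, show (-(1 / 4) + -(1 / 4) : ℝ) = -(1 / 2) by norm_num]
      ring
    have e2 : (y / 4) ^ (1 / 4 : ℝ) * (y / 4) ^ (-(1 / 4) : ℝ) = 1 := by
      rw [← Real.rpow_add hw]; simp
    constructor
    · refine (hRle y hy).trans ?_
      calc _ ≤ C1 * (y / 4) ^ (-(1 / 4) : ℝ) * (L * (C1 * (y / 4) ^ (-(1 / 4) : ℝ))) := by gcongr
        _ = L * C1 ^ 2 * ((y / 4) ^ (-(1 / 4) : ℝ) * (y / 4) ^ (-(1 / 4) : ℝ)) := by ring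
        _ = _ := by rw [e1]; ring
    · refine (hDle y).trans ?_
      calc _ ≤ C1 * (y / 4) ^ (1 / 4 : ℝ) * (L * (C1 * (y / 4) ^ (-(1 / 4) : ℝ))) +
            C1 * (y / 4) ^ (-(1 / 4) : ℝ) * (L * (C1 * (y / 4) ^ (1 / 4 : ℝ))) := by gcongr
        _ = 2 * L * C1 ^ 2 * ((y / 4) ^ (1 / 4 : ℝ) * (y / 4) ^ (-(1 / 4) : ℝ)) := by ring
        _ = _ := by rw [e2, mul_one]
  set C3 := 2 * L * C1 ^ 2 with hC3
  have hC30 : 0 < C3 := by positivity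
  set C5 := ((n : ℝ) ^ 2 / δ + 1) * C4 with hC5
  have hC45 : C4 ≤ C5 := le_mul_of_one_le_left hC40.le (by
    have : (0 : ℝ) ≤ (n : ℝ) ^ 2 / δ := by positivity
    linarith)
  refine ⟨C3 + C5, D, by linarith, ⟨fun y hy => ?_, ?_, fun y hy => ?_, fun y hy => ?_,
    fun y hy hy4 => ?_⟩, fun y hy hy4 => ?_⟩
  · have h := Complex.reCLM.hasFDerivAt.comp_hasDerivAt y
      (((besselG_hasDerivAt_div_four n hy).mul (hPd y hy)).const_mul cst)
    refine (h.congr_of_eventuallyEq ?_).congr_deriv ?_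
    · filter_upwards [lt_mem_nhds hy] with t ht
      rw [eR t ht]
      rfl
    · rw [hD, ← Complex.div_ofReal_re]
      simp only [Complex.reCLM_apply]
      congr 1
      ring
  · have hG : ContinuousOn (fun y : ℝ => besselG n (y / 4)) (Ioi 0) := fun y hy =>
      (besselG_hasDerivAt_div_four n hy).continuousAt.continuousWithinAt
    have hDG : ContinuousOn (fun y : ℝ => besselDG n (y / 4)) (Ioi 0) := fun y hy =>
      (besselDG_hasDerivAt_div_four n hy).continuousAt.continuousWithinAt
    have hPc : ContinuousOn P (Ioi 0) := fun y hy => (hPd y hy).continuousAt.continuousWithinAt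
    exact Complex.continuous_re.comp_continuousOn (continuousOn_const.mul
      ((hDG.mul hPc).add (hG.mul (deriv_besselYNumD_continuousOn n))))
  · refine (hlarge y hy).1.trans ?_
    have : 0 ≤ y ^ (-(1 / 2) : ℝ) := Real.rpow_nonneg (by linarith) _
    gcongr
    linarith
  · exact (hlarge y hy).2.trans (by linarith)
  · refine (tail_of_bound hδ (fun y hy hy4 => (hsmall y hy hy4).1)
      (fun y hy hy4 => (hsmall y hy hy4).2) hy hy4).trans ?_
    rw [← hC5]
    gcongr
    linarith
  · obtain ⟨a1, a2⟩ := hsmall y hy hy4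
    have : 0 < y ^ (-δ) := by positivity
    exact ⟨a1.trans (by gcongr; linarith), a2.trans (by gcongr; linarith)⟩



/-! ### Gaussian means and Gaussian-damped line integrals -/

/-- The mean of `f` against the Gaussian density `π^{-1/2} e^{-u²}`. -/
noncomputable def gaussMean (f : ℝ → ℂ) : ℂ :=
  ((Real.sqrt Real.pi : ℝ) : ℂ)⁻¹ * ∫ u : ℝ, f u * (Real.exp (-u ^ 2) : ℝ)

theorem integrable_exp_abs_mul_exp_neg_sq (B : ℝ) :
    Integrable fun u : ℝ => Real.exp (B * |u|) * Real.exp (-u ^ 2) := by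
  have h : ∀ b : ℝ, Integrable fun u : ℝ => Real.exp (b * u) * Real.exp (-u ^ 2) := fun b => by
    have h1 := (integrable_cexp_quadratic (b := 1) (by simp) (b : ℂ) 0).norm
    refine h1.congr (ae_of_all _ fun u => ?_)
    beta_reduce
    rw [Complex.norm_exp, ← Real.exp_add]
    congr 1
    have : (-1 * (u : ℂ) ^ 2 + b * u + 0) = ((-u ^ 2 + b * u : ℝ) : ℂ) := by push_cast; ring
    rw [this, Complex.ofReal_re]
    ring
  refine Integrable.mono' ((h B).add (h (-B))) (by fun_prop) (ae_of_all _ fun u => ?_)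
  rw [Real.norm_of_nonneg (by positivity)]
  simp only [Pi.add_apply]
  have h1 : 0 < Real.exp (B * u) := Real.exp_pos _
  have h2 : 0 < Real.exp (-B * u) := Real.exp_pos _
  rw [← add_mul]
  refine mul_le_mul_of_nonneg_right ?_ (Real.exp_pos _).le
  rcases abs_cases u with ⟨h, _⟩ | ⟨h, _⟩
  · rw [h]; linarith
  · rw [h, mul_neg, ← neg_mul]; linarith

theorem sqrt_pi_ne_zero : ((Real.sqrt Real.pi : ℝ) : ℂ) ≠ 0 := by
  exact_mod_cast (Real.sqrt_pos.2 Real.pi_pos).ne'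

theorem cexp_mul_exp_neg_sq (a : ℂ) (u : ℝ) :
    Complex.exp (2 * a * u) * (Real.exp (-u ^ 2) : ℝ) =
      Complex.exp (-1 * (u : ℂ) ^ 2 + 2 * a * u + 0) := by
  rw [Complex.ofReal_exp, ← Complex.exp_add]
  congr 1
  push_cast
  ring

theorem integral_cexp_mul_exp_neg_sq (a : ℂ) :
    ∫ u : ℝ, Complex.exp (2 * a * u) * (Real.exp (-u ^ 2) : ℝ) =
      (Real.sqrt Real.pi : ℝ) * Complex.exp (a ^ 2) := by
  simp_rw [cexp_mul_exp_neg_sq]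
  rw [integral_cexp_quadratic (by simp)]
  have h1 : (Real.pi / - -1 : ℂ) ^ (1 / 2 : ℂ) = (Real.sqrt Real.pi : ℝ) := by
    rw [neg_neg, div_one, Real.sqrt_eq_rpow, Complex.ofReal_cpow Real.pi_pos.le]
    norm_num
  rw [h1]
  congr 2
  ring

theorem gaussMean_cexp (a : ℂ) :
    gaussMean (fun u => Complex.exp (2 * a * u)) = Complex.exp (a ^ 2) := by
  rw [gaussMean, integral_cexp_mul_exp_neg_sq, inv_mul_cancel_left₀ sqrt_pi_ne_zero]

theorem integrable_cexp_mul_exp_neg_sq (a : ℂ) :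
    Integrable fun u : ℝ => Complex.exp (2 * a * u) * (Real.exp (-u ^ 2) : ℝ) := by
  simp_rw [cexp_mul_exp_neg_sq]
  exact integrable_cexp_quadratic (by simp) _ _

theorem norm_cexp_two_mul (a : ℂ) (u : ℝ) : ‖Complex.exp (2 * a * u)‖ = Real.exp (2 * a.re * u) := by
  rw [show (2 * a * u : ℂ) = (2 * a : ℂ) * u by ring, norm_cexp_real_mul]
  simp

theorem abs_le_exp_abs (u : ℝ) : |u| ≤ Real.exp |u| := by
  linarith [Real.add_one_le_exp |u|]

theorem integrable_mul_cexp_mul_exp_neg_sq (a : ℂ) :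
    Integrable fun u : ℝ => (u * Complex.exp (2 * a * u)) * (Real.exp (-u ^ 2) : ℝ) := by
  refine Integrable.mono' (integrable_exp_abs_mul_exp_neg_sq (1 + |2 * a.re|)) (by fun_prop)
    (ae_of_all _ fun u => ?_)
  rw [norm_mul, norm_mul, norm_cexp_two_mul, Complex.norm_real, Complex.norm_real,
    Real.norm_of_nonneg (Real.exp_pos _).le, add_mul, one_mul, Real.exp_add]
  have h1 : 2 * a.re * u ≤ |2 * a.re| * |u| := (le_abs_self _).trans (abs_mul _ _).le
  gcongr
  exact abs_le_exp_abs u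

theorem gaussMean_mul_cexp (a : ℂ) :
    gaussMean (fun u => u * Complex.exp (2 * a * u)) = a * Complex.exp (a ^ 2) := by
  have hd : ∀ u : ℝ, HasDerivAt
      (fun u : ℝ => Complex.exp (2 * a * u) * (Real.exp (-u ^ 2) : ℝ))
      (2 * a * (Complex.exp (2 * a * u) * (Real.exp (-u ^ 2) : ℝ)) -
        2 * ((u * Complex.exp (2 * a * u)) * (Real.exp (-u ^ 2) : ℝ))) u := fun u => by
    have h0 : HasDerivAt (fun u : ℝ => (u : ℂ)) 1 u := Complex.ofRealCLM.hasDerivAt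
    have h1 : HasDerivAt (fun u : ℝ => -1 * (u : ℂ) ^ 2 + 2 * a * u + 0)
        (-1 * (2 * (u : ℂ)) + 2 * a) u := by
      have := (((h0.pow 2).const_mul (-1)).add (h0.const_mul (2 * a))).add_const 0
      refine this.congr_deriv ?_
      simp
    have h2 := h1.cexp
    simp_rw [← cexp_mul_exp_neg_sq] at h2
    refine h2.congr_deriv ?_
    ring
  have i1 := integrable_cexp_mul_exp_neg_sq a
  have i2 := integrable_mul_cexp_mul_exp_neg_sq a
  have h := integral_eq_zero_of_hasDerivAt_of_integrable hd
    ((i1.const_mul (2 * a)).sub (i2.const_mul 2)) i1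
  rw [integral_sub (i1.const_mul _) (i2.const_mul _), integral_const_mul, integral_const_mul,
    integral_cexp_mul_exp_neg_sq] at h
  rw [gaussMean]
  have h' : ∫ u : ℝ, (u * Complex.exp (2 * a * u)) * (Real.exp (-u ^ 2) : ℝ) =
      a * ((Real.sqrt Real.pi : ℝ) * Complex.exp (a ^ 2)) := by linear_combination -(1 / 2) * h
  rw [h', mul_left_comm, inv_mul_cancel_left₀ sqrt_pi_ne_zero]

/-- Interchange of a Gaussian mean with a line integral. -/
theorem gaussMean_line_integral {H : ℝ → ℂ} (hH : Integrable H) {q : ℝ → ℂ} (hq : Continuous q)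
    (hqb : ∀ u, ‖q u‖ ≤ Real.exp |u|) (ε c : ℝ) :
    gaussMean (fun u => q u * ∫ t : ℝ, H t * Complex.exp (2 * (ε * (c + t * Complex.I)) * u)) =
      ∫ t : ℝ, H t * gaussMean fun u => q u * Complex.exp (2 * (ε * (c + t * Complex.I)) * u) := by
  have hprod : Integrable (Function.uncurry fun (u t : ℝ) => q u *
      (H t * Complex.exp (2 * (ε * (c + t * Complex.I)) * u)) * (Real.exp (-u ^ 2) : ℝ))
      (volume.prod volume) := by
    have h1 := (integrable_exp_abs_mul_exp_neg_sq (1 + |2 * (ε * c)|)).mul_prod hH.norm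
    refine Integrable.mono' h1 ?_ (ae_of_all _ fun z => ?_)
    · refine AEStronglyMeasurable.mul (AEStronglyMeasurable.mul ?_ (AEStronglyMeasurable.mul
        hH.aestronglyMeasurable.comp_snd ?_)) ?_
      · exact (hq.comp continuous_fst).aestronglyMeasurable
      · exact Continuous.aestronglyMeasurable (by fun_prop)
      · exact Continuous.aestronglyMeasurable (by fun_prop)
    · obtain ⟨u, t⟩ := z
      simp only [Function.uncurry]
      rw [norm_mul, norm_mul, norm_mul, norm_cexp_two_mul, Complex.norm_real,
        Real.norm_of_nonneg (Real.exp_pos _).le, add_mul, one_mul, Real.exp_add]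
      have h2 : (ε * (c + t * Complex.I) : ℂ).re = ε * c := by simp
      rw [h2]
      have h1 : 2 * (ε * c) * u ≤ |2 * (ε * c)| * |u| := (le_abs_self _).trans (abs_mul _ _).le
      calc _ ≤ Real.exp |u| * (‖H t‖ * Real.exp (|2 * (ε * c)| * |u|)) * Real.exp (-u ^ 2) := by
            gcongr
            exact hqb u
        _ = _ := by ring
  have h := integral_integral_swap hprod
  simp only [gaussMean]
  have e1 : ∀ u : ℝ, (q u * ∫ t : ℝ, H t * Complex.exp (2 * (ε * (c + t * Complex.I)) * u)) *
      (Real.exp (-u ^ 2) : ℝ) = ∫ t : ℝ, q u *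
      (H t * Complex.exp (2 * (ε * (c + t * Complex.I)) * u)) * (Real.exp (-u ^ 2) : ℝ) := fun u => by
    rw [integral_mul_const, integral_const_mul]
  simp_rw [e1]
  rw [h, ← integral_const_mul]
  refine integral_congr_ae (ae_of_all _ fun t => ?_)
  beta_reduce
  rw [mul_left_comm (H t), ← integral_const_mul (H t)]
  congr 1
  refine integral_congr_ae (ae_of_all _ fun u => ?_)
  simp only
  ring

theorem gaussMean_line_integral_one {H : ℝ → ℂ} (hH : Integrable H) (ε c : ℝ) :
    gaussMean (fun u => ∫ t : ℝ, H t * Complex.exp (2 * (ε * (c + t * Complex.I)) * u)) =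
      ∫ t : ℝ, H t * Complex.exp ((ε * (c + t * Complex.I)) ^ 2) := by
  have h := gaussMean_line_integral hH (q := fun _ => 1) continuous_const
    (fun u => by simp) ε c
  simpa only [one_mul, gaussMean_cexp] using h

theorem gaussMean_line_integral_id {H : ℝ → ℂ} (hH : Integrable H) (ε c : ℝ) :
    gaussMean (fun u => u * ∫ t : ℝ, H t * Complex.exp (2 * (ε * (c + t * Complex.I)) * u)) =
      ∫ t : ℝ, H t * (ε * (c + t * Complex.I) * Complex.exp ((ε * (c + t * Complex.I)) ^ 2)) := by
  have h := gaussMean_line_integral hH (q := fun u => (u : ℂ)) Complex.continuous_ofReal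
    (fun u => by rw [Complex.norm_real]; exact abs_le_exp_abs u) ε c
  simpa only [gaussMean_mul_cexp] using h

theorem norm_cexp_sq_line (ε c t : ℝ) :
    ‖Complex.exp ((ε * (c + t * Complex.I)) ^ 2)‖ = Real.exp (ε ^ 2 * c ^ 2) *
      Real.exp (-(ε ^ 2 * t ^ 2)) := by
  rw [Complex.norm_exp, ← Real.exp_add]
  congr 1
  have : (ε * (c + t * Complex.I) : ℂ) ^ 2 = ((ε ^ 2 * c ^ 2 - ε ^ 2 * t ^ 2 : ℝ) : ℂ) +
      ((2 * ε ^ 2 * c * t : ℝ) : ℂ) * Complex.I := by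
    push_cast
    linear_combination (ε : ℂ) ^ 2 * t ^ 2 * Complex.I_sq
  rw [this, Complex.add_re, Complex.ofReal_re, Complex.re_ofReal_mul, Complex.I_re]
  ring

theorem exp_mul_exp_neg_sq_le {K t : ℝ} {ε : ℝ} (hε : 0 < ε) :
    Real.exp (K * |t|) * Real.exp (-(ε ^ 2 * t ^ 2)) ≤
      Real.exp ((K + 1) ^ 2 / (4 * ε ^ 2)) * Real.exp (-|t|) := by
  rw [← Real.exp_add, ← Real.exp_add, Real.exp_le_exp, ← sub_nonneg]
  have : (K + 1) ^ 2 / (4 * ε ^ 2) + -|t| - (K * |t| + -(ε ^ 2 * t ^ 2)) =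
      ((K + 1) / (2 * ε) - ε * |t|) ^ 2 := by
    rw [← sq_abs t]
    field_simp
    ring
  rw [this]
  positivity

theorem integrable_exp_neg_abs : Integrable fun t : ℝ => Real.exp (-|t|) := by
  refine integrable_of_exp_bounds (a := 1) (b := 1) (C := 1)
    (Continuous.aestronglyMeasurable (by fun_prop)) one_pos one_pos (fun l hl => ?_) fun l hl => ?_
  · rw [Real.norm_of_nonneg (Real.exp_pos _).le, abs_of_nonpos hl]; simp
  · rw [Real.norm_of_nonneg (Real.exp_pos _).le, abs_of_pos hl]; simp

/-- Gaussian damping makes a function of exponential growth integrable on a vertical line. -/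
theorem integrable_mul_cexp_sq_line {A : ℝ → ℂ} (hA : Continuous A) {C K ε : ℝ} (hε : 0 < ε) (c : ℝ)
    (hb : ∀ t, ‖A t‖ ≤ C * Real.exp (K * |t|)) :
    Integrable fun t : ℝ => A t * Complex.exp ((ε * (c + t * Complex.I)) ^ 2) := by
  refine Integrable.mono' (integrable_exp_neg_abs.const_mul
    (C * Real.exp (ε ^ 2 * c ^ 2) * Real.exp ((K + 1) ^ 2 / (4 * ε ^ 2))))
    (Continuous.aestronglyMeasurable (by fun_prop)) (ae_of_all _ fun t => ?_)
  have hC : 0 ≤ C := nonneg_of_mul_nonneg_left ((norm_nonneg _).trans (hb 0)) (Real.exp_pos _)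
  rw [norm_mul, norm_cexp_sq_line]
  calc _ ≤ C * Real.exp (K * |t|) * (Real.exp (ε ^ 2 * c ^ 2) * Real.exp (-(ε ^ 2 * t ^ 2))) := by
        gcongr
        exact hb t
    _ = C * Real.exp (ε ^ 2 * c ^ 2) * (Real.exp (K * |t|) * Real.exp (-(ε ^ 2 * t ^ 2))) := by ring
    _ ≤ C * Real.exp (ε ^ 2 * c ^ 2) *
        (Real.exp ((K + 1) ^ 2 / (4 * ε ^ 2)) * Real.exp (-|t|)) := by
        gcongr ?_ * ?_
        exact exp_mul_exp_neg_sq_le hε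
    _ = _ := by ring

/-- Cauchy's theorem for a function of exponential growth damped by a Gaussian. -/
theorem integral_mul_cexp_sq_line_eq {A : ℂ → ℂ} {a b C K ε : ℝ} (hε : 0 < ε) (hab : a ≤ b)
    (hd : ∀ z : ℂ, a ≤ z.re → z.re ≤ b → DifferentiableAt ℂ A z)
    (hb : ∀ z : ℂ, a ≤ z.re → z.re ≤ b → ‖A z‖ ≤ C * Real.exp (K * |z.im|)) :
    ∫ t : ℝ, A (a + t * Complex.I) * Complex.exp ((ε * (a + t * Complex.I)) ^ 2) =
      ∫ t : ℝ, A (b + t * Complex.I) * Complex.exp ((ε * (b + t * Complex.I)) ^ 2) := by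
  have hcont : ∀ c : ℝ, a ≤ c → c ≤ b → Continuous fun t : ℝ => A (c + t * Complex.I) :=
    fun c h1 h2 => continuous_iff_continuousAt.2 fun t => by
      have h3 := (hd (c + t * Complex.I) (by simpa using h1) (by simpa using h2)).continuousAt
      exact ContinuousAt.comp (f := fun t : ℝ => (c + t * Complex.I : ℂ)) h3 (by fun_prop)
  have hbl : ∀ c : ℝ, a ≤ c → c ≤ b → ∀ t : ℝ,
      ‖A (c + t * Complex.I)‖ ≤ C * Real.exp (K * |t|) := fun c h1 h2 t => by
    simpa using hb (c + t * Complex.I) (by simpa using h1) (by simpa using h2)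
  have hC : 0 ≤ C := nonneg_of_mul_nonneg_left ((norm_nonneg _).trans (hbl a le_rfl hab 0))
    (Real.exp_pos _)
  refine integral_vertical_line_eq (f := fun z => A z * Complex.exp ((ε * z) ^ 2)) hab
    (fun z h1 h2 => (hd z h1 h2).mul (by fun_prop)) (fun η hη => ?_)
    (integrable_mul_cexp_sq_line (hcont a le_rfl hab) hε a (hbl a le_rfl hab))
    (integrable_mul_cexp_sq_line (hcont b hab le_rfl) hε b (hbl b hab le_rfl))
  set M := C * Real.exp (ε ^ 2 * (a ^ 2 + b ^ 2)) * Real.exp ((K + 1) ^ 2 / (4 * ε ^ 2)) with hM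
  have hM0 : 0 ≤ M := by positivity
  refine ⟨M / η, fun z h1 h2 hz => ?_⟩
  have hz' : z = ((z.re : ℝ) : ℂ) + (z.im : ℝ) * Complex.I := (Complex.re_add_im z).symm
  have hre : z.re ^ 2 ≤ a ^ 2 + b ^ 2 := by
    rcases le_total 0 z.re with h | h <;> nlinarith
  have hn : ‖Complex.exp ((ε * z) ^ 2)‖ =
      Real.exp (ε ^ 2 * z.re ^ 2) * Real.exp (-(ε ^ 2 * z.im ^ 2)) := by
    conv_lhs => rw [hz']
    exact norm_cexp_sq_line ε z.re z.im
  rw [norm_mul, hn]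
  calc _ ≤ C * Real.exp (K * |z.im|) *
        (Real.exp (ε ^ 2 * (a ^ 2 + b ^ 2)) * Real.exp (-(ε ^ 2 * z.im ^ 2))) := by
        gcongr
        exact hb z h1 h2
    _ = C * Real.exp (ε ^ 2 * (a ^ 2 + b ^ 2)) *
        (Real.exp (K * |z.im|) * Real.exp (-(ε ^ 2 * z.im ^ 2))) := by ring
    _ ≤ C * Real.exp (ε ^ 2 * (a ^ 2 + b ^ 2)) *
        (Real.exp ((K + 1) ^ 2 / (4 * ε ^ 2)) * Real.exp (-|z.im|)) := by
        gcongr ?_ * ?_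
        exact exp_mul_exp_neg_sq_le hε
    _ = M * Real.exp (-|z.im|) := by rw [hM]; ring
    _ ≤ η := by
        rw [Real.exp_neg, ← div_eq_mul_inv, div_le_iff₀ (Real.exp_pos _)]
        rw [div_le_iff₀ hη] at hz
        calc M ≤ η * |z.im| := by linarith
          _ ≤ η * Real.exp |z.im| := by
            gcongr
            linarith [Real.add_one_le_exp |z.im|]

/-- The two-sided Laplace transform of a Gaussian, on a vertical line. -/
theorem integral_cexp_sq_add_line {ε : ℝ} (hε : 0 < ε) (c d : ℝ) :
    ∫ t : ℝ, Complex.exp ((ε * (c + t * Complex.I)) ^ 2) *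
      Complex.exp (2 * (c + t * Complex.I) * d) =
    ((Real.sqrt Real.pi / ε * Real.exp (-(d / ε) ^ 2) : ℝ) : ℂ) := by
  have hε' : (ε : ℂ) ≠ 0 := by exact_mod_cast hε.ne'
  have h : ∀ t : ℝ, Complex.exp ((ε * (c + t * Complex.I)) ^ 2) *
      Complex.exp (2 * (c + t * Complex.I) * d) =
      Complex.exp (-(ε : ℂ) ^ 2 * t ^ 2 + 2 * (ε ^ 2 * c + d) * Complex.I * t +
        (ε ^ 2 * c ^ 2 + 2 * c * d)) := fun t => by
    rw [← Complex.exp_add]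
    congr 1
    linear_combination (ε : ℂ) ^ 2 * t ^ 2 * Complex.I_sq
  simp_rw [h]
  have hre : (-(ε : ℂ) ^ 2).re < 0 := by
    have : (-(ε : ℂ) ^ 2) = ((-ε ^ 2 : ℝ) : ℂ) := by push_cast; ring
    rw [this, Complex.ofReal_re]
    nlinarith
  rw [integral_cexp_quadratic hre]
  have h1 : (Real.pi / -(-(ε : ℂ) ^ 2)) ^ (1 / 2 : ℂ) = ((Real.sqrt Real.pi / ε : ℝ) : ℂ) := by
    have e1 : (Real.pi / -(-(ε : ℂ) ^ 2)) = ((Real.pi / ε ^ 2 : ℝ) : ℂ) := by push_cast; ring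
    have e2 : Real.sqrt Real.pi / ε = (Real.pi / ε ^ 2) ^ (1 / 2 : ℝ) := by
      rw [← Real.sqrt_eq_rpow, Real.sqrt_div Real.pi_pos.le, Real.sqrt_sq hε.le]
    rw [e1, e2, Complex.ofReal_cpow (by positivity)]
    norm_num
  rw [h1, Complex.ofReal_mul, Complex.ofReal_exp]
  congr 2
  push_cast
  field_simp
  linear_combination 4 * (-(ε : ℂ) ^ 2 * c - d) ^ 2 * Complex.I_sq

theorem norm_gaussMean_le {f : ℝ → ℂ} {M : ℝ} (hf : ∀ u, ‖f u‖ ≤ M) :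
    ‖gaussMean f‖ ≤ M := by
  have h0 : 0 < Real.sqrt Real.pi := Real.sqrt_pos.2 Real.pi_pos
  have hi : Integrable fun u : ℝ => Real.exp (-u ^ 2) := by
    simpa using integrable_exp_neg_mul_sq one_pos
  have hI : ∫ u : ℝ, Real.exp (-u ^ 2) = Real.sqrt Real.pi := by
    simpa using integral_gaussian 1
  have h1 : ‖∫ u : ℝ, f u * (Real.exp (-u ^ 2) : ℝ)‖ ≤ ∫ u : ℝ, M * Real.exp (-u ^ 2) := by
    refine norm_integral_le_of_norm_le (hi.const_mul M) (ae_of_all _ fun u => ?_)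
    rw [norm_mul, Complex.norm_real, Real.norm_of_nonneg (Real.exp_pos _).le]
    gcongr
    exact hf u
  rw [integral_const_mul, hI] at h1
  rw [gaussMean, norm_mul, norm_inv, Complex.norm_real, Real.norm_of_nonneg h0.le, inv_mul_le_iff₀ h0]
  linarith

/-- Gaussian means of functions `F ε` that converge pointwise to a constant `L`, under a common
exponential bound. -/
theorem tendsto_gaussMean {F : ℝ → ℝ → ℂ} {B M : ℝ} {L : ℂ} {l : Filter ℝ} [l.IsCountablyGenerated]
    (hm : ∀ ε, AEStronglyMeasurable (F ε)) (hb : ∀ᶠ ε in l, ∀ u, ‖F ε u‖ ≤ M * Real.exp (B * |u|))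
    (hL : ∀ u, Tendsto (fun ε => F ε u) l (𝓝 L)) :
    Tendsto (fun ε => gaussMean (F ε)) l (𝓝 L) := by
  have hI : ∫ u : ℝ, L * (Real.exp (-u ^ 2) : ℝ) = L * (Real.sqrt Real.pi : ℝ) := by
    rw [integral_const_mul, integral_complex_ofReal]
    congr 2
    simpa using integral_gaussian 1
  have h := tendsto_integral_filter_of_dominated_convergence (μ := volume) (l := l)
    (F := fun ε u => F ε u * (Real.exp (-u ^ 2) : ℝ)) (f := fun u => L * (Real.exp (-u ^ 2) : ℝ))
    (fun u => M * (Real.exp (B * |u|) * Real.exp (-u ^ 2)))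
    (Eventually.of_forall fun ε => (hm ε).mul (Continuous.aestronglyMeasurable (by fun_prop)))
    (hb.mono fun ε h => ae_of_all _ fun u => by
      rw [norm_mul, Complex.norm_real, Real.norm_of_nonneg (Real.exp_pos _).le, ← mul_assoc]
      exact mul_le_mul_of_nonneg_right (h u) (Real.exp_pos _).le)
    ((integrable_exp_abs_mul_exp_neg_sq B).const_mul M)
    (ae_of_all _ fun u => (hL u).mul_const _)
  rw [hI] at h
  have h2 := h.const_mul ((Real.sqrt Real.pi : ℝ) : ℂ)⁻¹
  rwa [mul_left_comm, inv_mul_cancel₀ sqrt_pi_ne_zero, mul_one] at h2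



/-! ### Gaussian means of the tail combination in the multiplicative variable -/

theorem integrable_mul_exp_neg_sq {f : ℝ → ℂ} (hm : AEStronglyMeasurable f) {M B : ℝ}
    (hb : ∀ u, ‖f u‖ ≤ M * Real.exp (B * |u|)) :
    Integrable fun u : ℝ => f u * (Real.exp (-u ^ 2) : ℝ) := by
  refine Integrable.mono' ((integrable_exp_abs_mul_exp_neg_sq B).const_mul M)
    (hm.mul (Continuous.aestronglyMeasurable (by fun_prop))) (ae_of_all _ fun u => ?_)
  rw [norm_mul, Complex.norm_real, Real.norm_of_nonneg (Real.exp_pos _).le, ← mul_assoc]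
  exact mul_le_mul_of_nonneg_right (hb u) (Real.exp_pos _).le

theorem mul_exp_cpow_neg {y : ℝ} (hy : 0 < y) (ε u : ℝ) (s : ℂ) :
    ((y * Real.exp (-(2 * ε * u)) : ℝ) : ℂ) ^ (-s) =
      (y : ℂ) ^ (-s) * Complex.exp (2 * (ε * s) * u) := by
  have hy' : (y : ℂ) ≠ 0 := by exact_mod_cast hy.ne'
  have hp : 0 < y * Real.exp (-(2 * ε * u)) := by positivity
  have hp' : ((y * Real.exp (-(2 * ε * u)) : ℝ) : ℂ) ≠ 0 := by exact_mod_cast hp.ne'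
  rw [Complex.cpow_def_of_ne_zero hy', Complex.cpow_def_of_ne_zero hp', ← Complex.ofReal_log hp.le,
    ← Complex.ofReal_log hy.le, Real.log_mul hy.ne' (Real.exp_pos _).ne', Real.log_exp,
    ← Complex.exp_add]
  congr 1
  push_cast
  ring

theorem norm_cpow_neg_line {y : ℝ} (hy : 0 < y) (c t : ℝ) :
    ‖(y : ℂ) ^ (-((c : ℂ) + t * Complex.I))‖ = y ^ (-c) := by
  rw [Complex.norm_cpow_eq_rpow_re_of_pos hy]
  simp

theorem continuous_cpow_neg_line {y : ℝ} (hy : 0 < y) (c : ℝ) :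
    Continuous fun t : ℝ => (y : ℂ) ^ (-((c : ℂ) + t * Complex.I)) := by
  have hy' : (y : ℂ) ≠ 0 := by exact_mod_cast hy.ne'
  exact Continuous.const_cpow (by fun_prop) (Or.inl hy')

theorem integrable_cpow_neg_line_mul {A : ℝ → ℂ} (hA : Integrable A) {y : ℝ} (hy : 0 < y) (c : ℝ) :
    Integrable fun t : ℝ => (y : ℂ) ^ (-((c : ℂ) + t * Complex.I)) * A t :=
  hA.bdd_mul (c := y ^ (-c)) (continuous_cpow_neg_line hy c).aestronglyMeasurable
    (ae_of_all _ fun t => (norm_cpow_neg_line hy c t).le)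

theorem integral_Ioi_cpow_neg_line {y : ℝ} (hy : 0 < y) {c : ℝ} (hc : 0 < c) (t : ℝ) :
    ∫ r in Ioi y, (r : ℂ) ^ (-((c : ℂ) + t * Complex.I)) / r =
      (y : ℂ) ^ (-((c : ℂ) + t * Complex.I)) / (c + t * Complex.I) := by
  have h := integral_Ioi_cpow_of_lt (a := -((c : ℂ) + t * Complex.I) - 1) (by simp; linarith) hy
  have e : ∀ r ∈ Ioi y, (r : ℂ) ^ (-((c : ℂ) + t * Complex.I)) / r =
      (r : ℂ) ^ (-((c : ℂ) + t * Complex.I) - 1) := fun r hr => by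
    have hr' : (r : ℂ) ≠ 0 := by
      have : 0 < r := hy.trans hr
      exact_mod_cast this.ne'
    rw [Complex.cpow_sub _ _ hr', Complex.cpow_one]
  rw [setIntegral_congr_fun measurableSet_Ioi e, h]
  rw [sub_add_cancel, neg_div_neg_eq]

/-- The Mellin line integral of `y ↦ ∫_y^∞ R dt/t`. -/
theorem tail_eq_line_integral {R : ℝ → ℝ} {A : ℝ → ℂ} {c : ℝ} (hc : 0 < c) (hA : Integrable A)
    (hR : ∀ y : ℝ, 0 < y →
      ∫ t : ℝ, (y : ℂ) ^ (-((c : ℂ) + t * Complex.I)) * A t = 2 * Real.pi * (R y : ℂ))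
    {y : ℝ} (hy : 0 < y) :
    ∫ t : ℝ, (y : ℂ) ^ (-((c : ℂ) + t * Complex.I)) * (A t / (c + t * Complex.I)) =
      2 * Real.pi * ((∫ r in Ioi y, R r / r : ℝ) : ℂ) := by
  have hprod : Integrable (Function.uncurry fun (r t : ℝ) =>
      (r : ℂ) ^ (-((c : ℂ) + t * Complex.I)) / r * A t)
      ((volume.restrict (Ioi y)).prod volume) := by
    have h1 : Integrable (fun r : ℝ => r ^ (-c - 1)) (volume.restrict (Ioi y)) :=
      integrableOn_Ioi_rpow_of_lt (by linarith) hy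
    have h2 := h1.mul_prod hA.norm
    refine Integrable.mono' h2 ?_ ?_
    · have hcont : ContinuousOn (fun z : ℝ × ℝ =>
          (z.1 : ℂ) ^ (-((c : ℂ) + z.2 * Complex.I)) / z.1) (Ioi y ×ˢ univ) := by
        refine ContinuousOn.div (fun z hz => ContinuousAt.continuousWithinAt ?_) (by fun_prop) ?_
        · have hz : 0 < z.1 := hy.trans hz.1
          exact ContinuousAt.cpow (by fun_prop) (by fun_prop)
            (Or.inl (by simpa using hz))
        · intro z hz
          have hz : 0 < z.1 := hy.trans hz.1
          exact_mod_cast hz.ne'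
      have hmeas := hcont.aestronglyMeasurable (μ := (volume : Measure (ℝ × ℝ)))
        (measurableSet_Ioi.prod MeasurableSet.univ)
      rw [Measure.volume_eq_prod, ← Measure.prod_restrict, Measure.restrict_univ] at hmeas
      exact hmeas.mul hA.aestronglyMeasurable.comp_snd
    · have hae : ∀ᵐ z : ℝ × ℝ ∂((volume.restrict (Ioi y)).prod volume), z.1 ∈ Ioi y := by
        have := ae_restrict_mem (μ := volume) (measurableSet_Ioi (a := y))
        exact Measure.quasiMeasurePreserving_fst.ae this
      filter_upwards [hae] with z hz
      have hz0 : 0 < z.1 := hy.trans hz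
      simp only [Function.uncurry]
      rw [norm_mul, norm_div, norm_cpow_neg_line hz0, Complex.norm_real,
        Real.norm_of_nonneg hz0.le, Real.rpow_sub_one hz0.ne']
  have h := integral_integral_swap hprod
  have e1 : ∀ r ∈ Ioi y, ∫ t : ℝ, (r : ℂ) ^ (-((c : ℂ) + t * Complex.I)) / r * A t =
      2 * Real.pi * ((R r / r : ℝ) : ℂ) := fun r hr => by
    have hr0 : 0 < r := hy.trans hr
    have : ∀ t : ℝ, (r : ℂ) ^ (-((c : ℂ) + t * Complex.I)) / r * A t =
        (r : ℂ)⁻¹ * ((r : ℂ) ^ (-((c : ℂ) + t * Complex.I)) * A t) := fun t => by ring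
    simp_rw [this]
    rw [integral_const_mul, hR r hr0]
    push_cast
    ring
  rw [setIntegral_congr_fun measurableSet_Ioi e1] at h
  rw [integral_const_mul, integral_complex_ofReal] at h
  rw [h]
  refine integral_congr_ae (ae_of_all _ fun t => ?_)
  beta_reduce
  rw [integral_mul_const, integral_Ioi_cpow_neg_line hy hc]
  ring

/-- A Gaussian mean of a Mellin line integral multiplies the symbol by `exp (ε² s²)`. -/
theorem gaussMean_of_line_integral {f : ℝ → ℂ} {A : ℝ → ℂ} {c : ℝ} (hA : Integrable A)
    (hf : ∀ y : ℝ, 0 < y →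
      ∫ t : ℝ, (y : ℂ) ^ (-((c : ℂ) + t * Complex.I)) * A t = 2 * Real.pi * f y)
    {y : ℝ} (hy : 0 < y) (ε : ℝ) :
    (2 * Real.pi * gaussMean (fun u => f (y * Real.exp (-(2 * ε * u)))) =
      ∫ t : ℝ, (y : ℂ) ^ (-((c : ℂ) + t * Complex.I)) * A t *
        Complex.exp ((ε * (c + t * Complex.I)) ^ 2)) ∧
    2 * Real.pi * gaussMean (fun u => u * f (y * Real.exp (-(2 * ε * u)))) =
      ∫ t : ℝ, (y : ℂ) ^ (-((c : ℂ) + t * Complex.I)) * A t *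
        (ε * (c + t * Complex.I) * Complex.exp ((ε * (c + t * Complex.I)) ^ 2)) := by
  have hi := integrable_cpow_neg_line_mul hA hy c
  have hpt : ∀ u : ℝ, 2 * Real.pi * f (y * Real.exp (-(2 * ε * u))) =
      ∫ t : ℝ, (y : ℂ) ^ (-((c : ℂ) + t * Complex.I)) * A t *
        Complex.exp (2 * (ε * (c + t * Complex.I)) * u) := fun u => by
    rw [← hf _ (by positivity)]
    refine integral_congr_ae (ae_of_all _ fun t => ?_)
    beta_reduce
    rw [mul_exp_cpow_neg hy]
    ring
  constructor
  · rw [← gaussMean_line_integral_one hi, gaussMean, gaussMean, mul_left_comm, ← integral_const_mul]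
    simp_rw [← hpt]
    simp only [mul_assoc]
  · rw [← gaussMean_line_integral_id hi, gaussMean, gaussMean, mul_left_comm, ← integral_const_mul]
    simp_rw [← hpt]
    congr 2
    ext u
    ring

theorem norm_le_of_line_integral {f : ℝ → ℂ} {A : ℝ → ℂ} {c : ℝ}
    (hf : ∀ y : ℝ, 0 < y →
      ∫ t : ℝ, (y : ℂ) ^ (-((c : ℂ) + t * Complex.I)) * A t = 2 * Real.pi * f y)
    {y : ℝ} (hy : 0 < y) : ‖f y‖ ≤ (∫ t : ℝ, ‖A t‖) * y ^ (-c) := by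
  have h1 : ‖∫ t : ℝ, (y : ℂ) ^ (-((c : ℂ) + t * Complex.I)) * A t‖ ≤
      ∫ t : ℝ, y ^ (-c) * ‖A t‖ := by
    refine (norm_integral_le_integral_norm _).trans (le_of_eq ?_)
    simp_rw [norm_mul, norm_cpow_neg_line hy]
  rw [hf y hy, norm_mul, integral_const_mul] at h1
  have h2 : (1 : ℝ) ≤ ‖(2 * Real.pi : ℂ)‖ := by
    rw [norm_mul, Complex.norm_real, Real.norm_of_nonneg Real.pi_pos.le]
    simp
    linarith [Real.pi_gt_three]
  rw [mul_comm]
  exact (le_mul_of_one_le_left (norm_nonneg _) h2).trans h1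

theorem rpow_neg_mul_exp_le {y : ℝ} (hy : 0 < y) (ε u c : ℝ) :
    (y * Real.exp (-(2 * ε * u))) ^ (-c) ≤ y ^ (-c) * Real.exp (|2 * ε * c| * |u|) := by
  rw [Real.mul_rpow hy.le (Real.exp_pos _).le, ← Real.exp_mul]
  refine mul_le_mul_of_nonneg_left (Real.exp_le_exp.2 ?_) (by positivity)
  calc -(2 * ε * u) * -c = 2 * ε * c * u := by ring
    _ ≤ |2 * ε * c * u| := le_abs_self _
    _ = _ := abs_mul _ _

theorem one_add_rpow_neg_mul_exp_le {y : ℝ} (hy : 0 < y) (ε u c : ℝ) :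
    1 + (y * Real.exp (-(2 * ε * u))) ^ (-c) ≤ (1 + y ^ (-c)) * Real.exp (|2 * ε * c| * |u|) := by
  have h := rpow_neg_mul_exp_le hy ε u c
  have h1 : 1 ≤ Real.exp (|2 * ε * c| * |u|) := Real.one_le_exp (by positivity)
  rw [add_mul, one_mul]
  linarith

/-- The Gaussian mean of `α² ∫_y^∞ R dt/t + y R'` multiplies the symbol of `R` by
`(α²/s - s) e^{ε² s²}`. The factor `-s` is obtained by integrating by parts in the Gaussian mean,
so that no derivative of the line integral of `R` is taken. -/
theorem WeberBounds.gaussMean_tail {α δ C : ℝ} {R D : ℝ → ℝ} (hW : WeberBounds α δ C R D)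
    {A : ℝ → ℂ} {c : ℝ} (hc : 0 < c) (hA : Integrable A)
    (hR : ∀ y : ℝ, 0 < y →
      ∫ t : ℝ, (y : ℂ) ^ (-((c : ℂ) + t * Complex.I)) * A t = 2 * Real.pi * (R y : ℂ))
    {y ε : ℝ} (hy : 0 < y) (hε : 0 < ε)
    (hi : Integrable fun t : ℝ => (c + t * Complex.I) * A t *
      Complex.exp ((ε * (c + t * Complex.I)) ^ 2)) :
    2 * Real.pi * gaussMean (fun u => (weberTail α R D (y * Real.exp (-(2 * ε * u))) : ℂ)) =
      ∫ t : ℝ, (y : ℂ) ^ (-((c : ℂ) + t * Complex.I)) *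
        (((α : ℂ) ^ 2 / (c + t * Complex.I) - (c + t * Complex.I)) * A t *
          Complex.exp ((ε * (c + t * Complex.I)) ^ 2)) := by
  have hε' : (ε : ℂ) ≠ 0 := by exact_mod_cast hε.ne'
  have hs0 : ∀ t : ℝ, (c + t * Complex.I : ℂ) ≠ 0 := fun t h => by
    have := congrArg Complex.re h
    simp at this
    exact hc.ne' this
  set Y : ℝ → ℝ := fun u => y * Real.exp (-(2 * ε * u)) with hYdef
  have hY : ∀ u, 0 < Y u := fun u => by positivity
  have hYc : Continuous Y := by fun_prop
  set T : ℝ → ℝ := fun y => ∫ r in Ioi y, R r / r with hT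
  -- `1/s` is bounded on the line, so the symbol of the tail integral is integrable
  have hA2 : Integrable fun t : ℝ => A t / (c + t * Complex.I) := by
    have hcont : Continuous fun t : ℝ => (c + t * Complex.I : ℂ)⁻¹ :=
      Continuous.inv₀ (by fun_prop) hs0
    have := hA.bdd_mul (c := c⁻¹) hcont.aestronglyMeasurable (ae_of_all _ fun t => by
      rw [norm_inv]
      refine inv_anti₀ hc ?_
      have := Complex.abs_re_le_norm (c + t * Complex.I : ℂ)
      simp only [Complex.add_re, Complex.ofReal_re, Complex.mul_re, Complex.I_re, mul_zero,
        Complex.ofReal_im, Complex.I_im, mul_one, sub_self, add_zero] at this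
      rwa [abs_of_pos hc] at this)
    exact this.congr (ae_of_all _ fun t => by beta_reduce; rw [div_eq_mul_inv, mul_comm])
  have hTl : ∀ y : ℝ, 0 < y → ∫ t : ℝ, (y : ℂ) ^ (-((c : ℂ) + t * Complex.I)) *
      (A t / (c + t * Complex.I)) = 2 * Real.pi * (T y : ℂ) := fun y hy =>
    tail_eq_line_integral hc hA hR hy
  -- Gaussian integrability of the four functions involved
  have hcomp : ∀ {f : ℝ → ℝ}, ContinuousOn f (Ioi 0) → Continuous fun u => ((f (Y u) : ℝ) : ℂ) :=
    fun hf => Complex.continuous_ofReal.comp (hf.comp_continuous hYc hY)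
  have bR : ∀ u, ‖(R (Y u) : ℂ)‖ ≤
      ((∫ t : ℝ, ‖A t‖) * y ^ (-c)) * Real.exp (|2 * ε * c| * |u|) := fun u => by
    have h1 := norm_le_of_line_integral (f := fun y => (R y : ℂ)) hR (hY u)
    refine h1.trans ?_
    rw [mul_assoc]
    exact mul_le_mul_of_nonneg_left (rpow_neg_mul_exp_le hy ε u c)
      (integral_nonneg fun _ => norm_nonneg _)
  have iR := integrable_mul_exp_neg_sq (hcomp hW.continuousOn).aestronglyMeasurable bR
  have iuR : Integrable fun u : ℝ => (u * (R (Y u) : ℂ)) * (Real.exp (-u ^ 2) : ℝ) := by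
    refine integrable_mul_exp_neg_sq (M := (∫ t : ℝ, ‖A t‖) * y ^ (-c)) (B := 1 + |2 * ε * c|)
      ((Complex.continuous_ofReal.mul (hcomp hW.continuousOn)).aestronglyMeasurable) fun u => ?_
    rw [norm_mul, Complex.norm_real, Real.norm_eq_abs, add_mul, one_mul, Real.exp_add]
    calc _ ≤ Real.exp |u| * (((∫ t : ℝ, ‖A t‖) * y ^ (-c)) * Real.exp (|2 * ε * c| * |u|)) :=
          mul_le_mul (abs_le_exp_abs u) (bR u) (norm_nonneg _) (Real.exp_pos _).le
      _ = _ := by ring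
  have iT : Integrable fun u : ℝ => (T (Y u) : ℂ) * (Real.exp (-u ^ 2) : ℝ) := by
    refine integrable_mul_exp_neg_sq (hcomp hW.integral_continuousOn).aestronglyMeasurable
      (M := (∫ t : ℝ, ‖A t / (c + t * Complex.I)‖) * y ^ (-c)) (B := |2 * ε * c|) fun u => ?_
    have h1 := norm_le_of_line_integral (f := fun y => (T y : ℂ)) hTl (hY u)
    refine h1.trans ?_
    rw [mul_assoc]
    exact mul_le_mul_of_nonneg_left (rpow_neg_mul_exp_le hy ε u c)
      (integral_nonneg fun _ => norm_nonneg _)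
  have iF : Integrable fun u : ℝ => (weberTail α R D (Y u) : ℂ) * (Real.exp (-u ^ 2) : ℝ) := by
    refine integrable_mul_exp_neg_sq (hcomp hW.weberTail_continuousOn).aestronglyMeasurable
      (M := (α ^ 2 + 1) * C * (1 + y ^ (-δ))) (B := |2 * ε * δ|) fun u => ?_
    rw [Complex.norm_real]
    refine (hW.abs_weberTail_le (hY u)).trans ?_
    rw [mul_assoc ((α ^ 2 + 1) * C)]
    refine mul_le_mul_of_nonneg_left (one_add_rpow_neg_mul_exp_le hy ε u δ) ?_
    have := hW.nonneg
    positivity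
  have eD : ∀ u, (D (Y u) : ℂ) * (Real.exp (-u ^ 2) : ℝ) =
      (weberTail α R D (Y u) : ℂ) * (Real.exp (-u ^ 2) : ℝ) -
        (α : ℂ) ^ 2 * ((T (Y u) : ℂ) * (Real.exp (-u ^ 2) : ℝ)) := fun u => by
    simp only [weberTail, hT]
    push_cast
    ring
  have iD : Integrable fun u : ℝ => (D (Y u) : ℂ) * (Real.exp (-u ^ 2) : ℝ) := by
    simp_rw [eD]
    exact iF.sub (iT.const_mul _)
  -- integration by parts turns the mean of `D` into a weighted mean of `R`
  have hder : ∀ u : ℝ, HasDerivAt (fun u => (R (Y u) : ℂ) * (Real.exp (-u ^ 2) : ℝ))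
      (-(2 * ε) * ((D (Y u) : ℂ) * (Real.exp (-u ^ 2) : ℝ)) -
        2 * ((u * (R (Y u) : ℂ)) * (Real.exp (-u ^ 2) : ℝ))) u := fun u => by
    have h1 : HasDerivAt Y (-(2 * ε) * Y u) u := by
      have h2 : HasDerivAt (fun u : ℝ => -(2 * ε * u)) (-(2 * ε)) u := by
        have h := ((hasDerivAt_id u).const_mul (2 * ε)).neg
        exact h.congr_deriv (by simp)
      refine (h2.exp.const_mul y).congr_deriv ?_
      simp only [hYdef]
      ring
    have h3 := ((hW.deriv (Y u) (hY u)).comp u h1).ofReal_comp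
    have h4 : HasDerivAt (fun u : ℝ => Real.exp (-u ^ 2)) (Real.exp (-u ^ 2) * -(2 * u)) u := by
      have h5 : HasDerivAt (fun u : ℝ => -u ^ 2) (-(2 * u)) u := by
        have h := ((hasDerivAt_id u).pow 2).neg
        exact h.congr_deriv (by simp)
      exact h5.exp
    refine (h3.mul h4.ofReal_comp).congr_deriv ?_
    have hY' : (Y u : ℂ) ≠ 0 := by exact_mod_cast (hY u).ne'
    simp only [Function.comp]
    push_cast
    field_simp
    ring
  have hparts := integral_eq_zero_of_hasDerivAt_of_integrable hder
    ((iD.const_mul _).sub (iuR.const_mul _)) iR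
  rw [integral_sub (iD.const_mul _) (iuR.const_mul _), integral_const_mul, integral_const_mul]
    at hparts
  have gD : gaussMean (fun u => (D (Y u) : ℂ)) =
      -(ε : ℂ)⁻¹ * gaussMean (fun u => u * (R (Y u) : ℂ)) := by
    simp only [gaussMean]
    have : ∫ u : ℝ, (D (Y u) : ℂ) * (Real.exp (-u ^ 2) : ℝ) =
        -(ε : ℂ)⁻¹ * ∫ u : ℝ, (u * (R (Y u) : ℂ)) * (Real.exp (-u ^ 2) : ℝ) := by
      field_simp
      linear_combination -(1 / 2) * hparts
    rw [this]
    ring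
  have gF : gaussMean (fun u => (weberTail α R D (Y u) : ℂ)) =
      (α : ℂ) ^ 2 * gaussMean (fun u => (T (Y u) : ℂ)) + gaussMean (fun u => (D (Y u) : ℂ)) := by
    simp only [gaussMean]
    simp_rw [eD]
    rw [integral_sub iF (iT.const_mul _), integral_const_mul]
    ring
  have l1 := (gaussMean_of_line_integral (f := fun y => (T y : ℂ)) hA2 hTl hy ε).1
  have l2 := (gaussMean_of_line_integral (f := fun y => (R y : ℂ)) hA hR hy ε).2
  have hb1 : Integrable fun t : ℝ => (y : ℂ) ^ (-((c : ℂ) + t * Complex.I)) *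
      (A t / (c + t * Complex.I)) * Complex.exp ((ε * (c + t * Complex.I)) ^ 2) := by
    have h1 := (integrable_cpow_neg_line_mul hA2 hy c).bdd_mul
      (f := fun t : ℝ => Complex.exp ((ε * (c + t * Complex.I)) ^ 2))
      (c := Real.exp (ε ^ 2 * c ^ 2))
      (Continuous.aestronglyMeasurable (by fun_prop)) (ae_of_all _ fun t => by
        rw [norm_cexp_sq_line]
        refine mul_le_of_le_one_right (Real.exp_pos _).le (Real.exp_le_one_iff.2 ?_)
        have : 0 ≤ ε ^ 2 * t ^ 2 := by positivity
        linarith)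
    exact h1.congr (ae_of_all _ fun t => mul_comm _ _)
  have hb2 : Integrable fun t : ℝ => (y : ℂ) ^ (-((c : ℂ) + t * Complex.I)) * A t *
      (ε * (c + t * Complex.I) * Complex.exp ((ε * (c + t * Complex.I)) ^ 2)) := by
    refine ((integrable_cpow_neg_line_mul hi hy c).const_mul (ε : ℂ)).congr
      (ae_of_all _ fun t => ?_)
    beta_reduce
    ring
  rw [gF, gD, mul_add, mul_left_comm, l1, mul_left_comm (2 * Real.pi : ℂ), l2, ← integral_const_mul,
    ← integral_const_mul, ← integral_add (hb1.const_mul _) (hb2.const_mul _)]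
  refine integral_congr_ae (ae_of_all _ fun t => ?_)
  beta_reduce
  have := hs0 t
  field_simp
  ring



/-! ### The symbol of the tail combination -/

/-- The Mellin symbol of `α² ∫_y^∞ R_{α,x} dt/t + y R_{α,x}'(y)`. Written through `inverseSymbol`, it
is seen to be analytic for `0 < Re s < 1/2`, also where the symbol of `R_{α,x}` has the pole `-α`. -/
noncomputable def tailSymbol (α x : ℝ) (s : ℂ) : ℂ :=
  -(betaSymbol x s * Complex.cos (Real.pi * s) * inverseSymbol α (-s)) / Real.pi ^ 2

/-- The factor `s + α` of `α² - s²` raises `Γ(s+α)` to `Γ(1+s+α)`, which removes the pole at `-α`,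
and the factor `α - s` lowers `1/Γ(1-s+α)` to `1/Γ(α-s)`. -/
theorem tailSymbol_eq {α x : ℝ} {s : ℂ} (h0 : 0 < s.re) (hα : -α < s.re) :
    ((α : ℂ) ^ 2 / s - s) * (4 ^ s * (-(weberSymbol α s * betaSymbol x s) *
      (Complex.sin (Real.pi * s) * Complex.cos (Real.pi * s)))) = tailSymbol α x s := by
  have hs : s ≠ 0 := fun h => by simp [h] at h0
  have hsα : s + α ≠ 0 := fun h => by
    have := congrArg Complex.re h
    simp at this
    linarith
  have hpi : (Real.pi : ℂ) ≠ 0 := by exact_mod_cast Real.pi_ne_zero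
  have hΓ : Complex.Gamma s ≠ 0 := Complex.Gamma_ne_zero_of_re_pos h0
  have e1 : Complex.Gamma (1 - -s + α) = (s + α) * Complex.Gamma (s + α) := by
    rw [← Complex.Gamma_add_one _ hsα]
    congr 1
    ring
  have e2 : (Complex.Gamma (-s + α))⁻¹ = (α - s) * (Complex.Gamma (1 - s + α))⁻¹ := by
    have h := Complex.one_div_Gamma_eq_self_mul_one_div_Gamma_add_one (-s + α)
    rw [h, show -s + α + 1 = 1 - s + (α : ℂ) by ring, show -s + (α : ℂ) = α - s by ring]
  have e3 : (Complex.Gamma (1 + -s))⁻¹ = Complex.Gamma s * Complex.sin (Real.pi * s) / Real.pi := by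
    rw [← sub_eq_add_neg, inv_Gamma_one_sub h0]
  have e4 : (Complex.Gamma (1 - -s))⁻¹ = (s * Complex.Gamma s)⁻¹ := by
    rw [← Complex.Gamma_add_one _ hs, sub_neg_eq_add, add_comm]
  rw [tailSymbol, inverseSymbol, e1, e2, e3, e4, neg_neg, weberSymbol]
  generalize Complex.sin (Real.pi * s) = S
  generalize Complex.cos (Real.pi * s) = K
  generalize (Complex.Gamma (1 - s + α))⁻¹ = G
  field_simp
  ring

theorem norm_ccos_pi_le (s : ℂ) : ‖Complex.cos (Real.pi * s)‖ ≤ Real.exp (4 * |s.im|) := by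
  refine (norm_ccos_le _).trans (Real.exp_le_exp.2 ?_)
  rw [Complex.im_ofReal_mul, abs_mul, abs_of_pos Real.pi_pos]
  exact mul_le_mul_of_nonneg_right Real.pi_le_four (abs_nonneg _)

theorem norm_Gamma_le_on_strip {a b : ℝ} (ha : 0 < a) : ∃ M : ℝ, 0 < M ∧ ∀ s : ℂ, a ≤ s.re →
    s.re ≤ b → ‖Complex.Gamma s‖ ≤ M := by
  obtain ⟨M, hM⟩ := (isCompact_Icc (a := a) (b := b)).exists_bound_of_continuousOn
    (f := Real.Gamma) fun x hx => (Real.differentiableAt_Gamma fun m hm => by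
      have : (0 : ℝ) ≤ m := m.cast_nonneg
      linarith [hx.1]).continuousAt.continuousWithinAt
  refine ⟨|M| + 1, by positivity, fun s h1 h2 => ?_⟩
  refine (norm_Gamma_le_Gamma_re (ha.trans_le h1)).trans ?_
  have h3 := (le_abs_self _).trans (hM s.re ⟨h1, h2⟩)
  linarith [le_abs_self M]

theorem betaSymbol_differentiableAt {x : ℝ} {s : ℂ} (h0 : 0 < s.re) (h1 : s.re < 1 / 2) :
    DifferentiableAt ℂ (betaSymbol x) s := by
  have e1 : DifferentiableAt ℂ (fun s : ℂ => Complex.Gamma (s + Complex.I * x)) s :=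
    differentiableAt_Gamma_of_re_pos (by fun_prop) (by simpa)
  have e2 : DifferentiableAt ℂ (fun s : ℂ => Complex.Gamma (s - Complex.I * x)) s :=
    differentiableAt_Gamma_of_re_pos (by fun_prop) (by simpa)
  have e3 : DifferentiableAt ℂ (fun s : ℂ => Complex.Gamma (1 - 2 * s)) s :=
    differentiableAt_Gamma_of_re_pos (by fun_prop) (by simp; linarith)
  exact ((e1.mul e2).mul e3).div_const _

theorem norm_betaSymbol_le (x : ℝ) {a b : ℝ} (ha : 0 < a) (hb : b < 1 / 2) :
    ∃ M : ℝ, 0 < M ∧ ∀ s : ℂ, a ≤ s.re → s.re ≤ b → ‖betaSymbol x s‖ ≤ M := by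
  obtain ⟨M1, hM1, h1⟩ := norm_Gamma_le_on_strip (b := b) ha
  obtain ⟨M2, hM2, h2⟩ := norm_Gamma_le_on_strip (a := 1 - 2 * b) (b := 1 - 2 * a) (by linarith)
  refine ⟨M1 * M1 * M2 / Real.pi, by have := Real.pi_pos; positivity, fun s hsa hsb => ?_⟩
  have i1 := h1 (s + Complex.I * x) (by simpa) (by simpa)
  have i2 := h1 (s - Complex.I * x) (by simpa) (by simpa)
  have i3 := h2 (1 - 2 * s) (by simp; linarith) (by simp; linarith)
  rw [betaSymbol, norm_div, norm_mul, norm_mul, Complex.norm_real, Real.norm_of_nonneg Real.pi_pos.le]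
  have := Real.pi_pos
  gcongr

theorem tailSymbol_differentiableAt {α x : ℝ} (hα : -1 < α) {s : ℂ} (h0 : 0 < s.re)
    (h1 : s.re < 1 / 2) : DifferentiableAt ℂ (tailSymbol α x) s := by
  have e1 : DifferentiableAt ℂ (fun s : ℂ => inverseSymbol α (-s)) s := by
    have := inverseSymbol_differentiableAt (α := α) (s := -s) (by simp; linarith)
    exact DifferentiableAt.comp (f := fun s : ℂ => -s) s this (by fun_prop)
  exact ((((betaSymbol_differentiableAt h0 h1).mul (by fun_prop)).mul e1).neg).div_const _

theorem norm_tailSymbol_le {α x : ℝ} (hα : -1 < α) {a b : ℝ} (ha : 0 < a) (hb : b < 1 / 2) :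
    ∃ M : ℝ, 0 < M ∧ ∀ s : ℂ, a ≤ s.re → s.re ≤ b →
      ‖tailSymbol α x s‖ ≤ M * Real.exp (16 * |s.im|) := by
  obtain ⟨M1, hM1, h1⟩ := norm_betaSymbol_le x ha hb
  obtain ⟨M2, hM2, h2⟩ := norm_inverseSymbol_le (α := α) (A := -b) (B := -a) (by linarith)
  have hpi := Real.pi_pos
  refine ⟨M1 * M2 / Real.pi ^ 2, by positivity, fun s hsa hsb => ?_⟩
  have i1 := h1 s hsa hsb
  have i2 := h2 (-s) (by simpa) (by simpa)
  have i3 := norm_ccos_pi_le s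
  rw [Complex.neg_im, abs_neg] at i2
  rw [tailSymbol, norm_div, norm_neg, norm_mul, norm_mul, norm_pow, Complex.norm_real,
    Real.norm_of_nonneg hpi.le]
  calc _ ≤ M1 * Real.exp (4 * |s.im|) * (M2 * Real.exp (12 * |s.im|)) / Real.pi ^ 2 := by gcongr
    _ = M1 * M2 / Real.pi ^ 2 * (Real.exp (4 * |s.im|) * Real.exp (12 * |s.im|)) := by ring
    _ = _ := by rw [← Real.exp_add]; ring_nf

theorem tailSymbol_line_integrable {α x : ℝ} (hα : -1 < α) {c ε : ℝ} (h0 : 0 < c) (h1 : c < 1 / 2)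
    (hε : 0 < ε) : Integrable fun t : ℝ => tailSymbol α x (c + t * Complex.I) *
      Complex.exp ((ε * (c + t * Complex.I)) ^ 2) := by
  obtain ⟨M, hM, h⟩ := norm_tailSymbol_le (x := x) hα (a := c) (b := c) h0 h1
  refine integrable_mul_cexp_sq_line (C := M) (K := 16) (continuous_iff_continuousAt.2 fun t => ?_)
    hε c fun t => ?_
  · have h3 := (tailSymbol_differentiableAt (x := x) hα (s := c + t * Complex.I) (by simpa)
      (by simpa using h1)).continuousAt
    exact ContinuousAt.comp (f := fun t : ℝ => (c + t * Complex.I : ℂ)) h3 (by fun_prop)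
  · simpa using h (c + t * Complex.I) (by simp) (by simp)

/-- The Gaussian mean of the tail combination as a Mellin line integral; the line may be any one with
`0 < Re s < 1/4`. -/
theorem gaussMean_weberTail {α x : ℝ} (hα : -(1 / 4) < α) (hx : x ≠ 0) {c ε y : ℝ} (h0 : 0 < c)
    (h1 : c < 1 / 4) (hε : 0 < ε) (hy : 0 < y) :
    2 * Real.pi * gaussMean (fun u =>
      (weberTail α (weberRe α x) (weberReD α x) (y * Real.exp (-(2 * ε * u))) : ℂ)) =
    ∫ t : ℝ, (y : ℂ) ^ (-((c : ℂ) + t * Complex.I)) * (tailSymbol α x (c + t * Complex.I) *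
      Complex.exp ((ε * (c + t * Complex.I)) ^ 2)) := by
  -- a line to the right of both `c` and the pole `-α`
  obtain ⟨b, hcb, hαb, hb⟩ : ∃ b : ℝ, c ≤ b ∧ -α < b ∧ b < 1 / 4 :=
    ⟨max c ((1 / 4 - α) / 2), le_max_left _ _, lt_max_of_lt_right (by linarith),
      max_lt h1 (by linarith)⟩
  have hb0 : 0 < b := h0.trans_le hcb
  have hα1 : -1 < α := by linarith
  have hsin := sin_pi_order_ne_zero (α := α) hx
  obtain ⟨C, -, hW⟩ := weberRe_bounds hα (isCompact_singleton (x := x))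
    (fun z hz => by rw [mem_singleton_iff.1 hz]; exact hsin) one_pos
  have hWx := (hW x rfl).1
  have hline := fun (y : ℝ) (hy : 0 < y) => weberRe_eq_line_integral hy hb0 hαb hb hsin
  set A : ℝ → ℂ := fun t => 4 ^ (b + t * Complex.I : ℂ) *
    (-(weberSymbol α (b + t * Complex.I) * betaSymbol x (b + t * Complex.I)) *
      (Complex.sin (Real.pi * (b + t * Complex.I)) *
        Complex.cos (Real.pi * (b + t * Complex.I)))) with hAdef
  have hdiv : ∀ (y : ℝ), 0 < y → ∀ t : ℝ, ((y / 4 : ℝ) : ℂ) ^ (-((b : ℂ) + t * Complex.I)) *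
      (-(weberSymbol α (b + t * Complex.I) * betaSymbol x (b + t * Complex.I)) *
      (Complex.sin (Real.pi * (b + t * Complex.I)) *
        Complex.cos (Real.pi * (b + t * Complex.I)))) =
      (y : ℂ) ^ (-((b : ℂ) + t * Complex.I)) * A t := fun y hy t => by
    rw [div_four_cpow_neg hy, mul_assoc]
  have hA : Integrable A := by
    have := (hline 1 one_pos).1
    simp_rw [hdiv 1 one_pos] at this
    simpa using this
  have hR : ∀ y : ℝ, 0 < y → ∫ t : ℝ, (y : ℂ) ^ (-((b : ℂ) + t * Complex.I)) * A t =
      2 * Real.pi * (weberRe α x y : ℂ) := fun y hy => by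
    have := (hline y hy).2
    simp_rw [hdiv y hy] at this
    exact this
  have hAt : ∀ t : ℝ, ((α : ℂ) ^ 2 / (b + t * Complex.I) - (b + t * Complex.I)) * A t =
      tailSymbol α x (b + t * Complex.I) := fun t => by
    rw [hAdef]
    exact tailSymbol_eq (by simpa) (by simpa)
  have hs0 : ∀ t : ℝ, (b + t * Complex.I : ℂ) ≠ 0 := fun t h => by
    have := congrArg Complex.re h
    simp at this
    exact hb0.ne' this
  have hi : Integrable fun t : ℝ => (b + t * Complex.I) * A t *
      Complex.exp ((ε * (b + t * Complex.I)) ^ 2) := by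
    -- `s R* = (α²/s) R* - F*`
    have i1 := tailSymbol_line_integrable (x := x) hα1 hb0 (by linarith : b < 1 / 2) hε
    have hcont : Continuous fun t : ℝ => (b + t * Complex.I : ℂ)⁻¹ *
        Complex.exp ((ε * (b + t * Complex.I)) ^ 2) :=
      (Continuous.inv₀ (by fun_prop) hs0).mul (by fun_prop)
    have i2 := (hA.bdd_mul (c := b⁻¹ * Real.exp (ε ^ 2 * b ^ 2)) hcont.aestronglyMeasurable
      (ae_of_all _ fun t => by
        rw [norm_mul, norm_inv, norm_cexp_sq_line]
        have h1 := Complex.abs_re_le_norm (b + t * Complex.I : ℂ)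
        simp only [Complex.add_re, Complex.ofReal_re, Complex.mul_re, Complex.I_re, mul_zero,
          Complex.ofReal_im, Complex.I_im, mul_one, sub_self, add_zero] at h1
        rw [abs_of_pos hb0] at h1
        have h2 : Real.exp (-(ε ^ 2 * t ^ 2)) ≤ 1 := Real.exp_le_one_iff.2 (by
          have : 0 ≤ ε ^ 2 * t ^ 2 := by positivity
          linarith)
        have h3 := inv_anti₀ hb0 h1
        calc _ ≤ b⁻¹ * (Real.exp (ε ^ 2 * b ^ 2) * 1) := by gcongr
          _ = _ := by rw [mul_one])).const_mul ((α : ℂ) ^ 2)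
    refine (i2.sub i1).congr (ae_of_all _ fun t => ?_)
    simp only [Pi.sub_apply]
    rw [← hAt]
    have := hs0 t
    field_simp
    ring
  rw [hWx.gaussMean_tail hb0 hA hR hy hε hi]
  simp_rw [hAt, ← mul_assoc]
  obtain ⟨M, hM, hbound⟩ := norm_tailSymbol_le (x := x) hα1 (a := c) (b := b) h0 (by linarith)
  have hshift := integral_mul_cexp_sq_line_eq
    (A := fun z => (y : ℂ) ^ (-z) * tailSymbol α x z) (C := (y ^ (-c) + y ^ (-b)) * M) (K := 16)
    hε hcb (fun z hz1 hz2 => ?_) (fun z hz1 hz2 => ?_)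
  · exact hshift.symm
  · exact (cpow_neg_differentiable hy z).mul
      (tailSymbol_differentiableAt hα1 (h0.trans_le hz1) (by linarith))
  · rw [norm_mul, mul_assoc]
    exact mul_le_mul (norm_cpow_neg_le hy hz1 hz2) (hbound z hz1 hz2) (norm_nonneg _) (by positivity)



/-! ### Parseval's formula for the damped tail combination -/

/-- Parseval's formula for a function given by an absolutely convergent Mellin line integral. -/
theorem integral_line_mul_mellin {G h : ℝ → ℂ} {B : ℝ → ℂ} {c : ℝ} (hB : Integrable B)
    (hG : ∀ y : ℝ, 0 < y →
      2 * Real.pi * G y = ∫ t : ℝ, (y : ℂ) ^ (-((c : ℂ) + t * Complex.I)) * B t)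
    (hh : MellinConvergent h (-c : ℝ)) :
    2 * Real.pi * ∫ y in Ioi (0 : ℝ), G y * (h y / y) =
      ∫ t : ℝ, B t * mellin h (-((c : ℂ) + t * Complex.I)) := by
  have hprod : Integrable (Function.uncurry fun (y t : ℝ) =>
      (y : ℂ) ^ (-((c : ℂ) + t * Complex.I)) * (h y / y) * B t)
      ((volume.restrict (Ioi 0)).prod volume) := by
    have h2 := hh.integrable_norm_rpow.mul_prod hB.norm
    refine Integrable.mono' h2 ?_ ?_
    · have hcont : ContinuousOn (fun z : ℝ × ℝ =>
          (z.1 : ℂ) ^ (-((c : ℂ) + z.2 * Complex.I)) / z.1) (Ioi 0 ×ˢ univ) := by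
        refine ContinuousOn.div (fun z hz => ContinuousAt.continuousWithinAt ?_) (by fun_prop) ?_
        · have hz : 0 < z.1 := hz.1
          exact ContinuousAt.cpow (by fun_prop) (by fun_prop)
            (Or.inl (by simpa using hz))
        · intro z hz
          have hz : 0 < z.1 := hz.1
          exact_mod_cast hz.ne'
      have hmeas := hcont.aestronglyMeasurable (μ := (volume : Measure (ℝ × ℝ)))
        (measurableSet_Ioi.prod MeasurableSet.univ)
      rw [Measure.volume_eq_prod, ← Measure.prod_restrict, Measure.restrict_univ] at hmeas
      refine ((hmeas.mul hh.aestronglyMeasurable.comp_fst).mul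
        hB.aestronglyMeasurable.comp_snd).congr (ae_of_all _ fun z => ?_)
      simp only [Function.uncurry, Pi.mul_apply]
      ring
    · have hae : ∀ᵐ z : ℝ × ℝ ∂((volume.restrict (Ioi 0)).prod volume), z.1 ∈ Ioi (0 : ℝ) := by
        have := ae_restrict_mem (μ := volume) (measurableSet_Ioi (a := (0 : ℝ)))
        exact Measure.quasiMeasurePreserving_fst.ae this
      filter_upwards [hae] with z hz
      have hz0 : 0 < z.1 := hz
      simp only [Function.uncurry]
      rw [norm_mul, norm_mul, norm_div, norm_cpow_neg_line hz0, Complex.norm_real,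
        Real.norm_of_nonneg hz0.le, Complex.ofReal_re, Real.rpow_sub_one hz0.ne']
      exact le_of_eq (by ring)
  have hswap := integral_integral_swap hprod
  have e1 : ∀ y ∈ Ioi (0 : ℝ), ∫ t : ℝ, (y : ℂ) ^ (-((c : ℂ) + t * Complex.I)) * (h y / y) * B t =
      2 * Real.pi * (G y * (h y / y)) := fun y hy => by
    have : ∀ t : ℝ, (y : ℂ) ^ (-((c : ℂ) + t * Complex.I)) * (h y / y) * B t =
        (h y / y) * ((y : ℂ) ^ (-((c : ℂ) + t * Complex.I)) * B t) := fun t => by ring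
    simp_rw [this]
    rw [integral_const_mul, ← hG y hy]
    ring
  rw [setIntegral_congr_fun measurableSet_Ioi e1, integral_const_mul] at hswap
  rw [hswap]
  refine integral_congr_ae (ae_of_all _ fun t => ?_)
  beta_reduce
  rw [integral_mul_const, mul_comm, mellin]
  congr 1
  refine setIntegral_congr_fun measurableSet_Ioi fun y hy => ?_
  have hy' : (y : ℂ) ≠ 0 := by exact_mod_cast (ne_of_gt hy)
  rw [Complex.cpow_sub _ _ hy', Complex.cpow_one, smul_eq_mul]
  ring

/-- The inverse Laplace integral of `inverseSymbol α · h^*`, damped by a Gaussian, on the line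
`Re w = -c`. -/
noncomputable def dampedInverse (α : ℝ) (h : ℝ → ℂ) (c ε l : ℝ) : ℂ :=
  (2 * Real.pi : ℂ)⁻¹ * ∫ t : ℝ, inverseSymbol α (-((c : ℂ) + t * Complex.I)) *
    mellin h (-((c : ℂ) + t * Complex.I)) * Complex.exp ((ε * (c + t * Complex.I)) ^ 2) *
      Complex.exp (-2 * (c + t * Complex.I) * l)

/-- On a strip of Mellin convergence `inverseSymbol α · h^*` is analytic of exponential growth. -/
theorem inverseSymbol_mul_mellin_strip {α : ℝ} {h : ℝ → ℂ} {a b a' b' : ℝ} (ha : a' < a)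
    (hb : b < b') (ha' : MellinConvergent h a') (hb' : MellinConvergent h b') (hbα : b < 1 + α) :
    (∀ s : ℂ, a ≤ s.re → s.re ≤ b →
      DifferentiableAt ℂ (fun s => inverseSymbol α s * mellin h s) s) ∧
    ∃ C : ℝ, 0 ≤ C ∧ ∀ s : ℂ, a ≤ s.re → s.re ≤ b →
      ‖inverseSymbol α s * mellin h s‖ ≤ C * Real.exp (12 * |s.im|) := by
  constructor
  · intro s h1 h2
    exact (inverseSymbol_differentiableAt (h2.trans_lt hbα)).mul
      (differentiableAt_mellin_between ha' hb' (ha.trans_le h1) (h2.trans_lt hb))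
  · obtain ⟨C, hC, h1⟩ := norm_inverseSymbol_le (α := α) (A := a) hbα
    obtain ⟨M, hM, h2⟩ := norm_mellin_le ha' hb'
    refine ⟨C * M, by positivity, fun s hs1 hs2 => ?_⟩
    rw [norm_mul]
    calc _ ≤ C * Real.exp (12 * |s.im|) * M :=
          mul_le_mul (h1 s hs1 hs2) (h2 s (ha.le.trans hs1) (hs2.trans hb.le)) (norm_nonneg _)
            (by positivity)
      _ = _ := by ring

theorem inverseSymbol_mul_mellin_line_integrable {α : ℝ} (hα : -1 < α) {h : ℝ → ℂ} {μ c ε : ℝ}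
    (hh : ∀ c : ℝ, |c| < μ → MellinConvergent h c) (h0 : 0 < c) (hc : c < μ) (hε : 0 < ε) :
    Integrable fun t : ℝ => inverseSymbol α (-((c : ℂ) + t * Complex.I)) *
      mellin h (-((c : ℂ) + t * Complex.I)) * Complex.exp ((ε * (c + t * Complex.I)) ^ 2) := by
  have hm : |-((c + μ) / 2)| < μ := by rw [abs_neg, abs_of_pos (by linarith)]; linarith
  obtain ⟨hd, C, hC, hb⟩ := inverseSymbol_mul_mellin_strip (α := α) (h := h) (a := -c) (b := -c)
    (a' := -((c + μ) / 2)) (b' := 0) (by linarith) (by linarith) (hh _ hm)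
    (hh 0 (by simpa using h0.trans hc)) (by linarith)
  refine integrable_mul_cexp_sq_line (C := C) (K := 12)
    (continuous_iff_continuousAt.2 fun t => ?_) hε c fun t => ?_
  · have h3 := (hd (-(c + t * Complex.I)) (by simp) (by simp)).continuousAt
    exact ContinuousAt.comp (f := fun t : ℝ => (-(c + t * Complex.I) : ℂ)) h3 (by fun_prop)
  · simpa using hb (-(c + t * Complex.I)) (by simp) (by simp)

theorem norm_dampedInverse_le {α c ε : ℝ} {h : ℝ → ℂ} (l : ℝ) :
    ‖dampedInverse α h c ε l‖ ≤ (∫ t : ℝ, ‖inverseSymbol α (-((c : ℂ) + t * Complex.I)) *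
      mellin h (-((c : ℂ) + t * Complex.I)) * Complex.exp ((ε * (c + t * Complex.I)) ^ 2)‖) *
        Real.exp (-2 * c * l) := by
  have h2 : ‖(2 * Real.pi : ℂ)⁻¹‖ ≤ 1 := by
    rw [norm_inv, norm_mul, Complex.norm_real, Real.norm_of_nonneg Real.pi_pos.le]
    refine inv_le_one_of_one_le₀ ?_
    simp
    linarith [Real.pi_gt_three]
  rw [dampedInverse, norm_mul, ← integral_mul_const]
  refine (mul_le_of_le_one_left (norm_nonneg _) h2).trans
    ((norm_integral_le_integral_norm _).trans (le_of_eq ?_))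
  refine integral_congr_ae (ae_of_all _ fun t => ?_)
  beta_reduce
  rw [norm_mul, norm_cexp_neg_two_mul]
  simp

/-- The pairing of the damped tail combination with `h`, as a sine integral. -/
theorem gaussMean_pairing_eq_sine_integral {α : ℝ} (hα : -(1 / 4) < α) {x : ℝ} (hx : x ≠ 0)
    {h : ℝ → ℂ} {μ c ε : ℝ} (hh : ∀ c : ℝ, |c| < μ → MellinConvergent h c) (hμ : μ < 1 / 4)
    (h0 : 0 < c) (hc : c < μ) (hε : 0 < ε) :
    -(Real.pi * Real.sinh (Real.pi * x) : ℝ) * ∫ y in Ioi (0 : ℝ), gaussMean (fun u =>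
      (weberTail α (weberRe α x) (weberReD α x) (y * Real.exp (-(2 * ε * u))) : ℂ)) * (h y / y) =
    (Real.pi : ℂ)⁻¹ * ∫ l : ℝ, (Real.sin (x * logArc l) : ℂ) * logArcDeriv l *
      dampedInverse α h c ε l := by
  have hpi : (Real.pi : ℂ) ≠ 0 := by exact_mod_cast Real.pi_ne_zero
  have hα1 : -1 < α := by linarith
  obtain ⟨N, hN⟩ : ∃ N : ℝ → ℂ, N = fun t : ℝ => inverseSymbol α (-((c : ℂ) + t * Complex.I)) *
    mellin h (-((c : ℂ) + t * Complex.I)) * Complex.exp ((ε * (c + t * Complex.I)) ^ 2) := ⟨_, rfl⟩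
  have hNi : Integrable N := hN ▸ inverseSymbol_mul_mellin_line_integrable hα1 hh h0 hc hε
  have hp := integral_line_mul_mellin
    (tailSymbol_line_integrable (x := x) hα1 h0 (by linarith) hε)
    (fun y hy => gaussMean_weberTail hα hx h0 (hc.trans hμ) hε hy)
    (hh (-c) (by rw [abs_neg, abs_of_pos h0]; exact hc))
  -- Fubini for the sine integral
  have hprod : Integrable (Function.uncurry fun (l t : ℝ) => (Real.sin (x * logArc l) : ℂ) *
      logArcDeriv l * (N t * Complex.exp (-2 * (c + t * Complex.I) * l)))
      (volume.prod volume) := by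
    have h1 := (integrable_sin_logArc x (s := c) (by simpa) (by simp; linarith)).norm.mul_prod
      hNi.norm
    refine Integrable.mono' h1 ?_ (ae_of_all _ fun z => ?_)
    · refine AEStronglyMeasurable.mul ?_ (AEStronglyMeasurable.mul
        hNi.aestronglyMeasurable.comp_snd ?_)
      · have := logArc_continuous
        have := logArcDeriv_continuous
        exact Continuous.aestronglyMeasurable (by fun_prop)
      · exact Continuous.aestronglyMeasurable (by fun_prop)
    · simp only [Function.uncurry]
      refine le_of_eq ?_
      simp only [norm_mul, norm_cexp_neg_two_mul, Complex.add_re, Complex.ofReal_re, Complex.mul_re, Complex.I_re, mul_zero,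
        Complex.ofReal_im, Complex.I_im, mul_one, sub_self, add_zero]
      ring
  have hswap := integral_integral_swap hprod
  have e1 : ∀ l : ℝ, ∫ t : ℝ, (Real.sin (x * logArc l) : ℂ) *
      logArcDeriv l * (N t * Complex.exp (-2 * (c + t * Complex.I) * l)) =
      2 * Real.pi * ((Real.sin (x * logArc l) : ℂ) * logArcDeriv l * dampedInverse α h c ε l) :=
    fun l => by
      have hl : dampedInverse α h c ε l = (2 * Real.pi : ℂ)⁻¹ *
          ∫ t : ℝ, N t * Complex.exp (-2 * (c + t * Complex.I) * l) := by rw [dampedInverse, hN]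
      rw [integral_const_mul, hl]
      generalize (∫ t : ℝ, N t * Complex.exp (-2 * (c + t * Complex.I) * l)) = X
      field_simp
  have e2 : ∀ t : ℝ, ∫ l : ℝ, (Real.sin (x * logArc l) : ℂ) *
      logArcDeriv l * (N t * Complex.exp (-2 * (c + t * Complex.I) * l)) =
      -(Real.pi ^ 2 * Complex.sinh (Real.pi * x)) *
        (tailSymbol α x (c + t * Complex.I) * Complex.exp ((ε * (c + t * Complex.I)) ^ 2) *
          mellin h (-((c : ℂ) + t * Complex.I))) := fun t => by
    have : ∀ l : ℝ, (Real.sin (x * logArc l) : ℂ) *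
        logArcDeriv l * (N t * Complex.exp (-2 * (c + t * Complex.I) * l)) =
        N t * ((Real.sin (x * logArc l) : ℂ) * Complex.exp (-2 * (c + t * Complex.I) * l) *
          logArcDeriv l) := fun l => by ring
    simp_rw [this]
    rw [integral_const_mul, sin_logArc_integral x (by simpa) (by simp; linarith), hN, tailSymbol]
    field_simp
  simp_rw [e1, e2] at hswap
  rw [integral_const_mul, integral_const_mul, ← hp] at hswap
  generalize (∫ l : ℝ, (Real.sin (x * logArc l) : ℂ) * logArcDeriv l * dampedInverse α h c ε l) = X
    at hswap ⊢
  generalize (∫ y in Ioi (0 : ℝ), gaussMean (fun u =>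
      (weberTail α (weberRe α x) (weberReD α x) (y * Real.exp (-(2 * ε * u))) : ℂ)) * (h y / y)) = Y
    at hswap ⊢
  push_cast
  generalize Complex.sinh (Real.pi * x) = S at hswap ⊢
  have hX : X = -(Real.pi ^ 2 * S) * Y := by
    have h2 : (2 * Real.pi : ℂ) ≠ 0 := mul_ne_zero two_ne_zero hpi
    apply mul_left_cancel₀ h2
    rw [hswap]
    ring
  rw [hX]
  field_simp

/-- To the right of the imaginary axis the damped inverse Laplace integral is a Gaussian mean of the
sine transform. -/
theorem dampedInverse_eq_gaussMean {α : ℝ} (hα : -(1 / 4) < α) {g : ℂ → ℂ}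
    (hf : SineAdmissible fun τ : ℝ => g τ) {μ c ε : ℝ}
    (hh : ∀ c : ℝ, |c| < μ → MellinConvergent (indexG α g) c)
    (h0 : 0 < c) (hc : c < μ) (hε : 0 < ε) (l : ℝ) :
    dampedInverse α (indexG α g) c ε l =
      gaussMean fun u => sineTransform (fun τ : ℝ => g τ) (logArc (l - ε * u)) := by
  have hpi : (Real.pi : ℂ) ≠ 0 := by exact_mod_cast Real.pi_ne_zero
  have hε' : (ε : ℂ) ≠ 0 := by exact_mod_cast hε.ne'
  set h := indexG α g with hhdef
  set f : ℝ → ℂ := fun τ : ℝ => g τ with hfdef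
  set P : ℝ → ℂ := fun m => sineTransform f (logArc m) with hP
  have hm : AEStronglyMeasurable h (volume.restrict (Ioi 0)) :=
    (hh 0 (by simpa using h0.trans hc)).aestronglyMeasurable
  -- the two lines: `b` to the right of `0` and `-α`, and a slightly larger `b'`
  obtain ⟨b, hb0, hαb, hb⟩ : ∃ b : ℝ, 0 < b ∧ -α < b ∧ b < 1 / 4 :=
    ⟨max (1 / 8) ((1 / 4 - α) / 2), lt_max_of_lt_left (by norm_num), lt_max_of_lt_right (by linarith),
      max_lt (by norm_num) (by linarith)⟩
  have hm' : |-((c + μ) / 2)| < μ := by rw [abs_neg, abs_of_pos (by linarith)]; linarith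
  obtain ⟨hd, C, hC, hbd⟩ := inverseSymbol_mul_mellin_strip (α := α) (h := h) (a := -c) (b := b)
    (a' := -((c + μ) / 2)) (b' := (b + 1 / 4) / 2) (by linarith) (by linarith) (hh _ hm')
    (indexG_mellinConvergent hf hm (by linarith) (by linarith) (by linarith)) (by linarith)
  have hshift := integral_mul_cexp_sq_line_eq
    (A := fun w => inverseSymbol α w * mellin h w * Complex.exp (2 * w * l))
    (C := C * Real.exp (2 * (c + b) * |l|)) (K := 12) hε (by linarith : -c ≤ b)
    (fun z hz1 hz2 => (hd z hz1 hz2).mul (by fun_prop)) (fun z hz1 hz2 => by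
      rw [norm_mul, norm_cexp_two_mul]
      have hre : 2 * z.re * l ≤ 2 * (c + b) * |l| := by
        have h1 : |z.re| ≤ c + b := abs_le.2 ⟨by linarith, by linarith⟩
        calc 2 * z.re * l ≤ |2 * z.re * l| := le_abs_self _
          _ = 2 * |z.re| * |l| := by rw [abs_mul, abs_mul, abs_two]
          _ ≤ _ := by gcongr
      calc _ ≤ C * Real.exp (12 * |z.im|) * Real.exp (2 * (c + b) * |l|) := by
            gcongr
            exact hbd z hz1 hz2
        _ = _ := by ring)
  have hleft : 2 * Real.pi * dampedInverse α h c ε l = ∫ t : ℝ,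
      inverseSymbol α ((-c : ℝ) + t * Complex.I) * mellin h ((-c : ℝ) + t * Complex.I) *
        Complex.exp (2 * ((-c : ℝ) + t * Complex.I) * l) *
          Complex.exp ((ε * ((-c : ℝ) + t * Complex.I)) ^ 2) := by
    rw [dampedInverse, mul_inv_cancel_left₀ (mul_ne_zero two_ne_zero hpi), ← integral_neg_eq_self]
    refine integral_congr_ae (ae_of_all _ fun t => ?_)
    have e : (-(c + (-t : ℝ) * Complex.I) : ℂ) = (-c : ℝ) + t * Complex.I := by push_cast; ring
    have e' : (c + (-t : ℝ) * Complex.I : ℂ) = -((-c : ℝ) + t * Complex.I) := by push_cast; ring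
    beta_reduce
    rw [e, e', show ∀ w : ℂ, -2 * -w * l = 2 * w * l by intro w; ring,
      show ∀ w : ℂ, (ε * -w) ^ 2 = (ε * w) ^ 2 by intro w; ring]
    ring
  -- Fubini on the right-hand line
  have hPi := sineLaplace_integrable hf (s := (b : ℂ)) (by simpa)
    (by rw [Complex.ofReal_re]; exact hb)
  have hgauss : Integrable fun t : ℝ => Complex.exp ((ε * (b + t * Complex.I)) ^ 2) := by
    have := integrable_mul_cexp_sq_line (A := fun _ => 1) (C := 1) (K := 0) continuous_const hε b
      (fun t => by simp)
    simpa using this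
  have hprod : Integrable (Function.uncurry fun (t m : ℝ) => P m *
      (Complex.exp ((ε * (b + t * Complex.I)) ^ 2) *
        Complex.exp (2 * (b + t * Complex.I) * (l - m : ℝ)))) (volume.prod volume) := by
    have h1 := (hgauss.norm.mul_prod hPi.norm).const_mul (Real.exp (2 * b * l))
    refine Integrable.mono' h1 ?_ (ae_of_all _ fun z => ?_)
    · have := (sineTransform_continuous hf).comp logArc_continuous
      have h2 : Continuous P := this
      exact Continuous.aestronglyMeasurable (by fun_prop)
    · simp only [Function.uncurry]
      rw [norm_mul, norm_mul, norm_mul, norm_cexp_neg_two_mul, norm_cexp_two_mul]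
      simp only [Complex.add_re, Complex.ofReal_re, Complex.mul_re, Complex.I_re, mul_zero,
        Complex.ofReal_im, Complex.I_im, mul_one, sub_self, add_zero]
      refine le_of_eq ?_
      rw [show 2 * b * (l - z.2) = 2 * b * l + -2 * b * z.2 by ring, Real.exp_add]
      ring
  have hswap := integral_integral_swap hprod
  have e1 : ∀ t : ℝ, 2 * ∫ m : ℝ, P m * (Complex.exp ((ε * (b + t * Complex.I)) ^ 2) *
        Complex.exp (2 * (b + t * Complex.I) * (l - m : ℝ))) =
      inverseSymbol α (b + t * Complex.I) * mellin h (b + t * Complex.I) *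
        Complex.exp (2 * (b + t * Complex.I) * l) *
          Complex.exp ((ε * (b + t * Complex.I)) ^ 2) := fun t => by
    rw [inverseSymbol_mul_mellin hf hm hb0 hαb hb, sineLaplace]
    have : ∀ m : ℝ, P m * (Complex.exp ((ε * (b + t * Complex.I)) ^ 2) *
        Complex.exp (2 * (b + t * Complex.I) * (l - m : ℝ))) =
        sineTransform f (logArc m) * Complex.exp (-2 * (b + t * Complex.I) * m) *
          (Complex.exp (2 * (b + t * Complex.I) * l) *
            Complex.exp ((ε * (b + t * Complex.I)) ^ 2)) := fun m => by
      have e : (2 * (b + t * Complex.I) * (l - m : ℝ) : ℂ) =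
          -2 * (b + t * Complex.I) * m + 2 * (b + t * Complex.I) * l := by push_cast; ring
      rw [e, Complex.exp_add, hP]
      ring
    simp_rw [this]
    rw [integral_mul_const]
    ring
  have e2 : ∀ m : ℝ, ∫ t : ℝ, P m * (Complex.exp ((ε * (b + t * Complex.I)) ^ 2) *
        Complex.exp (2 * (b + t * Complex.I) * (l - m : ℝ))) =
      P m * ((Real.sqrt Real.pi / ε * Real.exp (-((l - m) / ε) ^ 2) : ℝ) : ℂ) := fun m => by
    rw [integral_const_mul, integral_cexp_sq_add_line hε]
  -- the substitution `m = l - ε u`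
  have hsub : ∫ m : ℝ, P m * ((Real.sqrt Real.pi / ε * Real.exp (-((l - m) / ε) ^ 2) : ℝ) : ℂ) =
      (Real.sqrt Real.pi : ℝ) * ∫ u : ℝ, P (l - ε * u) * (Real.exp (-u ^ 2) : ℝ) := by
    have s1 := integral_sub_left_eq_self (μ := volume)
      (fun m : ℝ => P m * ((Real.sqrt Real.pi / ε * Real.exp (-((l - m) / ε) ^ 2) : ℝ) : ℂ)) l
    have s2 := Measure.integral_comp_mul_left (fun m : ℝ => P (l - m) *
      ((Real.sqrt Real.pi / ε * Real.exp (-((l - (l - m)) / ε) ^ 2) : ℝ) : ℂ)) ε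
    rw [s1, abs_of_pos (inv_pos.2 hε), Complex.real_smul] at s2
    have s3 : ∀ u : ℝ, P (l - ε * u) *
        ((Real.sqrt Real.pi / ε * Real.exp (-((l - (l - ε * u)) / ε) ^ 2) : ℝ) : ℂ) =
        ((Real.sqrt Real.pi : ℝ) : ℂ) / ε * (P (l - ε * u) * (Real.exp (-u ^ 2) : ℝ)) := fun u => by
      have : (l - (l - ε * u)) / ε = u := by field_simp; ring
      rw [this]
      push_cast
      ring
    simp_rw [s3] at s2
    rw [integral_const_mul] at s2
    rw [Complex.ofReal_inv] at s2
    generalize (∫ m : ℝ, P m *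
      ((Real.sqrt Real.pi / ε * Real.exp (-((l - m) / ε) ^ 2) : ℝ) : ℂ)) = X at s2 ⊢
    generalize (∫ u : ℝ, P (l - ε * u) * (Real.exp (-u ^ 2) : ℝ)) = Z at s2 ⊢
    field_simp at s2
    exact s2.symm
  have hfin : 2 * Real.pi * dampedInverse α h c ε l =
      2 * ((Real.sqrt Real.pi : ℝ) * ∫ u : ℝ, P (l - ε * u) * (Real.exp (-u ^ 2) : ℝ)) := by
    rw [hleft, hshift, ← hsub]
    simp_rw [e2] at hswap
    rw [← hswap, ← integral_const_mul]
    exact integral_congr_ae (ae_of_all _ fun t => (e1 t).symm)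
  rw [gaussMean]
  have hsq : ((Real.sqrt Real.pi : ℝ) : ℂ) * (Real.sqrt Real.pi : ℝ) = Real.pi := by
    rw [← Complex.ofReal_mul, Real.mul_self_sqrt Real.pi_pos.le]
  have hs := sqrt_pi_ne_zero
  generalize (∫ u : ℝ, P (l - ε * u) * (Real.exp (-u ^ 2) : ℝ)) = X at hfin ⊢
  rw [← hsq] at hfin
  field_simp
  have h2 : (2 * ((Real.sqrt Real.pi : ℝ) : ℂ)) ≠ 0 := mul_ne_zero two_ne_zero hs
  apply mul_left_cancel₀ h2
  linear_combination hfin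



/-! ### Sine inversion for test functions -/

/-- The sine transform `∫ φ(x) sin(xv) dx` of a test function. -/
noncomputable def testSine (φ : ℝ → ℝ) (v : ℝ) : ℂ :=
  ∫ x : ℝ, (φ x : ℂ) * (Real.sin (x * v) : ℂ)

open scoped FourierTransform ContDiff SchwartzMap

theorem sin_two_pi_eq (a : ℝ) : (Real.sin (2 * Real.pi * a) : ℂ) =
    (Complex.exp ((2 * Real.pi * a : ℝ) * Complex.I) -
      Complex.exp ((-2 * Real.pi * a : ℝ) * Complex.I)) / (2 * Complex.I) := by
  rw [Complex.ofReal_sin, Complex.sin]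
  have h1 : ((-2 * Real.pi * a : ℝ) : ℂ) * Complex.I = -((2 * Real.pi * a : ℝ) : ℂ) * Complex.I := by
    push_cast; ring
  rw [h1]
  generalize Complex.exp (-((2 * Real.pi * a : ℝ) : ℂ) * Complex.I) = E1
  generalize Complex.exp (((2 * Real.pi * a : ℝ) : ℂ) * Complex.I) = E2
  field_simp
  linear_combination (E1 - E2) * Complex.I_sq

theorem integrable_exp_real_mul_I_mul {f : ℝ → ℂ} (hf : Integrable f) (b : ℝ) :
    Integrable fun v : ℝ => Complex.exp ((b * v : ℝ) * Complex.I) * f v :=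
  hf.bdd_mul (c := 1) (Continuous.aestronglyMeasurable (by fun_prop))
    (ae_of_all _ fun v => by rw [Complex.norm_exp_ofReal_mul_I])

/-- A test function through its sine transform: smoothness makes the sine transform integrable, and
Fourier inversion recovers the odd part. -/
theorem testSine_inversion {φ : ℝ → ℝ} (hφ : ContDiff ℝ ∞ φ) (hc : HasCompactSupport φ) :
    Integrable (testSine φ) ∧ ∀ t : ℝ,
      ∫ v in Ioi (0 : ℝ), testSine φ v * (Real.sin (t * v) : ℂ) =
        Real.pi * ((φ t - φ (-t)) / 2 : ℝ) := by
  set ψ : 𝓢(ℝ, ℂ) := HasCompactSupport.toSchwartzMap (f := fun x => (φ x : ℂ))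
    (hc.comp_left (g := fun r : ℝ => (r : ℂ)) rfl) (Complex.ofRealCLM.contDiff.comp hφ) with hψ
  have hψx : ∀ x, ψ x = (φ x : ℂ) := fun x => rfl
  have hψi : Integrable (fun x => ψ x) := ψ.integrable
  set F : ℝ → ℂ := 𝓕 (ψ : ℝ → ℂ) with hF
  have hFi : Integrable F := by
    have := (𝓕 ψ).integrable (μ := volume)
    rwa [SchwartzMap.fourier_coe] at this
  have hFv : ∀ w, F w = ∫ v : ℝ, Complex.exp (((-2 * Real.pi * w) * v : ℝ) * Complex.I) * ψ v :=
    fun w => by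
      rw [hF, Real.fourier_real_eq_integral_exp_smul]
      refine integral_congr_ae (ae_of_all _ fun v => ?_)
      beta_reduce
      rw [smul_eq_mul, show -2 * Real.pi * v * w = -2 * Real.pi * w * v by ring]
  have hinv : ∀ t, ψ t = ∫ v : ℝ, Complex.exp (((2 * Real.pi * t) * v : ℝ) * Complex.I) * F v :=
    fun t => by
      have h := congrFun (ψ.continuous.fourierInv_fourier_eq ψ.integrable hFi) t
      rw [← h, Real.fourierInv_eq_fourier_neg, Real.fourier_real_eq_integral_exp_smul]
      refine integral_congr_ae (ae_of_all _ fun v => ?_)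
      beta_reduce
      rw [smul_eq_mul, show -2 * Real.pi * v * -t = 2 * Real.pi * t * v by ring]
  have hΦ : ∀ w, testSine φ (2 * Real.pi * w) = (F (-w) - F w) / (2 * Complex.I) := fun w => by
    rw [hFv, hFv, ← integral_sub (integrable_exp_real_mul_I_mul hψi _)
      (integrable_exp_real_mul_I_mul hψi _), testSine, ← integral_div]
    refine integral_congr_ae (ae_of_all _ fun v => ?_)
    beta_reduce
    rw [show v * (2 * Real.pi * w) = 2 * Real.pi * (w * v) by ring, sin_two_pi_eq, hψx,
      show -2 * Real.pi * -w * v = 2 * Real.pi * (w * v) by ring,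
      show -2 * Real.pi * w * v = -2 * Real.pi * (w * v) by ring]
    ring
  have h2pi : (2 * Real.pi : ℝ) ≠ 0 := by positivity
  have hΦi : Integrable (testSine φ) := by
    have h1 : Integrable fun w => testSine φ (2 * Real.pi * w) := by
      simp_rw [hΦ]
      exact (hFi.comp_neg.sub hFi).div_const _
    exact (integrable_comp_mul_left_iff _ h2pi).1 h1
  refine ⟨hΦi, fun t => ?_⟩
  have hsin : Integrable fun v => testSine φ v * (Real.sin (t * v) : ℂ) := by
    refine (hΦi.bdd_mul (c := 1) (f := fun v => (Real.sin (t * v) : ℂ))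
      (Continuous.aestronglyMeasurable (by fun_prop)) (ae_of_all _ fun v => ?_)).congr
        (ae_of_all _ fun v => mul_comm _ _)
    rw [Complex.norm_real, Real.norm_eq_abs]
    exact Real.abs_sin_le_one _
  -- the integrand is even, so the half line carries half of the integral
  have heven : ∀ v, testSine φ (-v) * (Real.sin (t * -v) : ℂ) =
      testSine φ v * (Real.sin (t * v) : ℂ) := fun v => by
    have : testSine φ (-v) = -testSine φ v := by
      rw [testSine, testSine, ← integral_neg]
      refine integral_congr_ae (ae_of_all _ fun x => ?_)
      beta_reduce
      rw [mul_neg, Real.sin_neg]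
      push_cast
      ring
    rw [this, mul_neg t, Real.sin_neg]
    push_cast
    ring
  have hhalf : ∫ v : ℝ, testSine φ v * (Real.sin (t * v) : ℂ) =
      2 * ∫ v in Ioi (0 : ℝ), testSine φ v * (Real.sin (t * v) : ℂ) := by
    rw [← intervalIntegral.integral_Iic_add_Ioi (b := 0) hsin.integrableOn hsin.integrableOn, two_mul]
    congr 1
    have := integral_comp_neg_Iic (0 : ℝ) fun v => testSine φ v * (Real.sin (t * v) : ℂ)
    simp_rw [heven] at this
    rw [this, neg_zero]
  -- rescale by `2π` and compare with Fourier inversion at `t` and `-t`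
  have hscale := Measure.integral_comp_mul_left
    (fun v => testSine φ v * (Real.sin (t * v) : ℂ)) (2 * Real.pi)
  have hS1 : Integrable fun v : ℝ => (Real.sin (2 * Real.pi * (t * v)) : ℂ) * F v :=
    hFi.bdd_mul (c := 1) (Continuous.aestronglyMeasurable (by fun_prop)) (ae_of_all _ fun v => by
      rw [Complex.norm_real, Real.norm_eq_abs]
      exact Real.abs_sin_le_one _)
  have hS2 : Integrable fun v : ℝ => (Real.sin (2 * Real.pi * (t * v)) : ℂ) * F (-v) :=
    hFi.comp_neg.bdd_mul (c := 1) (Continuous.aestronglyMeasurable (by fun_prop))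
      (ae_of_all _ fun v => by
        rw [Complex.norm_real, Real.norm_eq_abs]
        exact Real.abs_sin_le_one _)
  have hneg : ∫ v : ℝ, (Real.sin (2 * Real.pi * (t * v)) : ℂ) * F (-v) =
      -∫ v : ℝ, (Real.sin (2 * Real.pi * (t * v)) : ℂ) * F v := by
    rw [← integral_neg_eq_self, ← integral_neg]
    refine integral_congr_ae (ae_of_all _ fun v => ?_)
    beta_reduce
    rw [neg_neg, mul_neg t, mul_neg, Real.sin_neg]
    push_cast
    ring
  have hodd : ∫ v : ℝ, (Real.sin (2 * Real.pi * (t * v)) : ℂ) * F v =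
      (ψ t - ψ (-t)) / (2 * Complex.I) := by
    rw [hinv, hinv, ← integral_sub (integrable_exp_real_mul_I_mul hFi _)
      (integrable_exp_real_mul_I_mul hFi _), ← integral_div]
    refine integral_congr_ae (ae_of_all _ fun v => ?_)
    beta_reduce
    rw [sin_two_pi_eq, show 2 * Real.pi * t * v = 2 * Real.pi * (t * v) by ring,
      show 2 * Real.pi * -t * v = -2 * Real.pi * (t * v) by ring]
    ring
  have hcomp : ∫ v : ℝ, testSine φ (2 * Real.pi * v) * (Real.sin (t * (2 * Real.pi * v)) : ℂ) =
      (ψ t - ψ (-t)) / 2 := by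
    have e : ∀ v : ℝ, testSine φ (2 * Real.pi * v) * (Real.sin (t * (2 * Real.pi * v)) : ℂ) =
        (2 * Complex.I)⁻¹ * ((Real.sin (2 * Real.pi * (t * v)) : ℂ) * F (-v) -
          (Real.sin (2 * Real.pi * (t * v)) : ℂ) * F v) := fun v => by
      rw [hΦ, show t * (2 * Real.pi * v) = 2 * Real.pi * (t * v) by ring]
      ring
    simp_rw [e]
    rw [integral_const_mul, integral_sub hS2 hS1, hneg, hodd]
    field_simp
    linear_combination -2 * (ψ t - ψ (-t)) * Complex.I_sq
  rw [hcomp, hhalf, abs_of_pos (by positivity), Complex.real_smul, hψx, hψx] at hscale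
  generalize (∫ v in Ioi (0 : ℝ), testSine φ v * (Real.sin (t * v) : ℂ)) = X at hscale ⊢
  have hpi : (Real.pi : ℂ) ≠ 0 := by exact_mod_cast Real.pi_ne_zero
  push_cast at hscale ⊢
  field_simp at hscale
  linear_combination -(1 / 2) * hscale



/-! ### Removing the Gaussian damping -/

theorem norm_gaussMean_le_of_exp {f : ℝ → ℂ} {M B : ℝ} (hb : ∀ u, ‖f u‖ ≤ M * Real.exp (B * |u|)) :
    ‖gaussMean f‖ ≤ M * ∫ u : ℝ, Real.exp (B * |u|) * Real.exp (-u ^ 2) := by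
  have h1 : ‖∫ u : ℝ, f u * (Real.exp (-u ^ 2) : ℝ)‖ ≤
      ∫ u : ℝ, M * (Real.exp (B * |u|) * Real.exp (-u ^ 2)) := by
    refine norm_integral_le_of_norm_le ((integrable_exp_abs_mul_exp_neg_sq B).const_mul M)
      (ae_of_all _ fun u => ?_)
    rw [norm_mul, Complex.norm_real, Real.norm_of_nonneg (Real.exp_pos _).le, ← mul_assoc]
    exact mul_le_mul_of_nonneg_right (hb u) (Real.exp_pos _).le
  have h2 : ‖((Real.sqrt Real.pi : ℝ) : ℂ)⁻¹‖ ≤ 1 := by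
    rw [norm_inv, Complex.norm_real, Real.norm_of_nonneg (Real.sqrt_nonneg _)]
    refine inv_le_one_of_one_le₀ (Real.one_le_sqrt.2 ?_)
    linarith [Real.pi_gt_three]
  rw [integral_const_mul] at h1
  rw [gaussMean, norm_mul]
  exact (mul_le_of_le_one_left (norm_nonneg _) h2).trans h1

theorem aestronglyMeasurable_gaussMean_dilate {F : ℝ → ℝ} (hF : ContinuousOn F (Ioi 0)) (ε : ℝ) :
    AEStronglyMeasurable (fun y => gaussMean fun u => (F (y * Real.exp (-(2 * ε * u))) : ℂ))
      (volume.restrict (Ioi 0)) := by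
  have hc : ContinuousOn (fun z : ℝ × ℝ => (F (z.1 * Real.exp (-(2 * ε * z.2))) : ℂ) *
      (Real.exp (-z.2 ^ 2) : ℝ)) (Ioi 0 ×ˢ univ) := by
    refine ContinuousOn.mul (Complex.continuous_ofReal.comp_continuousOn (hF.comp (by fun_prop)
      fun z hz => ?_)) (by fun_prop)
    have : 0 < z.1 := hz.1
    exact mul_pos this (Real.exp_pos _)
  have hmeas := hc.aestronglyMeasurable (μ := (volume : Measure (ℝ × ℝ)))
    (measurableSet_Ioi.prod MeasurableSet.univ)
  rw [Measure.volume_eq_prod, ← Measure.prod_restrict, Measure.restrict_univ] at hmeas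
  exact (hmeas.integral_prod_right').const_mul _

namespace WeberBounds

variable {α δ C : ℝ} {R D : ℝ → ℝ}

theorem norm_tail_dilate_le (hW : WeberBounds α δ C R D) (hδ : 0 < δ) {ε y : ℝ} (h0 : 0 < ε)
    (h1 : ε ≤ 1) (hy : 0 < y) (u : ℝ) :
    ‖(weberTail α R D (y * Real.exp (-(2 * ε * u))) : ℂ)‖ ≤
      (α ^ 2 + 1) * C * (1 + y ^ (-δ)) * Real.exp (2 * δ * |u|) := by
  have hC := hW.nonneg
  have hp : 0 < y ^ (-δ) := by positivity
  rw [Complex.norm_real]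
  refine (hW.abs_weberTail_le (by positivity)).trans ?_
  rw [mul_assoc ((α ^ 2 + 1) * C)]
  refine mul_le_mul_of_nonneg_left ((one_add_rpow_neg_mul_exp_le hy ε u δ).trans ?_)
    (by positivity)
  refine mul_le_mul_of_nonneg_left (Real.exp_le_exp.2 ?_) (by positivity)
  refine mul_le_mul_of_nonneg_right ?_ (abs_nonneg _)
  rw [abs_of_pos (by positivity)]
  nlinarith

theorem norm_damped_integrand_le (hW : WeberBounds α δ C R D) (hδ : 0 < δ) {h : ℝ → ℂ} {ε y : ℝ}
    (h0 : 0 < ε) (h1 : ε ≤ 1) (hy : 0 < y) :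
    ‖gaussMean (fun u => (weberTail α R D (y * Real.exp (-(2 * ε * u))) : ℂ)) * (h y / y)‖ ≤
      ((α ^ 2 + 1) * C * ∫ u : ℝ, Real.exp (2 * δ * |u|) * Real.exp (-u ^ 2)) *
        (y ^ ((0 : ℝ) - 1) * ‖h y‖ + y ^ (-δ - 1) * ‖h y‖) := by
  have h2 := norm_gaussMean_le_of_exp (hW.norm_tail_dilate_le hδ h0 h1 hy)
  rw [norm_mul, norm_div, Complex.norm_real, Real.norm_of_nonneg hy.le, Real.rpow_sub_one hy.ne',
    Real.rpow_sub_one hy.ne', Real.rpow_zero]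
  refine (mul_le_mul_of_nonneg_right h2 (by positivity)).trans (le_of_eq ?_)
  ring

theorem integrable_pairing_bound {h : ℝ → ℂ} (h0 : MellinConvergent h (0 : ℝ))
    (hδ : MellinConvergent h (-δ : ℝ)) :
    IntegrableOn (fun y => y ^ ((0 : ℝ) - 1) * ‖h y‖ + y ^ (-δ - 1) * ‖h y‖) (Ioi 0) := by
  have i1 := h0.integrable_norm_rpow
  have i2 := hδ.integrable_norm_rpow
  rw [Complex.ofReal_re] at i1 i2
  exact i1.add i2

theorem norm_damped_pairing_le (hW : WeberBounds α δ C R D) (hδ : 0 < δ) {h : ℝ → ℂ}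
    (hh0 : MellinConvergent h (0 : ℝ)) (hhδ : MellinConvergent h (-δ : ℝ)) {ε : ℝ}
    (h0 : 0 < ε) (h1 : ε ≤ 1) :
    ‖∫ y in Ioi (0 : ℝ), gaussMean (fun u => (weberTail α R D (y * Real.exp (-(2 * ε * u))) : ℂ)) *
      (h y / y)‖ ≤ ((α ^ 2 + 1) * C * ∫ u : ℝ, Real.exp (2 * δ * |u|) * Real.exp (-u ^ 2)) *
        ∫ y in Ioi (0 : ℝ), (y ^ ((0 : ℝ) - 1) * ‖h y‖ + y ^ (-δ - 1) * ‖h y‖) := by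
  rw [← integral_const_mul]
  refine norm_integral_le_of_norm_le ((integrable_pairing_bound hh0 hhδ).const_mul _) ?_
  filter_upwards [ae_restrict_mem measurableSet_Ioi] with y hy
  exact hW.norm_damped_integrand_le hδ h0 h1 hy

/-- The damped pairings converge to the pairing itself, by dominated convergence with the bound
`O(1 + y^{-δ})` for the tail function. -/
theorem tendsto_damped_pairing (hW : WeberBounds α δ C R D) (hδ : 0 < δ) {h : ℝ → ℂ}
    (hh0 : MellinConvergent h (0 : ℝ)) (hhδ : MellinConvergent h (-δ : ℝ)) :
    Tendsto (fun ε => ∫ y in Ioi (0 : ℝ), gaussMean (fun u =>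
      (weberTail α R D (y * Real.exp (-(2 * ε * u))) : ℂ)) * (h y / y)) (𝓝[>] 0)
      (𝓝 (∫ y in Ioi (0 : ℝ), (weberTail α R D y : ℂ) * (h y / y))) := by
  have hpos : ∀ᶠ ε : ℝ in 𝓝[>] 0, 0 < ε ∧ ε ≤ 1 := by
    filter_upwards [Ioc_mem_nhdsGT one_pos] with ε hε using hε
  refine tendsto_integral_filter_of_dominated_convergence
    (fun y => ((α ^ 2 + 1) * C * ∫ u : ℝ, Real.exp (2 * δ * |u|) * Real.exp (-u ^ 2)) *
      (y ^ ((0 : ℝ) - 1) * ‖h y‖ + y ^ (-δ - 1) * ‖h y‖)) (Eventually.of_forall fun ε => ?_)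
    (hpos.mono fun ε hε => ?_) ((integrable_pairing_bound hh0 hhδ).const_mul _) ?_
  · refine (aestronglyMeasurable_gaussMean_dilate hW.weberTail_continuousOn ε).mul ?_
    exact (hh0.aestronglyMeasurable.mul
      (Complex.measurable_ofReal.inv).aestronglyMeasurable).congr
        (ae_of_all _ fun y => (div_eq_mul_inv _ _).symm)
  · filter_upwards [ae_restrict_mem measurableSet_Ioi] with y hy
    exact hW.norm_damped_integrand_le hδ hε.1 hε.2 hy
  · filter_upwards [ae_restrict_mem measurableSet_Ioi] with y hy
    have hy0 : 0 < y := hy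
    refine Tendsto.mul_const _ (tendsto_gaussMean (fun ε => ?_)
      (hpos.mono fun ε hε => hW.norm_tail_dilate_le hδ hε.1 hε.2 hy0) fun u => ?_)
    · exact (Complex.continuous_ofReal.comp (hW.weberTail_continuousOn.comp_continuous (by fun_prop)
        fun u => mul_pos hy0 (Real.exp_pos _))).aestronglyMeasurable
    · have h1 : Tendsto (fun ε : ℝ => y * Real.exp (-(2 * ε * u))) (𝓝[>] 0) (𝓝 y) := by
        have : Continuous fun ε : ℝ => y * Real.exp (-(2 * ε * u)) := by fun_prop
        have h2 := this.tendsto 0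
        simp only [mul_zero, zero_mul, neg_zero, Real.exp_zero, mul_one] at h2
        exact h2.mono_left nhdsWithin_le_nhds
      exact (Complex.continuous_ofReal.tendsto _).comp
        ((hW.weberTail_continuousOn.continuousAt (Ioi_mem_nhds hy0)).tendsto.comp h1)

end WeberBounds

/-- The pairing `∫_0^∞ F_x(y) h(y) dy/y` of the tail combination with `h`. -/
noncomputable def tailPairing (α : ℝ) (h : ℝ → ℂ) (x : ℝ) : ℂ :=
  ∫ y in Ioi (0 : ℝ), (weberTail α (weberRe α x) (weberReD α x) y : ℂ) * (h y / y)

theorem tailPairing_continuousOn {α δ : ℝ} (hα : -(1 / 4) < α) (hδ : 0 < δ) {h : ℝ → ℂ}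
    (hh0 : MellinConvergent h (0 : ℝ)) (hhδ : MellinConvergent h (-δ : ℝ)) :
    ContinuousOn (tailPairing α h) {0}ᶜ := by
  intro x₀ hx₀
  obtain ⟨r, hr0, hr⟩ := Metric.isOpen_iff.1 isOpen_compl_singleton x₀ hx₀
  have hsub : Metric.closedBall x₀ (r / 2) ⊆ {0}ᶜ :=
    (Metric.closedBall_subset_ball (by linarith)).trans hr
  obtain ⟨C, hC, hW⟩ := weberRe_bounds hα (isCompact_closedBall x₀ (r / 2))
    (fun x hx => sin_pi_order_ne_zero (hsub hx)) hδ
  have hnhds : Metric.closedBall x₀ (r / 2) ∈ 𝓝 x₀ := Metric.closedBall_mem_nhds _ (by linarith)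
  refine (continuousAt_of_dominated
    (bound := fun y => (α ^ 2 + 1) * C * (y ^ ((0 : ℝ) - 1) * ‖h y‖ + y ^ (-δ - 1) * ‖h y‖))
    ?_ ?_ ((WeberBounds.integrable_pairing_bound hh0 hhδ).const_mul _) ?_).continuousWithinAt
  · filter_upwards [hnhds] with x hx
    exact ((hW x hx).1.integrableOn_tail hh0 hhδ).1
  · filter_upwards [hnhds] with x hx
    filter_upwards [ae_restrict_mem measurableSet_Ioi] with y hy
    have hy0 : 0 < y := hy
    have h2 := (hW x hx).1.abs_weberTail_le hy0
    rw [norm_mul, norm_div, Complex.norm_real, Complex.norm_real, Real.norm_of_nonneg hy0.le,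
      Real.rpow_sub_one hy0.ne', Real.rpow_sub_one hy0.ne', Real.rpow_zero]
    refine (mul_le_mul_of_nonneg_right h2 (by positivity)).trans (le_of_eq ?_)
    ring
  · filter_upwards [ae_restrict_mem measurableSet_Ioi] with y hy
    exact (Complex.continuous_ofReal.continuousAt.comp
      ((weberTail_continuousOn_order hα hy).continuousAt
        (isOpen_compl_singleton.mem_nhds hx₀))).mul_const _

/-! ### The inversion formula at nonzero real points -/

section Inversion

variable {α μ : ℝ} {g : ℂ → ℂ}

/-- The damped inverse Laplace integral is bounded, uniformly in `ε`. -/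
theorem norm_dampedInverse_le_const (hα : -(1 / 4) < α) (hf : SineAdmissible fun τ : ℝ => g τ)
    {c ε : ℝ} (hh : ∀ c : ℝ, |c| < μ → MellinConvergent (indexG α g) c)
    (h0 : 0 < c) (hc : c < μ) (hε : 0 < ε) (l : ℝ) :
    ‖dampedInverse α (indexG α g) c ε l‖ ≤
      ∫ τ : ℝ, ‖g τ / τ‖ * (1 + |τ| ^ (0 : ℝ)) := by
  rw [dampedInverse_eq_gaussMean hα hf hh h0 hc hε]
  have hM : 0 ≤ ∫ τ : ℝ, ‖g τ / τ‖ * (1 + |τ| ^ (0 : ℝ)) :=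
    integral_nonneg fun τ => by positivity
  refine norm_gaussMean_le fun u => ?_
  refine (norm_sineTransform_logArc_le hf le_rfl (by norm_num) _).trans
    (mul_le_of_le_one_right hM (min_le_left _ _))

theorem dampedInverse_continuous (hα : -(1 / 4) < α) (hf : SineAdmissible fun τ : ℝ => g τ)
    {c ε : ℝ} (hh : ∀ c : ℝ, |c| < μ → MellinConvergent (indexG α g) c)
    (h0 : 0 < c) (hc : c < μ) (hε : 0 < ε) :
    Continuous fun l => dampedInverse α (indexG α g) c ε l := by
  simp_rw [dampedInverse_eq_gaussMean hα hf hh h0 hc hε, gaussMean]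
  have hP : Continuous fun l => sineTransform (fun τ : ℝ => g τ) (logArc l) :=
    (sineTransform_continuous hf).comp logArc_continuous
  have hM : 0 ≤ ∫ τ : ℝ, ‖g τ / τ‖ * (1 + |τ| ^ (0 : ℝ)) :=
    integral_nonneg fun τ => by positivity
  refine continuous_const.mul (continuous_of_dominated
    (bound := fun u => (∫ τ : ℝ, ‖g τ / τ‖ * (1 + |τ| ^ (0 : ℝ))) * Real.exp (-u ^ 2))
    (fun l => ?_) (fun l => ae_of_all _ fun u => ?_) ?_ (ae_of_all _ fun u => ?_))
  · exact ((hP.comp (by fun_prop : Continuous fun u : ℝ => l - ε * u)).mul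
      (by fun_prop)).aestronglyMeasurable
  · rw [norm_mul, Complex.norm_real, Real.norm_of_nonneg (Real.exp_pos _).le]
    refine mul_le_mul_of_nonneg_right ?_ (Real.exp_pos _).le
    exact (norm_sineTransform_logArc_le hf le_rfl (by norm_num) _).trans
      (mul_le_of_le_one_right hM (min_le_left _ _))
  · have := integrable_exp_neg_mul_sq one_pos
    simp only [neg_mul, one_mul] at this
    exact this.const_mul _
  · exact (hP.comp (by fun_prop : Continuous fun l : ℝ => l - ε * u)).mul continuous_const

/-- `P_ε(l) v'(l)` is integrable: `P_ε` is bounded and `v'(l) ≤ e^l` on the left, while on the right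
`P_ε` decays like `e^{-2cl}`. -/
theorem dampedInverse_integrable (hα : -(1 / 4) < α) (hf : SineAdmissible fun τ : ℝ => g τ)
    {c ε : ℝ} (hh : ∀ c : ℝ, |c| < μ → MellinConvergent (indexG α g) c)
    (h0 : 0 < c) (hc : c < μ) (hε : 0 < ε) :
    Integrable fun l => (logArcDeriv l : ℂ) * dampedInverse α (indexG α g) c ε l := by
  set M1 := ∫ τ : ℝ, ‖g τ / τ‖ * (1 + |τ| ^ (0 : ℝ)) with hM1
  set M2 := ∫ t : ℝ, ‖inverseSymbol α (-((c : ℂ) + t * Complex.I)) *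
      mellin (indexG α g) (-((c : ℂ) + t * Complex.I)) *
        Complex.exp ((ε * (c + t * Complex.I)) ^ 2)‖ with hM2
  have h1 : 0 ≤ M1 := integral_nonneg fun τ => by positivity
  have h2 : 0 ≤ M2 := integral_nonneg fun τ => norm_nonneg _
  have hcont := (Complex.continuous_ofReal.comp logArcDeriv_continuous).mul
    (dampedInverse_continuous hα hf hh h0 hc hε)
  refine integrable_of_exp_bounds (a := 1) (b := 2 * c) (C := M1 + 2 * M2)
    hcont.aestronglyMeasurable one_pos (by linarith) (fun l hl => ?_) fun l hl => ?_
  · rw [norm_mul, Complex.norm_real, Real.norm_of_nonneg (logArcDeriv_pos l).le, one_mul, mul_comm]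
    refine mul_le_mul ?_ (logArcDeriv_le_exp l) (logArcDeriv_pos l).le (by positivity)
    exact (norm_dampedInverse_le_const hα hf hh h0 hc hε l).trans (by linarith)
  · rw [norm_mul, Complex.norm_real, Real.norm_of_nonneg (logArcDeriv_pos l).le]
    calc _ ≤ 2 * (M2 * Real.exp (-2 * c * l)) :=
          mul_le_mul (logArcDeriv_le_two l) (norm_dampedInverse_le l) (norm_nonneg _) zero_le_two
      _ = 2 * M2 * Real.exp (-(2 * c * l)) := by ring_nf
      _ ≤ _ := mul_le_mul_of_nonneg_right (by linarith) (Real.exp_pos _).le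

/-- Tested against `φ`, the damped sine integrals converge to `∫ φ(t) g(t)/t dt`. -/
theorem tendsto_integral_test_sine (hα : -(1 / 4) < α) (hf : SineAdmissible fun τ : ℝ => g τ)
    (heven : ∀ τ : ℝ, g (-τ) = g τ)
    {c : ℝ} (hh : ∀ c : ℝ, |c| < μ → MellinConvergent (indexG α g) c)
    (h0 : 0 < c) (hc : c < μ) {φ : ℝ → ℝ} (hφ : ContDiff ℝ ((⊤ : ℕ∞) : WithTop ℕ∞) φ)
    (hφc : HasCompactSupport φ) :
    Tendsto (fun ε => ∫ x : ℝ, (φ x : ℂ) * ((Real.pi : ℂ)⁻¹ * ∫ l : ℝ,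
      (Real.sin (x * logArc l) : ℂ) * logArcDeriv l * dampedInverse α (indexG α g) c ε l))
      (𝓝[>] 0) (𝓝 (∫ τ : ℝ, (φ τ : ℂ) * (g τ / τ))) := by
  have hpi : (Real.pi : ℂ) ≠ 0 := by exact_mod_cast Real.pi_ne_zero
  obtain ⟨hΦi, hΦ⟩ := testSine_inversion hφ hφc
  have hφi : Integrable fun x => (φ x : ℂ) := (hφ.continuous.integrable_of_hasCompactSupport hφc).ofReal
  set P : ℝ → ℂ := sineTransform fun τ : ℝ => g τ with hP
  set M1 := ∫ τ : ℝ, ‖g τ / τ‖ * (1 + |τ| ^ (0 : ℝ)) with hM1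
  have hPc : Continuous P := sineTransform_continuous hf
  have hPb : ∀ l, ‖P (logArc l)‖ ≤ M1 := fun l => by
    refine (norm_sineTransform_logArc_le hf le_rfl (by norm_num) _).trans
      (mul_le_of_le_one_right (integral_nonneg fun τ => by positivity) (min_le_left _ _))
  -- Fubini: the left-hand side is a pairing with the sine transform of `φ`
  have hleft : ∀ ε : ℝ, 0 < ε → ∫ x : ℝ, (φ x : ℂ) * ((Real.pi : ℂ)⁻¹ * ∫ l : ℝ,
      (Real.sin (x * logArc l) : ℂ) * logArcDeriv l * dampedInverse α (indexG α g) c ε l) =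
      (Real.pi : ℂ)⁻¹ * ∫ l : ℝ, (logArcDeriv l • testSine φ (logArc l)) *
        dampedInverse α (indexG α g) c ε l := fun ε hε => by
    have hD := dampedInverse_integrable hα hf hh h0 hc hε
    have hprod : Integrable (Function.uncurry fun (x l : ℝ) => (φ x : ℂ) *
        (Real.sin (x * logArc l) : ℂ) * (logArcDeriv l * dampedInverse α (indexG α g) c ε l))
        (volume.prod volume) := by
      refine Integrable.mono' (hφi.norm.mul_prod hD.norm) ?_ (ae_of_all _ fun z => ?_)
      · refine (hφi.aestronglyMeasurable.comp_fst.mul ?_).mul hD.aestronglyMeasurable.comp_snd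
        have := logArc_continuous
        exact Continuous.aestronglyMeasurable (by fun_prop)
      · simp only [Function.uncurry]
        rw [norm_mul, norm_mul, Complex.norm_real (Real.sin _), Real.norm_eq_abs]
        refine mul_le_mul_of_nonneg_right ?_ (norm_nonneg _)
        exact mul_le_of_le_one_right (norm_nonneg _) (Real.abs_sin_le_one _)
    have hswap := integral_integral_swap hprod
    have e1 : ∀ x : ℝ, (φ x : ℂ) * ((Real.pi : ℂ)⁻¹ * ∫ l : ℝ,
        (Real.sin (x * logArc l) : ℂ) * logArcDeriv l * dampedInverse α (indexG α g) c ε l) =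
        (Real.pi : ℂ)⁻¹ * ∫ l : ℝ, (φ x : ℂ) * (Real.sin (x * logArc l) : ℂ) *
          (logArcDeriv l * dampedInverse α (indexG α g) c ε l) := fun x => by
      rw [mul_left_comm, ← integral_const_mul (φ x : ℂ)]
      congr 1
      refine integral_congr_ae (ae_of_all _ fun l => ?_)
      beta_reduce
      ring
    simp_rw [e1]
    rw [integral_const_mul, hswap]
    congr 1
    refine integral_congr_ae (ae_of_all _ fun l => ?_)
    beta_reduce
    rw [integral_mul_const, testSine, Complex.real_smul]
    ring
  have hcomp := integrableOn_comp_logArc hΦi.integrableOn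
  -- the sine transform of `φ` is integrable, and the damped inverse is bounded uniformly in `ε`
  have hlim : Tendsto (fun ε => ∫ l : ℝ, (logArcDeriv l • testSine φ (logArc l)) *
      dampedInverse α (indexG α g) c ε l) (𝓝[>] 0)
      (𝓝 (∫ l : ℝ, (logArcDeriv l • testSine φ (logArc l)) * P (logArc l))) := by
    have hpos : ∀ᶠ ε : ℝ in 𝓝[>] 0, 0 < ε := eventually_mem_nhdsWithin
    refine tendsto_integral_filter_of_dominated_convergence
      (fun l => ‖logArcDeriv l • testSine φ (logArc l)‖ * M1)
      (hpos.mono fun ε hε => hcomp.aestronglyMeasurable.mul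
        (dampedInverse_continuous hα hf hh h0 hc hε).aestronglyMeasurable)
      (hpos.mono fun ε hε => ae_of_all _ fun l => ?_) (hcomp.norm.mul_const _)
      (ae_of_all _ fun l => ?_)
    · rw [norm_mul]
      exact mul_le_mul_of_nonneg_left (norm_dampedInverse_le_const hα hf hh h0 hc hε l)
        (norm_nonneg _)
    · refine Tendsto.const_mul _ ?_
      have h1 : Tendsto (fun ε => gaussMean fun u => P (logArc (l - ε * u))) (𝓝[>] 0)
          (𝓝 (P (logArc l))) := by
        refine tendsto_gaussMean (M := M1) (B := 0) (fun ε => ?_)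
          (Eventually.of_forall fun ε u => ?_) fun u => ?_
        · exact ((hPc.comp logArc_continuous).comp
            (by fun_prop : Continuous fun u : ℝ => l - ε * u)).aestronglyMeasurable
        · simpa using hPb (l - ε * u)
        · have h2 := ((hPc.comp logArc_continuous).comp
            (by fun_prop : Continuous fun ε : ℝ => l - ε * u)).tendsto 0
          simp only [Function.comp, zero_mul, sub_zero] at h2
          exact h2.mono_left nhdsWithin_le_nhds
      refine h1.congr' (hpos.mono fun ε hε => ?_)
      exact (dampedInverse_eq_gaussMean hα hf hh h0 hc hε l).symm
  -- back in the variable `v`, Fubini moves the sine transform from `g(τ)/τ` to `φ`, where it inverts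
  have hval : (Real.pi : ℂ)⁻¹ * ∫ l : ℝ, (logArcDeriv l • testSine φ (logArc l)) * P (logArc l) =
      ∫ τ : ℝ, (φ τ : ℂ) * (g τ / τ) := by
    have e1 : ∫ l : ℝ, (logArcDeriv l • testSine φ (logArc l)) * P (logArc l) =
        ∫ v in Ioi (0 : ℝ), testSine φ v * P v := by
      rw [integral_comp_logArc]
      simp_rw [smul_mul_assoc]
    have hprod : Integrable (Function.uncurry fun (v τ : ℝ) => testSine φ v *
        (g τ / τ * (Real.sin (τ * v) : ℂ))) ((volume.restrict (Ioi 0)).prod volume) := by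
      refine Integrable.mono' (hΦi.integrableOn.norm.mul_prod hf.integrable.norm) ?_
        (ae_of_all _ fun z => ?_)
      · exact hΦi.integrableOn.aestronglyMeasurable.comp_fst.mul
          (hf.integrable.aestronglyMeasurable.comp_snd.mul
            (Continuous.aestronglyMeasurable (by fun_prop)))
      · simp only [Function.uncurry]
        rw [norm_mul, norm_mul, Complex.norm_real (Real.sin _), Real.norm_eq_abs]
        refine mul_le_mul_of_nonneg_left ?_ (norm_nonneg _)
        exact mul_le_of_le_one_right (norm_nonneg _) (Real.abs_sin_le_one _)
    have hswap := integral_integral_swap hprod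
    have e2 : ∫ v in Ioi (0 : ℝ), testSine φ v * P v =
        ∫ τ : ℝ, g τ / τ * (Real.pi * ((φ τ - φ (-τ)) / 2 : ℝ)) := by
      simp_rw [integral_const_mul] at hswap
      rw [show (∫ v in Ioi (0 : ℝ), testSine φ v * P v) = ∫ v in Ioi (0 : ℝ), testSine φ v *
        ∫ τ : ℝ, g τ / τ * (Real.sin (τ * v) : ℂ) from rfl, hswap]
      refine integral_congr_ae (ae_of_all _ fun τ => ?_)
      beta_reduce
      rw [← hΦ τ, ← integral_const_mul]
      refine integral_congr_ae (ae_of_all _ fun v => ?_)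
      beta_reduce
      ring
    obtain ⟨K, hK⟩ := hφc.exists_bound_of_continuous hφ.continuous
    have i1 : Integrable fun τ : ℝ => (φ τ : ℂ) * (g τ / τ) :=
      hf.integrable.bdd_mul (c := K) hφi.aestronglyMeasurable (ae_of_all _ fun τ => by
        rw [Complex.norm_real]; exact hK τ)
    have i2 : Integrable fun τ : ℝ => (φ (-τ) : ℂ) * (g τ / τ) :=
      hf.integrable.bdd_mul (c := K) hφi.comp_neg.aestronglyMeasurable (ae_of_all _ fun τ => by
        rw [Complex.norm_real]; exact hK (-τ))
    have hneg : ∫ τ : ℝ, (φ (-τ) : ℂ) * (g τ / τ) = -∫ τ : ℝ, (φ τ : ℂ) * (g τ / τ) := by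
      rw [← integral_neg_eq_self, ← integral_neg]
      refine integral_congr_ae (ae_of_all _ fun τ => ?_)
      beta_reduce
      rw [neg_neg, Complex.ofReal_neg, heven, div_neg, mul_neg]
    rw [e1, e2]
    have e3 : ∀ τ : ℝ, g τ / τ * (Real.pi * ((φ τ - φ (-τ)) / 2 : ℝ)) = (Real.pi / 2 : ℂ) *
        ((φ τ : ℂ) * (g τ / τ) - (φ (-τ) : ℂ) * (g τ / τ)) := fun τ => by
      push_cast
      ring
    simp_rw [e3]
    rw [integral_const_mul, integral_sub i1 i2, hneg]
    field_simp
    ring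
  rw [← hval]
  refine (hlim.const_mul _).congr' ?_
  filter_upwards [self_mem_nhdsWithin] with ε hε using (hleft ε hε).symm

/-- The inversion formula at every `x ≠ 0`. -/
theorem tailPairing_inversion (hα : -(1 / 4) < α) (hμ0 : 0 < μ) (hμ : μ < 1 / 4)
    (hf : SineAdmissible fun τ : ℝ => g τ) (heven : ∀ τ : ℝ, g (-τ) = g τ)
    (hh : ∀ c : ℝ, |c| < μ → MellinConvergent (indexG α g) c) {x : ℝ} (hx : x ≠ 0) :
    -(Real.pi * Real.sinh (Real.pi * x) : ℝ) * tailPairing α (indexG α g) x = g x / x := by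
  set h := indexG α g with hhdef
  have hδ0 : 0 < μ / 2 := by linarith
  have hδ : μ / 2 < μ := by linarith
  have hh0 : MellinConvergent h (0 : ℝ) := hh 0 (by simpa)
  have hhδ : MellinConvergent h (-(μ / 2) : ℝ) := hh _ (by rw [abs_neg, abs_of_pos hδ0]; exact hδ)
  set J : ℝ → ℂ := fun x => -(Real.pi * Real.sinh (Real.pi * x) : ℝ) * tailPairing α h x with hJ
  have hJc : ContinuousOn J {0}ᶜ := by
    refine ContinuousOn.mul (Continuous.continuousOn ?_) (tailPairing_continuousOn hα hδ0 hh0 hhδ)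
    have := Real.continuous_sinh
    fun_prop
  have hqc : ContinuousOn (fun x : ℝ => g x / x) {0}ᶜ :=
    hf.1.continuousOn.div (by fun_prop) fun x hx => by exact_mod_cast hx
  have hae : ∀ᵐ x : ℝ, x ∈ ({0}ᶜ : Set ℝ) → J x - g x / x = 0 := by
    refine isOpen_compl_singleton.ae_eq_zero_of_integral_contDiff_smul_eq_zero
      ((hJc.sub hqc).locallyIntegrableOn isOpen_compl_singleton.measurableSet)
      fun φ hφ hφc hφs => ?_
    have hlim := tendsto_integral_test_sine hα hf heven hh hδ0 hδ hφ hφc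
    -- the same integrals are damped pairings, which converge for every `x ≠ 0`, boundedly on the support of `φ`
    have hsupp : ∀ x, φ x ≠ 0 → x ∈ tsupport φ ∧ x ≠ 0 := fun x hx =>
      ⟨subset_tsupport _ hx, hφs (subset_tsupport _ hx)⟩
    obtain ⟨C, hC, hW⟩ := weberRe_bounds hα hφc (fun x hx => sin_pi_order_ne_zero (hφs hx)) hδ0
    set K := ((α ^ 2 + 1) * C * ∫ u : ℝ, Real.exp (2 * (μ / 2) * |u|) * Real.exp (-u ^ 2)) *
        ∫ y in Ioi (0 : ℝ), (y ^ ((0 : ℝ) - 1) * ‖h y‖ + y ^ (-(μ / 2) - 1) * ‖h y‖) with hK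
    have hφi : Integrable fun x => ‖φ x‖ :=
      (hφ.continuous.integrable_of_hasCompactSupport hφc).norm
    have hbi : Integrable fun x => ‖φ x‖ * (Real.pi * |Real.sinh (Real.pi * x)| * K) := by
      have h1 : Continuous fun x => ‖φ x‖ * (Real.pi * |Real.sinh (Real.pi * x)| * K) := by
        have := Real.continuous_sinh
        have := hφ.continuous
        fun_prop
      exact h1.integrable_of_hasCompactSupport (hφc.norm.mul_right)
    have hlim2 : Tendsto (fun ε => ∫ x : ℝ, (φ x : ℂ) * ((Real.pi : ℂ)⁻¹ * ∫ l : ℝ,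
        (Real.sin (x * logArc l) : ℂ) * logArcDeriv l * dampedInverse α h (μ / 2) ε l))
        (𝓝[>] 0) (𝓝 (∫ x : ℝ, (φ x : ℂ) * J x)) := by
      have hpos : ∀ᶠ ε : ℝ in 𝓝[>] 0, 0 < ε ∧ ε ≤ 1 := by
        filter_upwards [Ioc_mem_nhdsGT one_pos] with ε hε using hε
      refine tendsto_integral_filter_of_dominated_convergence
        (fun x => ‖φ x‖ * (Real.pi * |Real.sinh (Real.pi * x)| * K))
        (hpos.mono fun ε hε => ?_) (hpos.mono fun ε hε => ae_of_all _ fun x => ?_) hbi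
        (ae_of_all _ fun x => ?_)
      · have hD := dampedInverse_integrable hα hf hh hδ0 hδ hε.1
        have hcont : Continuous fun x : ℝ => ∫ l : ℝ, (Real.sin (x * logArc l) : ℂ) *
            logArcDeriv l * dampedInverse α h (μ / 2) ε l := by
          have hv := logArc_continuous
          have hd := logArcDeriv_continuous
          have hp := dampedInverse_continuous hα hf hh hδ0 hδ hε.1
          refine continuous_of_dominated (fun x => Continuous.aestronglyMeasurable (by fun_prop))
            (fun x => ae_of_all _ fun l => ?_) hD.norm (ae_of_all _ fun l => by fun_prop)
          rw [mul_assoc, norm_mul, Complex.norm_real, Real.norm_eq_abs]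
          exact mul_le_of_le_one_left (norm_nonneg _) (Real.abs_sin_le_one _)
        have hφcont := hφ.continuous
        exact Continuous.aestronglyMeasurable (by fun_prop)
      · rw [norm_mul, Complex.norm_real]
        rcases eq_or_ne (φ x) 0 with h0 | h0
        · simp [h0]
        · refine mul_le_mul_of_nonneg_left ?_ (norm_nonneg _)
          obtain ⟨hxs, hx0⟩ := hsupp x h0
          rw [← gaussMean_pairing_eq_sine_integral hα hx0 hh hμ hδ0 hδ hε.1, norm_mul, norm_neg,
            Complex.norm_real, Real.norm_eq_abs, abs_mul, abs_of_pos Real.pi_pos]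
          exact mul_le_mul_of_nonneg_left
            ((hW x hxs).1.norm_damped_pairing_le hδ0 hh0 hhδ hε.1 hε.2) (by positivity)
      · rcases eq_or_ne (φ x) 0 with h0 | h0
        · simp [h0]
        · refine Tendsto.const_mul _ ?_
          obtain ⟨hxs, hx0⟩ := hsupp x h0
          refine (((hW x hxs).1.tendsto_damped_pairing hδ0 hh0 hhδ).const_mul
            (-(Real.pi * Real.sinh (Real.pi * x) : ℝ) : ℂ)).congr' (hpos.mono fun ε hε => ?_)
          exact gaussMean_pairing_eq_sine_integral hα hx0 hh hμ hδ0 hδ hε.1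
    have heq := tendsto_nhds_unique hlim hlim2
    obtain ⟨N, hN⟩ := hφc.exists_bound_of_continuous hφ.continuous
    have hφi' : Integrable fun x => (φ x : ℂ) :=
      (hφ.continuous.integrable_of_hasCompactSupport hφc).ofReal
    have i1 : Integrable fun τ : ℝ => (φ τ : ℂ) * (g τ / τ) :=
      hf.integrable.bdd_mul (c := N) hφi'.aestronglyMeasurable (ae_of_all _ fun τ => by
        rw [Complex.norm_real]; exact hN τ)
    have i2 : Integrable fun x : ℝ => (φ x : ℂ) * J x := by
      have hon : IntegrableOn (fun x : ℝ => (φ x : ℂ) * J x) (tsupport φ) := by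
        refine ContinuousOn.integrableOn_compact hφc ?_
        exact (Complex.continuous_ofReal.comp hφ.continuous).continuousOn.mul (hJc.mono hφs)
      refine (integrableOn_iff_integrable_of_support_subset fun x hx => ?_).1 hon
      refine subset_tsupport _ fun h0 => hx ?_
      simp [h0]
    have : ∀ x : ℝ, φ x • (J x - g x / x) = (φ x : ℂ) * J x - (φ x : ℂ) * (g x / x) := fun x => by
      rw [Complex.real_smul, mul_sub]
    simp_rw [this]
    rw [integral_sub i2 i1, heq, sub_self]
  have hEq := Measure.eqOn_open_of_ae_eq (μ := volume) (f := J) (g := fun x : ℝ => g x / x)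
    ((ae_restrict_iff' isOpen_compl_singleton.measurableSet).2 (hae.mono fun x hx hx' =>
      sub_eq_zero.1 (hx hx'))) isOpen_compl_singleton hJc hqc
  exact hEq hx

end Inversion



/-! ### Bounds at every order, and the separate integrability for `α > -μ` -/

theorem eq_natCast_of_sin_pi_order_eq_zero {α x : ℝ} (hα : -(1 / 4) < α)
    (hs : Complex.sin (Real.pi * (α - Complex.I * x)) = 0) : x = 0 ∧ ∃ n : ℕ, α = n := by
  have hx : x = 0 := by
    by_contra hx
    exact sin_pi_order_ne_zero hx hs
  refine ⟨hx, ?_⟩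
  subst hx
  rw [Complex.ofReal_zero, mul_zero, sub_zero, ← Complex.ofReal_mul, ← Complex.ofReal_sin] at hs
  have hs' : Real.sin (Real.pi * α) = 0 := by exact_mod_cast hs
  obtain ⟨k, hk⟩ := Real.sin_eq_zero_iff.1 hs'
  have hk' : (k : ℝ) = α := by
    have := Real.pi_ne_zero
    rw [mul_comm] at hk
    exact mul_left_cancel₀ this hk
  have hk0 : 0 ≤ k := by
    have : (-1 : ℝ) < k := by rw [hk']; linarith
    have : (-1 : ℤ) < k := by exact_mod_cast this
    omega
  refine ⟨k.toNat, ?_⟩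
  rw [← hk']
  have : ((k.toNat : ℤ) : ℝ) = k := by rw [Int.toNat_of_nonneg hk0]
  exact_mod_cast this.symm

theorem rpow_add_one_le {α δ y : ℝ} (hδ : 0 ≤ δ) (hα : -α ≤ δ) (hy : 0 < y) (hy4 : y ≤ 4) :
    (y / 4) ^ α + 1 ≤ 2 * 4 ^ δ * y ^ (-δ) := by
  have h0 : 0 < y / 4 := by positivity
  have h1 : y / 4 ≤ 1 := by linarith
  have e : (y / 4) ^ (-δ) = 4 ^ δ * y ^ (-δ) := by
    rw [Real.div_rpow hy.le (by norm_num), Real.rpow_neg (by norm_num : (0 : ℝ) ≤ 4), div_inv_eq_mul,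
      mul_comm]
  have h2 : (y / 4) ^ α ≤ (y / 4) ^ (-δ) := Real.rpow_le_rpow_of_exponent_ge h0 h1 (by linarith)
  have h3 : 1 ≤ (y / 4) ^ (-δ) := Real.one_le_rpow_of_pos_of_le_one_of_nonpos h0 h1 (by linarith)
  rw [mul_assoc, ← e]
  linarith

/-- The bounds for `R_{α,x}` at every real `x`, the limiting case of integer order included. -/
theorem exists_weberRe_bounds {α : ℝ} (hα : -(1 / 4) < α) (x : ℝ) {δ : ℝ} (hδ : 0 < δ) :
    ∃ (C K : ℝ) (D : ℝ → ℝ), 0 < K ∧ WeberBounds α δ C (weberRe α x) D ∧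
      (-α ≤ δ → ∀ y, 0 < y → y ≤ 4 → |weberRe α x y| ≤ K * y ^ (-δ) ∧ |D y| ≤ K * y ^ (-δ)) := by
  by_cases hs : Complex.sin (Real.pi * (α - Complex.I * x)) = 0
  · obtain ⟨rfl, n, rfl⟩ := eq_natCast_of_sin_pi_order_eq_zero hα hs
    obtain ⟨C, D, hC, hW, hb⟩ := weberRe_nat_bounds n hδ
    exact ⟨C, C, D, hC, hW, fun _ y hy hy4 => hb y hy hy4⟩
  · obtain ⟨C, hC, hW⟩ := weberRe_bounds hα (isCompact_singleton (x := x))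
      (fun z hz => by rw [mem_singleton_iff.1 hz]; exact hs) hδ
    refine ⟨C, C * (2 * 4 ^ δ), weberReD α x, by positivity, (hW x rfl).1, fun hαδ y hy hy4 => ?_⟩
    have h1 := (hW x rfl).2 y hy hy4
    have h2 := mul_le_mul_of_nonneg_left (rpow_add_one_le hδ.le hαδ hy hy4) hC.le
    rw [← mul_assoc] at h2
    exact ⟨h1.1.trans h2, h1.2.trans h2⟩

namespace WeberBounds

variable {α δ C K : ℝ} {R D : ℝ → ℝ}

theorem abs_integral_le_of_small (hW : WeberBounds α δ C R D) (hδ : 0 < δ)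
    (hK : ∀ y, 0 < y → y ≤ 4 → |R y| ≤ K * y ^ (-δ)) {y : ℝ} (hy : 0 < y) :
    |∫ t in Ioi y, R t / t| ≤ (C + K / δ) * (1 + y ^ (-δ)) := by
  have hC := hW.nonneg
  have hK0 : 0 ≤ K := nonneg_of_mul_nonneg_left ((abs_nonneg _).trans (hK 1 one_pos (by norm_num)))
    (by positivity)
  have hp : 0 < y ^ (-δ) := by positivity
  have hq : 0 ≤ K / δ := by positivity
  rcases le_total 4 y with h4 | h4
  · refine (hW.abs_integral_le h4).trans ?_
    nlinarith [mul_nonneg hC hp.le, mul_nonneg hq hp.le]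
  · have h1 : |∫ t in y..4, R t / t| ≤ K / δ * y ^ (-δ) := by
      have hle : ‖∫ t in y..4, R t / t‖ ≤ ∫ t in y..4, K * t ^ (-δ - 1) := by
        refine intervalIntegral.norm_integral_le_of_norm_le h4 (ae_of_all _ fun t ht => ?_) ?_
        · have ht0 : 0 < t := hy.trans ht.1
          rw [norm_div, Real.norm_of_nonneg ht0.le, Real.norm_eq_abs, Real.rpow_sub_one ht0.ne',
            ← mul_div_assoc]
          exact div_le_div_of_nonneg_right (hK t ht0 ht.2) ht0.le
        · refine (intervalIntegral.intervalIntegrable_rpow (Or.inr fun h0 => ?_)).const_mul K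
          rw [uIcc_of_le h4] at h0
          exact absurd h0.1 (not_le.2 hy)
      have hne : (0 : ℝ) ∉ uIcc y 4 := fun h0 => by
        rw [uIcc_of_le h4] at h0
        exact absurd h0.1 (not_le.2 hy)
      rw [intervalIntegral.integral_const_mul, integral_rpow (Or.inr ⟨by linarith, hne⟩),
        sub_add_cancel, Real.norm_eq_abs] at hle
      refine hle.trans ?_
      have h5 : (0 : ℝ) < 4 ^ (-δ) := by positivity
      have e : K * ((4 ^ (-δ) - y ^ (-δ)) / -δ) = K / δ * (y ^ (-δ) - 4 ^ (-δ)) := by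
        field_simp
        ring
      rw [e]
      exact mul_le_mul_of_nonneg_left (by linarith) hq
    rw [hW.integral_eq hy]
    refine (abs_add_le _ _).trans ?_
    have h2 := hW.abs_integral_le le_rfl
    nlinarith [mul_nonneg hC hp.le, mul_nonneg hq hp.le]

theorem integrableOn_tail_term (hW : WeberBounds α δ C R D) (hδ : 0 < δ)
    (hK : ∀ y, 0 < y → y ≤ 4 → |R y| ≤ K * y ^ (-δ)) {h : ℝ → ℂ}
    (h0 : MellinConvergent h (0 : ℝ)) (hhδ : MellinConvergent h (-δ : ℝ)) :
    IntegrableOn (fun y => ∫ t in Ioi y, (R t : ℂ) * h y / (t * y)) (Ioi 0) := by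
  refine (integrableOn_mul_div_of_bound hW.integral_continuousOn
    (fun y hy => hW.abs_integral_le_of_small hδ hK hy) h0 hhδ).congr (ae_of_all _ fun y => ?_)
  beta_reduce
  rw [← integral_complex_ofReal, ← integral_mul_const]
  refine integral_congr_ae (ae_of_all _ fun t => ?_)
  beta_reduce
  push_cast
  rw [mul_div_mul_comm]

theorem integrableOn_deriv_term (hW : WeberBounds α δ C R D)
    (hK : ∀ y, 0 < y → y ≤ 4 → |D y| ≤ K * y ^ (-δ)) {h : ℝ → ℂ}
    (h0 : MellinConvergent h (0 : ℝ)) (hhδ : MellinConvergent h (-δ : ℝ)) :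
    IntegrableOn (fun y => ((_root_.deriv R y : ℝ) : ℂ) * h y) (Ioi 0) := by
  have hC := hW.nonneg
  have hK0 : 0 ≤ K := nonneg_of_mul_nonneg_left ((abs_nonneg _).trans (hK 1 one_pos (by norm_num)))
    (by positivity)
  have hb : ∀ y, 0 < y → |D y| ≤ (C + K) * (1 + y ^ (-δ)) := fun y hy => by
    have hp : 0 < y ^ (-δ) := by positivity
    have hp1 := mul_nonneg hC hp.le
    have hp2 := mul_nonneg hK0 hp.le
    rcases le_total 4 y with h4 | h4
    · have := hW.largeD y h4
      nlinarith
    · have := hK y hy h4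
      nlinarith
  refine (integrableOn_mul_div_of_bound hW.cont hb h0 hhδ).congr ?_
  filter_upwards [ae_restrict_mem measurableSet_Ioi] with y hy
  rw [(hW.deriv y hy).deriv]
  push_cast
  ring

end WeberBounds

theorem differentiableAt_of_analyticOnNhd_div_I {μ : ℝ} (hμ : 0 ≤ μ) {g : ℂ → ℂ}
    (hg : AnalyticOnNhd ℂ (fun z : ℂ => g (z / Complex.I)) (closedStrip μ)) (τ : ℝ) :
    DifferentiableAt ℂ g τ := by
  have h1 : DifferentiableAt ℂ (fun z : ℂ => g (z / Complex.I)) (τ * Complex.I) :=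
    (hg _ (by simpa [closedStrip] using hμ)).differentiableAt
  have h2 : DifferentiableAt ℂ (fun w : ℂ => g (w * Complex.I / Complex.I)) τ :=
    DifferentiableAt.comp (g := fun z : ℂ => g (z / Complex.I)) (f := fun w : ℂ => w * Complex.I)
      (τ : ℂ) h1 (by fun_prop)
  have e : (fun w : ℂ => g (w * Complex.I / Complex.I)) = g := by
    ext w
    rw [mul_div_cancel_right₀ _ Complex.I_ne_zero]
  rwa [e] at h2


theorem theorem5 (α μ : ℝ) (hα : -(1 / 4 : ℝ) < α) (hμ0 : 0 < μ) (hμ : μ < 1 / 4)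
    (g : ℂ → ℂ)
    (hg_even : ∀ z ∈ closedStrip μ, g (-z / Complex.I) = g (z / Complex.I))
    (hg_an : AnalyticOnNhd ℂ (fun z : ℂ => g (z / Complex.I)) (closedStrip μ))
    (hg0 : g 0 = 0) (hg0' : deriv g 0 = 0)
    (hg_real : MemLp (fun τ : ℝ => g (τ : ℂ)) 2 volume)
    (hg_line : MemLp (fun t : ℝ => g (((μ : ℂ) + t * Complex.I) / Complex.I)) 2 volume)
    (hG_conv : ∀ s ∈ openStrip μ, MellinConvergent (indexG α g) s)
    (hG_an : AnalyticOnNhd ℂ (mellin (indexG α g)) (openStrip μ))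
    (hG_L1 : ∀ ν : ℝ, |ν| < μ → Integrable (fun t : ℝ =>
      ((‖(ν : ℂ) + t * Complex.I‖ ^ (1 / 2 - ν) *
          Real.exp (Real.pi * ‖(ν : ℂ) + t * Complex.I‖ / 2) : ℝ) : ℂ) *
        mellin (indexG α g) ((ν : ℂ) + t * Complex.I)) volume) :
    ∀ x : ℝ,
      (∀ y : ℝ, 0 < y → DifferentiableAt ℝ (weberRe α x) y) ∧
      (∀ y : ℝ, 0 < y → IntegrableOn (fun t : ℝ => weberRe α x t / t) (Ioi y) volume) ∧
      IntegrableOn (fun y : ℝ =>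
        (α : ℂ) ^ 2 * (∫ t in Ioi y, (weberRe α x t : ℂ) * indexG α g y / (t * y)) +
          ((deriv (weberRe α x) y : ℝ) : ℂ) * indexG α g y) (Ioi 0) volume ∧
      g (x : ℂ) = -((Real.pi * x * Real.sinh (Real.pi * x) : ℝ) : ℂ) *
        ∫ y in Ioi (0 : ℝ),
          ((α : ℂ) ^ 2 * (∫ t in Ioi y, (weberRe α x t : ℂ) * indexG α g y / (t * y)) +
            ((deriv (weberRe α x) y : ℝ) : ℂ) * indexG α g y) ∧
      (-μ < α →
        IntegrableOn (fun y : ℝ =>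
          ∫ t in Ioi y, (weberRe α x t : ℂ) * indexG α g y / (t * y)) (Ioi 0) volume ∧
        IntegrableOn (fun y : ℝ =>
          ((deriv (weberRe α x) y : ℝ) : ℂ) * indexG α g y) (Ioi 0) volume ∧
        g (x : ℂ) = -((Real.pi * x * Real.sinh (Real.pi * x) : ℝ) : ℂ) *
          ((α : ℂ) ^ 2 * (∫ y in Ioi (0 : ℝ), ∫ t in Ioi y,
              (weberRe α x t : ℂ) * indexG α g y / (t * y)) +
            ∫ y in Ioi (0 : ℝ), ((deriv (weberRe α x) y : ℝ) : ℂ) * indexG α g y)) := by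
  have hmem : ∀ c : ℝ, |c| < μ → MellinConvergent (indexG α g) c := fun c hc =>
    hG_conv c (by simpa [openStrip] using hc)
  have heven : ∀ τ : ℝ, g (-τ) = g τ := fun τ => by
    have h := hg_even (τ * Complex.I) (by simpa [closedStrip] using hμ0.le)
    rwa [neg_div, mul_div_cancel_right₀ _ Complex.I_ne_zero] at h
  have hf : SineAdmissible fun τ : ℝ => g τ :=
    sineAdmissible_of_memLp (differentiableAt_of_analyticOnNhd_div_I hμ0.le hg_an) hg0 hg_real
  have h0 : MellinConvergent (indexG α g) (0 : ℝ) := hmem 0 (by simpa)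
  have hneg : ∀ δ : ℝ, 0 < δ → δ < μ → MellinConvergent (indexG α g) (-δ : ℝ) := fun δ h1 h2 =>
    hmem _ (by rwa [abs_neg, abs_of_pos h1])
  intro x
  obtain ⟨C, K, D, -, hW, -⟩ := exists_weberRe_bounds hα x (δ := μ / 2) (by linarith)
  have hcongr : ∀ y ∈ Ioi (0 : ℝ), (weberTail α (weberRe α x) D y : ℂ) * (indexG α g y / y) =
      (α : ℂ) ^ 2 * (∫ t in Ioi y, (weberRe α x t : ℂ) * indexG α g y / (t * y)) +
        ((deriv (weberRe α x) y : ℝ) : ℂ) * indexG α g y := fun y hy =>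
    (weberTail_integrand hy (hW.deriv y hy) _).symm
  have hident : g (x : ℂ) = -((Real.pi * x * Real.sinh (Real.pi * x) : ℝ) : ℂ) *
      ∫ y in Ioi (0 : ℝ),
        ((α : ℂ) ^ 2 * (∫ t in Ioi y, (weberRe α x t : ℂ) * indexG α g y / (t * y)) +
          ((deriv (weberRe α x) y : ℝ) : ℂ) * indexG α g y) := by
    rcases eq_or_ne x 0 with rfl | hx
    · simp [hg0]
    · have hinv := tailPairing_inversion hα hμ0 hμ hf heven hmem hx
      have hx' : (x : ℂ) ≠ 0 := by exact_mod_cast hx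
      have hpair : tailPairing α (indexG α g) x = ∫ y in Ioi (0 : ℝ),
          ((α : ℂ) ^ 2 * (∫ t in Ioi y, (weberRe α x t : ℂ) * indexG α g y / (t * y)) +
            ((deriv (weberRe α x) y : ℝ) : ℂ) * indexG α g y) :=
        setIntegral_congr_fun measurableSet_Ioi fun y hy =>
          (weberTail_integrand hy (weberRe_hasDerivAt hy (sin_pi_order_ne_zero hx)) _).symm
      rw [hpair, eq_div_iff hx'] at hinv
      rw [← hinv]
      push_cast
      ring
  refine ⟨fun y hy => (hW.deriv y hy).differentiableAt, fun y hy => hW.integrableOn hy,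
    (hW.integrableOn_tail h0 (hneg _ (by linarith) (by linarith))).congr_fun hcongr
      measurableSet_Ioi, hident, fun hαμ => ?_⟩
  -- an exponent `δ < μ` that also dominates the singularity `y^α` of `R` at the origin
  obtain ⟨δ, hδ0, hδμ, hαδ⟩ : ∃ δ : ℝ, 0 < δ ∧ δ < μ ∧ -α ≤ δ :=
    ⟨max (μ / 2) (-α), lt_max_of_lt_left (by linarith), max_lt (by linarith) (by linarith),
      le_max_right _ _⟩
  obtain ⟨C', K', D', -, hW', hb⟩ := exists_weberRe_bounds hα x hδ0
  have i1 := hW'.integrableOn_tail_term hδ0 (fun y h1 h2 => (hb hαδ y h1 h2).1) h0 (hneg δ hδ0 hδμ)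
  have i2 := hW'.integrableOn_deriv_term (fun y h1 h2 => (hb hαδ y h1 h2).2) h0 (hneg δ hδ0 hδμ)
  refine ⟨i1, i2, hident.trans ?_⟩
  rw [integral_add (i1.const_mul _) i2, integral_const_mul]
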